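/- **Conventions.** Let $d\ge 0$ and let $L=(L_1,\dots,L_d)$ be periods with $L_i\in\{1,2,3,\dots\}\cup\{\infty\}$. The hypercubic lattice with these periods has as its $k$-cells the pairs $(x,S)$ with $x\in\prod_i\mathbb Z/L_i$ (where $\mathbb Z/\infty=\mathbb Z$) and $S\subseteq\{1,\dots,d\}$, $|S|=k$. Cochains on it carry the cubical coboundary $\delta$ and the hypercubic higher cup products $\cup_k$ ($\cup=\cup_0$). Cochains of simplicial sets carry the simplicial coboundary and Steenrod's cup products $\cup_k$. All signs are such that, for $c$ of degree $p$ and $c'$ of degree $q$, $$\delta(c\cup_k c')=\delta c\cup_k c'+(-1)^pc\cup_k\delta c'+(-1)^{p+q-k}c\cup_{k-1}c'+(-1)^{pq+p+q}c'\cup_{k-1}c .$$ $\int$ is the sum over all $d$-cells. A cell also denotes its dual cochain, and $\partial c$ also denotes the cochain equal to $1$ (mod 2) on the boundary of $c$. For $d=2l-1$ put two qubits, of species $A$ and $B$, on every $l$-cell. A QCA of range $r$ is a $*$-automorphism of the algebra of local operators that, together with its inverse, enlarges supports by at most $r$; it is Clifford if it maps Pauli operators to Pauli operators up to phases. A finite-depth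 quantum circuit (FDQC) of depth $D$ and range $r$ is a composition of at most $D$ layers, each of which is conjugation by unitary gates on disjoint blocks of diameter at most $r$. For $(l-1)$-cells $f$ and $l$-cells $c$ put $$G_f^{\bullet}=X^{\bullet}_{\delta f}\prod_{c'}(Z^{\bullet}_{c'})^{\int\delta f\cup_1c'},\qquad U_c^\bullet=X^\bullet_c\prod_{c'}(Z^\bullet_{c'})^{\int c'\cup_1c}\qquad(\bullet=A,B).$$ * The automaton $\alpha$ of $\tfrac12(A_l\cup A_l+A_l\cup B_l+B_l\cup B_l)$ is $Z\mapsto\overline Z$, $X\mapsto\overline X$ with $\overline Z^A_c=Z^A_c\prod_f(G^B_f)^{\int c\cup f}$, $\overline Z^B_c=Z^B_c\prod_f(G^A_f)^{\int f\cup c}$ and $\overline X^\bullet_c=U^\bullet_c\prod_{c'}(\overline Z^\bullet_{c'})^{\int c'\cup_1c}$. * The automaton $\beta$ of $\tfrac12A_l\cup B_l$ is $Z^A_c\mapsto Z^A_c\prod_f(X^B_{\delta f})^{\int c\cup f}$, $Z^B_c\mapsto Z^B_c\prod_f(X^A_{\delta f})^{\int f\cup c}$, $X^\bullet_c\mapsto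 X^\bullet_c$. * $V=V^aV^b$ is the diagonal operator $V|a,b\rangle=\exp\!\big(-\tfrac{2\pi i}{4}\int(a\cup_1a+a\cup_2\delta a+b\cup_1b+b\cup_2\delta b)\big)|a,b\rangle$, where $a,b$ are the $l$-cochains with integer values in $\{0,1\}$ that label the computational basis states (of finite support on an infinite lattice). **Theorem.** 1. Let $A$ be an integer $l$-cochain, either of a simplicial set (with $l\ge1$) or of a hypercubic lattice of arbitrary dimension and periods (with $l\ge0$). Then $$\delta(A\cup_1A+A\cup_2\delta A)=\delta A\cup_2\delta A+((-1)^l-1)(A\cup A+A\cup_1\delta A).$$ If $l$ is odd and $\delta A\equiv0\pmod 2$, then $\tfrac12A\cup A=-\tfrac14\,\delta(A\cup_1A+A\cup_2\delta A)$ as $\mathbb R/\mathbb Z$-valued cochains; so $\tfrac12A\cup A$ is a coboundary. 2. Let $l\ge1$ and $d=2l-1$. There are $D$ and $r$, depending only on $l$, such that the following holds for all periods $L$. * (a) The automata $\alpha$ and $\beta$ exist, are uniquely determined, and are Clifford QCAs of range $r$. * (b) $\beta$ is a Clifford circuit of depth $D$ and range $r$, all of whose gates are among the gates of $\prod_{c,c'}CZ(X^A_c,X^B_{c'})^{\int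 c\cup\partial c'}$, where $CZ(X,X')=\tfrac12(1+X+X'-XX')$. * (c) If $l$ is odd (spatial dimension $d=4m+1$), then $\alpha$ is an FDQC of depth $D$ and range $r$. * (d) If $l\ge3$ is odd, then conjugation by $V$ is an FDQC $v$ of depth $D$ and range $r$, which is not Clifford if all $L_i\ne1$, and $v$ maps the ground state of $\beta$ to the ground state of $\alpha$ (the ground state of a QCA is the image of $|00\cdots0\rangle$ under it). * (e) If $l\ge3$ is odd, there is an FDQC $w$ of depth $D$ and range $r$, which is conjugation by a diagonal unitary that coincides with $V$ on all $|a,b\rangle$ with $\delta a\equiv\delta b\equiv0\pmod2$, such that $w$ is not Clifford if all $L_i\ne1$, and $w^{-1}\alpha w=\beta\gamma$ with an FDQC $\gamma$ of depth $D$ and range $r$ that fixes all $Z^A_c,Z^B_c$. In particular $w^{-1}\alpha w$ and $\beta$ have the same separators. -/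

import Mathlib

open scoped BigOperators Classical
open CategoryTheory Opposite

universe u

noncomputable section

namespace HigherQCA

/-! ### Simplicial cochains and Steenrod's cup-`k` products -/

/-- `n`-cochains of a simplicial set with coefficients in `R`. -/
abbrev SCochain (X : SSet.{u}) (n : ℕ) (R : Type*) := X.obj (op (SimplexCategory.mk n)) → R

/-- The simplicial coboundary `(δ c)(σ) = ∑ᵢ (-1)ⁱ c(dᵢ σ)`. -/
def sCoboundary {X : SSet.{u}} {n : ℕ} {R : Type*} [AddCommGroup R] (c : SCochain X n R) :
    SCochain X (n + 1) R :=
  fun σ => ∑ i : Fin (n + 2), ((-1 : ℤ) ^ (i : ℕ)) • c (X.δ i σ)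

/-- The value of a `p`-cochain on the face of an `n`-simplex `σ` spanned by the vertex set `U`
(zero when `U` does not have `p + 1` elements). -/
def evalFace {X : SSet.{u}} {n p : ℕ} {R : Type*} [Zero R] (c : SCochain X p R)
    (σ : X.obj (op (SimplexCategory.mk n))) (U : Finset (Fin (n + 1))) : R :=
  if h : U.card = p + 1 then
    c (X.map (SimplexCategory.mkHom (U.orderEmbOfFin h).toOrderHom).op σ)
  else 0

/-- The cup-`k` product `c ∪ₖ d` of a `p`-cochain and a `q`-cochain, as an `n`-cochain (it vanishes
unless `n + k = p + q`).  The sum runs over the vertices `i₀ < i₁ < ⋯ < iₖ` shared by the two faces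
`U = [0 → i₀, i₁ → i₂, …]` and `W = [i₀ → i₁, i₂ → i₃, …]`; the sign is that of the permutation
that sorts the sequence consisting of `U` followed by `W \ {i₀, …, iₖ}`. -/
def sCup {X : SSet.{u}} (k : ℕ) {p q : ℕ} (n : ℕ) {R : Type*} [CommRing R]
    (c : SCochain X p R) (d : SCochain X q R) : SCochain X n R :=
  fun σ => ∑ I ∈ Finset.powersetCard (k + 1) (Finset.univ : Finset (Fin (n + 1))),
    let U : Finset (Fin (n + 1)) :=
      Finset.univ.filter fun m => m ∈ I ∨ Even (I.filter (· < m)).card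
    let W : Finset (Fin (n + 1)) :=
      Finset.univ.filter fun m => m ∈ I ∨ Odd (I.filter (· < m)).card
    (-1 : R) ^ ((U ×ˢ (W \ I)).filter fun x => x.2 < x.1).card * evalFace c σ U * evalFace d σ W

/-! ### Cubical cochains on hypercubic lattices

`L : Fin d → ℕ` lists the periods of a `d`-dimensional hypercubic lattice. Since `ZMod 0 = ℤ`, a
direction with `L i = 0` is infinite: `L = 0` is the lattice `ℤᵈ`, and if no `L i` vanishes the
lattice is a finite torus. -/

/-- Positions of lattice points. -/
abbrev Pos {d : ℕ} (L : Fin d → ℕ) := (i : Fin d) → ZMod (L i)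

/-- A cell is a corner `x` with a set `S` of directions: the cube
`{y | yᵢ ∈ [xᵢ, xᵢ + 1] for i ∈ S, yᵢ = xᵢ for i ∉ S}`, of dimension `|S|`. -/
abbrev Cell {d : ℕ} (L : Fin d → ℕ) := Pos L × Finset (Fin d)

/-- Cochains (of all degrees at once). -/
abbrev Cochain {d : ℕ} (L : Fin d → ℕ) (R : Type*) := Cell L → R

/-- `c` is an `l`-cochain: it vanishes on cells of dimension other than `l`. -/
def IsOfDegree {d : ℕ} {L : Fin d → ℕ} {R : Type*} [Zero R] (l : ℕ) (c : Cochain L R) : Prop :=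
  ∀ σ : Cell L, σ.2.card ≠ l → c σ = 0

/-- The displacement by one unit in each of the directions in `s`. -/
def shift {d : ℕ} (L : Fin d → ℕ) (s : Finset (Fin d)) : Pos L := fun i => if i ∈ s then 1 else 0

/-- The cubical coboundary: `(δ c)(σ) = c(∂ σ)` with
`∂(•,…,•) = ∑_{ℓ, a ∈ {0,1}} (-1)^{ℓ + a} (•,…,a,…,•)`, where `ℓ = 1, 2, …` numbers the directions
of the cell in increasing order. -/
def coboundary {d : ℕ} {L : Fin d → ℕ} {R : Type*} [AddCommGroup R] (c : Cochain L R) :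
    Cochain L R :=
  fun σ => ∑ j ∈ σ.2, ((-1 : ℤ) ^ (σ.2.filter (· < j)).card) •
    (c (σ.1 + shift L {j}, σ.2.erase j) - c (σ.1, σ.2.erase j))

/-- The hypercubic cup-`k` product.  A term is given by the set `T` of the `k` directions shared
by the two faces, the set `P` of the further directions of the first face and the set `Q` of the
further directions of the second one.  In a direction `j ∉ T` preceded by an even number of
elements of `T` the fixed coordinate of the first face is `0` and that of the second face is `1`;
if the number is odd it is the other way round. -/
def cup {d : ℕ} {L : Fin d → ℕ} {R : Type*} [CommRing R] (k : ℕ) (b c : Cochain L R) :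
    Cochain L R :=
  fun σ => ∑ T ∈ Finset.powersetCard k σ.2, ∑ P ∈ (σ.2 \ T).powerset,
    let Q : Finset (Fin d) := (σ.2 \ T) \ P
    (-1 : R) ^ (((P ×ˢ Q).filter fun x => x.2 < x.1).card + k * Q.card) *
      b (σ.1 + shift L (Q.filter fun j => Odd (T.filter (· < j)).card), T ∪ P) *
      c (σ.1 + shift L (P.filter fun j => Even (T.filter (· < j)).card), T ∪ Q)

/-- `∫ c`: the sum of the values of `c` over all top-dimensional cells. -/
def integral {d : ℕ} {L : Fin d → ℕ} {R : Type*} [AddCommMonoid R] (c : Cochain L R) : R :=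
  ∑ᶠ x : Pos L, c (x, Finset.univ)

/-- The cochain dual to a cell. -/
def dual {d : ℕ} {L : Fin d → ℕ} {R : Type*} [CommRing R] (σ : Cell L) : Cochain L R :=
  Pi.single σ 1

/-- `∂σ` as a cochain: its value on a cell `τ` is the coefficient of `τ` in `∂σ`. -/
def boundary {d : ℕ} {L : Fin d → ℕ} {R : Type*} [CommRing R] (σ : Cell L) : Cochain L R :=
  fun τ => coboundary (dual τ) σ

/-! ### Qubits and local operators -/

/-- The two species of qubits. -/
inductive Species : Type
  | A : Species
  | B : Species

/-- One qubit of each species on every `l`-cell. -/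
abbrev Qubit {d : ℕ} (L : Fin d → ℕ) (l : ℕ) := Species × {σ : Cell L // σ.2.card = l}

/-- Computational basis states: all but finitely many qubits are in the state `0`. -/
abbrev Config {d : ℕ} (L : Fin d → ℕ) (l : ℕ) := Qubit L l →₀ ZMod 2

/-- Finite linear combinations of computational basis states. On a finite lattice this is the
Hilbert space `⨂ ℂ²`; in general it is a space on which the algebra of local operators acts
faithfully. -/
abbrev Hilb {d : ℕ} (L : Fin d → ℕ) (l : ℕ) := Config L l →₀ ℂ

abbrev Op {d : ℕ} (L : Fin d → ℕ) (l : ℕ) := Module.End ℂ (Hilb L l)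

section Operators

variable {d : ℕ} {L : Fin d → ℕ} {l : ℕ}

/-- The operator `|s⟩ ↦ θ(s) |s⟩`. -/
def diagOp (θ : Config L l → ℂ) : Op L l :=
  Finsupp.linearCombination ℂ fun s => Finsupp.single s (θ s)

/-- `X^w : |s⟩ ↦ |s + w⟩`, the product of the Pauli `X` operators on the qubits where `w` is `1`. -/
def xOp (w : Config L l) : Op L l := Finsupp.lmapDomain ℂ ℂ fun s => s + w

/-- `Z^v : |s⟩ ↦ (-1)^{v · s} |s⟩`, the product of the Pauli `Z` operators on the qubits where `v`
is `1`. -/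
def zOp (v : Qubit L l → ZMod 2) : Op L l :=
  diagOp fun s => if (s.sum fun q a => a * v q) = 0 then 1 else -1

/-- A finitely supported function, as a configuration. -/
def toConfig (f : Qubit L l → ZMod 2) : Config L l :=
  if h : (Function.support f).Finite then Finsupp.ofSupportFinite f h else 0

/-- A cochain with `ℤ/2` coefficients, read on the qubits of species `t`. -/
def onSpecies (t : Species) (c : Cochain L (ZMod 2)) : Qubit L l → ZMod 2 :=
  fun q => if q.1 = t then c q.2.1 else 0

/-- The sesquilinear form for which the basis states are orthonormal. -/
def herm (ψ φ : Hilb L l) : ℂ := ψ.sum fun s a => (starRingEnd ℂ) a * φ s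

/-- `O'` is the adjoint of `O`. -/
def IsAdjoint (O O' : Op L l) : Prop := ∀ ψ φ : Hilb L l, herm (O ψ) φ = herm ψ (O' φ)

def IsUnitaryOp (O : Op L l) : Prop := ∃ O' : Op L l, IsAdjoint O O' ∧ O * O' = 1 ∧ O' * O = 1

variable (L l) in
/-- The algebra of the operators supported on a set of qubits. -/
def localAlg (S : Set (Qubit L l)) : Subalgebra ℂ (Op L l) :=
  Algebra.adjoin ℂ {O | ∃ q ∈ S, O = xOp (Finsupp.single q 1) ∨ O = zOp (Pi.single q 1)}

variable (L l) in
/-- The algebra of all local operators (on a finite lattice, of all operators). -/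
abbrev Alg := localAlg L l Set.univ

/-- The Pauli operator `X_q`. -/
def xGen (q : Qubit L l) : Alg L l :=
  ⟨xOp (Finsupp.single q 1), Algebra.subset_adjoin ⟨q, Set.mem_univ q, Or.inl rfl⟩⟩

/-- The Pauli operator `Z_q`. -/
def zGen (q : Qubit L l) : Alg L l :=
  ⟨zOp (Pi.single q 1), Algebra.subset_adjoin ⟨q, Set.mem_univ q, Or.inr rfl⟩⟩

/-- A Pauli operator up to a phase. -/
def IsPauli (O : Op L l) : Prop :=
  ∃ (ζ : ℂ) (w v : Config L l), ‖ζ‖ = 1 ∧ O = ζ • (xOp w * zOp v)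

/-! ### Quantum cellular automata and finite-depth circuits -/

/-- The positions of `q` and `q'` differ by at most `r` in every coordinate. -/
def Near (r : ℕ) (q q' : Qubit L l) : Prop :=
  ∃ v : Fin d → ℤ, (∀ i, |v i| ≤ r) ∧ ∀ i, q'.2.1.1 i = q.2.1.1 i + (v i : ZMod (L i))

/-- A quantum cellular automaton of range `r`: a `*`-automorphism of the algebra of local
operators which, like its inverse, enlarges supports by at most `r`. -/
def IsQCA (r : ℕ) (Φ : Alg L l ≃ₐ[ℂ] Alg L l) : Prop :=
  (∀ O O' : Alg L l, IsAdjoint (O : Op L l) O' → IsAdjoint (Φ O : Op L l) (Φ O')) ∧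
  ∀ (q : Qubit L l) (O : Alg L l), (O : Op L l) ∈ localAlg L l {q} →
    (Φ O : Op L l) ∈ localAlg L l {q' | Near r q q'} ∧
    (Φ.symm O : Op L l) ∈ localAlg L l {q' | Near r q q'}

/-- A Clifford automorphism maps Pauli operators to Pauli operators. -/
def IsClifford (Φ : Alg L l ≃ₐ[ℂ] Alg L l) : Prop :=
  ∀ q : Qubit L l, IsPauli (Φ (xGen q) : Op L l) ∧ IsPauli (Φ (zGen q) : Op L l)

/-- One layer of a circuit with gates in `gates`: the qubits are partitioned into blocks (the
fibres of `blk`) of diameter at most `r`, and `Φ` acts on the operators of each block as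
conjugation by a unitary gate of that block. -/
def IsLayer (gates : Set (Op L l)) (r : ℕ) (Φ : Alg L l ≃ₐ[ℂ] Alg L l) : Prop :=
  ∃ (blk : Qubit L l → Qubit L l) (g : Qubit L l → Op L l),
    (∀ q q', blk q = blk q' → Near r q q') ∧
    (∀ b, g b ∈ gates ∧ IsUnitaryOp (g b) ∧ g b ∈ localAlg L l (blk ⁻¹' {b})) ∧
    ∀ (b : Qubit L l) (O : Alg L l), (O : Op L l) ∈ localAlg L l (blk ⁻¹' {b}) →
      (Φ O : Op L l) * g b = g b * O

/-- A circuit of at most `D` layers of gates from `gates`, each on a block of diameter at most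
`r`. -/
def IsCircuit (gates : Set (Op L l)) (D r : ℕ) (Φ : Alg L l ≃ₐ[ℂ] Alg L l) : Prop :=
  ∃ layers : List (Alg L l ≃ₐ[ℂ] Alg L l),
    layers.length ≤ D ∧ (∀ Ψ ∈ layers, IsLayer gates r Ψ) ∧ layers.prod = Φ

/-- A finite-depth quantum circuit: all local unitary gates are allowed. -/
def IsFDQC (D r : ℕ) (Φ : Alg L l ≃ₐ[ℂ] Alg L l) : Prop := IsCircuit Set.univ D r Φ

/-! ### The automata of the two topological actions -/

/-- The product over the qubits `c` of species `t` of `X_c^{(δλ)(c)}`. -/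
def xCoboundary (t : Species) (lam : Cochain L (ZMod 2)) : Op L l :=
  xOp (toConfig (onSpecies t (coboundary lam)))

/-- The gauge constraint `G_λ = X_{δλ} ∏_{c'} Z_{c'}^{∫ δλ ∪₁ c'}` of species `t`. -/
def gaugeOp (t : Species) (lam : Cochain L (ZMod 2)) : Op L l :=
  xCoboundary t lam *
    zOp (onSpecies t fun c' => integral (cup 1 (coboundary lam) (dual c')))

/-- The cochain that has the value `∫ c ∪ f` on a cell `f` when `t = A`, and the value `∫ f ∪ c`
when `t = B`. It is the dual cochain of exactly one cell, which has complementary directions;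
hence in the products `∏_f (⋯)_f^{∫ c ∪ f}`, `∏_f (⋯)_f^{∫ f ∪ c}` there is exactly one factor, and
evaluating `gaugeOp` or `xCoboundary` at this cochain yields that factor. -/
def pairing (t : Species) (c : Cell L) : Cochain L (ZMod 2) :=
  match t with
  | .A => fun f => integral (cup 0 (dual c) (dual f))
  | .B => fun f => integral (cup 0 (dual f) (dual c))

/-- The other species. -/
def Species.other : Species → Species
  | .A => .B
  | .B => .A

/-- The separators of `½(A ∪ A + A ∪ B + B ∪ B)`:
`Z̄ᴬ_c = Zᴬ_c ∏_f (Gᴮ_f)^{∫ c ∪ f}` and `Z̄ᴮ_c = Zᴮ_c ∏_f (Gᴬ_f)^{∫ f ∪ c}`. -/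
def zBar (q : Qubit L l) : Op L l := (zGen q : Op L l) * gaugeOp q.1.other (pairing q.1 q.2.1)

/-- The exponents `c' ↦ ∫ c' ∪₁ c`, on the qubits of the species of `q = (t, c)`. -/
def hopExp (q : Qubit L l) : Qubit L l → ZMod 2 :=
  onSpecies q.1 fun c' => integral (cup 1 (dual c') (dual q.2.1))

/-- The hopping operators `U_c = X_c ∏_{c'} Z_{c'}^{∫ c' ∪₁ c}`. -/
def hopOp (q : Qubit L l) : Op L l := (xGen q : Op L l) * zOp (hopExp q)

/-- `α` is the automaton `Z ↦ Z̄`, `X ↦ X̄` of `½(A ∪ A + A ∪ B + B ∪ B)`, whose flippers are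
`X̄_c = U_c ∏_{c'} Z̄_{c'}^{∫ c' ∪₁ c}`; since `α` is multiplicative, the last product is
`α (∏_{c'} Z_{c'}^{∫ c' ∪₁ c})`. -/
def IsThreeFermionQCA (α : Alg L l ≃ₐ[ℂ] Alg L l) : Prop :=
  ∀ q : Qubit L l, (α (zGen q) : Op L l) = zBar q ∧
    ∃ E : Alg L l, (E : Op L l) = zOp (hopExp q) ∧ (α (xGen q) : Op L l) = hopOp q * α E

/-- `β` is the automaton of `½ A ∪ B`: the separators are `Zᴬ_c ∏_f (Xᴮ_{δf})^{∫ c ∪ f}` and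
`Zᴮ_c ∏_f (Xᴬ_{δf})^{∫ f ∪ c}`, and the flippers are the `X_c`. -/
def IsABQCA (β : Alg L l ≃ₐ[ℂ] Alg L l) : Prop :=
  ∀ q : Qubit L l, (β (zGen q) : Op L l) = (zGen q : Op L l) * xCoboundary q.1.other (pairing q.1 q.2.1) ∧
    β (xGen q) = xGen q

variable (L l) in
/-- The gates of the circuit `∏_{c, c'} CZ(Xᴬ_c, Xᴮ_{c'})^{∫ c ∪ ∂c'}`, where
`CZ(X, X') = (1 + X + X' - X X') / 2` is the controlled-`Z` gate in the `X` basis. -/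
def czGates : Set (Op L l) :=
  {1} ∪ {O | ∃ c c' : {σ : Cell L // σ.2.card = l},
    integral (cup 0 (dual c.1) (boundary c'.1 : Cochain L (ZMod 2))) = 1 ∧
    O = (1 / 2 : ℂ) • (1 + (xGen (Species.A, c) : Op L l) + xGen (Species.B, c')
      - xGen (Species.A, c) * xGen (Species.B, c'))}

/-! ### The non-Clifford circuit and the ground states -/

/-- The integer `l`-cochain with values in `{0, 1}` labelling the state of the qubits of
species `t`. -/
def liftCochain (s : Config L l) (t : Species) : Cochain L ℤ :=
  fun σ => if h : σ.2.card = l then ((s (t, ⟨σ, h⟩)).val : ℤ) else 0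

/-- `exp(-(2πi/4) ∫ (a ∪₁ a + a ∪₂ δa))` for the species `t`. -/
def phaseV (t : Species) (s : Config L l) : ℂ :=
  Complex.exp (-(2 * Real.pi * Complex.I / 4) *
    ((integral (cup 1 (liftCochain s t) (liftCochain s t) +
      cup 2 (liftCochain s t) (coboundary (liftCochain s t))) : ℤ) : ℂ))

variable (L l) in
/-- The product `Vᵃ Vᵇ` of the diagonal unitaries `Vᵃ|a⟩ = exp(-(2πi/4) ∫ (a ∪₁ a + a ∪₂ δa)) |a⟩`
of the two species. -/
def vOp : Op L l := diagOp fun s => phaseV Species.A s * phaseV Species.B s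

/-- `δa ≡ δb ≡ 0 (mod 2)` for the cochains labelling the configuration. -/
def IsFluxFree (s : Config L l) : Prop :=
  ∀ (t : Species) (σ : Cell L), (2 : ℤ) ∣ coboundary (liftCochain s t) σ

/-- The expectation value of a local operator in the state `|00⋯0⟩`. -/
def vacuumExp (O : Alg L l) : ℂ := ((O : Op L l) (Finsupp.single 0 1)) 0

/-- The state obtained by applying `Φ` to `|00⋯0⟩`: it is stabilized by all `Φ (Z_q)`. -/
def groundState (Φ : Alg L l ≃ₐ[ℂ] Alg L l) (O : Alg L l) : ℂ := vacuumExp (Φ.symm O)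

end Operators

/-! Two checks on these definitions. -/

section Checks

variable {d : ℕ} {L : Fin d → ℕ} {l : ℕ}

theorem cup_zero_dual_dual (b c : Cell L) (x : Pos L) :
    cup 0 (dual b) (dual c : Cochain L (ZMod 2)) (x, Finset.univ) =
      if x = b.1 ∧ c = (b.1 + shift L b.2, b.2ᶜ) then 1 else 0 := by
  have hm : ∀ n : ℕ, ((-1 : ZMod 2)) ^ n = 1 := fun n => by
    rw [show (-1 : ZMod 2) = 1 from by decide, one_pow]
  have h0 : shift L ∅ = 0 := by funext i; simp [shift]
  have h1 : ∀ P : Finset (Fin d), (Finset.univ \ P) = Pᶜ := fun P => by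
    ext; simp
  simp only [cup, Finset.powersetCard_zero, Finset.sum_singleton, hm, one_mul,
    Finset.filter_empty, Finset.card_empty, Finset.empty_union, h1,
    Nat.not_odd_zero, Finset.filter_false, Even.zero, Finset.filter_true, h0, add_zero, dual]
  rw [Finset.sum_eq_single b.2]
  · by_cases hx : x = b.1
    · subst hx
      simp [Pi.single_apply, h1, eq_comm]
    · have : ¬ (x, b.2) = b := fun h => hx (by rw [← h])
      simp [Pi.single_apply, hx, this]
  · intro P _ hP
    have : ¬ (x, P) = b := fun h => hP (by rw [← h])
    simp [Pi.single_apply, this]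
  · intro h
    exact absurd (Finset.mem_univ _) h

theorem pairing_A (c : Cell L) : pairing .A c = dual (c.1 + shift L c.2, c.2ᶜ) := by
  funext f
  simp only [pairing, integral, cup_zero_dual_dual]
  rw [finsum_eq_single _ c.1 (fun x hx => by simp [hx])]
  simp [dual, Pi.single_apply]

theorem pairing_B (c : Cell L) : pairing .B c = dual (c.1 - shift L c.2ᶜ, c.2ᶜ) := by
  funext f
  simp only [pairing, integral, cup_zero_dual_dual]
  rw [finsum_eq_single _ f.1 (fun x hx => by simp [hx])]
  have : c = (f.1 + shift L f.2, f.2ᶜ) ↔ f = (c.1 - shift L c.2ᶜ, c.2ᶜ) := by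
    constructor
    · intro h; rw [h]; simp
    · intro h; rw [h]; simp
  simp [dual, Pi.single_apply, this]

theorem finite_support_coboundary {c : Cochain L (ZMod 2)} (hc : (Function.support c).Finite) :
    (Function.support (coboundary c)).Finite := by
  refine Set.Finite.subset (s := ⋃ j : Fin d,
    ((fun τ : Cell L => ((τ.1 - shift L {j}, insert j τ.2) : Cell L)) '' Function.support c) ∪
    ((fun τ : Cell L => ((τ.1, insert j τ.2) : Cell L)) '' Function.support c)) ?_ ?_
  · exact Set.finite_iUnion fun j => (hc.image _).union (hc.image _)
  · intro σ hσ
    obtain ⟨j, hj, hne⟩ := Finset.exists_ne_zero_of_sum_ne_zero hσ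
    refine Set.mem_iUnion.2 ⟨j, ?_⟩
    by_cases h : c (σ.1, σ.2.erase j) = 0
    · refine Or.inl ⟨(σ.1 + shift L {j}, σ.2.erase j), ?_, ?_⟩
      · intro h'
        exact hne (by rw [h, h']; simp)
      · ext1 <;> simp [Finset.insert_erase hj]
    · exact Or.inr ⟨(σ.1, σ.2.erase j), h, by ext1 <;> simp [Finset.insert_erase hj]⟩

/-- The function converted by `toConfig` in `xCoboundary` really has finite support. -/
theorem toConfig_apply (t : Species) (s : Species) (c : Cell L) (q : Qubit L l) :
    toConfig (onSpecies t (coboundary (pairing s c))) q =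
      onSpecies t (coboundary (pairing s c)) q := by
  have hp : (Function.support (pairing s c)).Finite := by
    cases s
    · rw [pairing_A]
      exact (Set.finite_singleton _).subset Pi.support_single_subset
    · rw [pairing_B]
      exact (Set.finite_singleton _).subset Pi.support_single_subset
  have h : (Function.support (onSpecies (l := l) t (coboundary (pairing s c)))).Finite := by
    have hinj : Function.Injective fun q : {q : Qubit L l // q.1 = t} => q.1.2.1 := by
      rintro ⟨⟨a, b, hb⟩, ha⟩ ⟨⟨a', b', hb'⟩, ha'⟩ h
      dsimp only at ha ha' h
      subst ha ha' h
      rfl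
    have hf := ((finite_support_coboundary hp).preimage hinj.injOn).image Subtype.val
    refine hf.subset fun q hq => ?_
    have hq' : onSpecies t (coboundary (pairing s c)) q ≠ 0 := hq
    unfold onSpecies at hq'
    by_cases ht : q.1 = t
    · rw [if_pos ht] at hq'
      exact ⟨⟨q, ht⟩, hq', rfl⟩
    · exact absurd (if_neg ht) hq'
  rw [toConfig, dif_pos h]
  rfl

end Checks


end HigherQCA

end

open HigherQCA

/-! Identities. Everything about cochains follows from the formula for `δ(c ∪ₖ c')`. It is proved on
one cube (one simplex) by induction on its largest direction (vertex) `m`: splitting off `m`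
expresses `δ` and `∪ₖ` through products of lower cochains on the remaining cell, where the inductive
hypothesis applies, and what remains is a comparison of signs (`coboundary_cup_apply`,
`faceCob_faceCup_apply`). The formula for `δ(A ∪₁ A)` and `δ(A ∪₂ δA)` gives the identity for `A ∪₁
A + A ∪₂ δA`; if `l` is odd and `δA = 2B`, its right side is `-2 A ∪ A` modulo 4.

Existence of the automata. The Pauli operators form a basis of the local algebra, so an automorphism
is given by images of the generators that satisfy the Pauli relations. On exponents over `ℤ/2` both
automata have the form `p ↦ p + (N u, κ' N u)` with `u = κ p.1 + p.2`; here `N` gives the `X`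
exponents of the decorations of the separators, and `κ`, `κ'` are the two adjoint maps of the form
`∫ · ∪₁ ·` (zero for `β`). The map is a symplectic involution because `N` is self-adjoint with
values in coboundaries and because `∫ δf ∪₁ δg` is symmetric and alternating modulo two by the
Leibniz rule (`CliffordData.exists_equiv`, `fermionData`). For `β`, the map `N` is a sum of `2d`
involutive pairings of `A` qubits with `B` qubits, and each pairing is a layer of disjoint
controlled-`Z` gates.

The circuit for `α`. Let `Q(a) = ∫ (a ∪₁ a + a ∪₂ δa)` with `l` odd. Changing the integer lift `a`
to `a + 2h` changes `Q` by `2 ∫ δa ∪₃ δh` modulo 4. Writing `δa = b + 2u` with `b` reduced modulo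
two, the corrected integral `Q(a) + 2 ∫ b ∪₃ u` depends modulo 4 only on `a` modulo two. Let `w` be
conjugation by the corresponding phase. Adding `δf` to `a` multiplies the phase by the sign of `∫ δf
∪₁ a + ∫ f ∪ δf`, so `w` turns `X_{δf}` into the gauge constraint `G_f` up to a sign. Consequently
`γ = β⁻¹ w⁻¹ α w` fixes every `Z` up to a sign, and the signs are trivial for `l ≥ 2`. A local
`*`-automorphism that fixes all `Z` is conjugation by a diagonal operator whose phase changes
locally under flips (`exists_localPhase_of_fix_z`), and every such conjugation is a finite-depth
circuit: color the qubits so that equal colors are far apart, and switch on the phase color by color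
(`IsLocalPhase.isFDQC`). Thus `α = w β γ w⁻¹` is a circuit.

Ground states. `V` and `w` have equal phases on flux-free configurations, and the ground state of
`β` is formally a superposition of such configurations. Since it need not be a vector on an infinite
lattice, the argument uses expectation values: a functional stabilized by all `Z` is the vacuum
expectation (`IsStabilized.unique`, `IsABQCA.vacuumExp_conj`).

Not Clifford. A diagonal Clifford operator has second differences of phase `±1`. The cross term of
`Q(a + h)` contains `∫ δa ∪₃ δh` with coefficient one, and for a suitable pair of cells this
integral is odd, which gives a second difference `±i` for `V` as well as for `w`. -/

noncomputable section

namespace HigherQCA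

/-! ### Coboundary formula for the hypercubic cup products -/

section CubicalFormula

variable {d : ℕ} {L : Fin d → ℕ} {R : Type*} [CommRing R]

/-- The cochain `b` translated by one unit in direction `m` if `a` holds. -/
def endFace (m : Fin d) (a : Prop) [Decidable a] (b : Cochain L R) : Cochain L R :=
  fun σ => b (σ.1 + (if a then shift L {m} else 0), σ.2)

/-- The cochain `b` evaluated on the cells extended by the direction `m`. -/
def extFace (m : Fin d) (b : Cochain L R) : Cochain L R :=
  fun σ => if m ∈ σ.2 then 0 else b (σ.1, insert m σ.2)

/-- `cup (k - 1)`, and zero for `k = 0`. -/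
def cupPred (k : ℕ) (b c : Cochain L R) : Cochain L R :=
  match k with
  | 0 => 0
  | k + 1 => cup k b c

/-- `b` is supported on the cells whose dimension has the parity of `p`. -/
def HasParity (p : ℕ) (b : Cochain L R) : Prop :=
  ∀ σ : Cell L, b σ ≠ 0 → Even (σ.2.card + p)

/-- One term of the cup product. -/
def cupTerm (k : ℕ) (b c : Cochain L R) (x : Pos L) (T P Q : Finset (Fin d)) : R :=
  (-1 : R) ^ (((P ×ˢ Q).filter fun x => x.2 < x.1).card + k * Q.card) *
      b (x + shift L (Q.filter fun j => Odd (T.filter (· < j)).card), T ∪ P) *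
      c (x + shift L (P.filter fun j => Even (T.filter (· < j)).card), T ∪ Q)

theorem cup_apply (k : ℕ) (b c : Cochain L R) (x : Pos L) (S : Finset (Fin d)) :
    cup k b c (x, S) = ∑ T ∈ Finset.powersetCard k S, ∑ P ∈ (S \ T).powerset,
      cupTerm k b c x T P ((S \ T) \ P) := rfl

theorem shift_insert {m : Fin d} {A : Finset (Fin d)} (h : m ∉ A) :
    shift L (insert m A) = shift L A + shift L {m} := by
  funext i
  by_cases hi : i = m
  · subst hi; simp [shift, h]
  · simp [shift, hi]

theorem shift_empty : shift L ∅ = 0 := by funext i; simp [shift]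

theorem neg_one_pow_of_even {a b : ℕ} (h : Even (a + b)) : (-1 : R) ^ a = (-1) ^ b := by
  rcases Nat.even_or_odd a with ha | ha
  · rw [ha.neg_one_pow, ((Nat.even_add.1 h).1 ha).neg_one_pow]
  · have hb : Odd b := by
      rw [← Nat.not_even_iff_odd] at ha ⊢
      exact fun hb => ha ((Nat.even_add.1 h).2 hb)
    rw [ha.neg_one_pow, hb.neg_one_pow]

variable {m : Fin d} {S T P Q : Finset (Fin d)}

theorem filter_lt_max (hT : ∀ j ∈ T, j < m) : T.filter (· < m) = T :=
  Finset.filter_true_of_mem hT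

theorem inv_insert_right (hP : ∀ j ∈ P, j < m) :
    ((P ×ˢ insert m Q).filter fun x => x.2 < x.1) = (P ×ˢ Q).filter fun x => x.2 < x.1 := by
  ext ⟨a, b⟩
  simp only [Finset.mem_filter, Finset.mem_product, Finset.mem_insert]
  constructor
  · rintro ⟨⟨ha, rfl | hb⟩, h⟩
    · exact absurd (hP a ha) (not_lt.2 h.le)
    · exact ⟨⟨ha, hb⟩, h⟩
  · rintro ⟨⟨ha, hb⟩, h⟩
    exact ⟨⟨ha, Or.inr hb⟩, h⟩

/-- As `m` exceeds all of `Q`, it forms an inversion with each element of `Q`. -/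
theorem inv_insert_left (hP : m ∉ P) (hQ : ∀ j ∈ Q, j < m) :
    ((insert m P ×ˢ Q).filter fun x => x.2 < x.1).card =
      ((P ×ˢ Q).filter fun x => x.2 < x.1).card + Q.card := by
  rw [Finset.insert_eq, Finset.union_product, Finset.filter_union, Finset.card_union_of_disjoint,
    add_comm, Finset.singleton_product]
  · congr 1
    rw [Finset.filter_true_of_mem, Finset.card_map]
    simp only [Finset.mem_map]
    rintro _ ⟨j, hj, rfl⟩
    exact hQ j hj
  · rw [Finset.disjoint_left]
    rintro ⟨a, b⟩ h h'
    simp only [Finset.mem_filter, Finset.mem_product, Finset.mem_singleton] at h h'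
    obtain ⟨⟨rfl, _⟩, _⟩ := h
    exact hP h'.1.1

/-- All `k` elements of `T` precede `m`, so the first face is moved to the far end in direction `m`
exactly when `k` is odd. A maximal element of `Q` creates no inversion; the sign comes from `k *
|Q|` alone. -/
theorem cupTerm_insert_Q (k : ℕ) (b c : Cochain L R) (x : Pos L) (hT : ∀ j ∈ T, j < m)
    (hP : ∀ j ∈ P, j < m) (hQ : ∀ j ∈ Q, j < m) (hk : T.card = k) :
    cupTerm k b c x T P (insert m Q) =
      (-1) ^ k * cupTerm k (endFace m (Odd k) b) (extFace m c) x T P Q := by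
  have hmQ : m ∉ Q := fun h => lt_irrefl _ (hQ m h)
  have hmT : m ∉ T := fun h => lt_irrefl _ (hT m h)
  unfold cupTerm endFace extFace
  rw [inv_insert_right hP, Finset.card_insert_of_notMem hmQ, Finset.union_insert,
    Finset.filter_insert, filter_lt_max hT, hk]
  have : (x + shift L (if Odd k then insert m (Q.filter fun j => Odd (T.filter (· < j)).card)
      else Q.filter fun j => Odd (T.filter (· < j)).card)) =
      x + shift L (Q.filter fun j => Odd (T.filter (· < j)).card) +
        if Odd k then shift L {m} else 0 := by
    split_ifs
    · rw [shift_insert (by simp [hmQ]), add_assoc]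
    · simp
  rw [this, if_neg (show ¬ m ∈ T ∪ Q by simp [hmT, hmQ])]
  ring

/-- A maximal element of `P` is inverted with all of `Q`, which costs `(-1)^|Q|`. Where `c` does not
vanish, `k + |Q|` has the parity of `q`, so this sign is the same for all terms. -/
theorem cupTerm_insert_P (k q : ℕ) (b c : Cochain L R) (hc : HasParity q c) (x : Pos L)
    (hT : ∀ j ∈ T, j < m)
    (hP : ∀ j ∈ P, j < m) (hQ : ∀ j ∈ Q, j < m) (hk : T.card = k) (hd : Disjoint T Q) :
    cupTerm k b c x T (insert m P) Q =
      (-1) ^ (q + k) * cupTerm k (extFace m b) (endFace m (Even k) c) x T P Q := by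
  have hmP : m ∉ P := fun h => lt_irrefl _ (hP m h)
  have hmT : m ∉ T := fun h => lt_irrefl _ (hT m h)
  unfold cupTerm endFace extFace
  rw [inv_insert_left hmP hQ, Finset.union_insert,
    Finset.filter_insert, filter_lt_max hT, hk]
  have : (x + shift L (if Even k then insert m (P.filter fun j => Even (T.filter (· < j)).card)
      else P.filter fun j => Even (T.filter (· < j)).card)) =
      x + shift L (P.filter fun j => Even (T.filter (· < j)).card) +
        if Even k then shift L {m} else 0 := by
    split_ifs
    · rw [shift_insert (by simp [hmP]), add_assoc]
    · simp
  rw [this, if_neg (show ¬ m ∈ T ∪ P by simp [hmT, hmP])]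
  dsimp only
  by_cases h0 : c (x + shift L (P.filter fun j => Even (T.filter (· < j)).card) +
        (if Even k then shift L {m} else 0), T ∪ Q) = 0
  · rw [h0]; ring
  · have h1 := hc _ h0
    rw [Finset.card_union_of_disjoint hd, hk] at h1
    have h2 : (-1 : R) ^ Q.card = (-1) ^ (q + k) :=
      neg_one_pow_of_even (by rwa [show Q.card + (q + k) = k + Q.card + q by ring])
    rw [add_right_comm, pow_add _ _ Q.card, h2]
    ring

/-- The exponent grows from `k * |Q|` to `(k + 1) * |Q|`; the parity of `c` makes the extra sign
independent of the term. The fixed coordinates in directions below `m` do not notice `m`. -/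
theorem cupTerm_insert_T (k q : ℕ) (b c : Cochain L R) (hc : HasParity q c) (x : Pos L)
    (hT : ∀ j ∈ T, j < m)
    (hP : ∀ j ∈ P, j < m) (hQ : ∀ j ∈ Q, j < m) (hk : T.card = k) (hd : Disjoint T Q) :
    cupTerm (k + 1) b c x (insert m T) P Q =
      (-1) ^ (q + (k + 1)) * cupTerm k (extFace m b) (extFace m c) x T P Q := by
  have hmT : m ∉ T := fun h => lt_irrefl _ (hT m h)
  have hmQ : m ∉ Q := fun h => lt_irrefl _ (hQ m h)
  have hmP : m ∉ P := fun h => lt_irrefl _ (hP m h)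
  have hf : ∀ j, j < m → (insert m T).filter (· < j) = T.filter (· < j) := fun j hj => by
    rw [Finset.filter_insert, if_neg (not_lt.2 hj.le)]
  have h1 : (Q.filter fun j => Odd ((insert m T).filter (· < j)).card) =
      Q.filter fun j => Odd (T.filter (· < j)).card :=
    Finset.filter_congr fun j hj => by rw [hf j (hQ j hj)]
  have h2 : (P.filter fun j => Even ((insert m T).filter (· < j)).card) =
      P.filter fun j => Even (T.filter (· < j)).card :=
    Finset.filter_congr fun j hj => by rw [hf j (hP j hj)]
  unfold cupTerm extFace
  rw [h1, h2, Finset.insert_union, Finset.insert_union, if_neg (by simp [hmT, hmP]),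
    if_neg (by simp [hmT, hmQ])]
  dsimp only
  by_cases h0 : c (x + shift L (P.filter fun j => Even (T.filter (· < j)).card),
    insert m (T ∪ Q)) = 0
  · rw [h0]; ring
  · have h3 := hc _ h0
    dsimp only at h3
    rw [Finset.card_insert_of_notMem (by simp [hmT, hmQ]), Finset.card_union_of_disjoint hd, hk]
      at h3
    have h4 : (-1 : R) ^ Q.card = (-1) ^ (q + (k + 1)) :=
      neg_one_pow_of_even (by rwa [show Q.card + (q + (k + 1)) = k + Q.card + 1 + q by ring])
    rw [add_mul, one_mul, ← add_assoc, pow_add _ _ Q.card, h4]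
    ring

/-- The last direction `m` lies in `P`, in `Q` or in `T`, and the three cases give the three
summands. In the last one a shared direction is used up, hence `cupPred`. -/
theorem cup_insert_max (k q : ℕ) (b c : Cochain L R) (hc : HasParity q c) (x : Pos L)
    (hS : ∀ j ∈ S, j < m) :
    cup k b c (x, insert m S) =
      (-1) ^ (q + k) * cup k (extFace m b) (endFace m (Even k) c) (x, S) +
      (-1) ^ k * cup k (endFace m (Odd k) b) (extFace m c) (x, S) +
      (-1) ^ (q + k) * cupPred k (extFace m b) (extFace m c) (x, S) := by
  have hmS : m ∉ S := fun h => lt_irrefl _ (hS m h)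
  have key : ∀ T ∈ Finset.powersetCard k S,
      ∑ P ∈ (insert m S \ T).powerset, cupTerm k b c x T P ((insert m S \ T) \ P) =
      (-1) ^ k * ∑ P ∈ (S \ T).powerset,
        cupTerm k (endFace m (Odd k) b) (extFace m c) x T P ((S \ T) \ P) +
      (-1) ^ (q + k) * ∑ P ∈ (S \ T).powerset,
        cupTerm k (extFace m b) (endFace m (Even k) c) x T P ((S \ T) \ P) := by
    intro T hT
    obtain ⟨hTS, hk⟩ := Finset.mem_powersetCard.1 hT
    have hmT : m ∉ T := fun h => hmS (hTS h)
    have hmST : m ∉ S \ T := fun h => hmS (Finset.sdiff_subset h)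
    rw [Finset.insert_sdiff_of_notMem _ hmT, Finset.sum_powerset_insert hmST, Finset.mul_sum,
      Finset.mul_sum]
    congr 1
    · refine Finset.sum_congr rfl fun P hP => ?_
      have hPS := Finset.mem_powerset.1 hP
      have hmP : m ∉ P := fun h => hmST (hPS h)
      rw [Finset.insert_sdiff_of_notMem _ hmP]
      exact cupTerm_insert_Q k b c x (fun j hj => hS j (hTS hj))
        (fun j hj => hS j (Finset.sdiff_subset (hPS hj)))
        (fun j hj => hS j (Finset.sdiff_subset (Finset.sdiff_subset hj))) hk
    · refine Finset.sum_congr rfl fun P hP => ?_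
      have hPS := Finset.mem_powerset.1 hP
      rw [Finset.insert_sdiff_insert, Finset.sdiff_insert_of_notMem hmST]
      exact cupTerm_insert_P k q b c hc x (fun j hj => hS j (hTS hj))
        (fun j hj => hS j (Finset.sdiff_subset (hPS hj)))
        (fun j hj => hS j (Finset.sdiff_subset (Finset.sdiff_subset hj))) hk
        (Finset.disjoint_of_subset_right Finset.sdiff_subset Finset.disjoint_sdiff)
  cases k with
  | zero =>
    have h0 := key ∅ (by simp)
    simp only [cup_apply, Finset.powersetCard_zero, Finset.sum_singleton, cupPred, Pi.zero_apply]
    rw [h0]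
    ring
  | succ k =>
    rw [cup_apply, Finset.powersetCard_succ_insert hmS, Finset.sum_union, Finset.sum_congr rfl key,
      Finset.sum_add_distrib, ← Finset.mul_sum, ← Finset.mul_sum, Finset.sum_image]
    · have h2 : ∀ T ∈ Finset.powersetCard k S,
          ∑ P ∈ (insert m S \ insert m T).powerset,
            cupTerm (k + 1) b c x (insert m T) P ((insert m S \ insert m T) \ P) =
          (-1) ^ (q + (k + 1)) * ∑ P ∈ (S \ T).powerset,
            cupTerm k (extFace m b) (extFace m c) x T P ((S \ T) \ P) := by
        intro T hT
        obtain ⟨hTS, hk⟩ := Finset.mem_powersetCard.1 hT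
        have hmST : m ∉ S \ T := fun h => hmS (Finset.sdiff_subset h)
        rw [Finset.insert_sdiff_insert, Finset.sdiff_insert_of_notMem hmS, Finset.mul_sum]
        refine Finset.sum_congr rfl fun P hP => ?_
        have hPS := Finset.mem_powerset.1 hP
        exact cupTerm_insert_T k q b c hc x (fun j hj => hS j (hTS hj))
          (fun j hj => hS j (Finset.sdiff_subset (hPS hj)))
          (fun j hj => hS j (Finset.sdiff_subset (Finset.sdiff_subset hj))) hk
          (Finset.disjoint_of_subset_right Finset.sdiff_subset Finset.disjoint_sdiff)
      rw [Finset.sum_congr rfl h2, ← Finset.mul_sum]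
      simp only [cup_apply, cupPred]
      ring
    · intro T hT T' hT' h
      have hm : ∀ T ∈ Finset.powersetCard k S, m ∉ T := fun T hT h =>
        hmS ((Finset.mem_powersetCard.1 hT).1 h)
      have := congrArg (fun A => Finset.erase A m) h
      simpa [Finset.erase_insert (hm T hT), Finset.erase_insert (hm T' hT')] using this
    · rw [Finset.disjoint_left]
      intro T hT hT'
      obtain ⟨T', _, rfl⟩ := Finset.mem_image.1 hT'
      exact hmS ((Finset.mem_powersetCard.1 hT).1 (Finset.mem_insert_self _ _))

theorem cup_add_left (k : ℕ) (b b' c : Cochain L R) :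
    cup k (b + b') c = cup k b c + cup k b' c := by
  funext σ
  simp only [cup, Pi.add_apply, mul_add, add_mul, Finset.sum_add_distrib]

theorem cup_add_right (k : ℕ) (b c c' : Cochain L R) :
    cup k b (c + c') = cup k b c + cup k b c' := by
  funext σ
  simp only [cup, Pi.add_apply, mul_add, Finset.sum_add_distrib]

theorem cup_smul_left (k : ℕ) (r : R) (b c : Cochain L R) :
    cup k (r • b) c = r • cup k b c := by
  funext σ
  simp only [cup, Pi.smul_apply, smul_eq_mul, Finset.mul_sum]
  refine Finset.sum_congr rfl fun T _ => Finset.sum_congr rfl fun P _ => ?_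
  ring

theorem cup_smul_right (k : ℕ) (r : R) (b c : Cochain L R) :
    cup k b (r • c) = r • cup k b c := by
  funext σ
  simp only [cup, Pi.smul_apply, smul_eq_mul, Finset.mul_sum]
  refine Finset.sum_congr rfl fun T _ => Finset.sum_congr rfl fun P _ => ?_
  ring

theorem cup_sub_left (k : ℕ) (b b' c : Cochain L R) :
    cup k (b - b') c = cup k b c - cup k b' c := by
  funext σ
  simp only [cup, Pi.sub_apply, mul_sub, sub_mul, Finset.sum_sub_distrib]

theorem cup_sub_right (k : ℕ) (b c c' : Cochain L R) :
    cup k b (c - c') = cup k b c - cup k b c' := by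
  funext σ
  simp only [cup, Pi.sub_apply, mul_sub, Finset.sum_sub_distrib]

theorem coboundary_add (b c : Cochain L R) :
    coboundary (b + c) = coboundary b + coboundary c := by
  funext σ
  simp only [coboundary, Pi.add_apply, ← Finset.sum_add_distrib, ← smul_add]
  exact Finset.sum_congr rfl fun j _ => by rw [add_sub_add_comm]

theorem coboundary_smul (r : R) (b : Cochain L R) :
    coboundary (r • b) = r • coboundary b := by
  funext σ
  simp only [coboundary, Pi.smul_apply, Finset.smul_sum, ← smul_sub]
  exact Finset.sum_congr rfl fun j _ => by rw [smul_comm]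

/-- As `m` comes last, the two faces orthogonal to `m` carry the sign of all of `S`, and the signs
of the other faces are those on `S`. -/
theorem coboundary_insert_max (c : Cochain L R) (x : Pos L) (hS : ∀ j ∈ S, j < m) :
    coboundary c (x, insert m S) = coboundary (extFace m c) (x, S) +
      (-1) ^ S.card * (endFace m True c (x, S) - c (x, S)) := by
  have hmS : m ∉ S := fun h => lt_irrefl _ (hS m h)
  unfold coboundary extFace endFace
  dsimp only
  rw [Finset.sum_insert hmS, add_comm]
  congr 1
  · refine Finset.sum_congr rfl fun j hj => ?_
    have hjm : j ≠ m := (hS j hj).ne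
    rw [Finset.filter_insert, if_neg (not_lt.2 (hS j hj).le),
      Finset.erase_insert_of_ne hjm.symm, if_neg (fun h => hmS (Finset.erase_subset _ _ h)),
      if_neg (fun h => hmS (Finset.erase_subset _ _ h))]
  · rw [Finset.filter_insert, if_neg (lt_irrefl m), filter_lt_max hS, Finset.erase_insert hmS,
      if_pos trivial, zsmul_eq_mul]
    push_cast
    rfl

/-- Only subcells of `S` enter, so identities that are valid just for cells below `m`, such as
`extFace_coboundary`, may be substituted into products. -/
theorem cup_congr {k : ℕ} {b b' c c' : Cochain L R}
    (hb : ∀ σ : Cell L, σ.2 ⊆ S → b σ = b' σ) (hc : ∀ σ : Cell L, σ.2 ⊆ S → c σ = c' σ)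
    (x : Pos L) : cup k b c (x, S) = cup k b' c' (x, S) := by
  simp only [cup_apply]
  refine Finset.sum_congr rfl fun T hT => Finset.sum_congr rfl fun P hP => ?_
  have hT := (Finset.mem_powersetCard.1 hT).1
  have hP := (Finset.mem_powerset.1 hP).trans Finset.sdiff_subset
  unfold cupTerm
  rw [hb _ (Finset.union_subset hT hP),
    hc _ (Finset.union_subset hT (Finset.sdiff_subset.trans Finset.sdiff_subset))]

theorem cupPred_congr {k : ℕ} {b b' c c' : Cochain L R}
    (hb : ∀ σ : Cell L, σ.2 ⊆ S → b σ = b' σ) (hc : ∀ σ : Cell L, σ.2 ⊆ S → c σ = c' σ)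
    (x : Pos L) : cupPred k b c (x, S) = cupPred k b' c' (x, S) := by
  cases k with
  | zero => rfl
  | succ k => exact cup_congr hb hc x

theorem coboundary_congr {c c' : Cochain L R}
    (hc : ∀ σ : Cell L, σ.2 ⊆ S → c σ = c' σ) (x : Pos L) :
    coboundary c (x, S) = coboundary c' (x, S) := by
  unfold coboundary
  refine Finset.sum_congr rfl fun j _ => ?_
  rw [hc _ (Finset.erase_subset j S), hc _ (Finset.erase_subset j S)]

theorem cup_endFace (k : ℕ) (m : Fin d) (a : Prop) [Decidable a] (b c : Cochain L R) :
    cup k (endFace m a b) (endFace m a c) = endFace m a (cup k b c) := by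
  funext ⟨x, S⟩
  simp only [cup_apply, endFace, cupTerm, add_right_comm]

theorem coboundary_endFace (m : Fin d) (a : Prop) [Decidable a] (c : Cochain L R) :
    coboundary (endFace m a c) = endFace m a (coboundary c) := by
  funext ⟨x, S⟩
  simp only [coboundary, endFace, add_right_comm]

theorem endFace_false (m : Fin d) (a : Prop) [Decidable a] (ha : ¬ a) (b : Cochain L R) :
    endFace m a b = b := by
  funext σ; simp [endFace, ha]

theorem endFace_true (m : Fin d) (a : Prop) [Decidable a] (ha : a) (b : Cochain L R) :
    endFace m a b = endFace m True b := by
  funext σ; simp [endFace, ha]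

/-- Removing a direction lowers the degree by one, which for parities is the same as raising it.
Working with parities avoids subtraction of degrees, and signs depend on nothing else. -/
theorem HasParity.extFace {p : ℕ} {b : Cochain L R} (hb : HasParity p b) (m : Fin d) :
    HasParity (p + 1) (extFace m b) := by
  intro σ h
  by_cases hm : m ∈ σ.2
  · exact absurd (if_pos hm) h
  · have := hb (σ.1, insert m σ.2) (by rwa [HigherQCA.extFace, if_neg hm] at h)
    dsimp only at this
    rw [Finset.card_insert_of_notMem hm] at this
    rwa [show σ.2.card + (p + 1) = σ.2.card + 1 + p by ring]

/-- Trades a sign that depends on the cell for a constant one, which can be pulled out of products.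
-/
theorem HasParity.mul_eq {p : ℕ} {b : Cochain L R} (hb : HasParity p b) (σ : Cell L) :
    (-1) ^ σ.2.card * b σ = (-1) ^ p * b σ := by
  by_cases h : b σ = 0
  · rw [h, mul_zero, mul_zero]
  · rw [neg_one_pow_of_even (hb σ h)]

theorem HasParity.coboundary {p : ℕ} {b : Cochain L R} (hb : HasParity p b) :
    HasParity (p + 1) (coboundary b) := by
  intro σ h
  obtain ⟨j, hj, hne⟩ := Finset.exists_ne_zero_of_sum_ne_zero h
  have : b (σ.1 + shift L {j}, σ.2.erase j) ≠ 0 ∨ b (σ.1, σ.2.erase j) ≠ 0 := by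
    by_contra! h'
    exact hne (by rw [h'.1, h'.2]; simp)
  have hc := Finset.card_erase_add_one hj
  rcases this with h | h <;> have h2 := hb _ h <;> dsimp only at h2 <;> rw [← hc] <;>
    rw [show (σ.2.erase j).card + 1 + (p + 1) = (σ.2.erase j).card + p + 2 by ring] <;>
    exact h2.add even_two

theorem HasParity.endFace {p : ℕ} {b : Cochain L R} (hb : HasParity p b) (m : Fin d) (a : Prop)
    [Decidable a] : HasParity p (endFace m a b) := fun σ h =>
  hb (σ.1 + _, σ.2) h

theorem HasParity.cup {p q : ℕ} {b c : Cochain L R} (hb : HasParity p b) (hc : HasParity q c)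
    (k : ℕ) : HasParity (p + q + k) (cup k b c) := by
  rintro ⟨x, S⟩ h
  rw [cup_apply] at h
  obtain ⟨T, hT, h⟩ := Finset.exists_ne_zero_of_sum_ne_zero h
  obtain ⟨P, hP, h⟩ := Finset.exists_ne_zero_of_sum_ne_zero h
  obtain ⟨hTS, hk⟩ := Finset.mem_powersetCard.1 hT
  have hP := Finset.mem_powerset.1 hP
  have h1 := hb _ (right_ne_zero_of_mul (left_ne_zero_of_mul h))
  have h2 := hc _ (right_ne_zero_of_mul h)
  dsimp only at h1 h2
  rw [Finset.card_union_of_disjoint (Finset.disjoint_of_subset_right hP Finset.disjoint_sdiff)]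
    at h1
  rw [Finset.card_union_of_disjoint
    (Finset.disjoint_of_subset_right Finset.sdiff_subset Finset.disjoint_sdiff)] at h2
  have h3 := Finset.card_sdiff_add_card_eq_card hP
  have h4 := Finset.card_sdiff_add_card_eq_card hTS
  dsimp only
  grind

/-- `coboundary_insert_max` as an identity of cochains with constant coefficients, fit for insertion
into cup products. -/
theorem extFace_coboundary {p : ℕ} {b : Cochain L R} (hb : HasParity p b)
    (hS : ∀ j ∈ S, j < m) (σ : Cell L) (hσ : σ.2 ⊆ S) :
    extFace m (coboundary b) σ =
      (coboundary (extFace m b) + (-1 : R) ^ p • (endFace m True b - b)) σ := by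
  obtain ⟨x, A⟩ := σ
  have hA : ∀ j ∈ A, j < m := fun j hj => hS j (hσ hj)
  rw [extFace, if_neg (fun h => lt_irrefl _ (hA m h)), coboundary_insert_max b x hA]
  simp only [Pi.add_apply, Pi.smul_apply, Pi.sub_apply, smul_eq_mul, mul_sub]
  have h1 := hb.mul_eq (x, A)
  have h2 := (hb.endFace m True).mul_eq (x, A)
  dsimp only at h1 h2
  rw [h1, h2]

theorem extFace_cup (k q : ℕ) (b c : Cochain L R) (hc : HasParity q c)
    (hS : ∀ j ∈ S, j < m) (σ : Cell L) (hσ : σ.2 ⊆ S) :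
    extFace m (cup k b c) σ =
      ((-1 : R) ^ (q + k) • cup k (extFace m b) (endFace m (Even k) c) +
      (-1 : R) ^ k • cup k (endFace m (Odd k) b) (extFace m c) +
      (-1 : R) ^ (q + k) • cupPred k (extFace m b) (extFace m c)) σ := by
  obtain ⟨x, A⟩ := σ
  have hA : ∀ j ∈ A, j < m := fun j hj => hS j (hσ hj)
  rw [extFace, if_neg (fun h => lt_irrefl _ (hA m h)), cup_insert_max k q b c hc x hA]
  rfl

/-- The coboundary formula for the hypercubic cup products. -/
theorem coboundary_cup_apply (S : Finset (Fin d)) : ∀ (k p q : ℕ) (b c : Cochain L R),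
    HasParity p b → HasParity q c → ∀ x : Pos L,
    coboundary (cup k b c) (x, S) = cup k (coboundary b) c (x, S) +
      (-1) ^ p * cup k b (coboundary c) (x, S) + (-1) ^ (p + q + k) * cupPred k b c (x, S) +
      (-1) ^ (p * q + p + q) * cupPred k c b (x, S) := by
  induction S using Finset.induction_on_max with
  | empty =>
    intro k p q b c hb hc x
    have h0 : ∀ (k : ℕ) (b c : Cochain L R), cup k b c (x, ∅) =
        if k = 0 then b (x, ∅) * c (x, ∅) else 0 := by
      intro k b c
      cases k with
      | zero => simp [cup, shift_empty]
      | succ k => rw [cup_apply, Finset.powersetCard_eq_empty.2 (by simp)]; simp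
    have h1 : ∀ c : Cochain L R, coboundary c (x, ∅) = 0 := fun c => by simp [coboundary]
    rcases k with _ | _ | k
    · simp [h0, h1, cupPred]
    -- On a vertex with `k = 1` only the two `cupPred` terms remain. Nonzero values force `p` and
    -- `q` to be even, and then the signs are opposite.
    · simp only [h0, h1, cupPred]
      by_cases hb0 : b (x, ∅) = 0
      · simp [hb0]
      by_cases hc0 : c (x, ∅) = 0
      · simp [hc0]
      have hp : Even p := by simpa using hb _ hb0
      have hq : Even q := by simpa using hc _ hc0
      simp [pow_add, pow_mul, hp.neg_one_pow, hq.neg_one_pow, mul_comm]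
    · simp [h0, h1, cupPred]
  | insert m S hS ih =>
    intro k p q b c hb hc x
    -- The direction `m` is split off everywhere, so that all products live on `S`. The inductive
    -- hypothesis is used for the pairs (extended, end face), (end face, extended) and, if `k > 0`,
    -- (extended, extended).
    have e1 := coboundary_congr (extFace_cup k q b c hc hS) x
    have e2 := ((hb.cup hc k).mul_eq (x, S))
    have e3 := (((hb.cup hc k).endFace m True).mul_eq (x, S))
    have e4 := extFace_coboundary hb hS
    have e5 := extFace_coboundary hc hS
    have f1 := cup_congr (k := k) e4 (fun σ _ => rfl : ∀ σ : Cell L, σ.2 ⊆ S → (endFace m (Even k) c) σ = _) x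
    have f2 := cup_congr (k := k) (fun σ _ => rfl : ∀ σ : Cell L, σ.2 ⊆ S → (endFace m (Odd k) b) σ = _) e5 x
    have f3 := cupPred_congr (k := k) e4 (fun σ _ => rfl : ∀ σ : Cell L, σ.2 ⊆ S → (extFace m c) σ = _) x
    have f4 := cupPred_congr (k := k) (fun σ _ => rfl : ∀ σ : Cell L, σ.2 ⊆ S → (extFace m b) σ = _) e5 x
    have i1 := ih k (p + 1) q (extFace m b) (endFace m (Even k) c) (hb.extFace m)
      (hc.endFace m _) x
    have i2 := ih k p (q + 1) (endFace m (Odd k) b) (extFace m c) (hb.endFace m _)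
      (hc.extFace m) x
    rw [coboundary_insert_max _ x hS, e1, cup_insert_max k q _ _ hc x hS,
      cup_insert_max k (q + 1) _ _ hc.coboundary x hS, mul_sub]
    dsimp only at e2 e3
    rw [e2, e3, f1, f2, f3, f4, ← cup_endFace]
    simp only [coboundary_add, coboundary_smul, Pi.add_apply, Pi.smul_apply, smul_eq_mul, i1, i2,
      cup_add_left, cup_smul_left, cup_add_right, cup_smul_right, cup_sub_left, cup_sub_right,
      Pi.sub_apply, coboundary_endFace]
    clear f1 f2 f3 f4 e1 e2 e3 e4 e5 i1 i2
    cases k with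
    | zero =>
      have h0 : ∀ b c : Cochain L R, cupPred 0 b c = 0 := fun _ _ => rfl
      have h1 : ∀ b : Cochain L R, endFace m (Odd 0) b = b := fun b =>
        endFace_false m _ (by simp) b
      have h2 : ∀ b : Cochain L R, endFace m (Even 0) b = endFace m True b := fun b =>
        endFace_true m _ (by simp) b
      have h3 : coboundary (0 : Cochain L R) = 0 := by funext σ; simp [coboundary]
      simp only [h0, h1, h2, h3, Pi.zero_apply]
      rcases Nat.even_or_odd p with hp | hp <;> rcases Nat.even_or_odd q with hq | hq <;>
        simp only [pow_add, pow_mul, hp.neg_one_pow, hq.neg_one_pow, pow_zero, pow_one, one_pow] <;>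
        ring
    | succ k =>
      have i3 := ih k (p + 1) (q + 1) (extFace m b) (extFace m c) (hb.extFace m) (hc.extFace m) x
      have h0 : ∀ b c : Cochain L R, cupPred (k + 1) b c = cup k b c := fun _ _ => rfl
      simp only [h0, i3, cup_insert_max k q b c hc x hS, cup_insert_max k p c b hb x hS,
        cup_add_left, cup_smul_left, cup_add_right, cup_smul_right, cup_sub_left, cup_sub_right,
        Pi.add_apply, Pi.smul_apply, Pi.sub_apply, smul_eq_mul]
      -- The parity decides which factor is evaluated on the far end; between the products with
      -- index `k + 1` and those with index `k` the roles are exchanged.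
      rcases Nat.even_or_odd k with hk | hk
      · have h1 : ∀ b : Cochain L R, endFace m (Odd (k + 1)) b = endFace m True b := fun b =>
          endFace_true m _ hk.add_one b
        have h2 : ∀ b : Cochain L R, endFace m (Even (k + 1)) b = b := fun b =>
          endFace_false m _ (by rw [Nat.not_even_iff_odd]; exact hk.add_one) b
        have h3 : ∀ b : Cochain L R, endFace m (Odd k) b = b := fun b =>
          endFace_false m _ (by rwa [Nat.not_odd_iff_even]) b
        have h4 : ∀ b : Cochain L R, endFace m (Even k) b = endFace m True b := fun b =>
          endFace_true m _ hk b
        simp only [h1, h2, h3, h4]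
        rcases Nat.even_or_odd p with hp | hp <;> rcases Nat.even_or_odd q with hq | hq <;>
          simp only [pow_add, pow_mul, hp.neg_one_pow, hq.neg_one_pow, hk.neg_one_pow, pow_one,
            one_pow, one_mul, mul_one, mul_neg, neg_neg] <;>
          ring
      · have h1 : ∀ b : Cochain L R, endFace m (Odd (k + 1)) b = b := fun b =>
          endFace_false m _ (by rw [Nat.not_odd_iff_even]; exact hk.add_one) b
        have h2 : ∀ b : Cochain L R, endFace m (Even (k + 1)) b = endFace m True b := fun b =>
          endFace_true m _ hk.add_one b
        have h3 : ∀ b : Cochain L R, endFace m (Odd k) b = endFace m True b := fun b =>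
          endFace_true m _ hk b
        have h4 : ∀ b : Cochain L R, endFace m (Even k) b = b := fun b =>
          endFace_false m _ (by rwa [Nat.not_even_iff_odd]) b
        simp only [h1, h2, h3, h4]
        rcases Nat.even_or_odd p with hp | hp <;> rcases Nat.even_or_odd q with hq | hq <;>
          simp only [pow_add, pow_mul, hp.neg_one_pow, hq.neg_one_pow, hk.neg_one_pow, pow_one,
            one_pow, one_mul, mul_one, mul_neg, neg_neg] <;>
          ring

theorem IsOfDegree.hasParity {p : ℕ} {b : Cochain L R} (hb : IsOfDegree p b) : HasParity p b := by
  intro σ h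
  by_cases hσ : σ.2.card = p
  · rw [hσ]; exact ⟨p, rfl⟩
  · exact absurd (hb σ hσ) h

theorem coboundary_cup {k p q : ℕ} {b c : Cochain L R} (hb : HasParity p b) (hc : HasParity q c) :
    coboundary (cup k b c) = cup k (coboundary b) c + (-1 : R) ^ p • cup k b (coboundary c) +
      (-1 : R) ^ (p + q + k) • cupPred k b c + (-1 : R) ^ (p * q + p + q) • cupPred k c b := by
  funext ⟨x, S⟩
  exact coboundary_cup_apply S k p q b c hb hc x

/-- The same induction: the differences of end faces appear twice with opposite signs. -/
theorem coboundary_coboundary_apply (S : Finset (Fin d)) : ∀ (p : ℕ) (c : Cochain L R),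
    HasParity p c → ∀ x : Pos L, coboundary (coboundary c) (x, S) = 0 := by
  induction S using Finset.induction_on_max with
  | empty => intro p c _ x; simp [coboundary]
  | insert m S hS ih =>
    intro p c hc x
    have h1 := coboundary_congr (extFace_coboundary hc hS) x
    have h2 := hc.coboundary.mul_eq (x, S)
    have h3 := (hc.coboundary.endFace m True).mul_eq (x, S)
    dsimp only at h2 h3
    have h4 : endFace m True c - c = endFace m True c + (-1 : R) • c := by
      rw [neg_one_smul, sub_eq_add_neg]
    rw [coboundary_insert_max _ x hS, h1, mul_sub, h2, h3, h4]
    simp only [coboundary_add, coboundary_smul, Pi.add_apply, Pi.smul_apply, smul_eq_mul,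
      ih (p + 1) _ (hc.extFace m) x, coboundary_endFace]
    ring

theorem coboundary_coboundary {p : ℕ} {c : Cochain L R} (hc : HasParity p c) :
    coboundary (coboundary c) = 0 := by
  funext ⟨x, S⟩
  exact coboundary_coboundary_apply S p c hc x

end CubicalFormula

/-! ### Coboundary formula for Steenrod's products, on functions of vertex sets -/

section SimplicialFormula

variable {N : ℕ} {R : Type*} [CommRing R]

/-- The coboundary of a function of finite sets of vertices. -/
def faceCob (f : Finset (Fin N) → R) : Finset (Fin N) → R :=
  fun V => ∑ v ∈ V, (-1 : R) ^ (V.filter (· < v)).card * f (V.erase v)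

/-- The vertices of the first face of a cup product. -/
def firstFace (I V : Finset (Fin N)) : Finset (Fin N) :=
  V.filter fun m => m ∈ I ∨ Even (I.filter (· < m)).card

/-- The vertices of the second face of a cup product. -/
def secondFace (I V : Finset (Fin N)) : Finset (Fin N) :=
  V.filter fun m => m ∈ I ∨ Odd (I.filter (· < m)).card

/-- One term of Steenrod's cup product. -/
def faceTerm (f g : Finset (Fin N) → R) (I U W : Finset (Fin N)) : R :=
  (-1 : R) ^ ((U ×ˢ (W \ I)).filter fun x => x.2 < x.1).card * f U * g W

/-- The cup product with `n` shared vertices for functions of finite sets of vertices. -/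
def faceCup (n : ℕ) (f g : Finset (Fin N) → R) : Finset (Fin N) → R :=
  fun V => ∑ I ∈ Finset.powersetCard n V, faceTerm f g I (firstFace I V) (secondFace I V)

/-- `faceCup (n - 1)`, and zero for `n = 0`. -/
def faceCupPred (n : ℕ) (f g : Finset (Fin N) → R) : Finset (Fin N) → R :=
  match n with
  | 0 => 0
  | n + 1 => faceCup n f g

/-- The function `f` evaluated on the sets extended by `m`. -/
def joinVertex (m : Fin N) (f : Finset (Fin N) → R) : Finset (Fin N) → R :=
  fun U => if m ∈ U then 0 else f (insert m U)

/-- `f` is supported on sets whose cardinality has the parity of `p`. -/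
def FaceParity (p : ℕ) (f : Finset (Fin N) → R) : Prop := ∀ U, f U ≠ 0 → Even (U.card + p)

variable {m : Fin N} {V I U W : Finset (Fin N)}

/-- All of `I` precedes `m`, so an unshared largest vertex goes to the first face when `|I|` is even
and to the second when it is odd. -/
theorem firstFace_insert (hI : ∀ j ∈ I, j < m) :
    firstFace I (insert m V) =
      if Even I.card then insert m (firstFace I V) else firstFace I V := by
  have hmI : m ∉ I := fun h => lt_irrefl _ (hI m h)
  simp only [firstFace, Finset.filter_insert, hmI, false_or, filter_lt_max hI]

theorem secondFace_insert (hI : ∀ j ∈ I, j < m) :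
    secondFace I (insert m V) =
      if Odd I.card then insert m (secondFace I V) else secondFace I V := by
  have hmI : m ∉ I := fun h => lt_irrefl _ (hI m h)
  simp only [secondFace, Finset.filter_insert, hmI, false_or, filter_lt_max hI]

theorem firstFace_insert_insert (hV : ∀ j ∈ V, j < m) :
    firstFace (insert m I) (insert m V) = insert m (firstFace I V) := by
  unfold firstFace
  rw [Finset.filter_insert, if_pos (Or.inl (Finset.mem_insert_self _ _))]
  congr 1
  refine Finset.filter_congr fun j hj => ?_
  rw [Finset.filter_insert, if_neg (not_lt.2 (hV j hj).le), Finset.mem_insert,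
    or_iff_right (hV j hj).ne]

theorem secondFace_insert_insert (hV : ∀ j ∈ V, j < m) :
    secondFace (insert m I) (insert m V) = insert m (secondFace I V) := by
  unfold secondFace
  rw [Finset.filter_insert, if_pos (Or.inl (Finset.mem_insert_self _ _))]
  congr 1
  refine Finset.filter_congr fun j hj => ?_
  rw [Finset.filter_insert, if_neg (not_lt.2 (hV j hj).le), Finset.mem_insert,
    or_iff_right (hV j hj).ne]

theorem firstFace_subset : firstFace I V ⊆ V := Finset.filter_subset _ _

theorem secondFace_subset : secondFace I V ⊆ V := Finset.filter_subset _ _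

theorem subset_secondFace (h : I ⊆ V) : I ⊆ secondFace I V := fun j hj =>
  Finset.mem_filter.2 ⟨h hj, Or.inl hj⟩

theorem faceTerm_insert_left (q : ℕ) (f g : Finset (Fin N) → R) (hg : FaceParity q g)
    (hU : ∀ j ∈ U, j < m) (hW : ∀ j ∈ W, j < m) (hIW : I ⊆ W) :
    faceTerm f g I (insert m U) W = (-1) ^ (q + I.card) * faceTerm (joinVertex m f) g I U W := by
  have hmU : m ∉ U := fun h => lt_irrefl _ (hU m h)
  unfold faceTerm joinVertex
  rw [inv_insert_left hmU fun j hj => hW j (Finset.sdiff_subset hj), if_neg hmU]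
  by_cases h0 : g W = 0
  · rw [h0]; ring
  · have h1 := hg _ h0
    have h2 := Finset.card_sdiff_add_card_eq_card hIW
    have h3 : (-1 : R) ^ (W \ I).card = (-1) ^ (q + I.card) :=
      neg_one_pow_of_even (by rw [← h2] at h1; convert h1 using 1; ring)
    rw [pow_add _ _ (W \ I).card, h3]
    ring

theorem faceTerm_insert_right (f g : Finset (Fin N) → R)
    (hU : ∀ j ∈ U, j < m) (hW : ∀ j ∈ W, j < m) (hI : m ∉ I) :
    faceTerm f g I U (insert m W) = faceTerm f (joinVertex m g) I U W := by
  have hmW : m ∉ W := fun h => lt_irrefl _ (hW m h)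
  unfold faceTerm joinVertex
  rw [Finset.insert_sdiff_of_notMem _ hI, inv_insert_right hU, if_neg hmW]

theorem faceTerm_insert_both (q : ℕ) (f g : Finset (Fin N) → R) (hg : FaceParity q g)
    (hU : ∀ j ∈ U, j < m) (hW : ∀ j ∈ W, j < m) (hIW : I ⊆ W) :
    faceTerm f g (insert m I) (insert m U) (insert m W) =
      (-1) ^ (q + (I.card + 1)) * faceTerm (joinVertex m f) (joinVertex m g) I U W := by
  have hmU : m ∉ U := fun h => lt_irrefl _ (hU m h)
  have hmW : m ∉ W := fun h => lt_irrefl _ (hW m h)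
  unfold faceTerm joinVertex
  rw [Finset.insert_sdiff_insert, Finset.sdiff_insert_of_notMem hmW,
    inv_insert_left hmU fun j hj => hW j (Finset.sdiff_subset hj), if_neg hmU, if_neg hmW]
  by_cases h0 : g (insert m W) = 0
  · rw [h0]; ring
  · have h1 := hg _ h0
    have h2 := Finset.card_sdiff_add_card_eq_card hIW
    have h3 : (-1 : R) ^ (W \ I).card = (-1) ^ (q + (I.card + 1)) :=
      neg_one_pow_of_even (by
        rw [Finset.card_insert_of_notMem hmW, ← h2] at h1
        convert h1 using 1; ring)
    rw [pow_add _ _ (W \ I).card, h3]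
    ring

/-- The largest vertex is either unshared, in the face determined by the parity of `n`, or shared.
In contrast to the cubical case, each `n` allows only one of the two unshared possibilities. -/
theorem faceCup_insert_max (n q : ℕ) (f g : Finset (Fin N) → R) (hg : FaceParity q g)
    (hV : ∀ j ∈ V, j < m) :
    faceCup n f g (insert m V) =
      (if Even n then (-1) ^ q * faceCup n (joinVertex m f) g V
        else faceCup n f (joinVertex m g) V) +
      (-1) ^ (q + n) * faceCupPred n (joinVertex m f) (joinVertex m g) V := by
  have hmV : m ∉ V := fun h => lt_irrefl _ (hV m h)
  have key : ∀ I ∈ Finset.powersetCard n V,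
      faceTerm f g I (firstFace I (insert m V)) (secondFace I (insert m V)) =
      if Even n then (-1) ^ q * faceTerm (joinVertex m f) g I (firstFace I V) (secondFace I V)
        else faceTerm f (joinVertex m g) I (firstFace I V) (secondFace I V) := by
    intro I hI
    obtain ⟨hIV, hn⟩ := Finset.mem_powersetCard.1 hI
    have hIm : ∀ j ∈ I, j < m := fun j hj => hV j (hIV hj)
    have hU : ∀ j ∈ firstFace I V, j < m := fun j hj => hV j (firstFace_subset hj)
    have hW : ∀ j ∈ secondFace I V, j < m := fun j hj => hV j (secondFace_subset hj)
    rw [firstFace_insert hIm, secondFace_insert hIm, hn]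
    split_ifs with h1 h2 h2
    · exact absurd h1 (Nat.not_even_iff_odd.2 h2)
    · rw [faceTerm_insert_left q f g hg hU hW (subset_secondFace hIV), hn, pow_add,
        h1.neg_one_pow, mul_one]
    · rw [faceTerm_insert_right f g hU hW fun h => hmV (hIV h)]
    · exact absurd (Nat.not_even_iff_odd.1 h1) h2
  have key' : ∑ I ∈ Finset.powersetCard n V,
      faceTerm f g I (firstFace I (insert m V)) (secondFace I (insert m V)) =
      if Even n then (-1) ^ q * faceCup n (joinVertex m f) g V
        else faceCup n f (joinVertex m g) V := by
    rw [Finset.sum_congr rfl key]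
    split_ifs
    · rw [← Finset.mul_sum]; rfl
    · rfl
  cases n with
  | zero =>
    rw [← key']
    simp [faceCup, faceCupPred]
  | succ n =>
    rw [← key', faceCup, Finset.powersetCard_succ_insert hmV, Finset.sum_union, Finset.sum_image]
    · congr 1
      simp only [faceCupPred, faceCup, Finset.mul_sum]
      refine Finset.sum_congr rfl fun I hI => ?_
      obtain ⟨hIV, hn⟩ := Finset.mem_powersetCard.1 hI
      rw [firstFace_insert_insert hV, secondFace_insert_insert hV, faceTerm_insert_both q f g hg
        (fun j hj => hV j (firstFace_subset hj)) (fun j hj => hV j (secondFace_subset hj))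
        (subset_secondFace hIV), hn]
    · intro T hT T' hT' h
      have hm : ∀ T ∈ Finset.powersetCard n V, m ∉ T := fun T hT h =>
        hmV ((Finset.mem_powersetCard.1 hT).1 h)
      have := congrArg (fun A => Finset.erase A m) h
      simpa [Finset.erase_insert (hm T hT), Finset.erase_insert (hm T' hT')] using this
    · rw [Finset.disjoint_left]
      intro T hT hT'
      obtain ⟨T', _, rfl⟩ := Finset.mem_image.1 hT'
      exact hmV ((Finset.mem_powersetCard.1 hT).1 (Finset.mem_insert_self _ _))

theorem faceCup_linear_left (n : ℕ) (r r' : R) (f f' g : Finset (Fin N) → R) :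
    faceCup n (r • f + r' • f') g = r • faceCup n f g + r' • faceCup n f' g := by
  funext V
  simp only [faceCup, faceTerm, Pi.add_apply, Pi.smul_apply, smul_eq_mul, Finset.mul_sum,
    ← Finset.sum_add_distrib]
  refine Finset.sum_congr rfl fun I _ => ?_
  ring

theorem faceCup_linear_right (n : ℕ) (r r' : R) (f g g' : Finset (Fin N) → R) :
    faceCup n f (r • g + r' • g') = r • faceCup n f g + r' • faceCup n f g' := by
  funext V
  simp only [faceCup, faceTerm, Pi.add_apply, Pi.smul_apply, smul_eq_mul, Finset.mul_sum,
    ← Finset.sum_add_distrib]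
  refine Finset.sum_congr rfl fun I _ => ?_
  ring

theorem faceCob_linear (r r' : R) (f f' : Finset (Fin N) → R) :
    faceCob (r • f + r' • f') = r • faceCob f + r' • faceCob f' := by
  funext V
  simp only [faceCob, Pi.add_apply, Pi.smul_apply, smul_eq_mul, Finset.mul_sum,
    ← Finset.sum_add_distrib]
  refine Finset.sum_congr rfl fun I _ => ?_
  ring

theorem faceCob_smul (r : R) (f : Finset (Fin N) → R) :
    faceCob (r • f) = r • faceCob f := by
  simpa using faceCob_linear r 0 f 0

theorem faceCob_insert_max (f : Finset (Fin N) → R) (hV : ∀ j ∈ V, j < m) :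
    faceCob f (insert m V) = faceCob (joinVertex m f) V + (-1) ^ V.card * f V := by
  have hmV : m ∉ V := fun h => lt_irrefl _ (hV m h)
  unfold faceCob joinVertex
  rw [Finset.sum_insert hmV, add_comm]
  congr 1
  · refine Finset.sum_congr rfl fun j hj => ?_
    rw [Finset.filter_insert, if_neg (not_lt.2 (hV j hj).le),
      Finset.erase_insert_of_ne (hV j hj).ne', if_neg (fun h => hmV (Finset.erase_subset _ _ h))]
  · rw [Finset.filter_insert, if_neg (lt_irrefl m), filter_lt_max hV, Finset.erase_insert hmV]

theorem faceCup_congr {n : ℕ} {f f' g g' : Finset (Fin N) → R}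
    (hf : ∀ U ⊆ V, f U = f' U) (hg : ∀ U ⊆ V, g U = g' U) :
    faceCup n f g V = faceCup n f' g' V := by
  unfold faceCup faceTerm
  refine Finset.sum_congr rfl fun I _ => ?_
  rw [hf _ firstFace_subset, hg _ secondFace_subset]

theorem faceCupPred_congr {n : ℕ} {f f' g g' : Finset (Fin N) → R}
    (hf : ∀ U ⊆ V, f U = f' U) (hg : ∀ U ⊆ V, g U = g' U) :
    faceCupPred n f g V = faceCupPred n f' g' V := by
  cases n with
  | zero => rfl
  | succ n => exact faceCup_congr hf hg

theorem faceCob_congr {f f' : Finset (Fin N) → R} (hf : ∀ U ⊆ V, f U = f' U) :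
    faceCob f V = faceCob f' V := by
  unfold faceCob
  exact Finset.sum_congr rfl fun j _ => by rw [hf _ (Finset.erase_subset j V)]

theorem FaceParity.mul_eq {p : ℕ} {f : Finset (Fin N) → R} (hf : FaceParity p f)
    (U : Finset (Fin N)) : (-1) ^ U.card * f U = (-1) ^ p * f U := by
  by_cases h : f U = 0
  · rw [h, mul_zero, mul_zero]
  · rw [neg_one_pow_of_even (hf U h)]

theorem FaceParity.join {p : ℕ} {f : Finset (Fin N) → R} (hf : FaceParity p f) (m : Fin N) :
    FaceParity (p + 1) (joinVertex m f) := by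
  intro U h
  by_cases hm : m ∈ U
  · exact absurd (if_pos hm) h
  · have := hf (insert m U) (by rwa [joinVertex, if_neg hm] at h)
    rw [Finset.card_insert_of_notMem hm] at this
    rwa [show U.card + (p + 1) = U.card + 1 + p by ring]

theorem FaceParity.cob {p : ℕ} {f : Finset (Fin N) → R} (hf : FaceParity p f) :
    FaceParity (p + 1) (faceCob f) := by
  intro U h
  obtain ⟨j, hj, hne⟩ := Finset.exists_ne_zero_of_sum_ne_zero h
  have h2 := hf _ (right_ne_zero_of_mul hne)
  rw [← Finset.card_erase_add_one hj, show (U.erase j).card + 1 + (p + 1) =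
    (U.erase j).card + p + 2 by ring]
  exact h2.add even_two

/-- The two faces cover `V` and intersect in `I`. This determines the parity of a cup product. -/
theorem card_firstFace_add (h : I ⊆ V) :
    (firstFace I V).card + (secondFace I V).card = V.card + I.card := by
  have h1 : firstFace I V ∪ secondFace I V = V := by
    ext j
    simp only [firstFace, secondFace, Finset.mem_union, Finset.mem_filter]
    have := Nat.even_or_odd (I.filter (· < j)).card
    tauto
  have h2 : firstFace I V ∩ secondFace I V = I := by
    ext j
    simp only [firstFace, secondFace, Finset.mem_inter, Finset.mem_filter]
    have := @h j
    have h3 : ¬ (Even (I.filter (· < j)).card ∧ Odd (I.filter (· < j)).card) := fun h =>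
      Nat.not_even_iff_odd.2 h.2 h.1
    tauto
  rw [← Finset.card_union_add_card_inter, h1, h2]

theorem FaceParity.cup {p q : ℕ} {f g : Finset (Fin N) → R} (hf : FaceParity p f)
    (hg : FaceParity q g) (n : ℕ) : FaceParity (p + q + n) (faceCup n f g) := by
  intro V h
  obtain ⟨I, hI, h⟩ := Finset.exists_ne_zero_of_sum_ne_zero h
  obtain ⟨hIV, hn⟩ := Finset.mem_powersetCard.1 hI
  have h1 := hf _ (right_ne_zero_of_mul (left_ne_zero_of_mul h))
  have h2 := hg _ (right_ne_zero_of_mul h)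
  have h3 := card_firstFace_add hIV
  grind

theorem joinVertex_cob {p : ℕ} {f : Finset (Fin N) → R} (hf : FaceParity p f)
    (hV : ∀ j ∈ V, j < m) (U : Finset (Fin N)) (hU : U ⊆ V) :
    joinVertex m (faceCob f) U = ((1 : R) • faceCob (joinVertex m f) + (-1 : R) ^ p • f) U := by
  have hUm : ∀ j ∈ U, j < m := fun j hj => hV j (hU hj)
  rw [joinVertex, if_neg (fun h => lt_irrefl _ (hUm m h)), faceCob_insert_max f hUm, hf.mul_eq,
    one_smul]
  rfl

theorem joinVertex_cup (n q : ℕ) (f g : Finset (Fin N) → R) (hg : FaceParity q g)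
    (hV : ∀ j ∈ V, j < m) (U : Finset (Fin N)) (hU : U ⊆ V) :
    joinVertex m (faceCup n f g) U =
      ((1 : R) • (if Even n then (-1 : R) ^ q • faceCup n (joinVertex m f) g
        else faceCup n f (joinVertex m g)) +
      (-1 : R) ^ (q + n) • faceCupPred n (joinVertex m f) (joinVertex m g)) U := by
  have hUm : ∀ j ∈ U, j < m := fun j hj => hV j (hU hj)
  rw [joinVertex, if_neg (fun h => lt_irrefl _ (hUm m h)), faceCup_insert_max n q f g hg hUm,
    one_smul]
  split_ifs <;> rfl

/-- Here `p` and `q` count vertices, so they exceed the degrees by one, and `n = k + 1`; this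
accounts for the signs that differ from the cubical ones. The induction adds the largest vertex,
that is, it regards a simplex as a cone. -/
theorem faceCob_faceCup_apply (V : Finset (Fin N)) : ∀ (n p q : ℕ) (f g : Finset (Fin N) → R),
    FaceParity p f → FaceParity q g →
    faceCob (faceCup n f g) V = faceCup n (faceCob f) g V -
      (-1) ^ p * faceCup n f (faceCob g) V - (-1) ^ (p + q + n) * faceCupPred n f g V -
      (-1) ^ (p * q) * faceCupPred n g f V := by
  induction V using Finset.induction_on_max with
  | empty =>
    intro n p q f g hf hg
    have h0 : ∀ (n : ℕ) (f g : Finset (Fin N) → R), faceCup n f g ∅ =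
        if n = 0 then f ∅ * g ∅ else 0 := by
      intro n f g
      cases n with
      | zero => simp [faceCup, faceTerm, firstFace, secondFace]
      | succ n => rw [faceCup, Finset.powersetCard_eq_empty.2 (by simp)]; simp
    have h1 : ∀ f : Finset (Fin N) → R, faceCob f ∅ = 0 := fun f => by simp [faceCob]
    rcases n with _ | _ | n
    · simp [h0, h1, faceCupPred]
    · simp only [h0, h1, faceCupPred]
      by_cases hb0 : f ∅ = 0
      · simp [hb0]
      by_cases hc0 : g ∅ = 0
      · simp [hc0]
      have hp : Even p := by simpa using hf _ hb0
      have hq : Even q := by simpa using hg _ hc0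
      simp [pow_add, pow_mul, hp.neg_one_pow, hq.neg_one_pow, mul_comm]
    · simp [h0, h1, faceCupPred]
  | insert m V hV ih =>
    intro n p q f g hf hg
    have e1 := faceCob_congr (joinVertex_cup n q f g hg hV)
    have e2 := (hf.cup hg n).mul_eq V
    have e4 := joinVertex_cob hf hV
    have e5 := joinVertex_cob hg hV
    have f1 := faceCup_congr (n := n) e4 (fun _ _ => rfl : ∀ U ⊆ V, g U = _)
    have f2 := faceCup_congr (n := n) (fun _ _ => rfl : ∀ U ⊆ V, f U = _) e5
    have f3 := faceCupPred_congr (n := n) e4 (fun _ _ => rfl : ∀ U ⊆ V, (joinVertex m g) U = _)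
    have f4 := faceCupPred_congr (n := n) (fun _ _ => rfl : ∀ U ⊆ V, (joinVertex m f) U = _) e5
    have i1 := ih n (p + 1) q (joinVertex m f) g (hf.join m) hg
    have i2 := ih n p (q + 1) f (joinVertex m g) hf (hg.join m)
    rw [faceCob_insert_max _ hV, e1, e2, faceCup_insert_max n q _ _ hg hV,
      faceCup_insert_max n (q + 1) _ _ hg.cob hV, f1, f2, f3, f4]
    clear f1 f2 f3 f4 e1 e2 e4 e5
    cases n with
    | zero =>
      have h0 : ∀ f g : Finset (Fin N) → R, faceCupPred 0 f g = 0 := fun _ _ => rfl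
      have h3 : faceCob (0 : Finset (Fin N) → R) = 0 := by funext U; simp [faceCob]
      simp only [h0, Even.zero, if_true, faceCob_linear, faceCob_smul, h3, Pi.zero_apply,
        Pi.add_apply, Pi.smul_apply, smul_eq_mul, i1, faceCup_linear_left, faceCup_linear_right]
      rcases Nat.even_or_odd p with hp | hp <;> rcases Nat.even_or_odd q with hq | hq <;>
        simp only [pow_add, pow_mul, hp.neg_one_pow, hq.neg_one_pow, pow_zero, pow_one, one_pow,
          mul_one, mul_neg, neg_neg, mul_zero] <;>
        ring
    | succ n =>
      have i3 := ih n (p + 1) (q + 1) (joinVertex m f) (joinVertex m g) (hf.join m) (hg.join m)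
      have h0 : ∀ f g : Finset (Fin N) → R, faceCupPred (n + 1) f g = faceCup n f g :=
        fun _ _ => rfl
      rcases Nat.even_or_odd n with hn | hn
      · simp only [h0, Nat.even_add_one, hn, not_true_eq_false, if_false, if_true, faceCob_linear,
          Pi.add_apply, Pi.smul_apply, smul_eq_mul, i2, i3, faceCup_linear_left,
          faceCup_linear_right, faceCup_insert_max n q f g hg hV, faceCup_insert_max n p g f hf hV]
        rcases Nat.even_or_odd p with hp | hp <;> rcases Nat.even_or_odd q with hq | hq <;>
          simp only [pow_add, pow_mul, hp.neg_one_pow, hq.neg_one_pow, hn.neg_one_pow, pow_one,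
            one_pow, one_mul, mul_one, mul_neg, neg_neg] <;>
          ring
      · have hn' : ¬ Even n := Nat.not_even_iff_odd.2 hn
        simp only [h0, Nat.even_add_one, hn', not_false_eq_true, if_false, if_true, faceCob_linear,
          faceCob_smul, Pi.add_apply, Pi.smul_apply, smul_eq_mul, i1, i3, faceCup_linear_left,
          faceCup_linear_right, faceCup_insert_max n q f g hg hV, faceCup_insert_max n p g f hf hV]
        rcases Nat.even_or_odd p with hp | hp <;> rcases Nat.even_or_odd q with hq | hq <;>
          simp only [pow_add, pow_mul, hp.neg_one_pow, hq.neg_one_pow, hn.neg_one_pow, pow_one,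
            one_pow, one_mul, mul_one, mul_neg, neg_neg] <;>
          ring

theorem faceCob_faceCup {n p q : ℕ} {f g : Finset (Fin N) → R} (hf : FaceParity p f)
    (hg : FaceParity q g) :
    faceCob (faceCup n f g) = faceCup n (faceCob f) g - (-1 : R) ^ p • faceCup n f (faceCob g) -
      (-1 : R) ^ (p + q + n) • faceCupPred n f g - (-1 : R) ^ (p * q) • faceCupPred n g f := by
  funext V
  exact faceCob_faceCup_apply V n p q f g hf hg

theorem faceCob_faceCob_apply (V : Finset (Fin N)) : ∀ (p : ℕ) (f : Finset (Fin N) → R),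
    FaceParity p f → faceCob (faceCob f) V = 0 := by
  induction V using Finset.induction_on_max with
  | empty => intro p f _; simp [faceCob]
  | insert m V hV ih =>
    intro p f hf
    rw [faceCob_insert_max _ hV, faceCob_congr (joinVertex_cob hf hV), hf.cob.mul_eq,
      faceCob_linear]
    simp only [Pi.add_apply, Pi.smul_apply, smul_eq_mul, ih (p + 1) _ (hf.join m)]
    ring

theorem faceCob_faceCob {p : ℕ} {f : Finset (Fin N) → R} (hf : FaceParity p f) :
    faceCob (faceCob f) = 0 := by
  funext V
  exact faceCob_faceCob_apply V p f hf

end SimplicialFormula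

/-! ### From vertex sets to simplicial sets -/

section SimplicialBridge

variable {N N' : ℕ} {R : Type*} [CommRing R]

theorem filter_lt_map (φ : Fin N' ↪o Fin N) (I : Finset (Fin N')) (m : Fin N') :
    ((I.map φ.toEmbedding).filter (· < φ m)).card = (I.filter (· < m)).card := by
  rw [Finset.filter_map, Finset.card_map]
  congr 1
  refine Finset.filter_congr fun j _ => ?_
  simp

theorem faceCob_map (φ : Fin N' ↪o Fin N) (f : Finset (Fin N) → R) (V : Finset (Fin N')) :
    faceCob (fun U => f (U.map φ.toEmbedding)) V = faceCob f (V.map φ.toEmbedding) := by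
  unfold faceCob
  rw [Finset.sum_map]
  refine Finset.sum_congr rfl fun v _ => ?_
  dsimp only
  rw [Finset.map_erase]
  congr 2
  exact (filter_lt_map φ V v).symm

theorem firstFace_map (φ : Fin N' ↪o Fin N) (I V : Finset (Fin N')) :
    firstFace (I.map φ.toEmbedding) (V.map φ.toEmbedding) =
      (firstFace I V).map φ.toEmbedding := by
  unfold firstFace
  rw [Finset.filter_map]
  congr 1
  refine Finset.filter_congr fun j _ => ?_
  rw [Function.comp, Finset.mem_map' φ.toEmbedding]
  exact or_congr Iff.rfl (by rw [← filter_lt_map φ]; rfl)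

theorem secondFace_map (φ : Fin N' ↪o Fin N) (I V : Finset (Fin N')) :
    secondFace (I.map φ.toEmbedding) (V.map φ.toEmbedding) =
      (secondFace I V).map φ.toEmbedding := by
  unfold secondFace
  rw [Finset.filter_map]
  congr 1
  refine Finset.filter_congr fun j _ => ?_
  rw [Function.comp, Finset.mem_map' φ.toEmbedding]
  exact or_congr Iff.rfl (by rw [← filter_lt_map φ]; rfl)

/-- An order embedding preserves all comparisons of vertices, hence the two faces and the signs. -/
theorem faceCup_map (φ : Fin N' ↪o Fin N) (n : ℕ) (f g : Finset (Fin N) → R)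
    (V : Finset (Fin N')) :
    faceCup n (fun U => f (U.map φ.toEmbedding)) (fun U => g (U.map φ.toEmbedding)) V =
      faceCup n f g (V.map φ.toEmbedding) := by
  unfold faceCup
  rw [Finset.powersetCard_map, Finset.sum_map]
  refine Finset.sum_congr rfl fun I _ => ?_
  change _ = faceTerm f g (I.map φ.toEmbedding) (firstFace (I.map φ.toEmbedding) _)
    (secondFace (I.map φ.toEmbedding) _)
  rw [firstFace_map, secondFace_map]
  unfold faceTerm
  congr 3
  rw [← Finset.map_sdiff, ← Finset.prodMap_map_product, Finset.filter_map, Finset.card_map]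
  congr 1
  refine Finset.filter_congr fun j _ => ?_
  simp

variable {X : SSet.{u}}

/-- A face of a face is a face: the composite of the two order embeddings is the increasing
enumeration of the image set. -/
theorem evalFace_map {n n' p : ℕ} (c : SCochain X p R) (φ : Fin (n' + 1) ↪o Fin (n + 1))
    (σ : X.obj (op (SimplexCategory.mk n))) (U : Finset (Fin (n' + 1))) :
    evalFace c (X.map (SimplexCategory.mkHom φ.toOrderHom).op σ) U =
      evalFace c σ (U.map φ.toEmbedding) := by
  unfold evalFace
  by_cases h : U.card = p + 1
  · have h' : (U.map φ.toEmbedding).card = p + 1 := by rw [Finset.card_map, h]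
    rw [dif_pos h, dif_pos h', ← Functor.map_comp_apply, ← op_comp]
    congr 3
    have : (U.orderEmbOfFin h).trans φ = (U.map φ.toEmbedding).orderEmbOfFin h' := by
      apply Finset.orderEmbOfFin_unique'
      intro x
      simp
    rw [← this]
    rfl
  · rw [dif_neg h, dif_neg (by rwa [Finset.card_map])]

theorem evalFace_univ {n : ℕ} (c : SCochain X n R) (σ : X.obj (op (SimplexCategory.mk n))) :
    evalFace c σ Finset.univ = c σ := by
  have h : (Finset.univ : Finset (Fin (n + 1))).card = n + 1 := by simp
  rw [evalFace, dif_pos h]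
  have : SimplexCategory.mkHom (Finset.univ.orderEmbOfFin h).toOrderHom =
      𝟙 (SimplexCategory.mk n) := by
    have h2 : Finset.univ.orderEmbOfFin h = RelEmbedding.refl _ :=
      (Finset.orderEmbOfFin_unique' h fun x => Finset.mem_univ _).symm
    rw [h2]
    rfl
  rw [this]
  simp

theorem evalFace_erase {n p : ℕ} (c : SCochain X p R) (i : Fin (n + 2))
    (σ : X.obj (op (SimplexCategory.mk (n + 1)))) (U : Finset (Fin (n + 1))) :
    evalFace c (X.δ i σ) U = evalFace c σ (U.map (Fin.succAboveOrderEmb i).toEmbedding) :=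
  evalFace_map c (Fin.succAboveOrderEmb i) σ U

theorem univ_map_succAbove {n : ℕ} (i : Fin (n + 2)) :
    (Finset.univ : Finset (Fin (n + 1))).map (Fin.succAboveOrderEmb i).toEmbedding =
      Finset.univ.erase i := by
  ext j
  simp only [Finset.mem_map, Finset.mem_univ, true_and, Finset.mem_erase, and_true]
  exact Fin.exists_succAbove_eq_iff

theorem sum_univ_eq_faceCob {n : ℕ} (F : Finset (Fin (n + 2)) → R) (c : Fin (n + 2) → R)
    (h : ∀ i, c i = F (Finset.univ.erase i)) :
    ∑ i : Fin (n + 2), ((-1 : ℤ) ^ (i : ℕ)) • c i = faceCob F Finset.univ := by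
  unfold faceCob
  refine Finset.sum_congr rfl fun i _ => ?_
  have : (Finset.univ.filter (· < i)).card = (i : ℕ) := by
    rw [Finset.filter_gt_eq_Iio, Fin.card_Iio]
  rw [this, h, zsmul_eq_mul]
  push_cast
  rfl

theorem sCoboundary_eq {n : ℕ} (c : SCochain X n R) (σ : X.obj (op (SimplexCategory.mk (n + 1)))) :
    sCoboundary c σ = faceCob (evalFace c σ) Finset.univ :=
  sum_univ_eq_faceCob _ _ fun i => by
    rw [← univ_map_succAbove, ← evalFace_erase, evalFace_univ]

theorem evalFace_parity {n p : ℕ} (c : SCochain X p R) (σ : X.obj (op (SimplexCategory.mk n))) :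
    FaceParity (p + 1) (evalFace c σ) := by
  intro U hU
  by_cases h : U.card = p + 1
  · rw [h]; exact ⟨_, rfl⟩
  · exact absurd (dif_neg h) hU

/-- On the faces of a fixed simplex the two coboundaries agree; sets of the wrong size give zero on
both sides. -/
theorem evalFace_sCoboundary {n p : ℕ} (c : SCochain X p R)
    (σ : X.obj (op (SimplexCategory.mk n))) :
    evalFace (sCoboundary c) σ = faceCob (evalFace c σ) := by
  funext U
  by_cases h : U.card = p + 1 + 1
  · rw [evalFace, dif_pos h, sCoboundary_eq,
      show evalFace c (X.map (SimplexCategory.mkHom (U.orderEmbOfFin h).toOrderHom).op σ) =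
        fun V => evalFace c σ (V.map (U.orderEmbOfFin h).toEmbedding) from
        funext fun V => evalFace_map c (U.orderEmbOfFin h) σ V, faceCob_map]
    congr 1
    exact Finset.map_orderEmbOfFin_univ U h
  · rw [evalFace, dif_neg h]
    symm
    refine Finset.sum_eq_zero fun v hv => ?_
    rw [evalFace, dif_neg, mul_zero]
    intro h'
    exact h (by rw [← Finset.card_erase_add_one hv, h'])

theorem sCup_eq {k p q n : ℕ} (c : SCochain X p R) (d : SCochain X q R)
    (σ : X.obj (op (SimplexCategory.mk n))) :
    sCup k n c d σ = faceCup (k + 1) (evalFace c σ) (evalFace d σ) Finset.univ := rfl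

/-- Each codimension-one face of `σ` is treated by naturality of `faceCup`, so no relation between
`n`, `k`, `p` and `q` is needed. -/
theorem sCoboundary_sCup {k p q n : ℕ} (c : SCochain X p R) (d : SCochain X q R)
    (σ : X.obj (op (SimplexCategory.mk (n + 1)))) :
    sCoboundary (sCup k n c d) σ =
      faceCob (faceCup (k + 1) (evalFace c σ) (evalFace d σ)) Finset.univ :=
  sum_univ_eq_faceCob _ _ fun i => by
    rw [sCup_eq, ← univ_map_succAbove, ← faceCup_map]
    congr 1 <;> (funext U; exact evalFace_erase _ i σ U)

theorem sCoboundary_add {n : ℕ} {M : Type*} [AddCommGroup M] (c d : SCochain X n M) :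
    sCoboundary (c + d) = sCoboundary c + sCoboundary d := by
  funext σ
  simp only [sCoboundary, Pi.add_apply, smul_add, Finset.sum_add_distrib]

/-- The coboundary identity for the quadratic refinement of Steenrod's square. -/
theorem sCoboundary_cup_self {l n : ℕ} (A : SCochain X l R) :
    sCoboundary (sCup 1 n A A + sCup 2 n A (sCoboundary A)) =
      sCup 2 (n + 1) (sCoboundary A) (sCoboundary A) +
        ((-1) ^ l - 1 : ℤ) • (sCup 0 (n + 1) A A + sCup 1 (n + 1) A (sCoboundary A)) := by
  funext σ
  have hf := evalFace_parity A σ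
  have hs : ∀ (z : ℤ) (F : SCochain X (n + 1) R), (z • F) σ = (z : R) * F σ := fun z F => by
    rw [← zsmul_eq_mul]; rfl
  simp only [sCoboundary_add, Pi.add_apply, hs, sCoboundary_sCup, sCup_eq,
    evalFace_sCoboundary]
  rw [faceCob_faceCup hf hf, faceCob_faceCup hf hf.cob, faceCob_faceCob hf]
  have h0 : ∀ n, faceCup n (evalFace A σ) 0 = 0 := fun n => by
    funext V; simp [faceCup, faceTerm]
  have h1 : ∀ (n : ℕ) (f g : Finset (Fin (n + 1 + 1)) → R) m,
    faceCupPred (m + 1) f g = faceCup m f g := fun _ _ _ _ => rfl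
  simp only [h0, Pi.sub_apply, Pi.smul_apply, smul_eq_mul, Pi.zero_apply]
  simp only [h1]
  push_cast
  rcases Nat.even_or_odd l with hl | hl <;>
    simp only [pow_add, pow_mul, hl.neg_one_pow, pow_one, one_pow, one_mul, mul_one, mul_neg,
      neg_neg, even_two.neg_one_pow] <;>
    ring

end SimplicialBridge

/-! ### The cubical identity and the coboundary of quarter classes -/

section CupSquare

variable {d : ℕ} {L : Fin d → ℕ} {R : Type*} [CommRing R]

theorem cup_zero_right (k : ℕ) (b : Cochain L R) : cup k b 0 = 0 := by
  funext σ; simp [cup]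

theorem cup_zero_left (k : ℕ) (b : Cochain L R) : cup k 0 b = 0 := by
  funext σ; simp [cup]

/-- The first coboundary is `δA ∪₁ A + (-1)^l A ∪₁ δA + ((-1)^l - 1) A ∪ A`, the second one `δA ∪₂
δA - A ∪₁ δA - δA ∪₁ A`. -/
theorem coboundary_cup_self {l : ℕ} {A : Cochain L R} (hA : HasParity l A) :
    coboundary (cup 1 A A + cup 2 A (coboundary A)) =
      cup 2 (coboundary A) (coboundary A) +
        ((-1) ^ l - 1 : ℤ) • (cup 0 A A + cup 1 A (coboundary A)) := by
  funext σ
  have hs : ∀ (z : ℤ) (F : Cochain L R), (z • F) σ = (z : R) * F σ := fun z F => by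
    rw [← zsmul_eq_mul]; rfl
  rw [coboundary_add, coboundary_cup hA hA, coboundary_cup hA hA.coboundary,
    coboundary_coboundary hA, cup_zero_right]
  simp only [Pi.add_apply, hs]
  simp only [Pi.add_apply, Pi.smul_apply, smul_eq_mul, Pi.zero_apply, cupPred]
  push_cast
  rcases Nat.even_or_odd l with hl | hl <;>
    simp only [pow_add, pow_mul, hl.neg_one_pow, pow_one, one_pow, one_mul, mul_one, mul_neg,
      neg_neg, even_two.neg_one_pow] <;>
    ring

theorem coboundary_map {M M' : Type*} [AddCommGroup M] [AddCommGroup M'] (φ : M →+ M')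
    (c : Cochain L M) : coboundary (fun σ => φ (c σ)) = fun σ => φ (coboundary c σ) := by
  funext σ
  simp only [coboundary, map_sum, map_zsmul, map_sub]

theorem sCoboundary_map {X : SSet.{u}} {n : ℕ} {M M' : Type*} [AddCommGroup M] [AddCommGroup M']
    (φ : M →+ M') (c : SCochain X n M) :
    sCoboundary (fun σ => φ (c σ)) = fun σ => φ (sCoboundary c σ) := by
  funext σ
  simp only [sCoboundary, map_sum, map_zsmul]

/-- The homomorphism `z ↦ -z / 4` to the circle `ℝ / ℤ`. -/
def negQuarter : ℤ →+ AddCircle (1 : ℝ) :=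
  AddMonoidHom.mk' (fun z => ((-(z : ℝ) / 4 : ℝ) : AddCircle (1 : ℝ))) fun a b => by
    rw [← AddCircle.coe_add]
    congr 1
    push_cast
    ring

/-- `-e / 4` equals `y / 2` plus the integer `z - x`. -/
theorem negQuarter_eq {e x y z : ℤ} (h : e = 4 * x - 2 * y - 4 * z) :
    (((y : ℝ) / 2 : ℝ) : AddCircle (1 : ℝ)) = negQuarter e := by
  have h1 : (-(e : ℝ) / 4 : ℝ) = (y : ℝ) / 2 + (z - x : ℤ) • (1 : ℝ) := by
    rw [h]
    push_cast
    simp only [zsmul_eq_mul]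
    push_cast
    ring
  change _ = ((-(e : ℝ) / 4 : ℝ) : AddCircle (1 : ℝ))
  rw [h1, AddCircle.coe_add, AddCircle.coe_zsmul, AddCircle.coe_period, smul_zero, add_zero]

theorem half_cup_self {l : ℕ} {A : Cochain L ℤ} (hA : HasParity l A) (hl : Odd l)
    (h2 : ∀ σ, (2 : ℤ) ∣ coboundary A σ) :
    (fun σ => ((((cup 0 A A σ : ℤ) : ℝ) / 2 : ℝ) : AddCircle (1 : ℝ))) =
      coboundary fun σ => negQuarter ((cup 1 A A + cup 2 A (coboundary A)) σ) := by
  choose B hB using h2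
  have hB : coboundary A = (2 : ℤ) • B := funext hB
  rw [coboundary_map]
  funext σ
  -- With `δA = 2B` and `l` odd the coboundary is `4 B ∪₂ B - 2 A ∪ A - 4 A ∪₁ B`.
  refine negQuarter_eq (x := cup 2 B B σ) (z := cup 1 A B σ) ?_
  rw [coboundary_cup_self hA, hB]
  simp only [cup_smul_left, cup_smul_right, hl.neg_one_pow, Pi.add_apply, Pi.smul_apply,
    smul_eq_mul]
  ring

theorem sHalf_cup_self {X : SSet.{u}} {l n : ℕ} {A : SCochain X l ℤ} (hl : Odd l)
    (h2 : ∀ σ, (2 : ℤ) ∣ sCoboundary A σ) :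
    (fun σ => ((((sCup 0 (n + 1) A A σ : ℤ) : ℝ) / 2 : ℝ) : AddCircle (1 : ℝ))) =
      sCoboundary fun σ => negQuarter ((sCup 1 n A A + sCup 2 n A (sCoboundary A)) σ) := by
  choose B hB using h2
  have hB : sCoboundary A = (2 : ℤ) • B := funext hB
  rw [sCoboundary_map]
  funext σ
  have he : evalFace ((2 : ℤ) • B) σ = (2 : ℤ) • evalFace B σ + (0 : ℤ) • evalFace B σ := by
    funext U
    simp only [evalFace, Pi.add_apply, Pi.smul_apply]
    split_ifs <;> simp
  refine negQuarter_eq (x := sCup 2 (n + 1) B B σ) (z := sCup 1 (n + 1) A B σ) ?_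
  have hs : ∀ (z : ℤ) (F : SCochain X (n + 1) ℤ), (z • F) σ = z * F σ := fun z F => rfl
  rw [sCoboundary_cup_self A, hB]
  simp only [sCup_eq, hs, hl.neg_one_pow, Pi.add_apply]
  rw [he, faceCup_linear_left]
  simp only [faceCup_linear_right, Pi.add_apply, Pi.smul_apply, smul_eq_mul]
  ring

end CupSquare

/-! ### Pauli operators as a basis of the local algebra -/

section PauliCalculus

variable {d : ℕ} {L : Fin d → ℕ} {l : ℕ}

/-- The basis vector `|s⟩`. -/
def ket (s : Config L l) : Hilb L l := Finsupp.single s 1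

theorem op_ext {O O' : Op L l} (h : ∀ s, O (ket s) = O' (ket s)) : O = O' :=
  Finsupp.lhom_ext' fun s => LinearMap.ext_ring (h s)

theorem diagOp_ket (θ : Config L l → ℂ) (s : Config L l) : diagOp θ (ket s) = θ s • ket s := by
  simp [diagOp, ket]

theorem xOp_ket (w s : Config L l) : xOp w (ket s) = ket (s + w) := by
  simp [xOp, ket]

/-- The sign `(-1)ᵃ`. -/
def sgn (a : ZMod 2) : ℂ := if a = 0 then 1 else -1

theorem sgn_zero : sgn 0 = 1 := if_pos rfl

theorem sgn_one : sgn 1 = -1 := if_neg one_ne_zero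

theorem zmod2_cases (a : ZMod 2) : a = 0 ∨ a = 1 := by
  revert a; decide

theorem sgn_add (a b : ZMod 2) : sgn (a + b) = sgn a * sgn b := by
  rcases zmod2_cases a with rfl | rfl <;> rcases zmod2_cases b with rfl | rfl <;>
    simp [sgn_zero, sgn_one, show (1 + 1 : ZMod 2) = 0 from rfl]

theorem sgn_mul_self (a : ZMod 2) : sgn a * sgn a = 1 := by
  rw [← sgn_add, CharTwo.add_self_eq_zero, sgn_zero]

theorem sgn_ne_zero (a : ZMod 2) : sgn a ≠ 0 := left_ne_zero_of_mul_eq_one (sgn_mul_self a)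

theorem sgn_injective : Function.Injective sgn := by
  intro a b h
  rcases zmod2_cases a with rfl | rfl <;> rcases zmod2_cases b with rfl | rfl <;>
    simp_all [sgn_zero, sgn_one, CharZero.neg_eq_self_iff, CharZero.eq_neg_self_iff]

/-- The pairing `v · s`. -/
def dot (v : Qubit L l → ZMod 2) : Config L l →ₗ[ZMod 2] ZMod 2 :=
  Finsupp.linearCombination (ZMod 2) v

theorem dot_single (v : Qubit L l → ZMod 2) (q : Qubit L l) : dot v (Finsupp.single q 1) = v q := by
  simp [dot]

theorem dot_add (u v : Qubit L l → ZMod 2) (s : Config L l) :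
    dot (u + v) s = dot u s + dot v s := by
  simp [dot, Finsupp.linearCombination_apply, Finsupp.sum, mul_add, Finset.sum_add_distrib]

theorem dot_zero (s : Config L l) : dot (0 : Qubit L l → ZMod 2) s = 0 := by
  simp [dot]

theorem config_induction {p : Config L l → Prop} (s : Config L l) (h0 : p 0)
    (hadd : ∀ s q, p s → p (Finsupp.single q 1 + s)) : p s := by
  induction s using Finsupp.induction with
  | zero => exact h0
  | single_add q a s _ ha ih =>
    obtain rfl : a = 1 := (zmod2_cases a).resolve_left ha
    exact hadd s q ih

theorem config_add_self (s : Config L l) : s + s = 0 := by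
  ext q; exact CharTwo.add_self_eq_zero _

theorem single_dot (q : Qubit L l) (t : Config L l) :
    dot (Finsupp.single q 1 : Config L l) t = t q := by
  induction t using config_induction with
  | h0 => rw [map_zero]; rfl
  | hadd t q' ih =>
    rw [map_add, ih, dot_single, Finsupp.add_apply]
    congr 1
    simp [Finsupp.single_apply, eq_comm]

theorem dot_comm (s t : Config L l) : dot s t = dot t s := by
  induction s using config_induction with
  | h0 => rw [map_zero]; exact dot_zero t
  | hadd s q ih => rw [map_add, Finsupp.coe_add, dot_add, ih, dot_single, single_dot]

theorem zOp_ket (v : Qubit L l → ZMod 2) (s : Config L l) :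
    zOp v (ket s) = sgn (dot v s) • ket s := by
  rw [zOp, diagOp_ket]
  rfl

theorem xOp_add (w w' : Config L l) : xOp (w + w') = xOp w * xOp w' :=
  op_ext fun s => by
    rw [Module.End.mul_apply, xOp_ket, xOp_ket, xOp_ket, add_assoc, add_comm w]

theorem zOp_add (v v' : Qubit L l → ZMod 2) : zOp (v + v') = zOp v * zOp v' :=
  op_ext fun s => by
    rw [Module.End.mul_apply, zOp_ket, zOp_ket, map_smul, zOp_ket, smul_smul, dot_add, sgn_add,
      mul_comm]

theorem xOp_zero : xOp (0 : Config L l) = 1 :=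
  op_ext fun s => by rw [xOp_ket, add_zero]; rfl

theorem zOp_zero : zOp (0 : Qubit L l → ZMod 2) = 1 :=
  op_ext fun s => by rw [zOp_ket, dot_zero, sgn_zero, one_smul]; rfl

theorem zOp_mul_xOp (v : Qubit L l → ZMod 2) (w : Config L l) :
    zOp v * xOp w = sgn (dot v w) • (xOp w * zOp v) :=
  op_ext fun s => by
    rw [LinearMap.smul_apply, Module.End.mul_apply, Module.End.mul_apply, xOp_ket, zOp_ket,
      zOp_ket, map_smul, xOp_ket, smul_smul, map_add, sgn_add, mul_comm]

theorem diagOp_mul (θ η : Config L l → ℂ) : diagOp θ * diagOp η = diagOp fun s => θ s * η s :=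
  op_ext fun s => by
    rw [Module.End.mul_apply, diagOp_ket, diagOp_ket, map_smul, diagOp_ket, smul_smul, mul_comm]

theorem diagOp_one : diagOp (fun _ : Config L l => 1) = 1 :=
  op_ext fun s => by rw [diagOp_ket, one_smul]; rfl

/-- The Pauli operator with the exponents `w` of the `X` and `v` of the `Z` operators. -/
def pau (w v : Config L l) : Op L l := xOp w * zOp v

theorem pau_mul (w v w' v' : Config L l) :
    pau w v * pau w' v' = sgn (dot v w') • pau (w + w') (v + v') := by
  unfold pau
  rw [mul_assoc, ← mul_assoc (zOp v), zOp_mul_xOp, Finsupp.coe_add, xOp_add, zOp_add,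
    smul_mul_assoc, mul_smul_comm, mul_assoc, mul_assoc]

theorem pau_zero : pau (0 : Config L l) 0 = 1 := by
  rw [pau, xOp_zero, Finsupp.coe_zero, zOp_zero, one_mul]

theorem zOp_single (q : Qubit L l) :
    zOp (Pi.single q 1 : Qubit L l → ZMod 2) = zOp (Finsupp.single q 1 : Config L l) := by
  rw [Finsupp.single_eq_pi_single]

theorem xOp_mem_localAlg {S : Set (Qubit L l)} {w : Config L l} (hw : ∀ q, w q ≠ 0 → q ∈ S) :
    xOp w ∈ localAlg L l S := by
  induction w using Finsupp.induction with
  | zero => rw [xOp_zero]; exact one_mem _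
  | single_add q a w hq ha ih =>
    obtain rfl : a = 1 := (zmod2_cases a).resolve_left ha
    rw [xOp_add]
    refine mul_mem (Algebra.subset_adjoin ⟨q, hw q ?_, Or.inl rfl⟩) (ih fun p hp => hw p ?_)
    · simp [Finsupp.notMem_support_iff.1 hq]
    · have : p ≠ q := fun h => hq (by rw [← h]; exact Finsupp.mem_support_iff.2 hp)
      simpa [Finsupp.single_apply, this.symm] using hp

theorem zOp_mem_localAlg {S : Set (Qubit L l)} {w : Config L l} (hw : ∀ q, w q ≠ 0 → q ∈ S) :
    zOp w ∈ localAlg L l S := by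
  induction w using Finsupp.induction with
  | zero => rw [Finsupp.coe_zero, zOp_zero]; exact one_mem _
  | single_add q a w hq ha ih =>
    obtain rfl : a = 1 := (zmod2_cases a).resolve_left ha
    rw [Finsupp.coe_add, zOp_add, ← zOp_single]
    refine mul_mem (Algebra.subset_adjoin ⟨q, hw q ?_, Or.inr rfl⟩) (ih fun p hp => hw p ?_)
    · simp [Finsupp.notMem_support_iff.1 hq]
    · have : p ≠ q := fun h => hq (by rw [← h]; exact Finsupp.mem_support_iff.2 hp)
      simpa [Finsupp.single_apply, this.symm] using hp

theorem pau_mem_localAlg {S : Set (Qubit L l)} {w v : Config L l} (hw : ∀ q, w q ≠ 0 → q ∈ S)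
    (hv : ∀ q, v q ≠ 0 → q ∈ S) : pau w v ∈ localAlg L l S :=
  mul_mem (xOp_mem_localAlg hw) (zOp_mem_localAlg hv)

/-- The Pauli operator `pau w v` as an element of the algebra of local operators. -/
def pauAlg (p : Config L l × Config L l) : Alg L l :=
  ⟨pau p.1 p.2, pau_mem_localAlg (fun _ _ => trivial) (fun _ _ => trivial)⟩

theorem xGen_eq (q : Qubit L l) : xGen q = pauAlg (Finsupp.single q 1, 0) :=
  Subtype.ext (by
    change xOp _ = xOp _ * zOp _
    rw [Finsupp.coe_zero, zOp_zero, mul_one])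

theorem zGen_eq (q : Qubit L l) : zGen q = pauAlg (0, Finsupp.single q 1) :=
  Subtype.ext (by
    change zOp _ = xOp _ * zOp _
    rw [xOp_zero, one_mul, zOp_single])

theorem pauAlg_mul (p p' : Config L l × Config L l) :
    pauAlg p * pauAlg p' = sgn (dot p.2 p'.1) • pauAlg (p + p') :=
  Subtype.ext (pau_mul _ _ _ _)

theorem pauAlg_zero : pauAlg (0 : Config L l × Config L l) = 1 := Subtype.ext pau_zero

/-- Products of Pauli operators are Pauli operators up to sign, so their span is already a
subalgebra. -/
theorem localAlg_le_span (S : Set (Qubit L l)) (O : Op L l) (hO : O ∈ localAlg L l S) :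
    O ∈ Submodule.span ℂ {P | ∃ w v : Config L l, (∀ q, w q ≠ 0 → q ∈ S) ∧
      (∀ q, v q ≠ 0 → q ∈ S) ∧ P = pau w v} := by
  set A : Set (Op L l) := {P | ∃ w v : Config L l, (∀ q, w q ≠ 0 → q ∈ S) ∧
      (∀ q, v q ≠ 0 → q ∈ S) ∧ P = pau w v}
  have hadd : ∀ w w' : Config L l, (∀ q, w q ≠ 0 → q ∈ S) → (∀ q, w' q ≠ 0 → q ∈ S) →
      ∀ q, (w + w') q ≠ 0 → q ∈ S := fun w w' h h' q hq => by
    by_contra hqS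
    have h1 : w q = 0 := by by_contra h1; exact hqS (h q h1)
    have h2 : w' q = 0 := by by_contra h1; exact hqS (h' q h1)
    exact hq (by rw [Finsupp.add_apply, h1, h2, add_zero])
  have h1 : (1 : Op L l) ∈ Submodule.span ℂ A :=
    Submodule.subset_span ⟨0, 0, by simp, by simp, pau_zero.symm⟩
  have h2 : ∀ x y, x ∈ Submodule.span ℂ A → y ∈ Submodule.span ℂ A →
      x * y ∈ Submodule.span ℂ A := by
    intro x y hx hy
    induction hx, hy using Submodule.span_induction₂ with
    | mem_mem x y hx hy =>
      obtain ⟨w, v, hw, hv, rfl⟩ := hx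
      obtain ⟨w', v', hw', hv', rfl⟩ := hy
      rw [pau_mul]
      exact Submodule.smul_mem _ _ (Submodule.subset_span
        ⟨_, _, hadd _ _ hw hw', hadd _ _ hv hv', rfl⟩)
    | zero_left => simp
    | zero_right => simp
    | add_left x y z _ _ _ hx hy => rw [add_mul]; exact add_mem hx hy
    | add_right x y z _ _ _ hx hy => rw [mul_add]; exact add_mem hx hy
    | smul_left r x y _ _ h => rw [smul_mul_assoc]; exact Submodule.smul_mem _ _ h
    | smul_right r x y _ _ h => rw [mul_smul_comm]; exact Submodule.smul_mem _ _ h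
  have h3 : localAlg L l S ≤ (Submodule.span ℂ A).toSubalgebra h1 h2 := by
    refine Algebra.adjoin_le ?_
    rintro O ⟨q, hq, rfl | rfl⟩
    · refine Submodule.subset_span ⟨Finsupp.single q 1, 0, fun p hp => ?_, by simp, ?_⟩
      · by_cases h : q = p
        · exact h ▸ hq
        · simp [h] at hp
      · rw [pau, Finsupp.coe_zero, zOp_zero, mul_one]
    · refine Submodule.subset_span ⟨0, Finsupp.single q 1, by simp, fun p hp => ?_, ?_⟩
      · by_cases h : q = p
        · exact h ▸ hq
        · simp [h] at hp
      · rw [pau, xOp_zero, one_mul, zOp_single]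
  exact h3 hO

theorem span_pauAlg : ⊤ ≤ Submodule.span ℂ (Set.range (pauAlg (L := L) (l := l))) := by
  rintro ⟨O, hO⟩ _
  have h := localAlg_le_span _ O hO
  have h2 : Submodule.span ℂ {P | ∃ w v : Config L l, (∀ q, w q ≠ 0 → q ∈ Set.univ) ∧
      (∀ q, v q ≠ 0 → q ∈ Set.univ) ∧ P = pau w v} ≤
      (Submodule.span ℂ (Set.range (pauAlg (L := L) (l := l)))).map (Alg L l).val.toLinearMap := by
    rw [Submodule.span_le]
    rintro P ⟨w, v, _, _, rfl⟩
    exact ⟨pauAlg (w, v), Submodule.subset_span ⟨_, rfl⟩, rfl⟩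
  obtain ⟨O', hO', h3⟩ := h2 h
  have : O' = ⟨O, hO⟩ := Subtype.ext h3
  rwa [← this]

/-- The character `s ↦ (-1)^{v · s}`. -/
def character (v : Config L l) : Multiplicative (Config L l) →* ℂ where
  toFun s := sgn (dot v s.toAdd)
  map_one' := by
    change sgn (dot v 0) = 1
    rw [map_zero, sgn_zero]
  map_mul' s t := by
    change sgn (dot v (s.toAdd + t.toAdd)) = _
    rw [map_add, sgn_add]

theorem character_injective : Function.Injective (character (L := L) (l := l)) := by
  intro v v' h
  ext q
  have := DFunLike.congr_fun h (Multiplicative.ofAdd (Finsupp.single q 1))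
  change sgn (dot v (Finsupp.single q 1)) = sgn (dot v' (Finsupp.single q 1)) at this
  rwa [dot_single, dot_single, sgn_injective.eq_iff] at this

theorem linearIndependent_character : LinearIndependent ℂ
    (fun v : Config L l => (character v : Multiplicative (Config L l) → ℂ)) :=
  (linearIndependent_monoidHom (Multiplicative (Config L l)) ℂ).comp _ character_injective

/-- A finite combination of characters vanishes only if its coefficients do. -/
theorem character_sum_eq_zero {f : Config L l →₀ ℂ}
    (h : ∀ s : Config L l, (f.sum fun v a => a * sgn (dot v s)) = 0) : f = 0 := by
  refine (linearIndependent_iff.1 (linearIndependent_character (L := L) (l := l))) f ?_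
  funext s
  rw [Finsupp.linearCombination_apply, Finsupp.sum, Finset.sum_apply]
  exact h s.toAdd

/-- The matrix entry from `s` to `s + w` sees only the operators with `X` part `w`, and as a
function of `s` it is a combination of the characters `(-1)^{v · s}`, which are independent by
Dedekind's lemma. -/
theorem linearIndependent_pau :
    LinearIndependent ℂ fun p : Config L l × Config L l => pau p.1 p.2 := by
  refine (injective_iff_map_eq_zero (Finsupp.linearCombination ℂ _)).2 fun f hf => ?_
  have h1 : ∀ s t : Config L l, (f.sum fun p a => a * (sgn (dot p.2 s) * ket (s + p.1) t)) = 0 := by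
    intro s t
    have := congrArg (fun O : Op L l => (O (ket s)) t) hf
    rw [Finsupp.linearCombination_apply, Finsupp.sum,
      LinearMap.sum_apply, Finsupp.finsetSum_apply] at this
    rw [Finsupp.sum, ← show _ = (0 : ℂ) from this]
    refine Finset.sum_congr rfl fun p _ => ?_
    rw [LinearMap.smul_apply, pau, Module.End.mul_apply, zOp_ket, map_smul, xOp_ket]
    rfl
  ext ⟨w, v⟩
  have h2 : f.curry w = 0 := by
    refine character_sum_eq_zero fun s => ?_
    have h3 := h1 s (s + w)
    rw [← Finsupp.sum_curry_index f
      (fun w' v a => a * (sgn (dot v s) * ket (s + w') (s + w)))] at h3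
    · rw [Finsupp.sum, Finset.sum_eq_single w] at h3
      · simpa [ket] using h3
      · intro w' _ hw'
        simp [ket, hw']
      · intro hw
        rw [Finsupp.notMem_support_iff.1 hw, Finsupp.sum_zero_index]
  have := DFunLike.congr_fun h2 v
  rwa [Finsupp.curry_apply] at this

theorem linearIndependent_pauAlg : LinearIndependent ℂ (pauAlg (L := L) (l := l)) :=
  LinearIndependent.of_comp (Alg L l).val.toLinearMap linearIndependent_pau

/-- The basis of Pauli operators of the algebra of local operators. -/
def pauBasis : Module.Basis (Config L l × Config L l) ℂ (Alg L l) :=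
  Module.Basis.mk linearIndependent_pauAlg span_pauAlg

theorem pauBasis_apply (p : Config L l × Config L l) : pauBasis p = pauAlg p := by
  simp [pauBasis]

end PauliCalculus

/-! ### Universal property of the Pauli relations -/

section Universal

variable {d : ℕ} {L : Fin d → ℕ} {l : ℕ}

/-- Commuting involutions are the images of a basis under a homomorphism from a
`ZMod 2`-vector space. -/
theorem exists_mulHom {ι 𝒜 : Type*} [Monoid 𝒜] (x : ι → 𝒜) (hc : ∀ i j, x i * x j = x j * x i)
    (hs : ∀ i, x i * x i = 1) : ∃ F : (ι →₀ ZMod 2) → 𝒜, F 0 = 1 ∧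
      (∀ a b, F (a + b) = F a * F b) ∧ ∀ i, F (Finsupp.single i 1) = x i := by
  have hcomm : ∀ a ∈ Set.range x, ∀ b ∈ Set.range x, a * b = b * a := by
    rintro _ ⟨i, rfl⟩ _ ⟨j, rfl⟩
    exact hc i j
  -- Commuting elements generate a commutative submonoid, in which finite products over a
  -- configuration make sense.
  let _ : CommMonoid (Submonoid.closure (Set.range x)) :=
    Submonoid.closureCommMonoidOfComm 𝒜 hcomm
  let y : ι → Submonoid.closure (Set.range x) := fun i =>
    ⟨x i, Submonoid.subset_closure ⟨i, rfl⟩⟩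
  have hy : ∀ i, y i * y i = 1 := fun i => Subtype.ext (hs i)
  refine ⟨fun w => ((w.prod fun i a => y i ^ a.val : Submonoid.closure (Set.range x)) : 𝒜),
    ?_, ?_, ?_⟩
  · simp
  · intro a b
    dsimp only
    rw [Finsupp.prod_add_index]
    · rfl
    · intro i _; exact pow_zero _
    · intro i _ a b
      rcases zmod2_cases a with rfl | rfl <;> rcases zmod2_cases b with rfl | rfl
      · simp
      · simp
      · simp
      · rw [show (1 + 1 : ZMod 2).val = 0 from rfl, show (1 : ZMod 2).val = 1 from rfl, pow_zero,
          pow_one, hy]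
  · intro i
    dsimp only
    rw [Finsupp.prod_single_index]
    · rw [show (1 : ZMod 2).val = 1 from rfl, pow_one]
    · exact pow_zero _

/-- The map is prescribed on the Pauli basis; multiplicativity on pairs of basis elements needs only
the sign for moving `Z` past `X`. -/
theorem exists_algHom_of_mulHom {𝒜 : Type*} [Semiring 𝒜] [Algebra ℂ 𝒜] (X Z : Config L l → 𝒜)
    (hX0 : X 0 = 1) (hX : ∀ a b, X (a + b) = X a * X b)
    (hZ0 : Z 0 = 1) (hZ : ∀ a b, Z (a + b) = Z a * Z b)
    (hZX : ∀ v w, Z v * X w = sgn (dot v w) • (X w * Z v)) :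
    ∃ Φ : Alg L l →ₐ[ℂ] 𝒜, ∀ w v, Φ (pauAlg (w, v)) = X w * Z v := by
  let f : Alg L l →ₗ[ℂ] 𝒜 := pauBasis.constr ℂ fun p => X p.1 * Z p.2
  have hf : ∀ p, f (pauAlg p) = X p.1 * Z p.2 := fun p => by
    rw [← pauBasis_apply, Module.Basis.constr_basis]
  have hmul : ∀ a b, f (a * b) = f a * f b := by
    intro a b
    have key : (LinearMap.mul ℂ (Alg L l)).compr₂ f = (LinearMap.mul ℂ 𝒜).compl₁₂ f f := by
      refine pauBasis.ext fun p => pauBasis.ext fun p' => ?_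
      simp only [LinearMap.compr₂_apply, LinearMap.mul_apply', LinearMap.compl₁₂_apply,
        pauBasis_apply]
      rw [pauAlg_mul, map_smul, hf, hf, hf, Prod.fst_add, Prod.snd_add, hX, hZ, mul_assoc (X p.1),
        mul_assoc (X p.1), ← mul_assoc (Z p.2), hZX, smul_mul_assoc, mul_smul_comm, mul_assoc]
    exact LinearMap.congr_fun (LinearMap.congr_fun key a) b
  refine ⟨AlgHom.ofLinearMap f ?_ hmul, fun w v => hf (w, v)⟩
  rw [← pauAlg_zero, hf, Prod.fst_zero, Prod.snd_zero, hX0, hZ0, mul_one]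

/-- Operators satisfying the relations of the Pauli operators are the images of the Pauli
operators under a homomorphism. -/
theorem exists_algHom {𝒜 : Type*} [Semiring 𝒜] [Algebra ℂ 𝒜] (x z : Qubit L l → 𝒜)
    (hxc : ∀ i j, x i * x j = x j * x i) (hxs : ∀ i, x i * x i = 1)
    (hzc : ∀ i j, z i * z j = z j * z i) (hzs : ∀ i, z i * z i = 1)
    (hzx : ∀ i j, z i * x j = (if i = j then -1 else 1 : ℂ) • (x j * z i)) :
    ∃ Φ : Alg L l →ₐ[ℂ] 𝒜, ∀ q, Φ (xGen q) = x q ∧ Φ (zGen q) = z q := by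
  obtain ⟨X, hX0, hX, hXs⟩ := exists_mulHom x hxc hxs
  obtain ⟨Z, hZ0, hZ, hZs⟩ := exists_mulHom z hzc hzs
  have h1 : ∀ q w, z q * X w = sgn (w q) • (X w * z q) := by
    intro q w
    induction w using config_induction with
    | h0 => rw [hX0, Finsupp.zero_apply, sgn_zero, one_mul, mul_one, one_smul]
    | hadd w q' ih =>
      have h2 : (if q = q' then -1 else 1 : ℂ) =
          sgn ((Finsupp.single q' 1 : Config L l) q) := by
        rw [Finsupp.single_apply]
        by_cases h : q = q'
        · rw [if_pos h, if_pos h.symm, sgn_one]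
        · rw [if_neg h, if_neg (Ne.symm h), sgn_zero]
      rw [hX, hXs, ← mul_assoc, hzx, smul_mul_assoc, mul_assoc, ih, mul_smul_comm, smul_smul,
        ← mul_assoc, Finsupp.add_apply, sgn_add, h2]
  have hZX : ∀ v w : Config L l, Z v * X w = sgn (dot v w) • (X w * Z v) := by
    intro v w
    induction v using config_induction with
    | h0 => rw [hZ0, Finsupp.coe_zero, dot_zero, sgn_zero, one_mul, mul_one, one_smul]
    | hadd v q ih =>
      rw [hZ, hZs, mul_assoc, ih, mul_smul_comm, ← mul_assoc, h1, smul_mul_assoc, smul_smul,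
        mul_assoc, Finsupp.coe_add, dot_add, single_dot, sgn_add, mul_comm (sgn (w q))]
  obtain ⟨Φ, hΦ⟩ := exists_algHom_of_mulHom X Z hX0 hX hZ0 hZ hZX
  refine ⟨Φ, fun q => ⟨?_, ?_⟩⟩
  · rw [xGen_eq, hΦ, hXs, hZ0, mul_one]
  · rw [zGen_eq, hΦ, hZs, hX0, one_mul]

theorem algHom_ext {𝒜 : Type*} [Semiring 𝒜] [Algebra ℂ 𝒜] {Φ Ψ : Alg L l →ₐ[ℂ] 𝒜}
    (hx : ∀ q, Φ (xGen q) = Ψ (xGen q)) (hz : ∀ q, Φ (zGen q) = Ψ (zGen q)) : Φ = Ψ := by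
  refine AlgHom.adjoin_ext ?_
  rintro O ⟨q, _, rfl | rfl⟩
  · exact hx q
  · exact hz q

theorem algEquiv_ext {Φ Ψ : Alg L l ≃ₐ[ℂ] Alg L l}
    (hx : ∀ q, Φ (xGen q) = Ψ (xGen q)) (hz : ∀ q, Φ (zGen q) = Ψ (zGen q)) : Φ = Ψ := by
  have : Φ.toAlgHom = Ψ.toAlgHom := algHom_ext hx hz
  exact AlgEquiv.ext fun O => AlgHom.congr_fun this O

/-- Induction over the elements of the algebra of local operators. -/
theorem alg_induction {p : Alg L l → Prop} (O : Alg L l) (hx : ∀ q, p (xGen q))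
    (hz : ∀ q, p (zGen q)) (hC : ∀ c : ℂ, p (algebraMap ℂ _ c))
    (hadd : ∀ O O', p O → p O' → p (O + O')) (hmul : ∀ O O', p O → p O' → p (O * O')) : p O := by
  obtain ⟨O, hO⟩ := O
  induction hO using Algebra.adjoin_induction with
  | mem O h =>
    obtain ⟨q, _, rfl | rfl⟩ := h
    · exact hx q
    · exact hz q
  | algebraMap c => exact hC c
  | add O O' h h' ih ih' => exact hadd ⟨O, h⟩ ⟨O', h'⟩ ih ih'
  | mul O O' h h' ih ih' => exact hmul ⟨O, h⟩ ⟨O', h'⟩ ih ih'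

end Universal

/-! ### Adjoints -/

section Adjoint

variable {d : ℕ} {L : Fin d → ℕ} {l : ℕ}

theorem herm_ket_left (s : Config L l) (φ : Hilb L l) : herm (ket s) φ = φ s := by
  simp [herm, ket]

theorem herm_add_left (ψ ψ' φ : Hilb L l) : herm (ψ + ψ') φ = herm ψ φ + herm ψ' φ := by
  unfold herm
  rw [Finsupp.sum_add_index] <;> intros <;> simp [add_mul]

theorem herm_smul_left (c : ℂ) (ψ φ : Hilb L l) :
    herm (c • ψ) φ = (starRingEnd ℂ) c * herm ψ φ := by
  unfold herm
  rw [Finsupp.sum_smul_index fun _ => by simp, Finsupp.mul_sum]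
  refine Finsupp.sum_congr fun s _ => ?_
  rw [map_mul, mul_assoc]

theorem herm_add_right (ψ φ φ' : Hilb L l) : herm ψ (φ + φ') = herm ψ φ + herm ψ φ' := by
  simp [herm, Finsupp.sum, mul_add, Finset.sum_add_distrib]

theorem herm_smul_right (c : ℂ) (ψ φ : Hilb L l) : herm ψ (c • φ) = c * herm ψ φ := by
  simp [herm, Finsupp.sum, Finset.mul_sum, mul_left_comm]

theorem herm_conj (ψ φ : Hilb L l) : (starRingEnd ℂ) (herm ψ φ) = herm φ ψ := by
  induction ψ using Finsupp.induction_linear with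
  | zero => simp [herm]
  | add ψ ψ' h h' => rw [herm_add_left, map_add, h, h', herm_add_right]
  | single s a =>
    induction φ using Finsupp.induction_linear with
    | zero => simp [herm]
    | add φ φ' h h' => rw [herm_add_right, map_add, h, h', herm_add_left]
    | single t b =>
      by_cases h : s = t
      · subst h; simp [herm, mul_comm]
      · simp [herm, h, Ne.symm h]

theorem ket_smul_induction {p : Hilb L l → Prop} (ψ : Hilb L l) (h0 : p 0)
    (hadd : ∀ ψ ψ', p ψ → p ψ' → p (ψ + ψ')) (hs : ∀ (c : ℂ) s, p (c • ket s)) : p ψ := by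
  induction ψ using Finsupp.induction_linear with
  | zero => exact h0
  | add ψ ψ' h h' => exact hadd ψ ψ' h h'
  | single s a =>
    have := hs a s
    rwa [ket, Finsupp.smul_single_one] at this

theorem isAdjoint_iff {O O' : Op L l} :
    IsAdjoint O O' ↔ ∀ s t, (starRingEnd ℂ) (O (ket s) t) = O' (ket t) s := by
  constructor
  · intro h s t
    have := h (ket s) (ket t)
    rwa [herm_ket_left, ← herm_conj, herm_ket_left] at this
  · intro h ψ φ
    induction ψ using ket_smul_induction with
    | h0 => simp [herm]
    | hadd ψ ψ' h h' => rw [map_add, herm_add_left, herm_add_left, h, h']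
    | hs c s =>
      induction φ using ket_smul_induction with
      | h0 => simp [herm]
      | hadd φ φ' h h' => rw [map_add, herm_add_right, herm_add_right, h, h']
      | hs c' t =>
        rw [map_smul, map_smul, herm_smul_left, herm_smul_left, herm_smul_right, herm_smul_right,
          herm_ket_left, ← herm_conj, herm_ket_left, h]

theorem IsAdjoint.unique {O O₁ O₂ : Op L l} (h₁ : IsAdjoint O O₁) (h₂ : IsAdjoint O O₂) :
    O₁ = O₂ :=
  op_ext fun t => Finsupp.ext fun s => by
    rw [← isAdjoint_iff.1 h₁, ← isAdjoint_iff.1 h₂]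

theorem IsAdjoint.add {O O' P P' : Op L l} (h : IsAdjoint O O') (h' : IsAdjoint P P') :
    IsAdjoint (O + P) (O' + P') := fun ψ φ => by
  rw [LinearMap.add_apply, LinearMap.add_apply, herm_add_left, herm_add_right, h, h']

theorem IsAdjoint.mul {O O' P P' : Op L l} (h : IsAdjoint O O') (h' : IsAdjoint P P') :
    IsAdjoint (O * P) (P' * O') := fun ψ φ => by
  rw [Module.End.mul_apply, Module.End.mul_apply, h, h']

theorem IsAdjoint.smul {O O' : Op L l} (h : IsAdjoint O O') (c : ℂ) :
    IsAdjoint (c • O) ((starRingEnd ℂ) c • O') := fun ψ φ => by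
  rw [LinearMap.smul_apply, LinearMap.smul_apply, herm_smul_left, herm_smul_right, h]

theorem isAdjoint_one : IsAdjoint (1 : Op L l) 1 := fun _ _ => rfl

theorem isAdjoint_algebraMap (c : ℂ) :
    IsAdjoint (algebraMap ℂ (Op L l) c) (algebraMap ℂ (Op L l) ((starRingEnd ℂ) c)) := by
  rw [Algebra.algebraMap_eq_smul_one, Algebra.algebraMap_eq_smul_one]
  exact isAdjoint_one.smul c

theorem isAdjoint_diagOp (θ : Config L l → ℂ) :
    IsAdjoint (diagOp θ) (diagOp fun s => (starRingEnd ℂ) (θ s)) := by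
  rw [isAdjoint_iff]
  intro s t
  rw [diagOp_ket, diagOp_ket]
  by_cases h : s = t
  · subst h; simp [ket]
  · simp [ket, h, Ne.symm h]

theorem sgn_conj (a : ZMod 2) : (starRingEnd ℂ) (sgn a) = sgn a := by
  rcases zmod2_cases a with rfl | rfl <;> simp [sgn_zero, sgn_one]

theorem isAdjoint_zOp (v : Qubit L l → ZMod 2) : IsAdjoint (zOp v) (zOp v) := by
  have := isAdjoint_diagOp fun s : Config L l => sgn (dot v s)
  simp only [sgn_conj] at this
  exact this

theorem isAdjoint_xOp (w : Config L l) : IsAdjoint (xOp w) (xOp w) := by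
  rw [isAdjoint_iff]
  intro s t
  rw [xOp_ket, xOp_ket]
  by_cases h : s + w = t
  · have h' : t + w = s := by rw [← h, add_assoc, config_add_self, add_zero]
    simp [ket, h, h']
  · have h' : t + w ≠ s := fun h' => h (by rw [← h', add_assoc, config_add_self, add_zero])
    simp [ket, h, h']

theorem isAdjoint_pau (w v : Config L l) : IsAdjoint (pau w v) (sgn (dot v w) • pau w v) := by
  have := (isAdjoint_xOp w).mul (isAdjoint_zOp v)
  rwa [zOp_mul_xOp] at this

/-- An adjoint of `O` whose image is adjoint to the image of `O` is built along the generation of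
the algebra. Uniqueness of adjoints then covers every adjoint in `map_isAdjoint`. -/
theorem exists_adjoint (Φ : Alg L l →ₐ[ℂ] Alg L l)
    (hx : ∀ q, IsAdjoint (Φ (xGen q) : Op L l) (Φ (xGen q)))
    (hz : ∀ q, IsAdjoint (Φ (zGen q) : Op L l) (Φ (zGen q))) (O : Alg L l) :
    ∃ O' : Alg L l, IsAdjoint (O : Op L l) O' ∧ IsAdjoint (Φ O : Op L l) (Φ O') := by
  induction O using alg_induction with
  | hx q => exact ⟨xGen q, isAdjoint_xOp _, hx q⟩
  | hz q => exact ⟨zGen q, isAdjoint_zOp _, hz q⟩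
  | hC c =>
    refine ⟨algebraMap ℂ _ ((starRingEnd ℂ) c), isAdjoint_algebraMap c, ?_⟩
    rw [AlgHom.commutes, AlgHom.commutes]
    exact isAdjoint_algebraMap c
  | hadd O P h h' =>
    obtain ⟨O', h1, h2⟩ := h
    obtain ⟨P', h3, h4⟩ := h'
    refine ⟨O' + P', h1.add h3, ?_⟩
    rw [map_add, map_add]
    exact h2.add h4
  | hmul O P h h' =>
    obtain ⟨O', h1, h2⟩ := h
    obtain ⟨P', h3, h4⟩ := h'
    refine ⟨P' * O', h1.mul h3, ?_⟩
    rw [map_mul, map_mul]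
    exact h2.mul h4

/-- A homomorphism that maps the generators to self-adjoint operators respects adjoints. -/
theorem map_isAdjoint (Φ : Alg L l →ₐ[ℂ] Alg L l)
    (hx : ∀ q, IsAdjoint (Φ (xGen q) : Op L l) (Φ (xGen q)))
    (hz : ∀ q, IsAdjoint (Φ (zGen q) : Op L l) (Φ (zGen q))) (O O' : Alg L l)
    (h : IsAdjoint (O : Op L l) O') : IsAdjoint (Φ O : Op L l) (Φ O') := by
  obtain ⟨P, h1, h2⟩ := exists_adjoint Φ hx hz O
  have : O' = P := Subtype.ext (h.unique h1)
  rwa [this]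

end Adjoint

/-! ### Clifford automorphisms from linear data over `ℤ/2` -/

section Clifford

variable {d : ℕ} {L : Fin d → ℕ} {l : ℕ}

/-- `O` is the Pauli operator with exponents `p`, up to a sign. -/
def IsSignedPauli (p : Config L l × Config L l) (O : Alg L l) : Prop :=
  ∃ a : ZMod 2, O = sgn a • pauAlg p

theorem isSignedPauli_pauAlg (p : Config L l × Config L l) : IsSignedPauli p (pauAlg p) :=
  ⟨0, by rw [sgn_zero, one_smul]⟩

theorem IsSignedPauli.mul {p p' : Config L l × Config L l} {O O' : Alg L l}
    (h : IsSignedPauli p O) (h' : IsSignedPauli p' O') : IsSignedPauli (p + p') (O * O') := by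
  obtain ⟨a, rfl⟩ := h
  obtain ⟨a', rfl⟩ := h'
  refine ⟨a' + a + dot p.2 p'.1, ?_⟩
  rw [smul_mul_assoc, mul_smul_comm, pauAlg_mul, smul_smul, smul_smul, sgn_add, sgn_add]
  congr 1
  ring

/-- The symplectic form that governs the commutation of Pauli operators. -/
def sympl (p p' : Config L l × Config L l) : ZMod 2 := dot p.2 p'.1 + dot p'.2 p.1

theorem IsSignedPauli.comm {p p' : Config L l × Config L l} {O O' : Alg L l}
    (h : IsSignedPauli p O) (h' : IsSignedPauli p' O') :
    O * O' = sgn (sympl p p') • (O' * O) := by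
  obtain ⟨a, rfl⟩ := h
  obtain ⟨a', rfl⟩ := h'
  simp only [smul_mul_assoc, mul_smul_comm, pauAlg_mul, smul_smul, sympl, sgn_add]
  rw [add_comm p' p]
  congr 1
  linear_combination (-(sgn a) * sgn a' * sgn (dot p.2 p'.1)) * sgn_mul_self (dot p'.2 p.1)

theorem IsSignedPauli.sq {p : Config L l × Config L l} {O : Alg L l}
    (h : IsSignedPauli p O) : O * O = sgn (dot p.2 p.1) • 1 := by
  obtain ⟨a, rfl⟩ := h
  rw [smul_mul_assoc, mul_smul_comm, pauAlg_mul, smul_smul, smul_smul, sgn_mul_self, one_mul]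
  congr 1
  rw [show p + p = 0 from Prod.ext (config_add_self _) (config_add_self _), pauAlg_zero]

/-- The adjoint reverses the order of the `X` and `Z` parts, which costs the sign of their overlap.
-/
theorem IsSignedPauli.isAdjoint {p : Config L l × Config L l} {O : Alg L l}
    (h : IsSignedPauli p O) (hp : dot p.2 p.1 = 0) : IsAdjoint (O : Op L l) O := by
  obtain ⟨a, rfl⟩ := h
  have := (isAdjoint_pau p.1 p.2).smul (sgn a)
  rwa [hp, sgn_zero, one_smul, sgn_conj] at this

theorem IsSignedPauli.isPauli {p : Config L l × Config L l} {O : Alg L l}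
    (h : IsSignedPauli p O) : IsPauli (O : Op L l) := by
  obtain ⟨a, rfl⟩ := h
  refine ⟨sgn a, p.1, p.2, ?_, rfl⟩
  rcases zmod2_cases a with rfl | rfl <;> simp [sgn_zero, sgn_one]

theorem IsSignedPauli.mem_localAlg {p : Config L l × Config L l} {O : Alg L l}
    (h : IsSignedPauli p O) {S : Set (Qubit L l)} (h1 : ∀ q, p.1 q ≠ 0 → q ∈ S)
    (h2 : ∀ q, p.2 q ≠ 0 → q ∈ S) : (O : Op L l) ∈ localAlg L l S := by
  obtain ⟨a, rfl⟩ := h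
  exact Subalgebra.smul_mem _ (pau_mem_localAlg h1 h2) _

theorem pauAlg_single_x (q : Qubit L l) : IsSignedPauli (Finsupp.single q 1, 0) (xGen q) :=
  xGen_eq q ▸ isSignedPauli_pauAlg _

theorem pauAlg_single_z (q : Qubit L l) : IsSignedPauli (0, Finsupp.single q 1) (zGen q) :=
  zGen_eq q ▸ isSignedPauli_pauAlg _

/-- Signs are left undetermined: the exponents, on which `Φ` acts additively, suffice for
commutation relations and supports. -/
theorem map_isSignedPauli (Φ : Alg L l →ₐ[ℂ] Alg L l)
    (M : (Config L l × Config L l) →+ (Config L l × Config L l))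
    (hx : ∀ q, IsSignedPauli (M (Finsupp.single q 1, 0)) (Φ (xGen q)))
    (hz : ∀ q, IsSignedPauli (M (0, Finsupp.single q 1)) (Φ (zGen q)))
    {p : Config L l × Config L l} {O : Alg L l} (h : IsSignedPauli p O) :
    IsSignedPauli (M p) (Φ O) := by
  have h1 : ∀ w : Config L l, IsSignedPauli (M (w, 0)) (Φ (pauAlg (w, 0))) := by
    intro w
    induction w using config_induction with
    | h0 => exact ⟨0, by simp [← Prod.zero_eq_mk, pauAlg_zero, sgn_zero]⟩
    | hadd w q ih =>
      have h2 : pauAlg (Finsupp.single q 1 + w, 0) = xGen q * pauAlg (w, 0) := by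
        rw [xGen_eq, pauAlg_mul, Finsupp.coe_zero, dot_zero, sgn_zero, one_smul, Prod.mk_add_mk,
          add_zero]
      have h3 : ((Finsupp.single q 1 + w, 0) : Config L l × Config L l) =
          (Finsupp.single q 1, 0) + (w, 0) := by simp
      rw [h2, map_mul, h3, map_add]
      exact (hx q).mul ih
  have h2 : ∀ w : Config L l, IsSignedPauli (M (0, w)) (Φ (pauAlg (0, w))) := by
    intro w
    induction w using config_induction with
    | h0 => exact ⟨0, by simp [← Prod.zero_eq_mk, pauAlg_zero, sgn_zero]⟩
    | hadd w q ih =>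
      have h2 : pauAlg (0, Finsupp.single q 1 + w) = zGen q * pauAlg (0, w) := by
        rw [zGen_eq, pauAlg_mul, map_zero, sgn_zero, one_smul, Prod.mk_add_mk, add_zero]
      have h3 : ((0, Finsupp.single q 1 + w) : Config L l × Config L l) =
          (0, Finsupp.single q 1) + (0, w) := by simp
      rw [h2, map_mul, h3, map_add]
      exact (hz q).mul ih
  obtain ⟨a, rfl⟩ := h
  have h3 : pauAlg p = pauAlg (p.1, 0) * pauAlg (0, p.2) := by
    rw [pauAlg_mul, map_zero, sgn_zero, one_smul]
    simp
  obtain ⟨b, hb⟩ := (h1 p.1).mul (h2 p.2)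
  refine ⟨a + b, ?_⟩
  rw [map_smul, h3, map_mul, hb, ← map_add, smul_smul, sgn_add]
  simp

/-- The linear data of a Clifford automorphism of the type of the boundary theories of
`½(κ + A ∪ B)`. -/
structure CliffordData (L : Fin d → ℕ) (l : ℕ) where
  /-- Exponents of `X` in the decorations. -/
  N : Config L l →+ Config L l
  /-- Exponents of `Z` in the hopping operators. -/
  κ : Config L l →+ Config L l
  /-- Exponents of `Z` in the gauge constraints. -/
  κ' : Config L l →+ Config L l
  N_adj : ∀ a b, dot (N a) b = dot a (N b)
  κ_adj : ∀ a b, dot (κ a) b = dot a (κ' b)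
  symm : ∀ a b, dot (κ' (N a)) (N b) = dot (κ' (N b)) (N a)
  alt : ∀ a, dot (κ' (N a)) (N a) = 0
  N_single : ∀ q, N (Finsupp.single q 1) q = 0
  N_κ : ∀ q, dot (N (κ (Finsupp.single q 1))) (κ (Finsupp.single q 1)) = 0

namespace CliffordData

variable (D : CliffordData L l)

/-- The action on the exponents of Pauli operators. -/
def mat : (Config L l × Config L l) →+ (Config L l × Config L l) where
  toFun p := (p.1 + D.N (D.κ p.1 + p.2), p.2 + D.κ' (D.N (D.κ p.1 + p.2)))
  map_zero' := by simp
  map_add' p p' := by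
    ext1 <;> simp only [Prod.fst_add, Prod.snd_add, map_add] <;> abel

theorem mat_apply (p : Config L l × Config L l) :
    D.mat p = (p.1 + D.N (D.κ p.1 + p.2), p.2 + D.κ' (D.N (D.κ p.1 + p.2))) := rfl

theorem dot_κ_N (a b : Config L l) : dot (D.κ' (D.N a)) b = dot (D.N a) (D.κ b) := by
  rw [dot_comm, ← D.κ_adj, dot_comm]

/-- With `u = κ p.1 + p.2` the map is `p ↦ p + (N u, κ' N u)`. The terms with one decoration combine
to `N u · u' + N u' · u`, zero because `N` is self-adjoint; those with two combine to `κ' N u · N u'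
+ κ' N u' · N u`, zero by `symm`. -/
theorem sympl_mat (p p' : Config L l × Config L l) :
    sympl (D.mat p) (D.mat p') = sympl p p' := by
  simp only [sympl, mat_apply]
  generalize hu : D.κ p.1 + p.2 = u
  generalize hu' : D.κ p'.1 + p'.2 = u'
  simp only [Finsupp.coe_add, dot_add, map_add]
  have h1 : dot (D.κ' (D.N u)) p'.1 = dot (D.N u) (D.κ p'.1) := D.dot_κ_N _ _
  have h2 : dot (D.κ' (D.N u')) p.1 = dot (D.N u') (D.κ p.1) := D.dot_κ_N _ _
  have h3 : dot p.2 (D.N u') = dot (D.N u') p.2 := dot_comm _ _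
  have h4 : dot p'.2 (D.N u) = dot (D.N u) p'.2 := dot_comm _ _
  have h5 : dot (D.N u) (D.κ p'.1) + dot (D.N u) p'.2 = dot (D.N u) u' := by rw [← map_add, hu']
  have h6 : dot (D.N u') (D.κ p.1) + dot (D.N u') p.2 = dot (D.N u') u := by rw [← map_add, hu]
  have h7 : dot (D.N u) u' = dot (D.N u') u := by rw [D.N_adj, dot_comm]
  rw [h1, h2, h3, h4, D.symm u u']
  have e1 := CharTwo.add_self_eq_zero (dot (D.N u') u)
  have e2 := CharTwo.add_self_eq_zero (dot (D.κ' (D.N u')) (D.N u))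
  linear_combination h5 + h6 + h7 + e1 + e2

/-- The map changes `u` by `(κ + κ') N u`, which `N` annihilates by `symm` and adjointness. Hence
the second application adds the same vector as the first. -/
theorem mat_mat (p : Config L l × Config L l) : D.mat (D.mat p) = p := by
  have h0 : ∀ u, D.N (D.κ (D.N u) + D.κ' (D.N u)) = 0 := by
    intro u
    ext q
    rw [← single_dot, dot_comm, D.N_adj, Finsupp.coe_add, dot_add, D.symm,
      dot_comm (D.κ (D.N u)), ← dot_κ_N]
    exact CharTwo.add_self_eq_zero _
  simp only [mat_apply]
  set u := D.κ p.1 + p.2 with hu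
  have h1 : D.κ (p.1 + D.N u) + (p.2 + D.κ' (D.N u)) = u + (D.κ (D.N u) + D.κ' (D.N u)) := by
    rw [map_add, hu]; abel
  rw [h1, map_add D.N u, h0, add_zero, add_assoc, config_add_self, add_zero, add_assoc, config_add_self,
    add_zero]

/-- Even overlap of the `X` and `Z` parts makes the images of the generators self-adjoint
involutions. Here and in `dot_mat_x` the conditions `alt`, `N_single` and `N_κ` enter. -/
theorem dot_mat_z (q : Qubit L l) :
    dot (D.mat (0, Finsupp.single q 1)).2 (D.mat (0, Finsupp.single q 1)).1 = 0 := by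
  simp only [mat_apply, map_zero, zero_add, Finsupp.coe_add, dot_add, single_dot, D.N_single,
    D.alt]

theorem dot_mat_x (q : Qubit L l) :
    dot (D.mat (Finsupp.single q 1, 0)).2 (D.mat (Finsupp.single q 1, 0)).1 = 0 := by
  simp only [mat_apply, add_zero, zero_add, map_add, D.alt, dot_κ_N, D.N_κ]

/-- As `mat` is symplectic, the prescribed images commute like the generators. The images of the `Z`
operators are assembled into `Z` first, since those of the `X` operators contain products of them.
-/
theorem exists_hom : ∃ Φ : Alg L l →ₐ[ℂ] Alg L l,
    (∀ q, Φ (zGen q) = zGen q *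
      pauAlg (D.N (Finsupp.single q 1), D.κ' (D.N (Finsupp.single q 1)))) ∧
    (∀ q, Φ (xGen q) = xGen q * pauAlg (0, D.κ (Finsupp.single q 1)) *
      Φ (pauAlg (0, D.κ (Finsupp.single q 1)))) ∧
    (∀ p O, IsSignedPauli p O → IsSignedPauli (D.mat p) (Φ O)) := by
  let z : Qubit L l → Alg L l := fun q =>
    zGen q * pauAlg (D.N (Finsupp.single q 1), D.κ' (D.N (Finsupp.single q 1)))
  have hz : ∀ q, IsSignedPauli (D.mat (0, Finsupp.single q 1)) (z q) := fun q => by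
    have := (pauAlg_single_z q).mul (isSignedPauli_pauAlg
      (D.N (Finsupp.single q 1), D.κ' (D.N (Finsupp.single q 1))))
    rwa [show (0, Finsupp.single q 1) + (D.N (Finsupp.single q 1), D.κ' (D.N (Finsupp.single q 1)))
      = D.mat (0, Finsupp.single q 1) by simp [mat_apply]] at this
  have hcomm : ∀ {p p' O O'}, IsSignedPauli (D.mat p) O → IsSignedPauli (D.mat p') O' →
      O * O' = sgn (sympl p p') • (O' * O) := fun h h' => by rw [h.comm h', sympl_mat]
  have hzc : ∀ i j, z i * z j = z j * z i := fun i j => by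
    rw [hcomm (hz i) (hz j)]
    simp [sympl, sgn_zero]
  have hzs : ∀ i, z i * z i = 1 := fun i => by
    rw [(hz i).sq, dot_mat_z, sgn_zero, one_smul]
  obtain ⟨Z, hZ0, hZ, hZs⟩ := exists_mulHom z hzc hzs
  have hZp : ∀ v, IsSignedPauli (D.mat (0, v)) (Z v) := by
    intro v
    induction v using config_induction with
    | h0 => exact ⟨0, by rw [← Prod.zero_eq_mk, map_zero, hZ0, pauAlg_zero, sgn_zero, one_smul]⟩
    | hadd v q ih =>
      rw [hZ, hZs, show ((0, Finsupp.single q 1 + v) : Config L l × Config L l) =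
        (0, Finsupp.single q 1) + (0, v) by simp, map_add]
      exact (hz q).mul ih
  let x : Qubit L l → Alg L l := fun q =>
    xGen q * pauAlg (0, D.κ (Finsupp.single q 1)) * Z (D.κ (Finsupp.single q 1))
  have hx : ∀ q, IsSignedPauli (D.mat (Finsupp.single q 1, 0)) (x q) := fun q => by
    have := ((pauAlg_single_x q).mul (isSignedPauli_pauAlg (0, D.κ (Finsupp.single q 1)))).mul
      (hZp (D.κ (Finsupp.single q 1)))
    rwa [show (Finsupp.single q 1, 0) + (0, D.κ (Finsupp.single q 1)) +
      D.mat (0, D.κ (Finsupp.single q 1)) = D.mat (Finsupp.single q 1, 0) by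
        simp [mat_apply, ← add_assoc, config_add_self]] at this
  have hxc : ∀ i j, x i * x j = x j * x i := fun i j => by
    rw [hcomm (hx i) (hx j)]
    simp [sympl, sgn_zero, dot_zero]
  have hxs : ∀ i, x i * x i = 1 := fun i => by
    rw [(hx i).sq, dot_mat_x, sgn_zero, one_smul]
  have hzx : ∀ i j, z i * x j = (if i = j then -1 else 1 : ℂ) • (x j * z i) := fun i j => by
    rw [hcomm (hz i) (hx j)]
    congr 1
    simp only [sympl, single_dot, Finsupp.coe_zero, dot_zero, add_zero, Finsupp.single_apply]
    by_cases h : i = j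
    · rw [if_pos h, if_pos h.symm, sgn_one]
    · rw [if_neg h, if_neg (Ne.symm h), sgn_zero]
  obtain ⟨Φ, hΦ⟩ := exists_algHom x z hxc hxs hzc hzs hzx
  have hΦZ : ∀ v, Φ (pauAlg (0, v)) = Z v := by
    intro v
    induction v using config_induction with
    | h0 => rw [← Prod.zero_eq_mk, pauAlg_zero, map_one, hZ0]
    | hadd v q ih =>
      rw [show pauAlg (0, Finsupp.single q 1 + v) = zGen q * pauAlg (0, v) by
        rw [zGen_eq, pauAlg_mul, map_zero, sgn_zero, one_smul, Prod.mk_add_mk, add_zero],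
        map_mul, (hΦ q).2, ih, hZ, hZs]
  refine ⟨Φ, fun q => (hΦ q).2, fun q => by rw [hΦZ, (hΦ q).1], fun p O h => ?_⟩
  exact map_isSignedPauli Φ D.mat (fun q => by rw [(hΦ q).1]; exact hx q)
    (fun q => by rw [(hΦ q).2]; exact hz q) h

/-- `mat` is an involution, so `Φ²` multiplies each Pauli operator by a sign. Therefore `Φ⁴ = 1`,
and the inverse `Φ³` acts on exponents like `Φ`. -/
theorem exists_equiv : ∃ Φ : Alg L l ≃ₐ[ℂ] Alg L l,
    (∀ q, Φ (zGen q) = zGen q *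
      pauAlg (D.N (Finsupp.single q 1), D.κ' (D.N (Finsupp.single q 1)))) ∧
    (∀ q, Φ (xGen q) = xGen q * pauAlg (0, D.κ (Finsupp.single q 1)) *
      Φ (pauAlg (0, D.κ (Finsupp.single q 1)))) ∧
    (∀ p O, IsSignedPauli p O → IsSignedPauli (D.mat p) (Φ O)) ∧
    (∀ p O, IsSignedPauli p O → IsSignedPauli (D.mat p) (Φ.symm O)) := by
  obtain ⟨Φ, hz, hx, hp⟩ := D.exists_hom
  have h2 : ∀ p, ∃ a : ZMod 2, Φ (Φ (pauAlg p)) = sgn a • pauAlg p := fun p => by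
    have := hp _ _ (hp p _ (isSignedPauli_pauAlg p))
    rwa [mat_mat] at this
  have h4 : ∀ p, Φ (Φ (Φ (Φ (pauAlg p)))) = pauAlg p := fun p => by
    obtain ⟨a, ha⟩ := h2 p
    rw [ha, map_smul, map_smul, ha, smul_smul, sgn_mul_self, one_smul]
  have h5 : Φ.comp (Φ.comp (Φ.comp Φ)) = AlgHom.id ℂ _ :=
    algHom_ext (fun q => by rw [xGen_eq]; exact h4 _) (fun q => by rw [zGen_eq]; exact h4 _)
  refine ⟨AlgEquiv.ofAlgHom Φ (Φ.comp (Φ.comp Φ)) h5 (by rw [← h5]; rfl), hz, hx, hp,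
    fun p O h => ?_⟩
  change IsSignedPauli _ (Φ (Φ (Φ O)))
  have := hp _ _ (hp _ _ (hp _ _ h))
  rwa [mat_mat] at this

end CliffordData

theorem localAlg_mono {S T : Set (Qubit L l)} (h : S ⊆ T) : localAlg L l S ≤ localAlg L l T :=
  Algebra.adjoin_mono fun _ ⟨q, hq, h'⟩ => ⟨q, h hq, h'⟩

theorem map_localAlg (Φ : Alg L l →ₐ[ℂ] Alg L l) {S T : Set (Qubit L l)}
    (h : ∀ q ∈ S, (Φ (xGen q) : Op L l) ∈ localAlg L l T ∧ (Φ (zGen q) : Op L l) ∈ localAlg L l T)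
    (O : Alg L l) (hO : (O : Op L l) ∈ localAlg L l S) : (Φ O : Op L l) ∈ localAlg L l T := by
  obtain ⟨O, hO'⟩ := O
  change O ∈ localAlg L l S at hO
  induction hO using Algebra.adjoin_induction with
  | mem O hq =>
    obtain ⟨q, hq, rfl | rfl⟩ := hq
    · exact (h q hq).1
    · exact (h q hq).2
  | algebraMap c =>
    have : (⟨algebraMap ℂ _ c, hO'⟩ : Alg L l) = algebraMap ℂ _ c := rfl
    rw [this, AlgHom.commutes]
    exact Subalgebra.algebraMap_mem _ c
  | add O P h1 h2 ih ih' =>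
    have h1 := localAlg_mono (Set.subset_univ S) h1
    have h2 := localAlg_mono (Set.subset_univ S) h2
    have : (⟨O + P, hO'⟩ : Alg L l) = ⟨O, h1⟩ + ⟨P, h2⟩ := rfl
    rw [this, map_add]
    exact add_mem (ih h1) (ih' h2)
  | mul O P h1 h2 ih ih' =>
    have h1 := localAlg_mono (Set.subset_univ S) h1
    have h2 := localAlg_mono (Set.subset_univ S) h2
    have : (⟨O * P, hO'⟩ : Alg L l) = ⟨O, h1⟩ * ⟨P, h2⟩ := rfl
    rw [this, map_mul]
    exact mul_mem (ih h1) (ih' h2)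

end Clifford

/-! ### Greedy coloring -/

section Coloring

/-- Greedy coloring: if every element is related to at most `N` elements, then `N + 1` colors
suffice to separate related elements. -/
theorem exists_coloring {ι : Type*} (R : ι → ι → Prop) (hR : ∀ a b, R a b → R b a) (N : ℕ)
    (hN : ∀ a, ∃ s : Finset ι, s.card ≤ N ∧ ∀ b, R a b → b ∈ s) :
    ∃ c : ι → ℕ, (∀ a, c a < N + 1) ∧ ∀ a b, R a b → c a = c b → a = b := by
  choose s hs hsR using hN
  have key : ∀ (a : ι) (f : ι → ℕ), ∃ k, k < N + 1 ∧ ∀ b ∈ s a, f b ≠ k := by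
    intro a f
    by_contra! h
    have h1 : Finset.range (N + 1) ⊆ (s a).image f := fun k hk => by
      obtain ⟨b, hb, h2⟩ := h k (Finset.mem_range.1 hk)
      exact Finset.mem_image.2 ⟨b, hb, h2⟩
    have := (Finset.card_le_card h1).trans Finset.card_image_le
    rw [Finset.card_range] at this
    have := hs a
    omega
  choose pick hpick hne using key
  -- Recursion along a well-ordering: `a` avoids the colors of its earlier neighbours. The default
  -- `0` for later ones excludes at most one color per neighbour as well, so `N + 1` colors are
  -- enough.
  let c : ι → ℕ := (IsWellFounded.wf : WellFounded (WellOrderingRel (α := ι))).fix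
    fun a rec => pick a fun b => if h : WellOrderingRel b a then rec b h else 0
  have hc : ∀ a, c a = pick a fun b => if WellOrderingRel b a then c b else 0 := fun a => by
    simp only [c]
    rw [WellFounded.fix_eq]
    congr 1
  have hlt : ∀ a b, R a b → WellOrderingRel b a → c a ≠ c b := fun a b hab hba h => by
    rw [hc a] at h
    refine hne a (fun b => if WellOrderingRel b a then c b else 0) b (hsR a b hab) ?_
    rw [if_pos hba, h]
  refine ⟨c, fun a => by rw [hc]; exact hpick _ _, fun a b hab h => ?_⟩
  rcases trichotomous_of (WellOrderingRel (α := ι)) a b with h' | h' | h'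
  · exact absurd h.symm (hlt b a (hR a b hab) h')
  · exact h'
  · exact absurd h (hlt a b hab h')

end Coloring

/-! ### Neighbourhoods, local functions and diagonal operators -/

section Diagonal

variable {d : ℕ} {L : Fin d → ℕ} {l : ℕ}

theorem Near.refl (r : ℕ) (q : Qubit L l) : Near r q q := ⟨0, by simp, by simp⟩

theorem Near.symm {r : ℕ} {q q' : Qubit L l} (h : Near r q q') : Near r q' q := by
  obtain ⟨v, hv, h⟩ := h
  exact ⟨-v, fun i => by simpa using hv i, fun i => by simp [h i]⟩

theorem Near.trans {r r' : ℕ} {q q' q'' : Qubit L l} (h : Near r q q') (h' : Near r' q' q'') :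
    Near (r + r') q q'' := by
  obtain ⟨v, hv, h⟩ := h
  obtain ⟨v', hv', h'⟩ := h'
  refine ⟨v + v', fun i => (abs_add_le _ _).trans ?_, fun i => ?_⟩
  · push_cast
    exact add_le_add (hv i) (hv' i)
  · rw [h' i, h i]; simp [add_assoc]

theorem Near.mono {r r' : ℕ} {q q' : Qubit L l} (h : Near r q q') (hr : r ≤ r') :
    Near r' q q' := by
  obtain ⟨v, hv, h⟩ := h
  exact ⟨v, fun i => (hv i).trans (by exact_mod_cast hr), h⟩

/-- A bound for the number of qubits in a ball. -/
def ballCard (d r : ℕ) : ℕ := (2 * r + 1) ^ d * (2 * 2 ^ d)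

theorem exists_ball (r : ℕ) (q : Qubit L l) :
    ∃ s : Finset (Qubit L l), s.card ≤ ballCard d r ∧ ∀ q', Near r q q' → q' ∈ s := by
  -- A qubit near `q` is determined by a displacement in `[-r, r]^d`, a species and a set of
  -- directions.
  let V := (Fintype.piFinset fun _ : Fin d => Finset.Icc (-(r : ℤ)) r) ×ˢ
    (({Species.A, Species.B} : Finset Species) ×ˢ (Finset.univ : Finset (Finset (Fin d))))
  let f : (Fin d → ℤ) × Species × Finset (Fin d) → Qubit L l := fun p =>
    if h : p.2.2.card = l then (p.2.1, ⟨(fun i => q.2.1.1 i + (p.1 i : ZMod (L i)), p.2.2), h⟩)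
    else q
  refine ⟨V.image f, Finset.card_image_le.trans ?_, ?_⟩
  · rw [Finset.card_product, Finset.card_product, Fintype.card_piFinset]
    refine Nat.mul_le_mul ?_ (Nat.mul_le_mul Finset.card_le_two ?_)
    · simp only [Int.card_Icc, Finset.prod_const, Finset.card_univ, Fintype.card_fin]
      exact Nat.pow_le_pow_left (by omega) d
    · simp
  · rintro ⟨t, ⟨x, S⟩, hS⟩ ⟨v, hv, h⟩
    refine Finset.mem_image.2 ⟨(v, t, S), ?_, ?_⟩
    · simp only [V, Finset.mem_product, Fintype.mem_piFinset, Finset.mem_Icc, Finset.mem_insert,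
        Finset.mem_singleton, Finset.mem_univ, and_true]
      exact ⟨fun i => abs_le.1 (hv i), by cases t <;> simp⟩
    · simp only [f]
      rw [dif_pos hS]
      simp only [← h]

theorem near_finite (r : ℕ) (q : Qubit L l) : {q' | Near r q q'}.Finite := by
  obtain ⟨s, _, h⟩ := exists_ball r q
  exact s.finite_toSet.subset h

/-- The function `F` depends only on the qubits in `S`. -/
def IsLocalFun {β : Type*} (S : Set (Qubit L l)) (F : Config L l → β) : Prop :=
  ∀ s p, p ∉ S → F (s + Finsupp.single p 1) = F s

/-- Two configurations differ in finitely many qubits, so single flips outside `S` lead from one to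
the other. -/
theorem IsLocalFun.congr {β : Type*} {S : Set (Qubit L l)} {F : Config L l → β}
    (hF : IsLocalFun S F) {s s' : Config L l} (h : ∀ q ∈ S, s q = s' q) : F s = F s' := by
  have key : ∀ t : Config L l, (∀ q ∈ S, t q = 0) → F (s' + t) = F s' := by
    intro t
    induction t using Finsupp.induction with
    | zero => intro _; rw [add_zero]
    | single_add q a t hq ha ih =>
      intro ht
      obtain rfl : a = 1 := (zmod2_cases a).resolve_left ha
      have h0 : t q = 0 := Finsupp.notMem_support_iff.1 hq
      have hqS : q ∉ S := fun hqS => by simpa [h0] using ht q hqS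
      rw [add_comm (Finsupp.single q 1), ← add_assoc, hF _ _ hqS]
      refine ih fun p hp => ?_
      have hpq : p ≠ q := fun h => hqS (h ▸ hp)
      simpa [Finsupp.single_apply, hpq.symm] using ht p hp
  have h2 : s = s' + (s' + s) := by rw [← add_assoc, config_add_self, zero_add]
  rw [h2]
  refine key _ fun q hq => ?_
  rw [Finsupp.add_apply, h q hq, CharTwo.add_self_eq_zero]

theorem isLocalFun_of_congr {β : Type*} {S : Set (Qubit L l)} {F : Config L l → β}
    (h : ∀ s s', (∀ q ∈ S, s q = s' q) → F s = F s') : IsLocalFun S F := fun s p hp =>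
  h _ _ fun q hq => by
    have : p ≠ q := fun h => hp (h ▸ hq)
    simp [this]

/-- The algebra generated by the Pauli `Z` operators of the qubits in `S`. -/
def zAlg (S : Set (Qubit L l)) : Subalgebra ℂ (Op L l) :=
  Algebra.adjoin ℂ {O | ∃ q ∈ S, O = zOp (Pi.single q 1)}

theorem zAlg_le (S : Set (Qubit L l)) : zAlg S ≤ localAlg L l S :=
  Algebra.adjoin_mono fun _ ⟨q, hq, h⟩ => ⟨q, hq, Or.inr h⟩

theorem zAlg_mono {S T : Set (Qubit L l)} (h : S ⊆ T) : zAlg S ≤ zAlg T :=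
  Algebra.adjoin_mono fun _ ⟨q, hq, h'⟩ => ⟨q, h hq, h'⟩

theorem dot_piSingle (q : Qubit L l) (s : Config L l) :
    dot (Pi.single q 1 : Qubit L l → ZMod 2) s = s q := by
  rw [← Finsupp.single_eq_pi_single, single_dot]

/-- Splitting by the value of the qubit `q`: `F` is put together from two functions independent of
`q` by means of the projections `(1 ± Z_q) / 2`. -/
theorem diagOp_mem_zAlg_finset (S : Finset (Qubit L l)) : ∀ F : Config L l → ℂ,
    IsLocalFun (S : Set (Qubit L l)) F → diagOp F ∈ zAlg (S : Set (Qubit L l)) := by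
  induction S using Finset.induction with
  | empty =>
    intro F hF
    have : diagOp F = algebraMap ℂ _ (F 0) := op_ext fun s => by
      rw [diagOp_ket, hF.congr (s' := 0) (by simp)]
      rfl
    rw [this]
    exact Subalgebra.algebraMap_mem _ _
  | insert q S hq ih =>
    intro F hF
    have hloc : ∀ a, IsLocalFun (S : Set (Qubit L l)) fun s : Config L l =>
        F (s.erase q + Finsupp.single q a) := fun a => by
      refine isLocalFun_of_congr fun s s' h => hF.congr fun p hp => ?_
      rw [Finsupp.add_apply, Finsupp.add_apply]
      congr 1
      by_cases hpq : p = q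
      · subst hpq; simp
      · rw [Finsupp.erase_ne hpq, Finsupp.erase_ne hpq]
        rw [Finset.coe_insert, Set.mem_insert_iff, or_iff_right hpq] at hp
        exact h p hp
    have h0 := zAlg_mono (Finset.coe_subset.2 (Finset.subset_insert q S)) (ih _ (hloc 0))
    have h1 := zAlg_mono (Finset.coe_subset.2 (Finset.subset_insert q S)) (ih _ (hloc 1))
    have hz : zOp (Pi.single q 1) ∈ zAlg ((insert q S : Finset _) : Set (Qubit L l)) :=
      Algebra.subset_adjoin ⟨q, by simp, rfl⟩
    have key : diagOp F = (1 / 2 : ℂ) • (diagOp (fun s => F (s.erase q + Finsupp.single q 0)) *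
        (1 + zOp (Pi.single q 1)) + diagOp (fun s => F (s.erase q + Finsupp.single q 1)) *
        (1 + (-1 : ℂ) • zOp (Pi.single q 1))) := op_ext fun s => by
      simp only [LinearMap.smul_apply, LinearMap.add_apply, Module.End.mul_apply,
        Module.End.one_apply, zOp_ket, map_add, map_smul,
        diagOp_ket, dot_piSingle, smul_smul, ← add_smul]
      congr 1
      have h2 : s.erase q + Finsupp.single q (s q) = s := by
        rw [add_comm]; exact Finsupp.single_add_erase q s
      rcases zmod2_cases (s q) with h | h <;> rw [h] at h2 <;> rw [h, h2]
      · rw [sgn_zero]; ring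
      · rw [sgn_one]; ring
    rw [key]
    refine Subalgebra.smul_mem _ (add_mem (mul_mem h0 (add_mem (one_mem _) hz))
      (mul_mem h1 (add_mem (one_mem _) (Subalgebra.smul_mem _ hz _)))) _

theorem diagOp_mem_zAlg {S : Set (Qubit L l)} (hS : S.Finite) {F : Config L l → ℂ}
    (hF : IsLocalFun S F) : diagOp F ∈ zAlg S := by
  have := diagOp_mem_zAlg_finset hS.toFinset F (by rwa [hS.coe_toFinset])
  rwa [hS.coe_toFinset] at this

theorem diagOp_mul_xOp (F : Config L l → ℂ) (w : Config L l) :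
    diagOp F * xOp w = xOp w * diagOp fun s => F (s + w) :=
  op_ext fun s => by
    rw [Module.End.mul_apply, Module.End.mul_apply, xOp_ket, diagOp_ket, diagOp_ket, map_smul,
      xOp_ket]

theorem diagOp_comm_zOp (F : Config L l → ℂ) (v : Qubit L l → ZMod 2) :
    diagOp F * zOp v = zOp v * diagOp F := by
  rw [zOp, diagOp_mul, diagOp_mul]
  simp only [mul_comm]

theorem diagOp_comm {S : Set (Qubit L l)} {F : Config L l → ℂ}
    (hF : ∀ s, ∀ q ∈ S, F (s + Finsupp.single q 1) = F s) {O : Op L l}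
    (hO : O ∈ localAlg L l S) : diagOp F * O = O * diagOp F := by
  have : localAlg L l S ≤ Subalgebra.centralizer ℂ {diagOp F} := by
    refine Algebra.adjoin_le ?_
    rintro O ⟨q, hq, rfl | rfl⟩ <;> rw [SetLike.mem_coe, Subalgebra.mem_centralizer_iff] <;>
      rintro _ rfl
    · rw [diagOp_mul_xOp]
      simp only [hF _ _ hq]
    · exact diagOp_comm_zOp F _
  exact Subalgebra.mem_centralizer_iff ℂ |>.1 (this hO) _ rfl

/-- An operator supported on `S` commutes with `X_p` for `p` outside `S`; for a diagonal operator
this means that its entries ignore the qubit `p`. -/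
theorem isLocalFun_of_mem {S : Set (Qubit L l)} {F : Config L l → ℂ}
    (hF : diagOp F ∈ localAlg L l S) : IsLocalFun S F := by
  intro s p hp
  have : localAlg L l S ≤ Subalgebra.centralizer ℂ {xOp (Finsupp.single p 1 : Config L l)} := by
    refine Algebra.adjoin_le ?_
    rintro O ⟨q, hq, rfl | rfl⟩ <;> rw [SetLike.mem_coe, Subalgebra.mem_centralizer_iff] <;>
      rintro _ rfl
    · rw [← xOp_add, ← xOp_add, add_comm]
    · have : q ≠ p := fun h => hp (h ▸ hq)
      rw [zOp_mul_xOp, dot_piSingle, Finsupp.single_apply, if_neg this.symm, sgn_zero, one_smul]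
  have h1 := Subalgebra.mem_centralizer_iff ℂ |>.1 (this hF) _ rfl
  have h2 := LinearMap.congr_fun h1 (ket s)
  rw [Module.End.mul_apply, Module.End.mul_apply, xOp_ket, diagOp_ket, diagOp_ket, map_smul,
    xOp_ket] at h2
  have h3 := DFunLike.congr_fun h2 (s + Finsupp.single p 1)
  simpa [ket] using h3.symm

end Diagonal

/-! ### Conjugation by diagonal operators of local phases -/

section DiagonalConjugation

variable {d : ℕ} {L : Fin d → ℕ} {l : ℕ}

/-- `Φ` is conjugation by the diagonal operator `θ`. -/
def IsDiagConj (θ : Config L l → ℂ) (Φ : Alg L l ≃ₐ[ℂ] Alg L l) : Prop :=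
  ∀ O : Alg L l, (Φ O : Op L l) * diagOp θ = diagOp θ * O

theorem diagOp_mul_inv {θ : Config L l → ℂ} (hθ : ∀ s, θ s ≠ 0) :
    diagOp θ * diagOp (fun s => (θ s)⁻¹) = 1 := by
  rw [diagOp_mul, ← diagOp_one]
  exact congrArg diagOp (funext fun s => mul_inv_cancel₀ (hθ s))

theorem diagOp_inv_mul {θ : Config L l → ℂ} (hθ : ∀ s, θ s ≠ 0) :
    diagOp (fun s => (θ s)⁻¹) * diagOp θ = 1 := by
  rw [diagOp_mul, ← diagOp_one]
  exact congrArg diagOp (funext fun s => inv_mul_cancel₀ (hθ s))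

theorem diagOp_mul_right_cancel {θ : Config L l → ℂ} (hθ : ∀ s, θ s ≠ 0) {O O' : Op L l}
    (h : O * diagOp θ = O' * diagOp θ) : O = O' := by
  have := congrArg (· * diagOp fun s => (θ s)⁻¹) h
  simpa only [mul_assoc, diagOp_mul_inv hθ, mul_one] using this

/-- A diagonal operator of local phases: `θ` changes by a phase that depends only on the
neighbourhood of a qubit when this qubit is flipped. -/
def IsLocalPhase (R : ℕ) (θ : Config L l → ℂ) : Prop :=
  (∀ s, ‖θ s‖ = 1) ∧
    ∀ q, IsLocalFun {q' | Near R q q'} fun s => θ (s + Finsupp.single q 1) / θ s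

theorem ne_zero_of_norm_one {θ : Config L l → ℂ} (h : ∀ s, ‖θ s‖ = 1) (s : Config L l) :
    θ s ≠ 0 := norm_ne_zero_iff.1 (by rw [h]; exact one_ne_zero)

theorem IsLocalPhase.ne_zero {R : ℕ} {θ : Config L l → ℂ} (h : IsLocalPhase R θ) (s : Config L l) :
    θ s ≠ 0 := ne_zero_of_norm_one h.1 s

theorem IsLocalPhase.mul {R : ℕ} {θ η : Config L l → ℂ} (h : IsLocalPhase R θ)
    (h' : IsLocalPhase R η) : IsLocalPhase R fun s => θ s * η s :=
  ⟨fun s => by rw [norm_mul, h.1, h'.1, one_mul], fun q s p hp => by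
    have h1 := h.2 q s p hp
    have h2 := h'.2 q s p hp
    simp only [mul_div_mul_comm] at h1 h2 ⊢
    rw [h1, h2]⟩

theorem IsLocalPhase.inv {R : ℕ} {θ : Config L l → ℂ} (h : IsLocalPhase R θ) :
    IsLocalPhase R fun s => (θ s)⁻¹ :=
  ⟨fun s => by rw [norm_inv, h.1, inv_one], fun q s p hp => by
    have h1 := congrArg (·⁻¹) (h.2 q s p hp)
    simpa only [inv_div, div_eq_mul_inv, inv_inv, mul_inv, mul_comm] using h1⟩

theorem diagOp_mul_xOp_eq {θ : Config L l → ℂ} (hθ : ∀ s, θ s ≠ 0) (w : Config L l) :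
    diagOp θ * xOp w = xOp w * diagOp (fun s => θ (s + w) / θ s) * diagOp θ := by
  rw [diagOp_mul_xOp, mul_assoc, diagOp_mul]
  congr 2
  exact funext fun s => (div_mul_cancel₀ _ (hθ s)).symm

/-- Conjugation by a diagonal operator, on the algebra of local operators. -/
theorem exists_diagHom {R : ℕ} {θ : Config L l → ℂ} (h : IsLocalPhase R θ) :
    ∃ Φ : Alg L l →ₐ[ℂ] Alg L l, ∀ O, (Φ O : Op L l) * diagOp θ = diagOp θ * O := by
  have key : ∀ O : Alg L l, ∃ O' : Alg L l, (O' : Op L l) * diagOp θ = diagOp θ * O := by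
    intro O
    induction O using alg_induction with
    | hx q =>
      -- `X_q` acquires only the ratio of the phases after and before the flip, a function of
      -- finitely many qubits, although `diagOp θ` itself need not be a local operator.
      have h1 := zAlg_le _ (diagOp_mem_zAlg (near_finite R q) (h.2 q))
      refine ⟨xGen q * ⟨_, localAlg_mono (Set.subset_univ _) h1⟩, ?_⟩
      exact (diagOp_mul_xOp_eq h.ne_zero _).symm
    | hz q => exact ⟨zGen q, (diagOp_comm_zOp _ _).symm⟩
    | hC c => exact ⟨algebraMap ℂ _ c, Algebra.commutes c (diagOp θ)⟩
    | hadd O O' ih ih' =>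
      obtain ⟨P, hP⟩ := ih
      obtain ⟨P', hP'⟩ := ih'
      exact ⟨P + P', by
        rw [AddMemClass.coe_add, AddMemClass.coe_add, add_mul, mul_add, hP, hP']⟩
    | hmul O O' ih ih' =>
      obtain ⟨P, hP⟩ := ih
      obtain ⟨P', hP'⟩ := ih'
      exact ⟨P * P', by
        rw [MulMemClass.coe_mul, MulMemClass.coe_mul, mul_assoc, hP', ← mul_assoc, hP,
          mul_assoc]⟩
  choose f hf using key
  have huniq : ∀ O O' : Alg L l, (O : Op L l) * diagOp θ = O' * diagOp θ → O = O' :=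
    fun O O' h' => Subtype.ext (diagOp_mul_right_cancel h.ne_zero h')
  have h1 : f 1 = 1 := huniq _ _ (by rw [hf]; simp)
  have hmul : ∀ O O', f (O * O') = f O * f O' := fun O O' => huniq _ _ (by
    rw [hf, MulMemClass.coe_mul, MulMemClass.coe_mul, mul_assoc, hf,
      ← mul_assoc (f O : Op L l), hf, mul_assoc])
  have h0 : f 0 = 0 := huniq _ _ (by rw [hf]; simp)
  have hadd : ∀ O O', f (O + O') = f O + f O' := fun O O' => huniq _ _ (by
    rw [hf, AddMemClass.coe_add, AddMemClass.coe_add, add_mul, mul_add, hf, hf])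
  have hC : ∀ c, f (algebraMap ℂ _ c) = algebraMap ℂ _ c := fun c => huniq _ _ (by
    rw [hf]
    exact (Algebra.commutes c (diagOp θ)).symm)
  exact ⟨AlgHom.mk (RingHom.mk (MonoidHom.mk (OneHom.mk f h1) hmul) h0 hadd) hC, hf⟩

theorem exists_diagConj {R : ℕ} {θ : Config L l → ℂ} (h : IsLocalPhase R θ) :
    ∃ Φ : Alg L l ≃ₐ[ℂ] Alg L l, IsDiagConj θ Φ := by
  obtain ⟨Φ, hΦ⟩ := exists_diagHom h
  obtain ⟨Ψ, hΨ⟩ := exists_diagHom h.inv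
  have huniq : ∀ {O O' : Alg L l}, (O : Op L l) * diagOp θ = O' * diagOp θ → O = O' :=
    fun h' => Subtype.ext (diagOp_mul_right_cancel h.ne_zero h')
  have hΨ' : ∀ O : Alg L l, (O : Op L l) * diagOp θ = diagOp θ * Ψ O := fun O => by
    have h1 := congrArg (fun P => diagOp θ * P * diagOp θ) (hΨ O)
    simp only [mul_assoc, diagOp_inv_mul h.ne_zero, mul_one] at h1
    rw [h1, ← mul_assoc, diagOp_mul_inv h.ne_zero, one_mul]
  refine ⟨AlgEquiv.ofAlgHom Φ Ψ (AlgHom.ext fun O => huniq ?_) (AlgHom.ext fun O => ?_), hΦ⟩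
  · exact (hΦ _).trans (hΨ' O).symm
  · have h1 := (hΨ' (Φ O)).symm.trans (hΦ O)
    have h2 := congrArg (fun P => diagOp (fun s => (θ s)⁻¹) * P) h1
    simp only [← mul_assoc, diagOp_inv_mul h.ne_zero, one_mul] at h2
    exact Subtype.ext h2

theorem IsDiagConj.mul {θ η : Config L l → ℂ} {Φ Ψ : Alg L l ≃ₐ[ℂ] Alg L l}
    (h : IsDiagConj θ Φ) (h' : IsDiagConj η Ψ) : IsDiagConj (fun s => θ s * η s) (Φ * Ψ) :=
  fun O => by
    rw [← diagOp_mul, AlgEquiv.mul_apply, ← mul_assoc, h, mul_assoc, h', mul_assoc]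

theorem IsDiagConj.inv {θ : Config L l → ℂ} (hθ : ∀ s, θ s ≠ 0) {Φ : Alg L l ≃ₐ[ℂ] Alg L l}
    (h : IsDiagConj θ Φ) : IsDiagConj (fun s => (θ s)⁻¹) Φ⁻¹ := fun O => by
  have h1 := h (Φ⁻¹ O)
  rw [← AlgEquiv.mul_apply, mul_inv_cancel, AlgEquiv.one_apply] at h1
  have h2 := congrArg (fun P => diagOp (fun s => (θ s)⁻¹) * P * diagOp fun s => (θ s)⁻¹) h1
  simp only [mul_assoc, diagOp_mul_inv hθ, mul_one] at h2
  rw [h2, ← mul_assoc, diagOp_inv_mul hθ, one_mul]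

theorem IsDiagConj.unique {θ : Config L l → ℂ} (hθ : ∀ s, θ s ≠ 0)
    {Φ Ψ : Alg L l ≃ₐ[ℂ] Alg L l} (h : IsDiagConj θ Φ) (h' : IsDiagConj θ Ψ) : Φ = Ψ :=
  AlgEquiv.ext fun O => Subtype.ext (diagOp_mul_right_cancel hθ ((h O).trans (h' O).symm))

theorem IsDiagConj.const_mul {θ : Config L l → ℂ} {Φ : Alg L l ≃ₐ[ℂ] Alg L l}
    (h : IsDiagConj θ Φ) (c : ℂ) : IsDiagConj (fun s => c * θ s) Φ := fun O => by
  have : diagOp (fun s => c * θ s) = c • diagOp θ := op_ext fun s => by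
    rw [LinearMap.smul_apply, diagOp_ket, diagOp_ket, smul_smul]
  rw [this, mul_smul_comm, h, smul_mul_assoc]

theorem IsDiagConj.map_zGen {θ : Config L l → ℂ} (hθ : ∀ s, θ s ≠ 0)
    {Φ : Alg L l ≃ₐ[ℂ] Alg L l} (h : IsDiagConj θ Φ) (q : Qubit L l) : Φ (zGen q) = zGen q :=
  Subtype.ext (diagOp_mul_right_cancel hθ ((h _).trans (diagOp_comm_zOp _ _)))

theorem IsDiagConj.map_xGen {θ : Config L l → ℂ} (hθ : ∀ s, θ s ≠ 0)
    {Φ : Alg L l ≃ₐ[ℂ] Alg L l} (h : IsDiagConj θ Φ) (q : Qubit L l) :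
    (Φ (xGen q) : Op L l) = xGen q * diagOp fun s => θ (s + Finsupp.single q 1) / θ s :=
  diagOp_mul_right_cancel hθ ((h _).trans (diagOp_mul_xOp_eq hθ _))

theorem isDiagConj_of_gens {θ : Config L l → ℂ} {Φ : Alg L l ≃ₐ[ℂ] Alg L l}
    (hz : ∀ q, Φ (zGen q) = zGen q)
    (hx : ∀ q, (Φ (xGen q) : Op L l) * diagOp θ = diagOp θ * xGen q) : IsDiagConj θ Φ := by
  intro O
  induction O using alg_induction with
  | hx q => exact hx q
  | hz q => rw [hz]; exact (diagOp_comm_zOp _ _).symm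
  | hC c => rw [AlgEquiv.commutes]; exact Algebra.commutes c (diagOp θ)
  | hadd O O' ih ih' =>
    rw [map_add, AddMemClass.coe_add, AddMemClass.coe_add, add_mul, mul_add, ih, ih']
  | hmul O O' ih ih' =>
    rw [map_mul, MulMemClass.coe_mul, MulMemClass.coe_mul, mul_assoc, ih', ← mul_assoc, ih,
      mul_assoc]

end DiagonalConjugation

/-! ### Diagonal operators of local phases as circuits -/

section DiagonalCircuit

variable {d : ℕ} {L : Fin d → ℕ} {l : ℕ}

/-- The restriction of a configuration to the qubits with the property `P`. -/
def restr (P : Qubit L l → Prop) (s : Config L l) : Config L l := s.filter P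

theorem restr_apply (P : Qubit L l → Prop) (s : Config L l) (q : Qubit L l) :
    restr P s q = if P q then s q else 0 := Finsupp.filter_apply _ _ _

theorem restr_add_single_pos {P : Qubit L l → Prop} (s : Config L l) {p : Qubit L l} (h : P p) :
    restr P (s + Finsupp.single p 1) = restr P s + Finsupp.single p 1 := by
  rw [restr, restr, Finsupp.filter_add, Finsupp.filter_single_of_pos _ h]

theorem restr_add_single_neg {P : Qubit L l → Prop} (s : Config L l) {p : Qubit L l}
    (h : ¬ P p) : restr P (s + Finsupp.single p 1) = restr P s := by
  rw [restr, restr, Finsupp.filter_add, Finsupp.filter_single_of_neg _ h, add_zero]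

/-- If `p` is kept by both restrictions, flipping it changes the two phases by the same factor,
since the restricted configurations agree near `p`; if it is dropped by both, nothing changes. -/
theorem IsLocalPhase.filter_ratio {R : ℕ} {θ : Config L l → ℂ} (h : IsLocalPhase R θ)
    {P P' : Qubit L l → Prop} {p : Qubit L l} (hp : P p ↔ P' p)
    (hn : P p → ∀ q, Near R p q → (P q ↔ P' q)) (s : Config L l) :
    θ (restr P (s + Finsupp.single p 1)) / θ (restr P' (s + Finsupp.single p 1)) =
      θ (restr P s) / θ (restr P' s) := by
  by_cases hP : P p
  · rw [restr_add_single_pos s hP, restr_add_single_pos s (hp.1 hP)]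
    have := (h.2 p).congr (s := restr P s) (s' := restr P' s) fun q hq => by
      rw [restr_apply, restr_apply, if_congr (hn hP q hq) rfl rfl]
    have h1 := h.ne_zero (restr P s)
    have h2 := h.ne_zero (restr P' s)
    rw [div_eq_div_iff (h.ne_zero _) h2]
    rw [div_eq_div_iff h1 h2] at this
    linear_combination this
  · rw [restr_add_single_neg s hP, restr_add_single_neg s fun h' => hP (hp.2 h')]

theorem IsLocalPhase.filter {R : ℕ} {θ : Config L l → ℂ} (h : IsLocalPhase R θ)
    (P : Qubit L l → Prop) : IsLocalPhase R fun s => θ (restr P s) :=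
  ⟨fun s => h.1 _, fun q => by
    by_cases hq : P q
    · simp only [restr_add_single_pos _ hq]
      refine isLocalFun_of_congr fun s s' hs => (h.2 q).congr fun p hp => ?_
      rw [restr_apply, restr_apply, hs p hp]
    · simp only [restr_add_single_neg _ hq]
      refine isLocalFun_of_congr fun s s' _ => ?_
      rw [div_self (h.ne_zero _), div_self (h.ne_zero _)]⟩

theorem isUnitaryOp_diagOp {θ : Config L l → ℂ} (h : ∀ s, ‖θ s‖ = 1) : IsUnitaryOp (diagOp θ) := by
  have h1 : ∀ s, θ s * (starRingEnd ℂ) (θ s) = 1 := fun s => by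
    rw [Complex.mul_conj, Complex.normSq_eq_norm_sq, h]; simp
  refine ⟨_, isAdjoint_diagOp θ, ?_, ?_⟩
  · rw [diagOp_mul, ← diagOp_one]
    exact congrArg diagOp (funext h1)
  · rw [diagOp_mul, ← diagOp_one]
    exact congrArg diagOp (funext fun s => (mul_comm _ _).trans (h1 s))

/-- One layer of the circuit of a diagonal operator of local phases: the layer acts on the qubits
of one color. -/
theorem IsLocalPhase.isLayer {R : ℕ} {θ : Config L l → ℂ} (h : IsLocalPhase R θ)
    {c : Qubit L l → ℕ} (hc : ∀ a b, Near (2 * R) a b → c a = c b → a = b) (k : ℕ)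
    {Φ : Alg L l ≃ₐ[ℂ] Alg L l}
    (hΦ : IsDiagConj (fun s => θ (restr (fun q => c q < k + 1) s) *
      (θ (restr (fun q => c q < k) s))⁻¹) Φ) : IsLayer Set.univ (2 * R) Φ := by
  -- A block is the `R`-ball around a qubit of color `k`. These balls are disjoint because equal
  -- colors are more than `2 * R` apart. A qubit in no ball is a block of its own.
  let blk : Qubit L l → Qubit L l := fun p =>
    if h : ∃ b, c b = k ∧ Near R b p then h.choose else p
  have hblk : ∀ p, Near R (blk p) p := fun p => by
    by_cases hp : ∃ b, c b = k ∧ Near R b p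
    · simp only [blk, dif_pos hp]
      exact hp.choose_spec.2
    · simp only [blk, dif_neg hp]
      exact Near.refl _ _
  have hcen : ∀ b p, c b = k → Near R b p → blk p = b := fun b p hb hbp => by
    have hp : ∃ b, c b = k ∧ Near R b p := ⟨b, hb, hbp⟩
    have hck : c (blk p) = k := by
      simp only [blk, dif_pos hp]
      exact hp.choose_spec.1
    exact hc _ _ (two_mul R ▸ (hblk p).trans hbp.symm) (hck.trans hb.symm)
  -- The gate of the block of `b` switches on the qubit `b` alone, on top of the earlier colors. If
  -- `b` does not have color `k`, the gate is trivial.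
  let P : Qubit L l → Qubit L l → Prop := fun b p => c p < k ∨ (p = b ∧ c p = k)
  let G : Qubit L l → Config L l → ℂ := fun b s =>
    θ (restr (P b) s) / θ (restr (fun q => c q < k) s)
  have hG1 : ∀ b s, ‖G b s‖ = 1 := fun b s => by
    simp only [G]
    rw [norm_div, h.1, h.1, div_one]
  have hfin : ∀ b, (blk ⁻¹' {b}).Finite := fun b => (near_finite R b).subset fun p hp => by
    rw [← (show blk p = b from hp)]
    exact hblk p
  refine ⟨blk, fun b => diagOp (G b), fun q q' hq => ?_, fun b => ⟨trivial,
    isUnitaryOp_diagOp (hG1 b), ?_⟩, fun b O hO => ?_⟩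
  · rw [two_mul]
    exact (hblk q).symm.trans (hq ▸ hblk q')
  · refine zAlg_le _ (diagOp_mem_zAlg (hfin b) fun s p hp => ?_)
    have hp' : ∀ q, q = b → c q = k → ¬ Near R p q := fun q hqb hqk hn =>
      hp (by rw [← hqb]; exact hcen q p hqk hn.symm)
    refine h.filter_ratio ?_ (fun _ q hq => ?_) s
    · exact or_iff_left fun h1 => hp' p h1.1 h1.2 (Near.refl _ _)
    · exact or_iff_left fun h1 => hp' q h1.1 h1.2 hq
  -- `H` switches on the other qubits of color `k`. These are far from the block of `b`, so `H`
  -- commutes with the operators of the block.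
  · let H : Config L l → ℂ := fun s => θ (restr (fun q => c q < k + 1) s) / θ (restr (P b) s)
    have hH0 : ∀ s, H s ≠ 0 := fun s => div_ne_zero (h.ne_zero _) (h.ne_zero _)
    have hGH : diagOp (fun s => θ (restr (fun q => c q < k + 1) s) *
      (θ (restr (fun q => c q < k) s))⁻¹) = diagOp (G b) * diagOp H := by
      rw [diagOp_mul]
      refine congrArg diagOp (funext fun s => ?_)
      have := h.ne_zero (restr (P b) s)
      simp only [G, H]
      field_simp
    have hcomm : diagOp H * (O : Op L l) = O * diagOp H := by
      refine diagOp_comm (fun s p hp => ?_) hO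
      have hp : blk p = b := hp
      have hp' : ∀ q, c q = k → Near R p q → q = b := fun q hqk hn =>
        (hcen q p hqk hn.symm).symm.trans hp
      have hq : ∀ q, Near R p q → (c q < k + 1 ↔ P b q) := fun q hn => by
        simp only [P]
        constructor
        · intro h1
          rcases Nat.lt_succ_iff_lt_or_eq.1 h1 with h1 | h1
          · exact Or.inl h1
          · exact Or.inr ⟨hp' q h1 hn, h1⟩
        · rintro (h1 | h1) <;> omega
      exact h.filter_ratio (hq p (Near.refl _ _)) (fun _ => hq) s
    have h1 := hΦ O
    rw [hGH, ← mul_assoc, mul_assoc (diagOp (G b)), hcomm, ← mul_assoc] at h1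
    exact diagOp_mul_right_cancel hH0 h1

/-- Conjugation by a diagonal operator of local phases is a finite-depth circuit. -/
theorem IsLocalPhase.isFDQC {R : ℕ} {θ : Config L l → ℂ} (h : IsLocalPhase R θ)
    {Φ : Alg L l ≃ₐ[ℂ] Alg L l} (hΦ : IsDiagConj θ Φ) :
    IsFDQC (ballCard d (2 * R) + 1) (2 * R) Φ := by
  obtain ⟨c, hcN, hc⟩ := exists_coloring (Near (L := L) (l := l) (2 * R))
    (fun _ _ h => h.symm) (ballCard d (2 * R)) (exists_ball _)
  have hex : ∀ k, ∃ Ψ : Alg L l ≃ₐ[ℂ] Alg L l,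
      IsDiagConj (fun s => θ (restr (fun q => c q < k + 1) s) *
        (θ (restr (fun q => c q < k) s))⁻¹) Ψ :=
    fun k => exists_diagConj ((h.filter _).mul (h.filter _).inv)
  choose Ψ hΨ using hex
  -- The product of the layers telescopes; the constant `θ 0` does not affect the conjugation.
  have hprod : ∀ n, IsDiagConj (fun s => θ (restr (fun q => c q < n) s) * (θ 0)⁻¹)
      ((List.range n).map Ψ).prod := by
    intro n
    induction n with
    | zero =>
      intro O
      have h0 : ∀ s : Config L l, restr (fun q => c q < 0) s = 0 := fun s => by
        ext q; simp [restr_apply]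
      simp only [h0, mul_inv_cancel₀ (h.ne_zero 0), diagOp_one, List.range_zero, List.map_nil,
        List.prod_nil, mul_one, one_mul, AlgEquiv.one_apply]
    | succ n ih =>
      rw [List.range_succ, List.map_append, List.prod_append, List.map_singleton,
        List.prod_singleton]
      have h1 := ih.mul (hΨ n)
      convert h1 using 2 with s
      have := h.ne_zero (restr (fun q => c q < n) s)
      field_simp
  refine ⟨(List.range (ballCard d (2 * R) + 1)).map Ψ, by simp, fun Υ hΥ => ?_, ?_⟩
  · obtain ⟨k, _, rfl⟩ := List.mem_map.1 hΥ
    exact h.isLayer hc k (hΨ k)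
  · have h1 := hprod (ballCard d (2 * R) + 1)
    have h2 : ∀ s : Config L l, restr (fun q => c q < ballCard d (2 * R) + 1) s = s := fun s => by
      ext q
      exact (restr_apply _ _ _).trans (if_pos (hcN q))
    simp only [h2] at h1
    refine h1.unique (fun s => mul_ne_zero (h.ne_zero _) (inv_ne_zero (h.ne_zero _))) ?_
    have := hΦ.const_mul (θ 0)⁻¹
    simpa only [mul_comm] using this

end DiagonalCircuit

/-! ### Composition of circuits and automorphisms that preserve the Pauli `Z` operators -/

section Circuits

variable {d : ℕ} {L : Fin d → ℕ} {l : ℕ}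

theorem IsLayer.mono {gates gates' : Set (Op L l)} {r r' : ℕ} {Φ : Alg L l ≃ₐ[ℂ] Alg L l}
    (h : IsLayer gates r Φ) (hg : gates ⊆ gates') (hr : r ≤ r') : IsLayer gates' r' Φ := by
  obtain ⟨blk, g, h1, h2, h3⟩ := h
  exact ⟨blk, g, fun q q' hq => (h1 q q' hq).mono hr, fun b => ⟨hg (h2 b).1, (h2 b).2⟩, h3⟩

theorem IsCircuit.mono {gates gates' : Set (Op L l)} {D D' r r' : ℕ} {Φ : Alg L l ≃ₐ[ℂ] Alg L l}
    (h : IsCircuit gates D r Φ) (hg : gates ⊆ gates') (hD : D ≤ D') (hr : r ≤ r') :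
    IsCircuit gates' D' r' Φ := by
  obtain ⟨layers, h1, h2, h3⟩ := h
  exact ⟨layers, h1.trans hD, fun Ψ hΨ => (h2 Ψ hΨ).mono hg hr, h3⟩

theorem IsCircuit.mul {gates : Set (Op L l)} {D D' r : ℕ} {Φ Φ' : Alg L l ≃ₐ[ℂ] Alg L l}
    (h : IsCircuit gates D r Φ) (h' : IsCircuit gates D' r Φ') :
    IsCircuit gates (D + D') r (Φ * Φ') := by
  obtain ⟨layers, h1, h2, h3⟩ := h
  obtain ⟨layers', h1', h2', h3'⟩ := h'
  refine ⟨layers ++ layers', by rw [List.length_append]; omega, fun Ψ hΨ => ?_, by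
    rw [List.prod_append, h3, h3']⟩
  exact (List.mem_append.1 hΨ).elim (h2 Ψ) (h2' Ψ)

/-- An operator that commutes with all Pauli `Z` operators is diagonal. -/
theorem eq_diagOp_of_comm {T : Op L l}
    (h : ∀ q : Qubit L l, T * zOp (Pi.single q 1) = zOp (Pi.single q 1) * T) :
    T = diagOp fun s => T (ket s) s := op_ext fun s => by
  rw [diagOp_ket]
  ext t
  by_cases hst : s = t
  · subst hst; simp [ket]
  · obtain ⟨q, hq⟩ : ∃ q, s q ≠ t q := by
      by_contra! h'
      exact hst (Finsupp.ext h')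
    have h1 := DFunLike.congr_fun (LinearMap.congr_fun (h q) (ket s)) t
    have h2 : ∀ ψ : Hilb L l, zOp (Pi.single q 1) ψ t = sgn (t q) * ψ t := by
      intro ψ
      induction ψ using ket_smul_induction with
      | h0 => simp
      | hadd ψ ψ' h h' => rw [map_add, Finsupp.add_apply, h, h', Finsupp.add_apply, mul_add]
      | hs c u =>
        rw [map_smul, zOp_ket, dot_piSingle]
        by_cases hut : u = t
        · subst hut; simp [ket, mul_comm]
        · simp [ket, hut]
    rw [Module.End.mul_apply, Module.End.mul_apply, zOp_ket, h2, map_smul, Finsupp.smul_apply,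
      dot_piSingle, smul_eq_mul] at h1
    have h3 : T (ket s) t = 0 := by
      have h4 : sgn (s q) - sgn (t q) ≠ 0 := sub_ne_zero.2 fun h5 => hq (sgn_injective h5)
      have h5 : (sgn (s q) - sgn (t q)) * T (ket s) t = 0 := by linear_combination h1
      exact (mul_eq_zero.1 h5).resolve_left h4
    rw [h3]
    simp [ket, hst]

theorem zGen_mul_xGen (p q : Qubit L l) :
    zGen p * xGen q = sgn ((Finsupp.single q 1 : Config L l) p) • (xGen q * zGen p) :=
  Subtype.ext (by
    have := zOp_mul_xOp (Pi.single p 1 : Qubit L l → ZMod 2) (Finsupp.single q 1)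
    rw [dot_piSingle] at this
    exact this)

theorem xGen_mul_self (q : Qubit L l) : xGen q * xGen q = 1 :=
  Subtype.ext (by
    change xOp _ * xOp _ = 1
    rw [← xOp_add, config_add_self, xOp_zero])

theorem zGen_mul_self (q : Qubit L l) : zGen q * zGen q = 1 :=
  Subtype.ext (by
    change zOp _ * zOp _ = 1
    rw [zOp_single, ← zOp_add, ← Finsupp.coe_add, config_add_self, Finsupp.coe_zero, zOp_zero])

/-- A local `*`-automorphism that fixes all Pauli `Z` operators is conjugation by a diagonal
operator of local phases. -/
theorem exists_localPhase_of_fix_z {R : ℕ} {γ : Alg L l ≃ₐ[ℂ] Alg L l}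
    (hz : ∀ q, γ (zGen q) = zGen q) (hadj : ∀ q, IsAdjoint (γ (xGen q) : Op L l) (γ (xGen q)))
    (hx : ∀ q, (γ (xGen q) : Op L l) ∈ localAlg L l {q' | Near R q q'}) :
    ∃ θ : Config L l → ℂ, IsLocalPhase R θ ∧ IsDiagConj θ γ := by
  -- `γ (X_q)` and `X_q` have the same commutation signs with all `Z`, so their product commutes
  -- with every `Z` and is diagonal.
  have hdiag : ∀ q, ∃ F : Config L l → ℂ, (γ (xGen q) : Op L l) * xOp (Finsupp.single q 1) =
      diagOp F := fun q => by
    refine ⟨_, eq_diagOp_of_comm fun p => ?_⟩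
    have h1 := congrArg γ (zGen_mul_xGen p q)
    rw [map_mul, map_smul, map_mul, hz] at h1
    have h2 := zGen_mul_xGen p q
    have h3 : γ (xGen q) * xGen q * zGen p = zGen p * (γ (xGen q) * xGen q) := by
      rw [← mul_assoc, h1, smul_mul_assoc, mul_assoc _ (zGen p), h2, mul_smul_comm, smul_smul,
        sgn_mul_self, one_smul, mul_assoc]
    exact congrArg Subtype.val h3
  choose F hF using hdiag
  have hγ : ∀ q, (γ (xGen q) : Op L l) = diagOp (F q) * xOp (Finsupp.single q 1) := fun q => by
    rw [← hF, mul_assoc, ← xOp_add, config_add_self, xOp_zero, mul_one]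
  have hFloc : ∀ q, IsLocalFun {q' | Near R q q'} (F q) := fun q => by
    refine isLocalFun_of_mem ?_
    rw [← hF]
    refine mul_mem (hx q) (Algebra.subset_adjoin ⟨q, Near.refl _ _, Or.inl rfl⟩)
  have hket : ∀ q s, (γ (xGen q) : Op L l) (ket s) =
      F q (s + Finsupp.single q 1) • ket (s + Finsupp.single q 1) := fun q s => by
    rw [hγ, Module.End.mul_apply, xOp_ket, diagOp_ket]
  have hcancel : ∀ (s : Config L l) q, s + Finsupp.single q 1 + Finsupp.single q 1 = s :=
    fun s q => by rw [add_assoc, config_add_self, add_zero]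
  -- Since `γ (X_q)` squares to one, the values of `F q` at `s` and at the flipped configuration are
  -- inverse to each other; since it is self-adjoint, they are complex conjugate.
  have hFnorm : ∀ q s, ‖F q s‖ = 1 := fun q s => by
    have h1 : F q (s + Finsupp.single q 1) * F q s = 1 := by
      have h2 : (γ (xGen q) : Op L l) ((γ (xGen q) : Op L l) (ket s)) = ket s := by
        rw [← Module.End.mul_apply, ← MulMemClass.coe_mul, ← map_mul, xGen_mul_self, map_one]
        rfl
      rw [hket, map_smul, hket, hcancel, smul_smul] at h2
      have h3 := DFunLike.congr_fun h2 s
      simpa [ket] using h3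
    have h2 := (isAdjoint_iff.1 (hadj q)) (s + Finsupp.single q 1) s
    rw [hket, hket, hcancel] at h2
    simp only [ket, Finsupp.smul_apply, Finsupp.single_eq_same, smul_eq_mul, mul_one] at h2
    rw [← h2, mul_comm, Complex.mul_conj, Complex.normSq_eq_norm_sq] at h1
    have h4 : ‖F q s‖ ^ 2 = 1 := by exact_mod_cast h1
    exact (pow_eq_one_iff_of_nonneg (norm_nonneg _) two_ne_zero).1 h4
  -- Conjugation by a phase with `θ 0 = 1` maps `X^s` to an operator that sends `|0⟩` to `θ s |s⟩`;
  -- this dictates the choice of `θ`.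
  let θ : Config L l → ℂ := fun s => (γ (pauAlg (s, 0)) : Op L l) (ket 0) s
  have hγs : ∀ s, (γ (pauAlg (s, 0)) : Op L l) (ket 0) = θ s • ket s ∧ ‖θ s‖ = 1 := by
    intro s
    induction s using config_induction with
    | h0 =>
      have h1 : θ 0 = 1 := by
        simp only [θ, ← Prod.zero_eq_mk, pauAlg_zero, map_one, OneMemClass.coe_one,
          Module.End.one_apply, ket, Finsupp.single_eq_same]
      rw [h1, ← Prod.zero_eq_mk, pauAlg_zero, map_one, one_smul, norm_one]
      exact ⟨rfl, rfl⟩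
    | hadd s q ih =>
      have h2 : pauAlg (Finsupp.single q 1 + s, 0) = xGen q * pauAlg (s, 0) := by
        rw [xGen_eq, pauAlg_mul, Finsupp.coe_zero, dot_zero, sgn_zero, one_smul, Prod.mk_add_mk,
          add_zero]
      have h3 : (γ (pauAlg (Finsupp.single q 1 + s, 0)) : Op L l) (ket 0) =
          (θ s * F q (s + Finsupp.single q 1)) • ket (Finsupp.single q 1 + s) := by
        rw [h2, map_mul, MulMemClass.coe_mul, Module.End.mul_apply, ih.1, map_smul, hket,
          smul_smul, add_comm s]
      have h4 : θ (Finsupp.single q 1 + s) = θ s * F q (s + Finsupp.single q 1) := by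
        simp only [θ] at h3 ⊢
        rw [h3]
        simp [ket]
      rw [h4, norm_mul, ih.2, hFnorm, one_mul]
      exact ⟨h3, rfl⟩
  have hθ : ∀ s q, θ (s + Finsupp.single q 1) = θ s * F q (s + Finsupp.single q 1) := by
    intro s q
    have h2 : pauAlg (s + Finsupp.single q 1, 0) = xGen q * pauAlg (s, 0) := by
      rw [xGen_eq, pauAlg_mul, Finsupp.coe_zero, dot_zero, sgn_zero, one_smul, Prod.mk_add_mk,
        add_zero, add_comm]
    have h3 := (hγs (s + Finsupp.single q 1)).1
    rw [h2, map_mul, MulMemClass.coe_mul, Module.End.mul_apply, (hγs s).1, map_smul, hket,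
      smul_smul] at h3
    have h4 := DFunLike.congr_fun h3 (s + Finsupp.single q 1)
    simpa [ket] using h4.symm
  have hθ0 : ∀ s, θ s ≠ 0 := ne_zero_of_norm_one fun s => (hγs s).2
  refine ⟨θ, ⟨fun s => (hγs s).2, fun q => ?_⟩, isDiagConj_of_gens hz fun q => ?_⟩
  · have h1 : (fun s => θ (s + Finsupp.single q 1) / θ s) =
        fun s => F q (s + Finsupp.single q 1) := funext fun s => by
      rw [hθ, mul_div_cancel_left₀ _ (hθ0 s)]
    rw [h1]
    intro s p hp
    beta_reduce
    rw [add_right_comm, hFloc q _ p hp]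
  · rw [hγ]
    refine op_ext fun s => ?_
    change (diagOp (F q) * xOp _ * diagOp θ : Op L l) (ket s) =
      (diagOp θ * xOp (Finsupp.single q 1) : Op L l) (ket s)
    simp only [Module.End.mul_apply, diagOp_ket, map_smul, xOp_ket, smul_smul, hθ]

/-- The automorphism that changes the signs of some of the Pauli `Z` operators is a layer of
`X` gates. -/
theorem exists_sign_layer (a : Qubit L l → ZMod 2) : ∃ σ : Alg L l ≃ₐ[ℂ] Alg L l,
    (∀ q, σ (zGen q) = sgn (a q) • zGen q) ∧ (∀ q, σ (xGen q) = xGen q) ∧ σ * σ = 1 ∧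
      IsLayer Set.univ 0 σ := by
  obtain ⟨Φ, hΦ⟩ := exists_algHom (L := L) (l := l) (𝒜 := Alg L l) xGen
    (fun q => sgn (a q) • zGen q)
    (fun i j => Subtype.ext (by
      change xOp _ * xOp _ = xOp _ * xOp _
      rw [← xOp_add, ← xOp_add, add_comm])) xGen_mul_self
    (fun i j => by
      have : zGen i * zGen j = zGen j * zGen i := Subtype.ext (by
        change zOp _ * zOp _ = zOp _ * zOp _
        rw [← zOp_add, ← zOp_add, add_comm])
      simp only [smul_mul_assoc, mul_smul_comm, this]
      rw [smul_comm])
    (fun i => by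
      simp only [smul_mul_assoc, mul_smul_comm, zGen_mul_self, smul_smul, sgn_mul_self, one_smul])
    (fun i j => by
      rw [smul_mul_assoc, mul_smul_comm, zGen_mul_xGen, smul_comm, Finsupp.single_apply]
      congr 1
      by_cases h : i = j
      · rw [if_pos h, if_pos h.symm, sgn_one]
      · rw [if_neg h, if_neg (Ne.symm h), sgn_zero])
  have h2 : Φ.comp Φ = AlgHom.id ℂ _ := algHom_ext
    (fun q => by simp only [AlgHom.comp_apply, (hΦ q).1, AlgHom.id_apply])
    (fun q => by
      simp only [AlgHom.comp_apply, (hΦ q).2, AlgHom.id_apply, map_smul, smul_smul, sgn_mul_self,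
        one_smul])
  refine ⟨AlgEquiv.ofAlgHom Φ Φ h2 h2, fun q => (hΦ q).2, fun q => (hΦ q).1,
    AlgEquiv.ext fun O => AlgHom.congr_fun h2 O, id,
    fun b => xOp (a b • Finsupp.single b 1), ?_, fun b => ⟨trivial, ?_, ?_⟩, fun b O hO => ?_⟩
  · rintro q q' rfl
    exact Near.refl _ _
  · have := isAdjoint_xOp (a b • Finsupp.single b 1 : Config L l)
    refine ⟨_, this, ?_, ?_⟩ <;> rw [← xOp_add, config_add_self, xOp_zero]
  · refine xOp_mem_localAlg fun q hq => ?_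
    by_contra h
    have : b ≠ q := fun h' => h h'.symm
    exact hq (by simp [this])
  · obtain ⟨O, hO'⟩ := O
    change O ∈ localAlg L l _ at hO
    change ((Φ _ : Alg L l) : Op L l) * _ = _ * O
    induction hO using Algebra.adjoin_induction with
    | mem O hq =>
      obtain ⟨q, hq, rfl | rfl⟩ := hq
      · have := (hΦ q).1
        unfold xGen at this
        rw [this, ← xOp_add, ← xOp_add, add_comm]
      · have := (hΦ q).2
        unfold zGen at this
        rw [this]
        change (sgn (a q) • zOp _) * _ = _
        obtain rfl : q = b := hq
        rw [smul_mul_assoc, zOp_mul_xOp, smul_smul, map_smul, dot_single, Pi.single_eq_same,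
          smul_eq_mul, mul_one, sgn_mul_self, one_smul]
    | algebraMap c =>
      have : (⟨algebraMap ℂ _ c, hO'⟩ : Alg L l) = algebraMap ℂ _ c := rfl
      rw [this, AlgHom.commutes]
      exact Algebra.commutes c (xOp _)
    | add O P h1 h2 ih ih' =>
      have h1 := localAlg_mono (Set.subset_univ _) h1
      have h2 := localAlg_mono (Set.subset_univ _) h2
      have : (⟨O + P, hO'⟩ : Alg L l) = ⟨O, h1⟩ + ⟨P, h2⟩ := rfl
      rw [this, map_add, AddMemClass.coe_add, add_mul, mul_add, ih h1, ih' h2]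
    | mul O P h1 h2 ih ih' =>
      have h1 := localAlg_mono (Set.subset_univ _) h1
      have h2 := localAlg_mono (Set.subset_univ _) h2
      have : (⟨O * P, hO'⟩ : Alg L l) = ⟨O, h1⟩ * ⟨P, h2⟩ := rfl
      rw [this, map_mul, MulMemClass.coe_mul, mul_assoc, ih' h2, ← mul_assoc, ih h1, mul_assoc]

end Circuits

/-! ### Layers of controlled-`Z` gates -/

section ControlledZ

variable {d : ℕ} {L : Fin d → ℕ} {l : ℕ}

theorem intertwine_of_gens {Φ : Alg L l ≃ₐ[ℂ] Alg L l} {S : Set (Qubit L l)} {g : Op L l}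
    (hx : ∀ q ∈ S, (Φ (xGen q) : Op L l) * g = g * xGen q)
    (hz : ∀ q ∈ S, (Φ (zGen q) : Op L l) * g = g * zGen q) (O : Alg L l)
    (hO : (O : Op L l) ∈ localAlg L l S) : (Φ O : Op L l) * g = g * O := by
  obtain ⟨O, hO'⟩ := O
  change O ∈ localAlg L l _ at hO
  change ((Φ _ : Alg L l) : Op L l) * _ = _ * O
  induction hO using Algebra.adjoin_induction with
  | mem O hq =>
    obtain ⟨q, hq, rfl | rfl⟩ := hq
    · exact hx q hq
    · exact hz q hq
  | algebraMap c =>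
    have : (⟨algebraMap ℂ _ c, hO'⟩ : Alg L l) = algebraMap ℂ _ c := rfl
    rw [this, AlgEquiv.commutes]
    exact Algebra.commutes c g
  | add O P h1 h2 ih ih' =>
    have h1 := localAlg_mono (Set.subset_univ _) h1
    have h2 := localAlg_mono (Set.subset_univ _) h2
    have : (⟨O + P, hO'⟩ : Alg L l) = ⟨O, h1⟩ + ⟨P, h2⟩ := rfl
    rw [this, map_add, AddMemClass.coe_add, add_mul, mul_add, ih h1, ih' h2]
  | mul O P h1 h2 ih ih' =>
    have h1 := localAlg_mono (Set.subset_univ _) h1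
    have h2 := localAlg_mono (Set.subset_univ _) h2
    have : (⟨O * P, hO'⟩ : Alg L l) = ⟨O, h1⟩ * ⟨P, h2⟩ := rfl
    rw [this, map_mul, MulMemClass.coe_mul, mul_assoc, ih' h2, ← mul_assoc, ih h1, mul_assoc]

theorem Species.other_other (t : Species) : t.other.other = t := by cases t <;> rfl

theorem Species.other_ne (t : Species) : t.other ≠ t := by cases t <;> exact nofun

theorem linComb_dot (n n' : Qubit L l → Config L l) (h : ∀ q p, n q p = n' p q) (a b : Config L l) :
    dot (Finsupp.linearCombination (ZMod 2) n a : Config L l) b =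
      dot a (Finsupp.linearCombination (ZMod 2) n' b : Config L l) := by
  induction a using config_induction with
  | h0 => rw [map_zero, Finsupp.coe_zero, dot_zero, dot_zero]
  | hadd a q ih =>
    rw [map_add, Finsupp.coe_add, Finsupp.coe_add, dot_add, dot_add, ih, single_dot,
      Finsupp.linearCombination_single, one_smul]
    congr 1
    clear ih
    induction b using config_induction with
    | h0 => rw [map_zero, map_zero]; rfl
    | hadd b p ih =>
      rw [map_add, map_add, Finsupp.add_apply, ih, dot_single, Finsupp.linearCombination_single,
        one_smul, h]

/-- The exponents `q ↦ μ q` of an involution `μ` of the qubits, where fixed points are dropped. -/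
def mateMap (μ : Qubit L l → Qubit L l) : Config L l →+ Config L l :=
  (Finsupp.linearCombination (ZMod 2) fun q =>
    if μ q = q then (0 : Config L l) else Finsupp.single (μ q) 1).toAddMonoidHom

theorem mateMap_single (μ : Qubit L l → Qubit L l) (q : Qubit L l) :
    mateMap μ (Finsupp.single q 1) = if μ q = q then 0 else Finsupp.single (μ q) 1 := by
  change Finsupp.linearCombination (ZMod 2) _ _ = _
  rw [Finsupp.linearCombination_single, one_smul]

theorem mateMap_adj {μ : Qubit L l → Qubit L l} (hμ : ∀ q, μ (μ q) = q) (a b : Config L l) :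
    dot (mateMap μ a) b = dot a (mateMap μ b) := by
  refine linComb_dot _ _ (fun q p => ?_) a b
  have h1 : μ q = p ↔ μ p = q := ⟨fun h => h ▸ hμ q, fun h => h ▸ hμ p⟩
  by_cases h : μ q = p
  · have h' := h1.1 h
    by_cases hqp : p = q
    · subst hqp; rfl
    · rw [if_neg (by rw [h]; exact hqp), if_neg (by rw [h']; exact fun h => hqp h.symm), h, h']
      simp
  · have h' := fun h' => h (h1.2 h')
    have h'' : μ p ≠ q := h'
    split_ifs <;> simp [h, h'']

/-- The data of a product of disjoint controlled-`Z` gates. -/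
def mateData (μ : Qubit L l → Qubit L l) (hμ : ∀ q, μ (μ q) = q) : CliffordData L l where
  N := mateMap μ
  κ := 0
  κ' := 0
  N_adj := mateMap_adj hμ
  κ_adj a b := by
    rw [AddMonoidHom.zero_apply, AddMonoidHom.zero_apply, map_zero, Finsupp.coe_zero, dot_zero]
  symm a b := by simp only [AddMonoidHom.zero_apply, Finsupp.coe_zero, dot_zero]
  alt a := by simp only [AddMonoidHom.zero_apply, Finsupp.coe_zero, dot_zero]
  N_single q := by
    rw [mateMap_single]
    by_cases h : μ q = q
    · rw [if_pos h]; rfl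
    · rw [if_neg h, Finsupp.single_apply, if_neg h]
  N_κ q := by simp only [AddMonoidHom.zero_apply, map_zero]

/-- The controlled-`Z` gate in the `X` basis. -/
def czGate (q q' : Qubit L l) : Op L l :=
  (1 / 2 : ℂ) • (1 + (xGen q : Op L l) + xGen q' - xGen q * xGen q')

theorem xOp_comm (w w' : Config L l) : xOp w * xOp w' = xOp w' * xOp w := by
  rw [← xOp_add, add_comm, xOp_add]

theorem czGate_eq (q q' : Qubit L l) : czGate q q' = (1 / 2 : ℂ) • (1 + xOp (Finsupp.single q 1) +
    xOp (Finsupp.single q' 1) + (-1 : ℂ) • (xOp (Finsupp.single q 1) *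
      xOp (Finsupp.single q' 1))) := op_ext fun s => by
  rw [czGate, LinearMap.smul_apply, LinearMap.smul_apply, LinearMap.sub_apply, sub_eq_add_neg,
    LinearMap.add_apply _ ((-1 : ℂ) • _) (ket s), LinearMap.smul_apply (-1 : ℂ), neg_one_smul]
  rfl

theorem czGate_comm (q q' : Qubit L l) : czGate q q' = czGate q' q := by
  rw [czGate_eq, czGate_eq, xOp_comm (Finsupp.single q 1),
    add_right_comm 1 (xOp (Finsupp.single q 1))]

theorem czGate_xGen (q q' p : Qubit L l) :
    (xGen p : Op L l) * czGate q q' = czGate q q' * xGen p := by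
  have h : ∀ w : Config L l, Commute (xGen p : Op L l) (xOp w) := fun w => xOp_comm _ _
  rw [czGate_eq]
  exact ((((Commute.one_right _).add_right (h _)).add_right (h _)).add_right
    (((h _).mul_right (h _)).smul_right _)).smul_right _

/-- Multiplication by `y` permutes the terms of `1 + x + y - x y` up to signs, and moving `z` past
`x` and `x y` restores these signs. -/
theorem mul_cz_eq {𝒜 : Type*} [Semiring 𝒜] [Algebra ℂ 𝒜] {x y z : 𝒜}
    (hzx : z * x = (-1 : ℂ) • (x * z)) (hzy : z * y = y * z)
    (hxy : x * y = y * x) (hy : y * y = 1) :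
    z * y * (1 + x + y + (-1 : ℂ) • (x * y)) = (1 + x + y + (-1 : ℂ) • (x * y)) * z := by
  have e1 : z * y * x = (-1 : ℂ) • (x * y * z) := by
    rw [mul_assoc, ← hxy, ← mul_assoc, hzx, smul_mul_assoc, mul_assoc, hzy, ← mul_assoc]
  have e2 : z * y * y = z := by rw [mul_assoc, hy, mul_one]
  have e3 : z * y * (x * y) = (-1 : ℂ) • (x * z) := by
    rw [← mul_assoc, e1, smul_mul_assoc, mul_assoc, hzy, mul_assoc, ← mul_assoc y, hy, one_mul]
  rw [mul_add, mul_add, mul_add, mul_one, mul_smul_comm, e1, e2, e3, hzy, add_mul, add_mul,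
    add_mul, one_mul, smul_mul_assoc]
  module

theorem cz_mul_self {𝒜 : Type*} [Semiring 𝒜] [Algebra ℂ 𝒜] {x y : 𝒜} (hxy : x * y = y * x)
    (hx : x * x = 1) (hy : y * y = 1) :
    (1 + x + y + (-1 : ℂ) • (x * y)) * (1 + x + y + (-1 : ℂ) • (x * y)) = (4 : ℂ) • (1 : 𝒜) := by
  have e1 : x * (x * y) = y := by rw [← mul_assoc, hx, one_mul]
  have e2 : y * (x * y) = x := by rw [hxy, ← mul_assoc, hy, one_mul]
  have e3 : x * y * x = y := by rw [hxy, mul_assoc, hx, mul_one]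
  have e4 : x * y * y = x := by rw [mul_assoc, hy, mul_one]
  have e5 : x * y * (x * y) = 1 := by rw [mul_assoc, e2, hx]
  simp only [mul_add, add_mul, one_mul, mul_one, smul_mul_assoc, mul_smul_comm, hx, hy, e1, e2,
    e3, e4, e5, ← hxy]
  module

theorem czGate_zGen {q q' : Qubit L l} (hq : q ≠ q') :
    (zGen q * xGen q' : Op L l) * czGate q q' = czGate q q' * zGen q := by
  have h1 := zOp_mul_xOp (Pi.single q 1 : Qubit L l → ZMod 2) (Finsupp.single q 1)
  have h2 := zOp_mul_xOp (Pi.single q 1 : Qubit L l → ZMod 2) (Finsupp.single q' 1)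
  have h3 := congrArg Subtype.val (xGen_mul_self q')
  rw [dot_piSingle, Finsupp.single_eq_same, sgn_one] at h1
  rw [dot_piSingle, Finsupp.single_apply, if_neg hq.symm, sgn_zero, one_smul] at h2
  rw [czGate_eq, mul_smul_comm, smul_mul_assoc]
  congr 1
  exact mul_cz_eq h1 h2 (xOp_comm _ _) h3

theorem isUnitaryOp_czGate (q q' : Qubit L l) : IsUnitaryOp (czGate q q') := by
  have h1 := isAdjoint_xOp (Finsupp.single q 1 : Config L l)
  have h2 := isAdjoint_xOp (Finsupp.single q' 1 : Config L l)
  have h4 : IsAdjoint (czGate q q') (czGate q q') := by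
    have h5 := ((((isAdjoint_one.add h1).add h2).add ((h1.mul h2).smul (-1))).smul (1 / 2 : ℂ))
    rw [xOp_comm (Finsupp.single q' 1), ← czGate_eq] at h5
    convert h5 using 1
    rw [czGate_eq, show (starRingEnd ℂ) (1 / 2) = 1 / 2 by
      rw [map_div₀, map_one, map_ofNat], map_neg, map_one]
  have h5 : czGate q q' * czGate q q' = 1 := by
    have h6 := cz_mul_self (xOp_comm (Finsupp.single q 1) (Finsupp.single q' 1))
      (congrArg Subtype.val (xGen_mul_self q)) (congrArg Subtype.val (xGen_mul_self q'))
    rw [czGate_eq, smul_mul_assoc, mul_smul_comm, h6, smul_smul, smul_smul]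
    norm_num
  exact ⟨_, h4, h5, h5⟩

theorem czGate_mem_localAlg {S : Set (Qubit L l)} {q q' : Qubit L l} (hq : q ∈ S) (hq' : q' ∈ S) :
    czGate q q' ∈ localAlg L l S := by
  have h : ∀ q ∈ S, (xGen q : Op L l) ∈ localAlg L l S := fun q hq =>
    Algebra.subset_adjoin ⟨q, hq, Or.inl rfl⟩
  rw [czGate_eq]
  exact Subalgebra.smul_mem _ (add_mem (add_mem (add_mem (one_mem _) (h q hq))
    (h q' hq')) (Subalgebra.smul_mem _ (mul_mem (h q hq) (h q' hq')) _)) _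

/-- Disjoint controlled-`Z` gates make up a layer of a circuit. -/
theorem exists_mate_layer (μ : Qubit L l → Qubit L l) (hμ : ∀ q, μ (μ q) = q)
    (hs : ∀ q, μ q ≠ q → (μ q).1 = q.1.other) {r : ℕ} (hr : ∀ q, Near r q (μ q))
    (hg : ∀ q, μ q ≠ q → q.1 = .A → czGate q (μ q) ∈ czGates L l) :
    ∃ Φ : Alg L l ≃ₐ[ℂ] Alg L l, (∀ q, Φ (xGen q) = xGen q) ∧
      (∀ q, Φ (zGen q) = zGen q * pauAlg (mateMap μ (Finsupp.single q 1), 0)) ∧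
      IsLayer (czGates L l) r Φ := by
  obtain ⟨Φ, hz, hx, -, -⟩ := (mateData μ hμ).exists_equiv
  have hx' : ∀ q, Φ (xGen q) = xGen q := fun q => by
    rw [hx]
    simp only [mateData, AddMonoidHom.zero_apply, ← Prod.zero_eq_mk, pauAlg_zero, map_one, mul_one]
  have hz' : ∀ q, Φ (zGen q) = zGen q * pauAlg (mateMap μ (Finsupp.single q 1), 0) := hz
  have hz1 : ∀ q, μ q = q → Φ (zGen q) = zGen q := fun q hq => by
    rw [hz', mateMap_single, if_pos hq, ← Prod.zero_eq_mk, pauAlg_zero, mul_one]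
  have hz2 : ∀ q, μ q ≠ q → Φ (zGen q) = zGen q * xGen (μ q) := fun q hq => by
    rw [hz', mateMap_single, if_neg hq, xGen_eq]
  -- A pair of partners is labelled by its `A` member, where its gate sits; a qubit without partner
  -- is its own label.
  let blk : Qubit L l → Qubit L l := fun q => if q.1 = .A then q else μ q
  have hblkA : ∀ q, q.1 = .A → blk q = q := fun q h => if_pos h
  have hblkB : ∀ q, q.1 ≠ .A → blk q = μ q := fun q h => if_neg h
  have hblkμ : ∀ q, blk q = q ∨ blk q = μ q := fun q => by
    by_cases h : q.1 = .A
    · exact Or.inl (hblkA q h)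
    · exact Or.inr (hblkB q h)
  have hmate : ∀ q, blk (μ q) = blk q := fun q => by
    by_cases h : μ q = q
    · rw [h]
    · have h1 := hs q h
      by_cases h2 : q.1 = .A
      · rw [hblkA q h2, hblkB _ (by rw [h1, h2]; exact nofun), hμ]
      · have h3 : (μ q).1 = .A := by
          rw [h1]
          cases hq : q.1
          · exact absurd hq h2
          · rfl
        rw [hblkB q h2, hblkA _ h3]
  have hfib : ∀ q b, blk q = b → q = b ∨ q = μ b := fun q b h => by
    rcases hblkμ q with h1 | h1
    · exact Or.inl (h1.symm.trans h)
    · exact Or.inr (by rw [← h, h1, hμ])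
  let g : Qubit L l → Op L l := fun b => if b.1 = .A ∧ μ b ≠ b then czGate b (μ b) else 1
  have hg1 : ∀ b, b.1 = .A ∧ μ b ≠ b → g b = czGate b (μ b) := fun b h => if_pos h
  have hg2 : ∀ b, ¬ (b.1 = .A ∧ μ b ≠ b) → g b = 1 := fun b h => if_neg h
  refine ⟨Φ, hx', hz', blk, g, ?_, ?_, ?_⟩
  · intro q q' h
    have h' := hfib q' _ h.symm
    rcases hblkμ q with h1 | h1 <;> rw [h1] at h'
    · rcases h' with rfl | rfl
      · exact Near.refl _ _
      · exact hr q
    · rw [hμ] at h'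
      rcases h' with rfl | rfl
      · exact hr q
      · exact Near.refl _ _
  · intro b
    by_cases h : b.1 = .A ∧ μ b ≠ b
    · rw [hg1 b h]
      refine ⟨hg b h.2 h.1, isUnitaryOp_czGate _ _, czGate_mem_localAlg (hblkA b h.1) ?_⟩
      exact (hmate b).trans (hblkA b h.1)
    · rw [hg2 b h]
      exact ⟨Or.inl rfl, ⟨1, isAdjoint_one, mul_one _, mul_one _⟩, one_mem _⟩
  · intro b
    by_cases h : b.1 = .A ∧ μ b ≠ b
    · rw [hg1 b h]
      refine intertwine_of_gens (fun q _ => by rw [hx']; exact czGate_xGen _ _ _) fun q hq => ?_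
      rcases hfib q b hq with rfl | rfl
      · rw [hz2 _ h.2]
        exact czGate_zGen h.2.symm
      · rw [hz2 _ (by rw [hμ]; exact h.2.symm), hμ, czGate_comm]
        exact czGate_zGen h.2
    · rw [hg2 b h]
      refine intertwine_of_gens (fun q _ => by rw [hx', mul_one, one_mul]) fun q hq => ?_
      have hbq : μ b = b := by
        by_contra h1
        have hA : b.1 ≠ .A := fun hA => h ⟨hA, h1⟩
        have h2 : blk b = μ b := hblkB b hA
        rcases hfib q b hq with rfl | rfl
        · exact h1 (h2.symm.trans hq)
        · exact h1 (h2.symm.trans ((hmate b).symm.trans hq))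
      have hq' : q = b := by
        rcases hfib q b hq with h1 | h1
        · exact h1
        · exact h1.trans hbq
      rw [hq', hz1 b hbq, mul_one, one_mul]

end ControlledZ

/-! ### The decorations as a sum of pairings, and the circuit for `β` -/

section Mates

variable {d : ℕ} {L : Fin d → ℕ} {l : ℕ}

theorem card_insert_compl (hd : d + 1 = 2 * l) {S : Finset (Fin d)} (hS : S.card = l) {j : Fin d}
    (hj : j ∈ S) : (insert j Sᶜ).card = l := by
  rw [Finset.card_insert_of_notMem (by simpa using hj), Finset.card_compl, Fintype.card_fin]
  omega

/-- The position of the partner of a qubit of a given species. -/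
def matePos (t : Species) (x : Pos L) (S T : Finset (Fin d)) (j : Fin d) : Pos L :=
  match t with
  | .A => x + shift L S - shift L T
  | .B => x + shift L T - shift L (insert j Sᶜ)

/-- The pairing of the `A` qubits with the `B` qubits such that the cells of two partners span all
directions and share the direction `j`. -/
def mate (hd : d + 1 = 2 * l) (j : Fin d) (T : Finset (Fin d)) (q : Qubit L l) : Qubit L l :=
  if h : L j ≠ 1 ∧ j ∈ q.2.1.2 then
    (q.1.other, ⟨(matePos q.1 q.2.1.1 q.2.1.2 T j, insert j q.2.1.2ᶜ),
      card_insert_compl hd q.2.2 h.2⟩)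
  else q

/-- Passing from `S` to `insert j Sᶜ` twice gives back `S` because `j` lies in both, and the two
cases of `matePos` are inverse translations. -/
theorem mate_mate (hd : d + 1 = 2 * l) (j : Fin d) (T : Finset (Fin d)) (q : Qubit L l) :
    mate hd j T (mate hd j T q) = q := by
  by_cases h : L j ≠ 1 ∧ j ∈ q.2.1.2
  · have h1 : mate hd j T q = (q.1.other, ⟨(matePos q.1 q.2.1.1 q.2.1.2 T j, insert j q.2.1.2ᶜ),
      card_insert_compl hd q.2.2 h.2⟩) := dif_pos h
    rw [h1, mate, dif_pos ⟨h.1, Finset.mem_insert_self _ _⟩]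
    obtain ⟨t, ⟨x, S⟩, hS⟩ := q
    simp only [Species.other_other]
    have h2 : insert j (S.erase j) = S := Finset.insert_erase h.2
    cases t <;> simp [matePos, Species.other, h2]
  · rw [mate, mate, dif_neg h, dif_neg h]

theorem mate_species (hd : d + 1 = 2 * l) (j : Fin d) (T : Finset (Fin d)) (q : Qubit L l)
    (h : mate hd j T q ≠ q) : (mate hd j T q).1 = q.1.other := by
  unfold mate at h ⊢
  split_ifs with h1
  · rfl
  · rw [dif_neg h1] at h
    exact absurd rfl h

theorem near_mate (hd : d + 1 = 2 * l) (j : Fin d) (T : Finset (Fin d)) (q : Qubit L l) :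
    Near 1 q (mate hd j T q) := by
  unfold mate
  split_ifs with h
  · have hbound : ∀ (P Q : Prop) [Decidable P] [Decidable Q],
        |(if P then (1 : ℤ) else 0) - (if Q then 1 else 0)| ≤ (1 : ℕ) := by
      intro P Q _ _; split_ifs <;> simp
    obtain ⟨t, ⟨x, S⟩, hS⟩ := q
    cases t
    · refine ⟨fun i => (if i ∈ S then 1 else 0) - (if i ∈ T then 1 else 0), fun i => hbound _ _,
        fun i => ?_⟩
      simp [matePos, shift, add_sub_assoc]
    · refine ⟨fun i => (if i ∈ T then 1 else 0) - (if i ∈ insert j Sᶜ then 1 else 0),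
        fun i => hbound _ _, fun i => ?_⟩
      simp [matePos, shift, add_sub_assoc]
  · exact Near.refl _ _

theorem mateMap_mate_apply (hd : d + 1 = 2 * l) (j : Fin d) (T : Finset (Fin d))
    (q p : Qubit L l) : mateMap (mate hd j T) (Finsupp.single q 1) p =
      if L j ≠ 1 ∧ j ∈ q.2.1.2 ∧ p.1 = q.1.other ∧ p.2.1.2 = insert j q.2.1.2ᶜ ∧
        p.2.1.1 = matePos q.1 q.2.1.1 q.2.1.2 T j then 1 else 0 := by
  rw [mateMap_single]
  by_cases h : L j ≠ 1 ∧ j ∈ q.2.1.2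
  · have h1 : mate hd j T q = (q.1.other, ⟨(matePos q.1 q.2.1.1 q.2.1.2 T j, insert j q.2.1.2ᶜ),
      card_insert_compl hd q.2.2 h.2⟩) := dif_pos h
    have h2 : mate hd j T q ≠ q := fun h' => by
      have := congrArg Prod.fst (h1.symm.trans h')
      exact Species.other_ne _ this
    rw [if_neg h2, Finsupp.single_apply, h1]
    refine if_congr ?_ rfl rfl
    obtain ⟨t, ⟨x, S⟩, hS⟩ := p
    constructor
    · intro h3
      simp only [Prod.mk.injEq, Subtype.mk.injEq] at h3
      exact ⟨h.1, h.2, h3.1.symm, h3.2.2.symm, h3.2.1.symm⟩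
    · rintro ⟨-, -, h3, h4, h5⟩
      simp only at h3 h4 h5
      subst h3 h4 h5
      rfl
  · have h1 : mate hd j T q = q := dif_neg h
    rw [if_pos h1, if_neg fun h' => h ⟨h'.1, h'.2.1⟩]
    rfl

theorem shift_singleton_eq_zero {j : Fin d} (h : L j = 1) : shift L {j} = 0 := by
  funext i
  by_cases hi : i = j
  · subst hi
    have : Subsingleton (ZMod (L i)) := by rw [h]; infer_instance
    exact Subsingleton.elim _ _
  · simp [shift, hi]

theorem shift_singleton_ne_zero {j : Fin d} (h : L j ≠ 1) : shift L {j} ≠ 0 := fun h0 => by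
  have h1 := congrFun h0 j
  simp only [shift, Finset.mem_singleton, if_true, Pi.zero_apply] at h1
  have : Fact (L j ≠ 1) := ⟨h⟩
  have h2 : Nontrivial (ZMod (L j)) := ZMod.nontrivial_iff.2 h
  exact one_ne_zero h1

/-- Modulo two the signs disappear: the cells of `δf` arise from `f` by adding a direction `i`, at
the two positions for which `f` is a face in that direction. -/
theorem coboundary_dual_apply (f σ : Cell L) : coboundary (dual f : Cochain L (ZMod 2)) σ =
    ∑ i, if i ∈ σ.2 ∧ σ.2.erase i = f.2 then
      (if σ.1 + shift L {i} = f.1 then (1 : ZMod 2) else 0) + (if σ.1 = f.1 then 1 else 0)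
    else 0 := by
  have hneg : ∀ (n : ℕ) (a : ZMod 2), ((-1 : ℤ) ^ n) • a = a := fun n a => by
    rcases neg_one_pow_eq_or ℤ n with h | h <;> rw [h]
    · rw [one_smul]
    · rw [neg_one_smul, ZMod.neg_eq_self_mod_two]
  rw [coboundary]
  simp only [hneg, CharTwo.sub_eq_add]
  rw [← Finset.sum_filter_add_sum_filter_not Finset.univ (· ∈ σ.2), Finset.filter_univ_mem]
  rw [Finset.sum_eq_zero (s := Finset.univ.filter fun i => i ∉ σ.2) fun i hi => by
    rw [if_neg fun h => (Finset.mem_filter.1 hi).2 h.1], add_zero]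
  refine Finset.sum_congr rfl fun i hi => ?_
  simp only [dual, Pi.single_apply, Prod.ext_iff]
  by_cases h : σ.2.erase i = f.2
  · simp [h, hi]
  · simp [h]

theorem erase_eq_compl_iff {S S' : Finset (Fin d)} {i : Fin d} :
    (i ∈ S' ∧ S'.erase i = Sᶜ) ↔ (i ∈ S ∧ S' = insert i Sᶜ) := by
  constructor
  · rintro ⟨h1, h2⟩
    refine ⟨?_, by rw [← h2, Finset.insert_erase h1]⟩
    by_contra h
    rw [← Finset.mem_compl, ← h2] at h
    exact Finset.notMem_erase _ _ h
  · rintro ⟨h1, rfl⟩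
    exact ⟨Finset.mem_insert_self _ _, Finset.erase_insert (by simpa using h1)⟩

/-- The cell `f` paired with `c` has the complementary directions, so `δf` adds one direction `j` of
`c`. The two positions of the added cell correspond to `∅` and `{j}`. -/
theorem sum_mateMap_apply (hd : d + 1 = 2 * l) (q p : Qubit L l) :
    ∑ j, (mateMap (mate hd j ∅) (Finsupp.single q 1) p +
      mateMap (mate hd j {j}) (Finsupp.single q 1) p) =
      onSpecies q.1.other (coboundary (pairing q.1 q.2.1)) p := by
  simp only [mateMap_mate_apply, onSpecies]
  by_cases hp : p.1 = q.1.other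
  swap
  · simp [hp]
  rw [if_pos hp]
  obtain ⟨t, ⟨x, S⟩, hS⟩ := q
  obtain ⟨t', ⟨x', S'⟩, hS'⟩ := p
  have h0 : shift L ∅ = 0 := shift_empty
  simp only at hp
  cases t
  · rw [pairing_A, coboundary_dual_apply]
    refine Finset.sum_congr rfl fun j _ => ?_
    simp only [hp, true_and, erase_eq_compl_iff, matePos, h0, sub_zero]
    by_cases h : j ∈ S ∧ S' = insert j Sᶜ
    -- With period one the two positions coincide and cancel modulo two, which is why `mate` omits
    -- such directions.
    · by_cases hL : L j = 1
      · simp [h, hL, shift_singleton_eq_zero hL, CharTwo.add_self_eq_zero]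
      · simp only [h, hL, and_self, ne_eq, not_false_eq_true, true_and, if_true, eq_sub_iff_add_eq]
        rw [add_comm]
    · rw [if_neg h, if_neg fun h' => h ⟨h'.2.1, h'.2.2.1⟩, if_neg fun h' => h ⟨h'.2.1, h'.2.2.1⟩,
        add_zero]
  · rw [pairing_B, coboundary_dual_apply]
    refine Finset.sum_congr rfl fun j _ => ?_
    have hiff : (j ∈ S' ∧ S'.erase j = Sᶜ) ↔ (j ∈ S ∧ S' = insert j Sᶜ) := erase_eq_compl_iff
    simp only [hp, true_and, hiff, matePos, h0, add_zero]
    by_cases h : j ∈ S ∧ S' = insert j Sᶜ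
    · have hj : j ∉ Sᶜ := by simpa using h.1
      have hs : shift L (insert j Sᶜ) = shift L Sᶜ + shift L {j} := by
        rw [← shift_insert hj]
      by_cases hL : L j = 1
      · simp [h, hL, shift_singleton_eq_zero hL, CharTwo.add_self_eq_zero]
      · simp only [h, hL, and_self, ne_eq, not_false_eq_true, true_and, if_true, hs,
          add_sub_add_right_eq_sub, eq_sub_iff_add_eq]
        congr 2
        rw [add_assoc, add_comm (shift L {j})]
    · rw [if_neg h, if_neg fun h' => h ⟨h'.2.1, h'.2.2.1⟩, if_neg fun h' => h ⟨h'.2.1, h'.2.2.1⟩,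
        add_zero]

theorem integral_cup_zero_dual (c : Cell L) (b : Cochain L (ZMod 2)) :
    integral (cup 0 (dual c) b) = b (c.1 + shift L c.2, c.2ᶜ) := by
  have hm : ∀ n : ℕ, ((-1 : ZMod 2)) ^ n = 1 := fun n => by
    rw [show (-1 : ZMod 2) = 1 from by decide, one_pow]
  have h1 : ∀ P : Finset (Fin d), (Finset.univ \ P) = Pᶜ := fun P => by
    ext; simp
  have key : ∀ x, cup 0 (dual c) b (x, Finset.univ) =
      if x = c.1 then b (c.1 + shift L c.2, c.2ᶜ) else 0 := by
    intro x
    simp only [cup, Finset.powersetCard_zero, Finset.sum_singleton, hm, one_mul,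
      Finset.filter_empty, Finset.card_empty, Finset.empty_union, h1,
      Nat.not_odd_zero, Finset.filter_false, Even.zero, Finset.filter_true, shift_empty, add_zero,
      dual]
    rw [Finset.sum_eq_single c.2]
    · by_cases hx : x = c.1
      · subst hx
        simp [h1]
      · have : ¬ (x, c.2) = c := fun h => hx (by rw [← h])
        simp [hx, this]
    · intro P _ hP
      have : ¬ (x, P) = c := fun h => hP (by rw [← h])
      simp [this]
    · intro h
      exact absurd (Finset.mem_univ _) h
  simp only [integral, key]
  rw [finsum_eq_single _ c.1 (fun x hx => by simp [hx]), if_pos rfl]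

/-- Only the direction `j` contributes to `∫ c ∪ ∂c'`, and `L j ≠ 1` prevents its two faces from
cancelling. -/
theorem czGate_mate_mem (hd : d + 1 = 2 * l) (j : Fin d) {T : Finset (Fin d)}
    (hT : T = ∅ ∨ T = {j}) (q : Qubit L l) (hq : mate hd j T q ≠ q) (hA : q.1 = .A) :
    czGate q (mate hd j T q) ∈ czGates L l := by
  have h : L j ≠ 1 ∧ j ∈ q.2.1.2 := by
    by_contra h
    exact hq (dif_neg h)
  have h1 : mate hd j T q = (q.1.other, ⟨(matePos q.1 q.2.1.1 q.2.1.2 T j, insert j q.2.1.2ᶜ),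
      card_insert_compl hd q.2.2 h.2⟩) := dif_pos h
  rw [h1]
  obtain ⟨t, ⟨x, S⟩, hS⟩ := q
  obtain rfl : t = .A := hA
  refine Or.inr ⟨_, _, ?_, rfl⟩
  rw [integral_cup_zero_dual, boundary, coboundary_dual_apply]
  simp only [erase_eq_compl_iff]
  have h2 : j ∈ S := h.2
  rw [Finset.sum_eq_single j]
  · rw [if_pos ⟨h2, rfl⟩]
    have h3 := shift_singleton_ne_zero h.1
    rcases hT with rfl | rfl
    · simp [matePos, shift_empty, h3]
    · simp [matePos, h3]
  · intro i _ hi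
    refine if_neg fun h' => ?_
    have h3 : j ∈ insert i Sᶜ := h'.2 ▸ Finset.mem_insert_self j _
    rcases Finset.mem_insert.1 h3 with h4 | h4
    · exact hi h4.symm
    · exact Finset.mem_compl.1 h4 h2
  · exact fun h => absurd (Finset.mem_univ _) h

theorem pauAlg_x_mul (w w' : Config L l) :
    pauAlg (w, 0) * pauAlg (w', 0) = pauAlg (w + w', 0) := by
  rw [pauAlg_mul, Finsupp.coe_zero, dot_zero, sgn_zero, one_smul, Prod.mk_add_mk, add_zero]

/-- The exponents of `X` in the decorations of the separators. -/
def decoMap (hd : d + 1 = 2 * l) : Config L l →+ Config L l :=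
  ∑ j, (mateMap (mate hd j ∅) + mateMap (mate hd j {j}))

theorem decoMap_single (hd : d + 1 = 2 * l) (q : Qubit L l) : decoMap hd (Finsupp.single q 1) =
    toConfig (onSpecies q.1.other (coboundary (pairing q.1 q.2.1))) := by
  ext p
  rw [toConfig_apply, ← sum_mateMap_apply hd, decoMap, AddMonoidHom.finsetSum_apply,
    Finsupp.finsetSum_apply]
  rfl

/-- The matrix of an involutive pairing is symmetric. -/
theorem decoMap_adj (hd : d + 1 = 2 * l) (a b : Config L l) :
    dot (decoMap hd a) b = dot a (decoMap hd b) := by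
  have hcoe : ∀ (s : Finset (Fin d)) (f : Fin d → Config L l),
      dot ((∑ j ∈ s, f j : Config L l)) b = ∑ j ∈ s, dot (f j) b := fun s f => by
    rw [dot_comm, map_sum]
    exact Finset.sum_congr rfl fun j _ => dot_comm _ _
  rw [decoMap, AddMonoidHom.finsetSum_apply, AddMonoidHom.finsetSum_apply, hcoe, map_sum]
  refine Finset.sum_congr rfl fun j _ => ?_
  rw [AddMonoidHom.add_apply, AddMonoidHom.add_apply, Finsupp.coe_add, dot_add, map_add,
    mateMap_adj (mate_mate hd j ∅), mateMap_adj (mate_mate hd j {j})]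

theorem xCoboundary_eq (hd : d + 1 = 2 * l) (q : Qubit L l) :
    xCoboundary q.1.other (pairing q.1 q.2.1) = xOp (decoMap hd (Finsupp.single q 1)) := by
  rw [decoMap_single]; rfl

/-- The automaton of `½ A ∪ B` exists and is a circuit of controlled-`Z` gates. -/
theorem exists_isABQCA (hd : d + 1 = 2 * l) (L : Fin d → ℕ) : ∃ β : Alg L l ≃ₐ[ℂ] Alg L l,
    (∀ q, β (xGen q) = xGen q) ∧
    (∀ q, β (zGen q) = zGen q * pauAlg (decoMap hd (Finsupp.single q 1), 0)) ∧
    IsCircuit (czGates L l) (2 * d) 2 β := by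
  have key : ∀ (J : List (Fin d)), ∃ Φ : Alg L l ≃ₐ[ℂ] Alg L l, (∀ q, Φ (xGen q) = xGen q) ∧
      (∀ q, Φ (zGen q) = zGen q * pauAlg ((J.map fun j => mateMap (mate hd j ∅)
        (Finsupp.single q 1) + mateMap (mate hd j {j}) (Finsupp.single q 1)).sum, 0)) ∧
      IsCircuit (czGates L l) (2 * J.length) 2 Φ := by
    intro J
    induction J with
    | nil =>
      refine ⟨1, fun q => rfl, fun q => ?_, [], le_rfl, by simp, rfl⟩
      rw [List.map_nil, List.sum_nil, ← Prod.zero_eq_mk, pauAlg_zero, mul_one]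
      rfl
    | cons j J ih =>
      obtain ⟨Φ, hx, hz, hc⟩ := ih
      have hlayer : ∀ T : Finset (Fin d), T = ∅ ∨ T = {j} → ∃ Φ : Alg L l ≃ₐ[ℂ] Alg L l,
          (∀ q, Φ (xGen q) = xGen q) ∧
          (∀ q, Φ (zGen q) = zGen q * pauAlg (mateMap (mate hd j T) (Finsupp.single q 1), 0)) ∧
          IsLayer (czGates L l) 2 Φ := fun T hT => by
        obtain ⟨Φ, h1, h2, h3⟩ := exists_mate_layer (L := L) (mate hd j T) (mate_mate hd j T)
          (mate_species hd j T) (near_mate hd j T) (czGate_mate_mem hd j hT)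
        exact ⟨Φ, h1, h2, h3.mono subset_rfl one_le_two⟩
      obtain ⟨Φ1, hx1, hz1, hc1⟩ := hlayer ∅ (Or.inl rfl)
      obtain ⟨Φ2, hx2, hz2, hc2⟩ := hlayer {j} (Or.inr rfl)
      -- All layers fix the `X` operators, so the decorations produced by successive layers simply
      -- multiply.
      have hfix : ∀ Ψ : Alg L l ≃ₐ[ℂ] Alg L l, (∀ q, Ψ (xGen q) = xGen q) → ∀ w,
          Ψ (pauAlg (w, 0)) = pauAlg (w, 0) := fun Ψ hΨ w => by
        induction w using config_induction with
        | h0 => rw [← Prod.zero_eq_mk, pauAlg_zero, map_one]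
        | hadd w q ih =>
          have h2 : pauAlg (Finsupp.single q 1 + w, 0) = xGen q * pauAlg (w, 0) := by
            rw [xGen_eq, pauAlg_mul, Finsupp.coe_zero, dot_zero, sgn_zero, one_smul,
              Prod.mk_add_mk, add_zero]
          rw [h2, map_mul, hΨ, ih]
      refine ⟨Φ1 * Φ2 * Φ, fun q => ?_, fun q => ?_, ?_⟩
      · rw [AlgEquiv.mul_apply, AlgEquiv.mul_apply, hx, hx2, hx1]
      · rw [AlgEquiv.mul_apply, AlgEquiv.mul_apply, hz, map_mul, map_mul, hfix Φ2 hx2,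
          hfix Φ1 hx1, hz2, map_mul, hfix Φ1 hx1, hz1, mul_assoc, mul_assoc, pauAlg_x_mul,
          pauAlg_x_mul, List.map_cons, List.sum_cons, add_assoc]
      · have h1 : IsCircuit (czGates L l) 1 2 Φ1 := ⟨[Φ1], le_rfl, by simpa using hc1, by simp⟩
        have h2 : IsCircuit (czGates L l) 1 2 Φ2 := ⟨[Φ2], le_rfl, by simpa using hc2, by simp⟩
        refine ((h1.mul h2).mul hc).mono subset_rfl ?_ le_rfl
        rw [List.length_cons]
        omega
  obtain ⟨β, h1, h2, h3⟩ := key (List.finRange d)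
  refine ⟨β, h1, fun q => ?_, by simpa using h3⟩
  rw [h2]
  congr 3
  rw [decoMap, AddMonoidHom.finsetSum_apply, ← List.ofFn_eq_map, ← List.sum_ofFn]
  rfl

end Mates

/-! ### Stokes' theorem and integrated Leibniz rules -/

section Integration

variable {d : ℕ} {L : Fin d → ℕ} {R : Type*} [CommRing R]

/-- Cochains of finite support. -/
def FinSupp (c : Cochain L R) : Prop := (Function.support c).Finite

theorem FinSupp.add {b c : Cochain L R} (hb : FinSupp b) (hc : FinSupp c) : FinSupp (b + c) :=
  (hb.union hc).subset (Function.support_add b c)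

theorem FinSupp.smul {c : Cochain L R} (hc : FinSupp c) (r : R) : FinSupp (r • c) :=
  hc.subset (Function.support_const_smul_subset r c)

theorem finSupp_zero : FinSupp (0 : Cochain L R) := by
  simp [FinSupp]

theorem finSupp_dual (σ : Cell L) : FinSupp (dual σ : Cochain L R) :=
  (Set.finite_singleton σ).subset Pi.support_single_subset

/-- Coboundaries and cup products look only at translates by the finitely many vectors `shift L A`,
so they preserve finiteness of supports. -/
theorem FinSupp.of_shift {M : Type*} [Zero M] {b : Cochain L M} (hb : (Function.support b).Finite)
    {c : Cochain L R} (h : ∀ x S, c (x, S) ≠ 0 → ∃ A U, b (x + shift L A, U) ≠ 0) :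
    FinSupp c := by
  refine Set.Finite.subset (s := ⋃ A : Finset (Fin d), ⋃ S : Finset (Fin d),
    (fun τ : Cell L => ((τ.1 - shift L A, S) : Cell L)) '' Function.support b) ?_ ?_
  · exact Set.finite_iUnion fun A => Set.finite_iUnion fun S => hb.image _
  · rintro ⟨x, S⟩ hσ
    obtain ⟨A, U, hU⟩ := h x S hσ
    exact Set.mem_iUnion.2 ⟨A, Set.mem_iUnion.2 ⟨S, _, hU, by simp⟩⟩

theorem exists_of_coboundary_ne_zero {c : Cochain L R} {σ : Cell L} (h : coboundary c σ ≠ 0) :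
    ∃ j ∈ σ.2, ∃ A, c (σ.1 + shift L A, σ.2.erase j) ≠ 0 := by
  obtain ⟨j, hj, hne⟩ := Finset.exists_ne_zero_of_sum_ne_zero h
  refine ⟨j, hj, ?_⟩
  by_cases h0 : c (σ.1, σ.2.erase j) = 0
  · exact ⟨{j}, fun h' => hne (by rw [h0, h']; simp)⟩
  · exact ⟨∅, by rwa [shift_empty, add_zero]⟩

theorem FinSupp.coboundary {c : Cochain L R} (hc : FinSupp c) : FinSupp (coboundary c) :=
  FinSupp.of_shift hc fun x S h => by
    obtain ⟨j, _, A, hA⟩ := exists_of_coboundary_ne_zero h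
    exact ⟨A, _, hA⟩

theorem exists_of_cup_ne_zero {k : ℕ} {b c : Cochain L R} {x : Pos L} {S : Finset (Fin d)}
    (h : cup k b c (x, S) ≠ 0) : ∃ A U B W, b (x + shift L A, U) ≠ 0 ∧
      c (x + shift L B, W) ≠ 0 := by
  rw [cup_apply] at h
  obtain ⟨T, hT, h⟩ := Finset.exists_ne_zero_of_sum_ne_zero h
  obtain ⟨P, hP, h⟩ := Finset.exists_ne_zero_of_sum_ne_zero h
  unfold cupTerm at h
  exact ⟨_, _, _, _, right_ne_zero_of_mul (left_ne_zero_of_mul h), right_ne_zero_of_mul h⟩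

theorem FinSupp.cup_left {b : Cochain L R} (hb : FinSupp b) (k : ℕ) (c : Cochain L R) :
    FinSupp (cup k b c) :=
  FinSupp.of_shift hb fun x S h => by
    obtain ⟨A, U, _, _, hA, _⟩ := exists_of_cup_ne_zero h
    exact ⟨A, U, hA⟩

theorem FinSupp.cup_right {c : Cochain L R} (hc : FinSupp c) (k : ℕ) (b : Cochain L R) :
    FinSupp (cup k b c) :=
  FinSupp.of_shift hc fun x S h => by
    obtain ⟨_, _, B, W, _, hB⟩ := exists_of_cup_ne_zero h
    exact ⟨B, W, hB⟩

theorem FinSupp.top {c : Cochain L R} (hc : FinSupp c) (S : Finset (Fin d)) :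
    (Function.support fun x : Pos L => c (x, S)).Finite :=
  hc.preimage (f := fun x : Pos L => ((x, S) : Cell L))
    (Function.Injective.injOn fun _ _ h => congrArg Prod.fst h)

theorem integral_zero : integral (0 : Cochain L R) = 0 := by
  simp [integral]

theorem integral_add {b c : Cochain L R} (hb : FinSupp b) (hc : FinSupp c) :
    integral (b + c) = integral b + integral c :=
  finsum_add_distrib (hb.top _) (hc.top _)

theorem integral_smul (r : R) {c : Cochain L R} (hc : FinSupp c) :
    integral (r • c) = r * integral c := by
  have h := (AddMonoidHom.mulLeft r).map_finsum (hc.top Finset.univ)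
  exact h.symm

theorem integral_map {R' : Type*} [CommRing R'] (φ : R →+* R') {c : Cochain L R}
    (hc : FinSupp c) : integral (fun σ => φ (c σ)) = φ (integral c) :=
  (φ.toAddMonoidHom.map_finsum (hc.top Finset.univ)).symm

/-- Stokes' theorem on a lattice without boundary. -/
theorem integral_coboundary {c : Cochain L R} (hc : FinSupp c) : integral (coboundary c) = 0 := by
  have hshift : ∀ (j : Fin d) (S : Finset (Fin d)),
      (Function.support fun x : Pos L => c (x + shift L {j}, S)).Finite := fun j S =>
    (hc.top S).preimage (f := fun x => x + shift L {j}) (add_left_injective _).injOn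
  have hterm : ∀ j : Fin d, ((Function.support fun x : Pos L =>
      ((-1 : ℤ) ^ ((Finset.univ : Finset (Fin d)).filter (· < j)).card) •
        (c (x + shift L {j}, Finset.univ.erase j) - c (x, Finset.univ.erase j)))).Finite :=
    fun j => ((hshift j (Finset.univ.erase j)).union (hc.top (Finset.univ.erase j))).subset
      fun x hx => by
      by_contra h
      simp only [Set.mem_union, Function.mem_support, not_or, not_not] at h
      obtain ⟨h1, h2⟩ := h
      exact hx (by beta_reduce; rw [h1, h2]; simp)
  unfold integral HigherQCA.coboundary
  rw [finsum_sum_comm _ _ fun j _ => hterm j]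
  refine Finset.sum_eq_zero fun j _ => ?_
  have h1 := (smulAddHom ℤ R ((-1 : ℤ) ^ ((Finset.univ : Finset (Fin d)).filter
    (· < j)).card)).map_finsum (f := fun x : Pos L => c (x + shift L {j}, Finset.univ.erase j) -
      c (x, Finset.univ.erase j)) (((hshift j _).union (hc.top _)).subset
        (Function.support_sub _ _))
  refine h1.symm.trans ?_
  -- The sums over the two faces in direction `j` differ by a translation of the lattice.
  rw [finsum_sub_distrib (hshift j _) (hc.top _)]
  have h2 := finsum_comp_equiv (Equiv.addRight (shift L {j}))
    (f := fun x : Pos L => c (x, Finset.univ.erase j))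
  simp only [Equiv.coe_addRight] at h2
  rw [h2, sub_self, map_zero]

/-- The integrated Leibniz rule for the cup product. -/
theorem integral_leibniz_zero {p q : ℕ} {b c : Cochain L R} (hb : HasParity p b)
    (hc : HasParity q c) (hb' : FinSupp b) :
    integral (cup 0 (coboundary b) c) + (-1) ^ p * integral (cup 0 b (coboundary c)) = 0 := by
  have h := integral_coboundary (hb'.cup_left 0 c)
  rw [coboundary_cup hb hc] at h
  simp only [cupPred, smul_zero, add_zero] at h
  rwa [integral_add (hb'.coboundary.cup_left _ _) ((hb'.cup_left _ _).smul _),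
    integral_smul _ (hb'.cup_left _ _)] at h

/-- The integrated Leibniz rule for the higher cup products. -/
theorem integral_leibniz {k p q : ℕ} {b c : Cochain L R} (hb : HasParity p b)
    (hc : HasParity q c) (hb' : FinSupp b) :
    integral (cup (k + 1) (coboundary b) c) + (-1) ^ p * integral (cup (k + 1) b (coboundary c)) +
      (-1) ^ (p + q + (k + 1)) * integral (cup k b c) +
      (-1) ^ (p * q + p + q) * integral (cup k c b) = 0 := by
  have h := integral_coboundary (hb'.cup_left (k + 1) c)
  rw [coboundary_cup hb hc] at h
  simp only [cupPred] at h
  rwa [integral_add (((hb'.coboundary.cup_left _ _).add ((hb'.cup_left _ _).smul _)).add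
      ((hb'.cup_left _ _).smul _)) ((hb'.cup_right _ _).smul _),
    integral_add ((hb'.coboundary.cup_left _ _).add ((hb'.cup_left _ _).smul _))
      ((hb'.cup_left _ _).smul _),
    integral_add (hb'.coboundary.cup_left _ _) ((hb'.cup_left _ _).smul _),
    integral_smul _ (hb'.cup_left _ _), integral_smul _ (hb'.cup_left _ _),
    integral_smul _ (hb'.cup_right _ _)] at h

theorem integral_cup_add_left (k : ℕ) {b b' : Cochain L R} (hb : FinSupp b) (hb' : FinSupp b')
    (c : Cochain L R) :
    integral (cup k (b + b') c) = integral (cup k b c) + integral (cup k b' c) := by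
  rw [cup_add_left, integral_add (hb.cup_left _ _) (hb'.cup_left _ _)]

theorem integral_cup_add_right (k : ℕ) (b : Cochain L R) {c c' : Cochain L R} (hc : FinSupp c)
    (hc' : FinSupp c') :
    integral (cup k b (c + c')) = integral (cup k b c) + integral (cup k b c') := by
  rw [cup_add_right, integral_add (hc.cup_right _ _) (hc'.cup_right _ _)]

theorem integral_cup_smul_left (k : ℕ) (r : R) {b : Cochain L R} (hb : FinSupp b)
    (c : Cochain L R) : integral (cup k (r • b) c) = r * integral (cup k b c) := by
  rw [cup_smul_left, integral_smul _ (hb.cup_left _ _)]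

theorem integral_cup_smul_right (k : ℕ) (r : R) (b : Cochain L R) {c : Cochain L R}
    (hc : FinSupp c) : integral (cup k b (r • c)) = r * integral (cup k b c) := by
  rw [cup_smul_right, integral_smul _ (hc.cup_right _ _)]

/-- `∫ δf ∪₁ δg` is symmetric modulo two. -/
theorem integral_coboundary_cup_one_symm {p : ℕ} {f g : Cochain L (ZMod 2)} (hf : HasParity p f)
    (hg : HasParity p g) (hf' : FinSupp f) (hg' : FinSupp g) :
    integral (cup 1 (coboundary f) (coboundary g)) =
      integral (cup 1 (coboundary g) (coboundary f)) := by
  have hm : (-1 : ZMod 2) = 1 := rfl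
  -- `h1` and `h2` express the two sides as `∫ f ∪ δg + ∫ δg ∪ f` and as the same with `f` and `g`
  -- exchanged; `h3` and `h4` move the coboundary to the other factor.
  have h1 := integral_leibniz (k := 0) hf hg.coboundary hf'
  have h2 := integral_leibniz (k := 0) hg hf.coboundary hg'
  have h3 := integral_leibniz_zero hf hg hf'
  have h4 := integral_leibniz_zero hg hf hg'
  rw [coboundary_coboundary hg, cup_zero_right, integral_zero, mul_zero, add_zero] at h1
  rw [coboundary_coboundary hf, cup_zero_right, integral_zero, mul_zero, add_zero] at h2
  simp only [hm, one_pow, one_mul] at h1 h2 h3 h4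
  linear_combination h1 - h2 - h4 - h3 +
    CharTwo.add_self_eq_zero (integral (cup 0 (coboundary f) g)) +
    CharTwo.add_self_eq_zero (integral (cup 0 g (coboundary f)))

/-- `∫ δf ∪₁ δf` vanishes modulo two. -/
theorem integral_coboundary_cup_one_self {p : ℕ} {f : Cochain L (ZMod 2)} (hf : HasParity p f)
    (hf' : FinSupp f) : integral (cup 1 (coboundary f) (coboundary f)) = 0 := by
  have hm : (-1 : ZMod 2) = 1 := rfl
  -- What remains is `∫ f ∪ δf + ∫ δf ∪ f`, the integral of a coboundary modulo two.
  have h1 := integral_leibniz (k := 0) hf hf.coboundary hf'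
  have h3 := integral_leibniz_zero hf hf hf'
  rw [coboundary_coboundary hf, cup_zero_right, integral_zero, mul_zero, add_zero] at h1
  simp only [hm, one_pow, one_mul] at h1 h3
  linear_combination h1 - h3

end Integration

/-! ### Distances of lattice points -/

section Geometry

variable {d : ℕ} {L : Fin d → ℕ}

/-- `y` differs from `x` by at most `r` in every coordinate. -/
def NearPos (r : ℕ) (x y : Pos L) : Prop :=
  ∃ v : Fin d → ℤ, (∀ i, |v i| ≤ r) ∧ ∀ i, y i = x i + (v i : ZMod (L i))

theorem NearPos.symm {r : ℕ} {x y : Pos L} (h : NearPos r x y) : NearPos r y x := by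
  obtain ⟨v, hv, h⟩ := h
  exact ⟨-v, fun i => by simpa using hv i, fun i => by simp [h i]⟩

theorem NearPos.trans {r r' : ℕ} {x y z : Pos L} (h : NearPos r x y) (h' : NearPos r' y z) :
    NearPos (r + r') x z := by
  obtain ⟨v, hv, h⟩ := h
  obtain ⟨v', hv', h'⟩ := h'
  refine ⟨v + v', fun i => (abs_add_le _ _).trans ?_, fun i => ?_⟩
  · push_cast
    exact add_le_add (hv i) (hv' i)
  · rw [h' i, h i]; simp [add_assoc]

theorem NearPos.mono {r r' : ℕ} {x y : Pos L} (h : NearPos r x y) (hr : r ≤ r') :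
    NearPos r' x y := by
  obtain ⟨v, hv, h⟩ := h
  exact ⟨v, fun i => (hv i).trans (by exact_mod_cast hr), h⟩

theorem nearPos_shift (x : Pos L) (A : Finset (Fin d)) : NearPos 1 x (x + shift L A) :=
  ⟨fun i => if i ∈ A then 1 else 0, fun i => by beta_reduce; split_ifs <;> simp, fun i => by simp [shift]⟩

theorem nearPos_shift_shift (x : Pos L) (A B : Finset (Fin d)) :
    NearPos 1 (x + shift L A) (x + shift L B) :=
  ⟨fun i => (if i ∈ B then 1 else 0) - if i ∈ A then 1 else 0,
    fun i => by beta_reduce; split_ifs <;> simp, fun i => by simp [shift]⟩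

/-- A nonzero product requires both cells to be faces of one cube. -/
theorem nearPos_of_integral_cup_dual {R : Type*} [CommRing R] {k : ℕ} {c c' : Cell L}
    (h : integral (cup k (dual c) (dual c') : Cochain L R) ≠ 0) : NearPos 1 c.1 c'.1 := by
  obtain ⟨x, hx⟩ : ∃ x, (cup k (dual c) (dual c') : Cochain L R) (x, Finset.univ) ≠ 0 := by
    by_contra! h'
    exact h (by simp [integral, h'])
  obtain ⟨A, U, B, W, h1, h2⟩ := exists_of_cup_ne_zero hx
  have h1' : (x + shift L A, U) = c := by
    by_contra h'
    exact h1 (Pi.single_eq_of_ne h' _)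
  have h2' : (x + shift L B, W) = c' := by
    by_contra h'
    exact h2 (Pi.single_eq_of_ne h' _)
  rw [← h1', ← h2']
  exact nearPos_shift_shift x A B

end Geometry

/-! ### The linear data of `α` and the range of Clifford automorphisms -/

section Kernel

variable {d : ℕ} {L : Fin d → ℕ} {l : ℕ}

/-- The cochain modulo two that labels the qubits of a species. -/
def coch (t : Species) (u : Config L l) : Cochain L (ZMod 2) :=
  fun σ => if h : σ.2.card = l then u (t, ⟨σ, h⟩) else 0

theorem coch_zero (t : Species) : coch t (0 : Config L l) = 0 := by
  funext σ; simp [coch]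

theorem coch_add (t : Species) (u v : Config L l) : coch t (u + v) = coch t u + coch t v := by
  funext σ
  by_cases h : σ.2.card = l <;> simp [coch, h]

theorem coch_single (t : Species) (q : Qubit L l) :
    coch t (Finsupp.single q 1) = if q.1 = t then dual q.2.1 else 0 := by
  funext σ
  obtain ⟨t', c, hc⟩ := q
  by_cases hσ : σ.2.card = l
  · simp only [coch, dif_pos hσ, Finsupp.single_apply, Prod.mk.injEq, Subtype.mk.injEq]
    by_cases ht : t' = t
    · simp [ht, dual, Pi.single_apply, eq_comm]
    · simp [ht]
  · have : σ ≠ c := fun h => hσ (h ▸ hc)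
    by_cases ht : t' = t <;> simp [coch, hσ, ht, dual, this]

theorem coch_of_eq {t : Species} {u : Config L l} {c : Cochain L (ZMod 2)} (hc : IsOfDegree l c)
    (h : ∀ σ, u (t, σ) = c σ.1) : coch t u = c := by
  funext σ
  by_cases hσ : σ.2.card = l
  · exact (dif_pos hσ).trans (h ⟨σ, hσ⟩)
  · exact (dif_neg hσ).trans (hc σ hσ).symm

theorem finSupp_coch (t : Species) (u : Config L l) : FinSupp (coch t u) := by
  induction u using config_induction with
  | h0 => rw [coch_zero]; exact finSupp_zero
  | hadd u q ih =>
    rw [coch_add, coch_single]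
    refine FinSupp.add ?_ ih
    split_ifs
    · exact finSupp_dual _
    · exact finSupp_zero

theorem toConfig_of_near {r : ℕ} {q : Qubit L l} {f : Qubit L l → ZMod 2}
    (h : ∀ p, f p ≠ 0 → Near r q p) (p : Qubit L l) : toConfig f p = f p := by
  have hf : (Function.support f).Finite := (near_finite r q).subset h
  rw [toConfig, dif_pos hf]
  rfl

theorem hopExp_near {q p : Qubit L l} (h : hopExp q p ≠ 0) : Near 1 q p := by
  unfold hopExp onSpecies at h
  split_ifs at h with h1
  · exact (nearPos_of_integral_cup_dual h).symm
  · exact absurd rfl h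

/-- The exponents `c' ↦ ∫ c ∪₁ c'`, on the qubits of the species of `q = (t, c)`. -/
def hopExpDual (q : Qubit L l) : Qubit L l → ZMod 2 :=
  onSpecies q.1 fun c' => integral (cup 1 (dual q.2.1) (dual c'))

theorem hopExpDual_near {q p : Qubit L l} (h : hopExpDual q p ≠ 0) : Near 1 q p := by
  unfold hopExpDual onSpecies at h
  split_ifs at h with h1
  · exact nearPos_of_integral_cup_dual h
  · exact absurd rfl h

variable (L l) in
/-- The exponents of `Z` in the hopping operators. -/
def hopMap : Config L l →+ Config L l :=
  (Finsupp.linearCombination (ZMod 2) fun q => toConfig (hopExp q)).toAddMonoidHom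

variable (L l) in
/-- The exponents of `Z` in the gauge constraints. -/
def gaugeMap : Config L l →+ Config L l :=
  (Finsupp.linearCombination (ZMod 2) fun q => toConfig (hopExpDual q)).toAddMonoidHom

theorem hopMap_single (q p : Qubit L l) : hopMap L l (Finsupp.single q 1) p = hopExp q p := by
  change (Finsupp.linearCombination (ZMod 2) _ _ : Config L l) p = _
  rw [Finsupp.linearCombination_single, one_smul, toConfig_of_near fun _ h => hopExp_near h]

theorem gaugeMap_single (q p : Qubit L l) :
    gaugeMap L l (Finsupp.single q 1) p = hopExpDual q p := by
  change (Finsupp.linearCombination (ZMod 2) _ _ : Config L l) p = _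
  rw [Finsupp.linearCombination_single, one_smul, toConfig_of_near fun _ h => hopExpDual_near h]

theorem hopMap_adj (a b : Config L l) : dot (hopMap L l a) b = dot a (gaugeMap L l b) := by
  refine linComb_dot _ _ (fun q p => ?_) a b
  rw [toConfig_of_near fun _ h => hopExp_near h, toConfig_of_near fun _ h => hopExpDual_near h]
  unfold hopExp hopExpDual onSpecies
  by_cases h : p.1 = q.1
  · rw [if_pos h, if_pos h.symm]
  · rw [if_neg h, if_neg fun h' => h h'.symm]

theorem gaugeMap_apply (u : Config L l) (p : Qubit L l) :
    gaugeMap L l u p = integral (cup 1 (coch p.1 u) (dual p.2.1)) := by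
  induction u using config_induction with
  | h0 => rw [map_zero, coch_zero, cup_zero_left, integral_zero]; rfl
  | hadd u q ih =>
    rw [map_add, Finsupp.add_apply, ih, gaugeMap_single, coch_add,
      integral_cup_add_left _ (finSupp_coch _ _) (finSupp_coch _ _), coch_single]
    congr 1
    unfold hopExpDual onSpecies
    by_cases h : p.1 = q.1
    · rw [if_pos h, if_pos h.symm]
    · rw [if_neg h, if_neg fun h' => h h'.symm, cup_zero_left, integral_zero]

/-- Identifies the bilinear form of the linear data with `∫ · ∪₁ ·`, summed over the species, so
that the Leibniz rules apply to it. -/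
theorem dot_gaugeMap (u w : Config L l) : dot (gaugeMap L l u) w =
    integral (cup 1 (coch .A u) (coch .A w)) + integral (cup 1 (coch .B u) (coch .B w)) := by
  induction w using config_induction with
  | h0 => simp only [map_zero, coch_zero, cup_zero_right, integral_zero, add_zero]
  | hadd w q ih =>
    rw [map_add, dot_single, ih, gaugeMap_apply, coch_add, coch_add,
      integral_cup_add_right _ _ (finSupp_coch _ _) (finSupp_coch _ _),
      integral_cup_add_right _ _ (finSupp_coch _ _) (finSupp_coch _ _), coch_single, coch_single]
    cases hq : q.1
    · simp only [if_true, reduceCtorEq, if_false, cup_zero_right, integral_zero]; ring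
    · simp only [if_true, reduceCtorEq, if_false, cup_zero_right, integral_zero]; ring

theorem isOfDegree_coboundary {R : Type*} [CommRing R] {m : ℕ} {c : Cochain L R}
    (hc : IsOfDegree m c) : IsOfDegree (m + 1) (coboundary c) := fun σ hσ => by
  by_contra h
  obtain ⟨j, hj, A, hA⟩ := exists_of_coboundary_ne_zero h
  refine hA (hc _ fun h' => hσ ?_)
  simp only at h'
  rw [← Finset.card_erase_add_one hj, h']

theorem pairing_eq_dual (q : Qubit L l) : ∃ x, pairing q.1 q.2.1 = dual (x, q.2.1.2ᶜ) := by
  cases q.1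
  · exact ⟨_, pairing_A _⟩
  · exact ⟨_, pairing_B _⟩

theorem isOfDegree_pairing (hd : d + 1 = 2 * l) (q : Qubit L l) :
    IsOfDegree (l - 1) (pairing q.1 q.2.1) := fun σ hσ => by
  obtain ⟨x, hx⟩ := pairing_eq_dual q
  rw [hx]
  refine Pi.single_eq_of_ne (fun h => hσ ?_) _
  rw [h, Finset.card_compl, Fintype.card_fin, q.2.2]
  omega

theorem finSupp_pairing (q : Qubit L l) : FinSupp (pairing q.1 q.2.1) := by
  obtain ⟨x, hx⟩ := pairing_eq_dual q
  rw [hx]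
  exact finSupp_dual _

theorem coch_decoMap_single (hd : d + 1 = 2 * l) (t : Species) (q : Qubit L l) :
    coch t (decoMap hd (Finsupp.single q 1)) =
      if t = q.1.other then coboundary (pairing q.1 q.2.1) else 0 := by
  have h1 : IsOfDegree l (coboundary (pairing q.1 q.2.1)) := by
    have := isOfDegree_coboundary (isOfDegree_pairing hd q)
    rwa [Nat.sub_add_cancel (by omega)] at this
  refine coch_of_eq ?_ fun σ => ?_
  · split_ifs
    · exact h1
    · exact fun _ _ => rfl
  · rw [decoMap_single, toConfig_apply, onSpecies]
    by_cases h : t = q.1.other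
    · rw [if_pos h, if_pos h]
    · rw [if_neg h, if_neg h]; rfl

/-- The exponents of `X` in the decorations are coboundaries. -/
theorem exists_coch_decoMap (hd : d + 1 = 2 * l) (t : Species) (u : Config L l) :
    ∃ f : Cochain L (ZMod 2), IsOfDegree (l - 1) f ∧ FinSupp f ∧
      coch t (decoMap hd u) = coboundary f := by
  induction u using config_induction with
  | h0 =>
    refine ⟨0, fun _ _ => rfl, finSupp_zero, ?_⟩
    rw [map_zero, coch_zero]
    exact (by simpa using (coboundary_smul (0 : ZMod 2) (0 : Cochain L (ZMod 2))).symm)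
  | hadd u q ih =>
    obtain ⟨f, h1, h2, h3⟩ := ih
    by_cases h : t = q.1.other
    · refine ⟨pairing q.1 q.2.1 + f, fun σ hσ => ?_, (finSupp_pairing q).add h2, ?_⟩
      · rw [Pi.add_apply, isOfDegree_pairing hd q σ hσ, h1 σ hσ, add_zero]
      · rw [map_add, coch_add, h3, coch_decoMap_single, if_pos h, coboundary_add]
    · exact ⟨f, h1, h2, by rw [map_add, coch_add, h3, coch_decoMap_single, if_neg h, zero_add]⟩

theorem dot_eq_zero {u v : Config L l} (h : ∀ q, u q = 0 ∨ v q = 0) : dot u v = 0 := by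
  rw [dot, Finsupp.linearCombination_apply, Finsupp.sum]
  refine Finset.sum_eq_zero fun q _ => ?_
  rcases h q with h | h <;> simp [h]

/-- The decorations exchange the species: by self-adjointness the value at `p` is the overlap of `u`
with the decoration of `p`, which lives on the other species. -/
theorem decoMap_apply_of_species (hd : d + 1 = 2 * l) {t : Species} {u : Config L l}
    (h : ∀ q, u q ≠ 0 → q.1 = t) {p : Qubit L l} (hp : p.1 = t) : decoMap hd u p = 0 := by
  rw [← dot_single (decoMap hd u), decoMap_adj, decoMap_single]
  refine dot_eq_zero fun q => ?_
  by_cases hq : u q = 0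
  · exact Or.inl hq
  · right
    rw [toConfig_apply, onSpecies, if_neg]
    rw [hp, h q hq]
    exact (Species.other_ne t).symm

/-- The data of the automaton of `½ (A ∪ A + A ∪ B + B ∪ B)`. -/
def fermionData (hd : d + 1 = 2 * l) (L : Fin d → ℕ) : CliffordData L l where
  N := decoMap hd
  κ := hopMap L l
  κ' := gaugeMap L l
  N_adj := decoMap_adj hd
  κ_adj := hopMap_adj
  symm a b := by
    rw [dot_gaugeMap, dot_gaugeMap]
    have key : ∀ t, integral (cup 1 (coch t (decoMap hd a)) (coch t (decoMap hd b))) =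
        integral (cup 1 (coch t (decoMap hd b)) (coch t (decoMap hd a))) := fun t => by
      obtain ⟨f, h1, h2, h3⟩ := exists_coch_decoMap hd t a
      obtain ⟨g, h1', h2', h3'⟩ := exists_coch_decoMap hd t b
      rw [h3, h3']
      exact integral_coboundary_cup_one_symm h1.hasParity h1'.hasParity h2 h2'
    rw [key, key]
  alt a := by
    rw [dot_gaugeMap]
    have key : ∀ t, integral (cup 1 (coch t (decoMap hd a)) (coch t (decoMap hd a))) = 0 :=
      fun t => by
        obtain ⟨f, h1, h2, h3⟩ := exists_coch_decoMap hd t a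
        rw [h3]
        exact integral_coboundary_cup_one_self h1.hasParity h2
    rw [key, key, add_zero]
  N_single q := decoMap_apply_of_species hd (t := q.1) (fun p hp => by
    by_contra h
    refine hp ?_
    have : q ≠ p := fun h' => h (h' ▸ rfl)
    simp [this]) rfl
  N_κ q := by
    have hs : ∀ p, hopMap L l (Finsupp.single q 1) p ≠ 0 → p.1 = q.1 := fun p hp => by
      rw [hopMap_single, hopExp, onSpecies] at hp
      by_contra h
      exact hp (if_neg h)
    -- The hopping exponents of `q` stay in the species of `q`, and their decorations lie in the
    -- other one.
    refine dot_eq_zero fun p => ?_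
    by_cases hp : hopMap L l (Finsupp.single q 1) p = 0
    · exact Or.inr hp
    · exact Or.inl (decoMap_apply_of_species hd hs (hs p hp))

theorem decoMap_near (hd : d + 1 = 2 * l) {q p : Qubit L l}
    (h : decoMap hd (Finsupp.single q 1) p ≠ 0) : Near 1 q p := by
  rw [decoMap, AddMonoidHom.finsetSum_apply, Finsupp.finsetSum_apply] at h
  obtain ⟨j, _, hj⟩ := Finset.exists_ne_zero_of_sum_ne_zero h
  have key : ∀ T, mateMap (mate hd j T) (Finsupp.single q 1) p ≠ 0 → Near 1 q p := fun T hT => by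
    rw [mateMap_single] at hT
    split_ifs at hT with h1
    · exact absurd rfl hT
    · rw [Finsupp.single_apply] at hT
      split_ifs at hT with h2
      · exact h2 ▸ near_mate hd j T q
      · exact absurd rfl hT
  by_cases h0 : mateMap (mate hd j ∅) (Finsupp.single q 1) p = 0
  · refine key {j} fun h' => hj ?_
    rw [AddMonoidHom.add_apply, Finsupp.add_apply, h0, h', add_zero]
  · exact key ∅ h0

/-- Additive maps of configurations enlarge supports by at most the sum of their ranges. -/
theorem near_of_map_ne_zero {M : Config L l →+ Config L l} {r r' : ℕ}
    (hM : ∀ q p, M (Finsupp.single q 1) p ≠ 0 → Near r' q p) {q : Qubit L l} {u : Config L l}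
    (hu : ∀ p, u p ≠ 0 → Near r q p) {p : Qubit L l} (hp : M u p ≠ 0) : Near (r + r') q p := by
  have key : ∀ v : Config L l, M v p ≠ 0 → ∃ p', v p' ≠ 0 ∧ M (Finsupp.single p' 1) p ≠ 0 := by
    intro v hv
    have h1 : v = v.sum Finsupp.single := (Finsupp.sum_single v).symm
    rw [h1, map_finsuppSum, Finsupp.sum, Finsupp.finsetSum_apply] at hv
    obtain ⟨p', hp', hne⟩ := Finset.exists_ne_zero_of_sum_ne_zero hv
    have h2 : v p' = 1 := (zmod2_cases _).resolve_left (Finsupp.mem_support_iff.1 hp')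
    rw [h2] at hne
    exact ⟨p', Finsupp.mem_support_iff.1 hp', hne⟩
  obtain ⟨p', h1, h2⟩ := key u hp
  exact (hu p' h1).trans (hM _ _ h2)

theorem hopMap_near {q p : Qubit L l} (h : hopMap L l (Finsupp.single q 1) p ≠ 0) : Near 1 q p :=
  hopExp_near (by rwa [hopMap_single] at h)

theorem gaugeMap_near {q p : Qubit L l} (h : gaugeMap L l (Finsupp.single q 1) p ≠ 0) :
    Near 1 q p :=
  hopExpDual_near (by rwa [gaugeMap_single] at h)

theorem single_near {r : ℕ} {q p : Qubit L l} (h : (Finsupp.single q 1 : Config L l) p ≠ 0) :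
    Near r q p := by
  have : q = p := by
    by_contra h'
    exact h (by simp [h'])
  exact this ▸ Near.refl _ _

theorem near_add {r : ℕ} {q p : Qubit L l} {u v : Config L l} (hu : ∀ p, u p ≠ 0 → Near r q p)
    (hv : ∀ p, v p ≠ 0 → Near r q p) (h : (u + v) p ≠ 0) : Near r q p := by
  by_cases h0 : u p = 0
  · exact hv p fun h' => h (by rw [Finsupp.add_apply, h0, h', add_zero])
  · exact hu p h0

/-- A Clifford automorphism of finite range, given by its action on Pauli operators. -/
theorem CliffordData.isQCA (D : CliffordData L l) {r : ℕ}
    (hN : ∀ q p, D.N (Finsupp.single q 1) p ≠ 0 → Near 1 q p)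
    (hκ : ∀ q p, D.κ (Finsupp.single q 1) p ≠ 0 → Near 1 q p)
    (hκ' : ∀ q p, D.κ' (Finsupp.single q 1) p ≠ 0 → Near 1 q p)
    {Φ : Alg L l ≃ₐ[ℂ] Alg L l}
    (h : ∀ p O, IsSignedPauli p O → IsSignedPauli (D.mat p) (Φ O))
    (h' : ∀ p O, IsSignedPauli p O → IsSignedPauli (D.mat p) (Φ.symm O)) (hr : 3 ≤ r) :
    IsQCA r Φ ∧ IsClifford Φ := by
  have hx := fun q => h _ _ (pauAlg_single_x q)
  have hz := fun q => h _ _ (pauAlg_single_z q)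
  have hsx : ∀ q p, (D.mat (Finsupp.single q 1, 0)).1 p ≠ 0 ∨
      (D.mat (Finsupp.single q 1, 0)).2 p ≠ 0 → Near 3 q p := by
    intro q p hp
    -- The range 3 comes from the composite of `κ`, `N` and `κ'`, each of range 1.
    have h2 : ∀ p, D.N (D.κ (Finsupp.single q 1)) p ≠ 0 → Near 2 q p :=
      fun p hp => near_of_map_ne_zero hN (hκ q) hp
    simp only [mat_apply, add_zero, zero_add] at hp
    rcases hp with hp | hp
    · exact near_add (fun p => single_near) (fun p hp => (h2 p hp).mono (by norm_num)) hp
    · exact near_of_map_ne_zero hκ' h2 hp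
  have hsz : ∀ q p, (D.mat (0, Finsupp.single q 1)).1 p ≠ 0 ∨
      (D.mat (0, Finsupp.single q 1)).2 p ≠ 0 → Near 3 q p := by
    intro q p hp
    simp only [mat_apply, map_zero, zero_add] at hp
    rcases hp with hp | hp
    · exact (hN q p hp).mono (by norm_num)
    · exact near_add (fun p => single_near)
        (fun p hp => (near_of_map_ne_zero hκ' (hN q) hp).mono (by norm_num)) hp
  have hloc : ∀ Ψ : Alg L l ≃ₐ[ℂ] Alg L l,
      (∀ p O, IsSignedPauli p O → IsSignedPauli (D.mat p) (Ψ O)) → ∀ (q : Qubit L l)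
      (O : Alg L l), (O : Op L l) ∈ localAlg L l {q} →
      (Ψ O : Op L l) ∈ localAlg L l {q' | Near r q q'} := by
    intro Ψ hΨ q O hO
    refine map_localAlg (Ψ : Alg L l →ₐ[ℂ] Alg L l) (fun p hp => ?_) O hO
    obtain rfl : p = q := hp
    exact ⟨(hΨ _ _ (pauAlg_single_x p)).mem_localAlg
        (fun q hq => (hsx p q (Or.inl hq)).mono hr) (fun q hq => (hsx p q (Or.inr hq)).mono hr),
      (hΨ _ _ (pauAlg_single_z p)).mem_localAlg
        (fun q hq => (hsz p q (Or.inl hq)).mono hr) (fun q hq => (hsz p q (Or.inr hq)).mono hr)⟩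
  refine ⟨⟨map_isAdjoint (Φ : Alg L l →ₐ[ℂ] Alg L l)
    (fun q => (hx q).isAdjoint (D.dot_mat_x q)) (fun q => (hz q).isAdjoint (D.dot_mat_z q)),
    fun q O hO => ⟨hloc Φ h q O hO, hloc Φ.symm h' q O hO⟩⟩,
    fun q => ⟨(hx q).isPauli, (hz q).isPauli⟩⟩

end Kernel

/-! ### Existence and uniqueness of the automata -/

section Automata

variable {d : ℕ} {L : Fin d → ℕ} {l : ℕ}

theorem zBar_eq (hd : d + 1 = 2 * l) (q : Qubit L l) : zBar q = ((zGen q * pauAlg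
    (decoMap hd (Finsupp.single q 1), gaugeMap L l (decoMap hd (Finsupp.single q 1))) :
      Alg L l) : Op L l) := by
  have h : (onSpecies q.1.other fun c' => integral (cup 1 (coboundary (pairing q.1 q.2.1))
      (dual c')) : Qubit L l → ZMod 2) = gaugeMap L l (decoMap hd (Finsupp.single q 1)) := by
    funext p
    rw [gaugeMap_apply, coch_decoMap_single, onSpecies]
    split_ifs
    · rfl
    · rw [cup_zero_left, integral_zero]
  rw [zBar, gaugeOp, h, xCoboundary_eq hd]
  rfl

theorem hopExp_eq (q : Qubit L l) :
    hopExp q = (hopMap L l (Finsupp.single q 1) : Qubit L l → ZMod 2) :=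
  funext fun p => (hopMap_single q p).symm

theorem coe_pauAlg_z (v : Config L l) : (pauAlg (0, v) : Op L l) = zOp v := by
  change xOp 0 * zOp _ = _
  rw [xOp_zero, one_mul]

theorem pauAlg_z_mul (v v' : Config L l) :
    pauAlg (0, v) * pauAlg (0, v') = pauAlg (0, v + v') := by
  rw [pauAlg_mul, map_zero, sgn_zero, one_smul, Prod.mk_add_mk, add_zero]

theorem map_pauAlg_z_congr {Φ Ψ : Alg L l ≃ₐ[ℂ] Alg L l} (h : ∀ q, Φ (zGen q) = Ψ (zGen q))
    (v : Config L l) : Φ (pauAlg (0, v)) = Ψ (pauAlg (0, v)) := by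
  induction v using config_induction with
  | h0 => rw [← Prod.zero_eq_mk, pauAlg_zero, map_one, map_one]
  | hadd v q ih => rw [← pauAlg_z_mul, ← zGen_eq, map_mul, map_mul, h, ih]

theorem map_pauAlg_x_congr {Φ Ψ : Alg L l ≃ₐ[ℂ] Alg L l} (h : ∀ q, Φ (xGen q) = Ψ (xGen q))
    (v : Config L l) : Φ (pauAlg (v, 0)) = Ψ (pauAlg (v, 0)) := by
  induction v using config_induction with
  | h0 => rw [← Prod.zero_eq_mk, pauAlg_zero, map_one, map_one]
  | hadd v q ih => rw [← pauAlg_x_mul, ← xGen_eq, map_mul, map_mul, h, ih]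

/-- Translates the definition by operators, with its auxiliary `E`, into equations in the local
algebra that have the form provided by `CliffordData`. -/
theorem isThreeFermionQCA_iff (hd : d + 1 = 2 * l) {α : Alg L l ≃ₐ[ℂ] Alg L l} :
    IsThreeFermionQCA α ↔
      (∀ q, α (zGen q) = zGen q * pauAlg
        (decoMap hd (Finsupp.single q 1), gaugeMap L l (decoMap hd (Finsupp.single q 1)))) ∧
      (∀ q, α (xGen q) = xGen q * pauAlg (0, hopMap L l (Finsupp.single q 1)) *
        α (pauAlg (0, hopMap L l (Finsupp.single q 1)))) := by
  have hE : ∀ (q : Qubit L l) (E : Alg L l), (E : Op L l) = zOp (hopExp q) ↔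
      E = pauAlg (0, hopMap L l (Finsupp.single q 1)) := fun q E => by
    rw [Subtype.ext_iff, coe_pauAlg_z, hopExp_eq]
  have hop : ∀ q : Qubit L l, hopOp q =
      ((xGen q * pauAlg (0, hopMap L l (Finsupp.single q 1)) : Alg L l) : Op L l) := fun q => by
    rw [MulMemClass.coe_mul, coe_pauAlg_z, ← hopExp_eq]
    rfl
  constructor
  · intro h
    refine ⟨fun q => Subtype.ext ((h q).1.trans (zBar_eq hd q)), fun q => ?_⟩
    obtain ⟨E, h1, h2⟩ := (h q).2
    rw [(hE q E).1 h1, hop] at h2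
    exact Subtype.ext h2
  · rintro ⟨hz, hx⟩ q
    refine ⟨(congrArg Subtype.val (hz q)).trans (zBar_eq hd q).symm, _, (hE q _).2 rfl, ?_⟩
    rw [hop]
    exact congrArg Subtype.val (hx q)

theorem isABQCA_iff (hd : d + 1 = 2 * l) {β : Alg L l ≃ₐ[ℂ] Alg L l} :
    IsABQCA β ↔ (∀ q, β (zGen q) = zGen q * pauAlg (decoMap hd (Finsupp.single q 1), 0)) ∧
      ∀ q, β (xGen q) = xGen q := by
  have hX : ∀ w : Config L l, (pauAlg (w, 0) : Op L l) = xOp w := fun w => by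
    change xOp _ * zOp ((0 : Config L l) : Qubit L l → ZMod 2) = _
    rw [Finsupp.coe_zero, zOp_zero, mul_one]
  have h : ∀ q : Qubit L l, (zGen q : Op L l) * xCoboundary q.1.other (pairing q.1 q.2.1) =
      ((zGen q * pauAlg (decoMap hd (Finsupp.single q 1), 0) : Alg L l) : Op L l) := fun q => by
    rw [xCoboundary_eq hd, MulMemClass.coe_mul, hX]
  constructor
  · exact fun h' => ⟨fun q => Subtype.ext ((h' q).1.trans (h q)), fun q => (h' q).2⟩
  · exact fun h' q => ⟨(congrArg Subtype.val (h'.1 q)).trans (h q).symm, h'.2 q⟩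

/-- For uniqueness: the images of the `Z` operators determine the last factor in the image of each
`X` operator. -/
theorem exists_threeFermionQCA (hd : d + 1 = 2 * l) (L : Fin d → ℕ) :
    ∃ α : Alg L l ≃ₐ[ℂ] Alg L l, IsThreeFermionQCA α ∧ (∀ α', IsThreeFermionQCA α' → α' = α) ∧
      IsQCA 3 α ∧ IsClifford α := by
  obtain ⟨α, hz, hx, h, h'⟩ := (fermionData hd L).exists_equiv
  refine ⟨α, (isThreeFermionQCA_iff hd).2 ⟨hz, hx⟩, fun α' hα' => ?_,
    (fermionData hd L).isQCA (fun _ _ => decoMap_near hd) (fun _ _ => hopMap_near)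
      (fun _ _ => gaugeMap_near) h h' le_rfl⟩
  obtain ⟨hz', hx'⟩ := (isThreeFermionQCA_iff hd).1 hα'
  have hzz : ∀ q, α' (zGen q) = α (zGen q) := fun q => by rw [hz', hz]; rfl
  refine algEquiv_ext (fun q => ?_) hzz
  rw [hx', hx, map_pauAlg_z_congr hzz]
  rfl

/-- The data of the automaton of `½ A ∪ B`. -/
def abData (hd : d + 1 = 2 * l) (L : Fin d → ℕ) : CliffordData L l where
  N := decoMap hd
  κ := 0
  κ' := 0
  N_adj := decoMap_adj hd
  κ_adj a b := by
    rw [AddMonoidHom.zero_apply, AddMonoidHom.zero_apply, map_zero, Finsupp.coe_zero, dot_zero]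
  symm a b := by simp only [AddMonoidHom.zero_apply, Finsupp.coe_zero, dot_zero]
  alt a := by simp only [AddMonoidHom.zero_apply, Finsupp.coe_zero, dot_zero]
  N_single q := (fermionData hd L).N_single q
  N_κ q := by simp only [AddMonoidHom.zero_apply, map_zero]

/-- The circuit of pairings and the automorphism from the linear data satisfy the same equations,
hence coincide. The former supplies the depth, the latter the range and the Clifford property. -/
theorem exists_abQCA (hd : d + 1 = 2 * l) (L : Fin d → ℕ) :
    ∃ β : Alg L l ≃ₐ[ℂ] Alg L l, IsABQCA β ∧ (∀ β', IsABQCA β' → β' = β) ∧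
      IsQCA 3 β ∧ IsClifford β ∧ IsCircuit (czGates L l) (2 * d) 2 β := by
  obtain ⟨β, hx, hz, hc⟩ := exists_isABQCA hd L
  have huniq : ∀ β' : Alg L l ≃ₐ[ℂ] Alg L l, IsABQCA β' → β' = β := fun β' h => by
    obtain ⟨hz', hx'⟩ := (isABQCA_iff hd).1 h
    exact algEquiv_ext (fun q => by rw [hx', hx]) fun q => by rw [hz', hz]
  obtain ⟨Φ, hΦz, hΦx, h, h'⟩ := (abData hd L).exists_equiv
  have hΦ : Φ = β := huniq Φ ((isABQCA_iff hd).2 ⟨hΦz, fun q => by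
    rw [hΦx]
    simp only [abData, AddMonoidHom.zero_apply, ← Prod.zero_eq_mk, pauAlg_zero, map_one, mul_one]⟩)
  subst hΦ
  have h0 : ∀ q p : Qubit L l, (0 : Config L l →+ Config L l) (Finsupp.single q 1) p ≠ 0 →
      Near 1 q p := fun q p h => absurd rfl h
  obtain ⟨h1, h2⟩ := (abData hd L).isQCA (fun _ _ => decoMap_near hd) h0 h0 h h' le_rfl
  exact ⟨Φ, (isABQCA_iff hd).2 ⟨hz, hx⟩, huniq, h1, h2, hc⟩

end Automata

/-! ### The phase integral and its correction by the flux -/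

section PhaseIntegrals

variable {d : ℕ} {L : Fin d → ℕ} {l : ℕ}

/-- `∫ (a ∪₁ a + a ∪₂ δa)`. -/
def sqIntegral (a : Cochain L ℤ) : ℤ := integral (cup 1 a a + cup 2 a (coboundary a))

/-- `∫ b ∪₃ u` for `δa = b + 2u` with `b` reduced modulo two. -/
def fluxIntegral (a : Cochain L ℤ) : ℤ :=
  integral (cup 3 (fun σ => coboundary a σ % 2) fun σ => coboundary a σ / 2)

theorem sqIntegral_eq {a : Cochain L ℤ} (ha : FinSupp a) :
    sqIntegral a = integral (cup 1 a a) + integral (cup 2 a (coboundary a)) :=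
  integral_add (ha.cup_left _ _) (ha.cup_left _ _)

/-- The Leibniz rules for `a ∪₂ h` and `δa ∪₃ h` bring the cross terms into this form. The last one,
with coefficient one, spoils the invariance under changes of the lift and makes the circuits
non-Clifford. -/
theorem sqIntegral_add (hl : Odd l) {a h : Cochain L ℤ} (ha : HasParity l a) (hh : HasParity l h)
    (ha' : FinSupp a) (hh' : FinSupp h) :
    sqIntegral (a + h) = sqIntegral a + sqIntegral h + 2 * integral (cup 1 a h) +
      2 * integral (cup 2 (coboundary a) h) + integral (cup 3 (coboundary a) (coboundary h)) := by
  have h1 := integral_leibniz (k := 1) ha hh ha'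
  have h2 := integral_leibniz (k := 2) ha.coboundary hh ha'.coboundary
  rw [coboundary_coboundary ha, cup_zero_left, integral_zero] at h2
  simp only [pow_add, pow_mul, hl.neg_one_pow, pow_one] at h1 h2
  norm_num at h1 h2
  rw [sqIntegral_eq (ha'.add hh'), sqIntegral_eq ha', sqIntegral_eq hh', coboundary_add,
    integral_cup_add_left _ ha' hh', integral_cup_add_left _ ha' hh',
    integral_cup_add_right _ _ ha' hh', integral_cup_add_right _ _ ha' hh',
    integral_cup_add_right _ _ ha'.coboundary hh'.coboundary,
    integral_cup_add_right _ _ ha'.coboundary hh'.coboundary]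
  linear_combination -h1 - h2

/-- An exact identity over the integers: the Leibniz rules for `δf ∪₂ a`, `f ∪₁ δf` and `f ∪ f`,
where the degree of `f` is even. -/
theorem sqIntegral_add_coboundary (hl : Odd l) {a f : Cochain L ℤ} (ha : HasParity l a)
    (hf : IsOfDegree (l - 1) f) (ha' : FinSupp a) (hf' : FinSupp f) :
    sqIntegral (a + coboundary f) = sqIntegral a + 2 * integral (cup 1 (coboundary f) a) -
      2 * integral (cup 0 f (coboundary f)) := by
  obtain ⟨m, rfl⟩ : ∃ m, l = m + 1 := ⟨l - 1, by have := hl.pos; omega⟩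
  have hm : Even m := by
    rcases Nat.even_or_odd m with h | h
    · exact h
    · exact absurd h.add_one (Nat.not_even_iff_odd.2 hl)
  have hfp : HasParity m f := hf.hasParity
  have h1 := integral_leibniz (k := 1) hfp.coboundary ha hf'.coboundary
  have h2 := integral_leibniz (k := 0) hfp hfp.coboundary hf'
  have h3 := integral_leibniz_zero hfp hfp hf'
  rw [coboundary_coboundary hfp, cup_zero_left, integral_zero] at h1
  rw [coboundary_coboundary hfp, cup_zero_right, integral_zero] at h2
  simp only [pow_add, pow_mul, hm.neg_one_pow, pow_one, one_pow] at h1 h2 h3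
  norm_num at h1 h2 h3
  simp only [hm.neg_one_pow, one_mul] at h1
  rw [sqIntegral_eq (ha'.add hf'.coboundary), sqIntegral_eq ha', coboundary_add,
    coboundary_coboundary hfp, add_zero,
    integral_cup_add_left _ ha' hf'.coboundary, integral_cup_add_left _ ha' hf'.coboundary,
    integral_cup_add_right _ _ ha' hf'.coboundary, integral_cup_add_right _ _ ha' hf'.coboundary]
  linear_combination -h1 + h2 + h3

theorem sqIntegral_two_smul {a : Cochain L ℤ} (ha : FinSupp a) :
    sqIntegral ((2 : ℤ) • a) = 4 * sqIntegral a := by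
  rw [sqIntegral_eq (ha.smul 2), sqIntegral_eq ha, coboundary_smul,
    integral_cup_smul_left _ _ ha, integral_cup_smul_left _ _ ha, integral_cup_smul_right _ _ _ ha,
    integral_cup_smul_right _ _ _ ha.coboundary]
  ring

theorem FinSupp.comp {c : Cochain L ℤ} (hc : FinSupp c) {f : ℤ → ℤ} (hf : f 0 = 0) :
    FinSupp fun σ => f (c σ) :=
  Set.Finite.subset hc fun σ hσ h => hσ (by beta_reduce; rw [h, hf])

/-- The residue of `δa` modulo two is unchanged, and its quotient grows by `δh`. -/
theorem fluxIntegral_add_two_smul {a h : Cochain L ℤ} (ha' : FinSupp a) (hh' : FinSupp h) :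
    fluxIntegral (a + (2 : ℤ) • h) = fluxIntegral a +
      integral (cup 3 (fun σ => coboundary a σ % 2) (coboundary h)) := by
  have h1 : (fun σ => coboundary (a + (2 : ℤ) • h) σ % 2) = fun σ => coboundary a σ % 2 := by
    funext σ
    rw [coboundary_add, coboundary_smul]
    simp only [Pi.add_apply, Pi.smul_apply, smul_eq_mul]
    omega
  have h2 : (fun σ => coboundary (a + (2 : ℤ) • h) σ / 2) =
      (fun σ => coboundary a σ / 2) + coboundary h := by
    funext σ
    rw [coboundary_add, coboundary_smul]
    simp only [Pi.add_apply, Pi.smul_apply, smul_eq_mul]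
    omega
  rw [fluxIntegral, h1, h2, integral_cup_add_right _ _ (ha'.coboundary.comp (f := (· / 2)) rfl)
    hh'.coboundary]
  rfl

/-- The phase integral with the correction that makes it invariant modulo four under changes of
the integer lift. -/
def fullIntegral (a : Cochain L ℤ) : ℤ := sqIntegral a + 2 * fluxIntegral a

/-- Let `δa = b + 2u`. Modulo 4 the first summand changes by `2 ∫ δa ∪₃ δh` and the correction by `2
∫ b ∪₃ δh`; together this is `4 ∫ (b + u) ∪₃ δh`. -/
theorem fullIntegral_add_two_smul (hl : Odd l) {a h : Cochain L ℤ} (ha : HasParity l a)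
    (hh : HasParity l h) (ha' : FinSupp a) (hh' : FinSupp h) :
    (4 : ℤ) ∣ fullIntegral (a + (2 : ℤ) • h) - fullIntegral a := by
  have hh2 : HasParity l ((2 : ℤ) • h) := fun σ hσ => hh σ fun h0 => hσ (by simp [h0])
  have h1 : coboundary a = (fun σ => coboundary a σ % 2) + (2 : ℤ) • fun σ => coboundary a σ / 2 := by
    funext σ
    simp only [Pi.add_apply, Pi.smul_apply, smul_eq_mul]
    omega
  have h2 : integral (cup 3 (coboundary a) (coboundary h)) =
      integral (cup 3 (fun σ => coboundary a σ % 2) (coboundary h)) +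
        2 * integral (cup 3 (fun σ => coboundary a σ / 2) (coboundary h)) := by
    conv_lhs => rw [h1]
    rw [integral_cup_add_left _ (ha'.coboundary.comp (f := (· % 2)) rfl)
      ((ha'.coboundary.comp (f := (· / 2)) rfl).smul 2),
      integral_cup_smul_left _ _ (ha'.coboundary.comp (f := (· / 2)) rfl)]
  rw [fullIntegral, fullIntegral, fluxIntegral_add_two_smul ha' hh',
    sqIntegral_add hl ha hh2 ha' (hh'.smul 2), sqIntegral_two_smul hh', coboundary_smul,
    integral_cup_smul_right _ _ _ hh', integral_cup_smul_right _ _ _ hh',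
    integral_cup_smul_right _ _ _ hh'.coboundary, h2]
  refine ⟨sqIntegral h + integral (cup 1 a h) + integral (cup 2 (coboundary a) h) +
    integral (cup 3 (fun σ => coboundary a σ % 2) (coboundary h)) +
    integral (cup 3 (fun σ => coboundary a σ / 2) (coboundary h)), ?_⟩
  ring

theorem fluxIntegral_add_coboundary {p : ℕ} (a : Cochain L ℤ) {f : Cochain L ℤ}
    (hf : HasParity p f) : fluxIntegral (a + coboundary f) = fluxIntegral a := by
  rw [fluxIntegral, coboundary_add, coboundary_coboundary hf, add_zero]
  rfl

theorem fullIntegral_add_coboundary (hl : Odd l) {a f : Cochain L ℤ} (ha : HasParity l a)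
    (hf : IsOfDegree (l - 1) f) (ha' : FinSupp a) (hf' : FinSupp f) :
    fullIntegral (a + coboundary f) = fullIntegral a + 2 * integral (cup 1 (coboundary f) a) -
      2 * integral (cup 0 f (coboundary f)) := by
  rw [fullIntegral, fluxIntegral_add_coboundary a hf.hasParity,
    sqIntegral_add_coboundary hl ha hf ha' hf', fullIntegral]
  ring

theorem fluxIntegral_eq_zero {a : Cochain L ℤ} (h : ∀ σ, (2 : ℤ) ∣ coboundary a σ) :
    fluxIntegral a = 0 := by
  have h0 : (fun σ => coboundary a σ % 2) = 0 := funext fun σ => Int.emod_eq_zero_of_dvd (h σ)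
  rw [fluxIntegral, h0, cup_zero_left, integral_zero]

/-- Reduction modulo two. -/
def modTwo (a : Cochain L ℤ) : Cochain L (ZMod 2) := fun σ => (a σ : ZMod 2)

theorem cup_modTwo (k : ℕ) (a b : Cochain L ℤ) : cup k (modTwo a) (modTwo b) = modTwo (cup k a b) := by
  funext σ
  simp only [cup, modTwo]
  push_cast
  rfl

theorem coboundary_modTwo (a : Cochain L ℤ) : coboundary (modTwo a) = modTwo (coboundary a) :=
  coboundary_map (Int.castAddHom (ZMod 2)) a

theorem integral_modTwo {a : Cochain L ℤ} (ha : FinSupp a) :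
    integral (modTwo a) = ((integral a : ℤ) : ZMod 2) :=
  integral_map (Int.castRingHom (ZMod 2)) ha

end PhaseIntegrals

/-! ### Integer lifts of configurations -/

section LiftedConfigurations

variable {d : ℕ} {L : Fin d → ℕ} {l : ℕ}

theorem modTwo_liftCochain (s : Config L l) (t : Species) : modTwo (liftCochain s t) = coch t s := by
  funext σ
  simp only [modTwo, liftCochain, coch]
  split_ifs
  · simp
  · simp

theorem isOfDegree_liftCochain (s : Config L l) (t : Species) : IsOfDegree l (liftCochain s t) :=
  fun _ h => dif_neg h

theorem liftCochain_eq_zero {s : Config L l} {t : Species} {σ : Cell L} (h : coch t s σ = 0) :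
    liftCochain s t σ = 0 := by
  unfold coch at h
  unfold liftCochain
  split_ifs at h ⊢ with h1
  · rw [h]; rfl
  · rfl

theorem finSupp_liftCochain (s : Config L l) (t : Species) : FinSupp (liftCochain s t) :=
  Set.Finite.subset (finSupp_coch t s) fun _ h h0 => h (liftCochain_eq_zero h0)

/-- Integer cochains that agree modulo two have the same phase integral modulo four. -/
theorem fullIntegral_congr (hl : Odd l) {a b : Cochain L ℤ} (ha : IsOfDegree l a)
    (hb : IsOfDegree l b) (ha' : FinSupp a) (hb' : FinSupp b) (h : modTwo a = modTwo b) :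
    (4 : ℤ) ∣ fullIntegral a - fullIntegral b := by
  have hdvd : ∀ σ, (2 : ℤ) ∣ a σ - b σ := fun σ => by
    have h1 := congrFun h σ
    simp only [modTwo] at h1
    exact (ZMod.intCast_eq_intCast_iff_dvd_sub _ _ 2).1 h1.symm
  choose c hc using hdvd
  have hab : a = b + (2 : ℤ) • c := funext fun σ => by
    simp only [Pi.add_apply, Pi.smul_apply, smul_eq_mul]
    linarith [hc σ]
  have hc0 : ∀ σ, a σ = 0 → b σ = 0 → c σ = 0 := fun σ h1 h2 => by
    have := hc σ
    rw [h1, h2] at this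
    omega
  have hcd : IsOfDegree l c := fun σ hσ => hc0 σ (ha σ hσ) (hb σ hσ)
  have hcf : FinSupp c := Set.Finite.subset (ha'.union hb') fun σ hσ => by
    by_contra h'
    simp only [Set.mem_union, Function.mem_support, not_or, not_not] at h'
    exact hσ (hc0 σ h'.1 h'.2)
  rw [hab]
  exact fullIntegral_add_two_smul hl hb.hasParity hcd.hasParity hb' hcf

end LiftedConfigurations

/-! ### Fourth roots of unity -/

section QuarterPhase

/-- `exp(-2πi n / 4)`. -/
def quarterPhase (n : ℤ) : ℂ := Complex.exp (-(2 * Real.pi * Complex.I / 4) * (n : ℂ))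

theorem quarterPhase_add (m n : ℤ) : quarterPhase (m + n) = quarterPhase m * quarterPhase n := by
  rw [quarterPhase, quarterPhase, quarterPhase, ← Complex.exp_add]
  congr 1
  push_cast
  ring

theorem norm_quarterPhase (n : ℤ) : ‖quarterPhase n‖ = 1 := by
  rw [quarterPhase, show (-(2 * Real.pi * Complex.I / 4) * (n : ℂ) : ℂ) =
    ((-(2 * Real.pi / 4) * n : ℝ) : ℂ) * Complex.I by push_cast; ring,
    Complex.norm_exp_ofReal_mul_I]

theorem quarterPhase_ne_zero (n : ℤ) : quarterPhase n ≠ 0 := Complex.exp_ne_zero _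

theorem quarterPhase_sub (m n : ℤ) : quarterPhase (m - n) = quarterPhase m / quarterPhase n := by
  rw [eq_div_iff (quarterPhase_ne_zero n), ← quarterPhase_add, sub_add_cancel]

theorem quarterPhase_four_mul (n : ℤ) : quarterPhase (4 * n) = 1 := by
  rw [quarterPhase, Complex.exp_eq_one_iff]
  exact ⟨-n, by push_cast; ring⟩

theorem quarterPhase_congr {m n : ℤ} (h : (4 : ℤ) ∣ m - n) : quarterPhase m = quarterPhase n := by
  obtain ⟨k, hk⟩ := h
  rw [show m = n + 4 * k by linarith, quarterPhase_add, quarterPhase_four_mul, mul_one]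

theorem quarterPhase_two : quarterPhase 2 = -1 := by
  rw [quarterPhase, show (-(2 * Real.pi * Complex.I / 4) * ((2 : ℤ) : ℂ) : ℂ) =
    -(Real.pi * Complex.I) by push_cast; ring, Complex.exp_neg, Complex.exp_pi_mul_I]
  norm_num

theorem quarterPhase_two_mul (n : ℤ) : quarterPhase (2 * n) = sgn (n : ZMod 2) := by
  rcases Int.even_or_odd' n with ⟨k, rfl | rfl⟩
  · rw [show (2 : ℤ) * (2 * k) = 4 * k by ring, quarterPhase_four_mul]
    push_cast
    rw [show (2 : ZMod 2) = 0 from rfl, zero_mul, sgn_zero]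
  · rw [show (2 : ℤ) * (2 * k + 1) = 4 * k + 2 by ring, quarterPhase_add, quarterPhase_four_mul,
      quarterPhase_two]
    push_cast
    rw [show (2 : ZMod 2) = 0 from rfl, zero_mul, zero_add, sgn_one, one_mul]

theorem quarterPhase_ne_sgn {n : ℤ} (hn : (n : ZMod 2) = 1) (a : ZMod 2) :
    quarterPhase n ≠ sgn a := by
  intro h
  have h1 : quarterPhase (2 * n) = sgn a * sgn a := by
    rw [two_mul, quarterPhase_add, h]
  rw [sgn_mul_self, quarterPhase_two_mul, hn, sgn_one] at h1
  norm_num at h1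

end QuarterPhase

/-! ### Locality of the phases of `V` and `w` -/

section PhaseLocality

variable {d : ℕ} {L : Fin d → ℕ} {l : ℕ}

/-- A sum of local functions changes by a local function when a qubit is flipped. -/
theorem isLocalFun_finsum_sub {R : ℕ} {e : Pos L → Config L l → ℤ}
    (he : ∀ x, IsLocalFun {q | NearPos R x q.2.1.1} (e x))
    (hfin : ∀ s, (Function.support fun x => e x s).Finite) (q : Qubit L l) :
    IsLocalFun {q' | Near (2 * R) q q'} fun s =>
      (∑ᶠ x, e x (s + Finsupp.single q 1)) - ∑ᶠ x, e x s := by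
  intro s p hp
  beta_reduce
  rw [← finsum_sub_distrib (hfin _) (hfin _), ← finsum_sub_distrib (hfin _) (hfin _)]
  refine finsum_congr fun x => ?_
  -- As `p` and `q` are more than `2 * R` apart, the density at `x` cannot depend on both.
  by_cases hpx : NearPos R x p.2.1.1
  · have hq : ¬ NearPos R x q.2.1.1 := fun h => hp (by
      rw [two_mul]
      exact h.symm.trans hpx)
    rw [he x _ q hq, he x _ q hq, sub_self, sub_self]
  · rw [add_right_comm, he x _ p hpx, he x _ p hpx]

theorem cup_congr_near {R : Type*} [CommRing R] {k : ℕ} {b b' c c' : Cochain L R} {x : Pos L}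
    (hb : ∀ A U, b (x + shift L A, U) = b' (x + shift L A, U))
    (hc : ∀ A U, c (x + shift L A, U) = c' (x + shift L A, U)) (S : Finset (Fin d)) :
    cup k b c (x, S) = cup k b' c' (x, S) := by
  simp only [cup_apply, cupTerm, hb, hc]

theorem coboundary_congr_near {R : Type*} [AddCommGroup R] {b b' : Cochain L R} {x : Pos L}
    (hb : ∀ A U, b (x + shift L A, U) = b' (x + shift L A, U)) (S : Finset (Fin d)) :
    coboundary b (x, S) = coboundary b' (x, S) := by
  have h0 : ∀ U, b (x, U) = b' (x, U) := fun U => by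
    have := hb ∅ U
    rwa [shift_empty, add_zero] at this
  simp only [coboundary, hb, h0]

theorem liftCochain_congr {s s' : Config L l} {x : Pos L} {R : ℕ}
    (h : ∀ q : Qubit L l, NearPos R x q.2.1.1 → s q = s' q) (t : Species) {y : Pos L}
    (hy : NearPos R x y) (U : Finset (Fin d)) :
    liftCochain s t (y, U) = liftCochain s' t (y, U) := by
  unfold liftCochain
  split_ifs with h1
  · rw [h (t, ⟨(y, U), h1⟩) hy]
  · rfl

/-- The radius is 2: a cup product looks one unit away, and a coboundary inside it one unit further.
The integrals therefore have range 4. -/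
theorem isLocalFun_densities (t : Species) (x : Pos L) (S : Finset (Fin d)) :
    IsLocalFun (l := l) {q | NearPos 2 x q.2.1.1} (fun s =>
      (cup 1 (liftCochain s t) (liftCochain s t) +
        cup 2 (liftCochain s t) (coboundary (liftCochain s t))) (x, S)) ∧
    IsLocalFun (l := l) {q | NearPos 2 x q.2.1.1} (fun s =>
      cup 3 (fun σ => coboundary (liftCochain s t) σ % 2)
        (fun σ => coboundary (liftCochain s t) σ / 2) (x, S)) := by
  have key : ∀ s s' : Config L l, (∀ q ∈ {q : Qubit L l | NearPos 2 x q.2.1.1}, s q = s' q) →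
      (∀ A U, liftCochain s t (x + shift L A, U) = liftCochain s' t (x + shift L A, U)) ∧
      (∀ A U, coboundary (liftCochain s t) (x + shift L A, U) =
        coboundary (liftCochain s' t) (x + shift L A, U)) := fun s s' h =>
    ⟨fun A U => liftCochain_congr h t ((nearPos_shift x A).mono one_le_two) U,
      fun A U => coboundary_congr_near (fun B W => liftCochain_congr h t
        ((nearPos_shift x A).trans (nearPos_shift _ B)) W) U⟩
  refine ⟨isLocalFun_of_congr fun s s' h => ?_, isLocalFun_of_congr fun s s' h => ?_⟩
  · obtain ⟨h1, h2⟩ := key s s' h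
    rw [Pi.add_apply, Pi.add_apply, cup_congr_near h1 h1, cup_congr_near h1 h2]
  · obtain ⟨h1, h2⟩ := key s s' h
    exact cup_congr_near (fun A U => by rw [h2]) (fun A U => by rw [h2]) S

theorem isLocalPhase_quarterPhase {n : Config L l → ℤ} {R : ℕ}
    (h : ∀ q, IsLocalFun {q' | Near R q q'} fun s => n (s + Finsupp.single q 1) - n s) :
    IsLocalPhase R fun s => quarterPhase (n s) :=
  ⟨fun s => norm_quarterPhase _, fun q s p hp => by
    have := h q s p hp
    simp only [← quarterPhase_sub] at this ⊢
    rw [this]⟩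

theorem isLocalFun_sqIntegral (t : Species) (q : Qubit L l) : IsLocalFun {q' | Near 4 q q'}
    fun s => sqIntegral (liftCochain (s + Finsupp.single q 1) t) - sqIntegral (liftCochain s t) :=
  isLocalFun_finsum_sub (fun x => (isLocalFun_densities t x Finset.univ).1)
    (fun s => FinSupp.top (((finSupp_liftCochain s t).cup_left _ _).add
      ((finSupp_liftCochain s t).cup_left _ _)) _) q

theorem isLocalFun_fluxIntegral (t : Species) (q : Qubit L l) : IsLocalFun {q' | Near 4 q q'}
    fun s => fluxIntegral (liftCochain (s + Finsupp.single q 1) t) -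
      fluxIntegral (liftCochain s t) :=
  isLocalFun_finsum_sub (fun x => (isLocalFun_densities t x Finset.univ).2)
    (fun s => FinSupp.top (((finSupp_liftCochain s t).coboundary.comp (f := (· % 2)) rfl).cup_left
      _ _) _) q

/-- The phases of the circuit `V`. -/
def thetaV (s : Config L l) : ℂ := phaseV .A s * phaseV .B s

/-- The phases of the circuit `w`. -/
def thetaW (s : Config L l) : ℂ :=
  quarterPhase (fullIntegral (liftCochain s .A)) * quarterPhase (fullIntegral (liftCochain s .B))

theorem phaseV_eq (t : Species) (s : Config L l) :
    phaseV t s = quarterPhase (sqIntegral (liftCochain s t)) := rfl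

theorem isLocalPhase_thetaV : IsLocalPhase (L := L) (l := l) 4 thetaV :=
  (isLocalPhase_quarterPhase (isLocalFun_sqIntegral .A)).mul
    (isLocalPhase_quarterPhase (isLocalFun_sqIntegral .B))

theorem isLocalFun_fullIntegral (t : Species) (q : Qubit L l) : IsLocalFun {q' | Near 4 q q'}
    fun s => fullIntegral (liftCochain (s + Finsupp.single q 1) t) -
      fullIntegral (liftCochain s t) := fun s p hp => by
  have h1 := isLocalFun_sqIntegral t q s p hp
  have h2 := isLocalFun_fluxIntegral t q s p hp
  simp only [fullIntegral] at h1 h2 ⊢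
  linarith

theorem isLocalPhase_thetaW : IsLocalPhase (L := L) (l := l) 4 thetaW :=
  (isLocalPhase_quarterPhase (isLocalFun_fullIntegral .A)).mul
    (isLocalPhase_quarterPhase (isLocalFun_fullIntegral .B))

theorem thetaW_eq_thetaV {s : Config L l} (hs : IsFluxFree s) : thetaW s = thetaV s := by
  rw [thetaW, thetaV, phaseV_eq, phaseV_eq, fullIntegral, fullIntegral,
    fluxIntegral_eq_zero (hs .A), fluxIntegral_eq_zero (hs .B), mul_zero, add_zero, add_zero]

end PhaseLocality

/-! ### Behaviour of the phase of `w` under gauge transformations -/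

section GaugeTransformations

variable {d : ℕ} {L : Fin d → ℕ} {l : ℕ}

theorem modTwo_add (a b : Cochain L ℤ) : modTwo (a + b) = modTwo a + modTwo b := by
  funext σ; simp [modTwo]

theorem modTwo_dual (c : Cell L) : modTwo (dual c) = dual c := by
  funext σ
  by_cases h : σ = c
  · subst h; simp [modTwo, dual]
  · simp [modTwo, dual, h]

/-- The lift of `s + w` agrees with the lift of `s` plus `δf` only modulo two; invariance under
changes of the lift allows the exact formula for adding `δf` to be used nevertheless. -/
theorem quarterPhase_fullIntegral_add (hl : Odd l) (t : Species) (s w : Config L l)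
    {f : Cochain L ℤ} (hf : IsOfDegree (l - 1) f) (hf' : FinSupp f)
    (hw : coch t w = modTwo (coboundary f)) :
    quarterPhase (fullIntegral (liftCochain (s + w) t)) =
      sgn (integral (cup 1 (coch t w) (coch t s))) *
        sgn (integral (cup 0 (modTwo f) (coboundary (modTwo f)))) *
        quarterPhase (fullIntegral (liftCochain s t)) := by
  have hdeg : IsOfDegree l (liftCochain s t + coboundary f) := fun σ hσ => by
    have h1 := isOfDegree_coboundary hf
    rw [Nat.sub_add_cancel hl.pos] at h1
    rw [Pi.add_apply, isOfDegree_liftCochain s t σ hσ, h1 σ hσ, add_zero]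
  rw [quarterPhase_congr (fullIntegral_congr hl (isOfDegree_liftCochain (s + w) t) hdeg
    (finSupp_liftCochain _ _) ((finSupp_liftCochain s t).add hf'.coboundary) (by
      rw [modTwo_liftCochain, coch_add, modTwo_add, modTwo_liftCochain, hw])),
    fullIntegral_add_coboundary hl (isOfDegree_liftCochain s t).hasParity hf
      (finSupp_liftCochain _ _) hf', quarterPhase_sub, quarterPhase_add, quarterPhase_two_mul,
    quarterPhase_two_mul, hw, ← modTwo_liftCochain, cup_modTwo, coboundary_modTwo, cup_modTwo,
    integral_modTwo (hf'.coboundary.cup_left _ _), integral_modTwo (hf'.cup_left _ _),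
    div_eq_iff (sgn_ne_zero _)]
  linear_combination (-(quarterPhase (fullIntegral (liftCochain s t))) *
    sgn ((integral (cup 1 (coboundary f) (liftCochain s t)) : ℤ) : ZMod 2)) *
      sgn_mul_self ((integral (cup 0 f (coboundary f)) : ℤ) : ZMod 2)

/-- The sign of the decoration of a separator under the circuit `w`. -/
def decoSign (q : Qubit L l) : ZMod 2 :=
  integral (cup 0 (pairing q.1 q.2.1) (coboundary (pairing q.1 q.2.1)))

/-- A cell of `δf` contains the directions of `f`. As `f` has positive dimension `l - 1`, no such
cell is complementary to `f`, so `∫ f ∪ δf` vanishes. -/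
theorem decoSign_eq_zero (hd : d + 1 = 2 * l) (hl : 2 ≤ l) (q : Qubit L l) : decoSign q = 0 := by
  obtain ⟨x, hx⟩ := pairing_eq_dual q
  rw [decoSign, hx, integral_cup_zero_dual, coboundary_dual_apply]
  refine Finset.sum_eq_zero fun i _ => if_neg ?_
  simp only [compl_compl]
  rintro ⟨hi, h⟩
  have h1 : (q.2.1.2)ᶜ.card = l - 1 := by
    rw [Finset.card_compl, Fintype.card_fin, q.2.2]
    omega
  obtain ⟨j, hj⟩ := Finset.card_pos.1 (show 0 < (q.2.1.2)ᶜ.card by omega)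
  have h2 := Finset.mem_of_mem_erase (h ▸ hj)
  exact Finset.mem_compl.1 hj h2

/-- The decoration is a coboundary `δf` on a single species. The sign of `∫ δf ∪₁ s` is that of the
`Z` part of the gauge constraint. -/
theorem thetaW_add_decoMap (hd : d + 1 = 2 * l) (hl : Odd l) (q : Qubit L l) (s : Config L l) :
    thetaW (s + decoMap hd (Finsupp.single q 1)) = sgn (decoSign q) *
      sgn (dot (gaugeMap L l (decoMap hd (Finsupp.single q 1))) s) * thetaW s := by
  have h1 : ∀ t, quarterPhase (fullIntegral
      (liftCochain (s + decoMap hd (Finsupp.single q 1)) t)) =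
      sgn (integral (cup 1 (coch t (decoMap hd (Finsupp.single q 1))) (coch t s))) *
        sgn (if t = q.1.other then decoSign q else 0) *
        quarterPhase (fullIntegral (liftCochain s t)) := fun t => by
    by_cases ht : t = q.1.other
    · obtain ⟨x, hx⟩ := pairing_eq_dual q
      have h2 := quarterPhase_fullIntegral_add hl t s (decoMap hd (Finsupp.single q 1))
        (f := dual (x, q.2.1.2ᶜ)) (fun σ hσ => by
          refine Pi.single_eq_of_ne (fun h => hσ ?_) _
          rw [h, Finset.card_compl, Fintype.card_fin, q.2.2]
          omega) (finSupp_dual _) (by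
          rw [coch_decoMap_single, if_pos ht, ← coboundary_modTwo, modTwo_dual, hx])
      rw [h2, if_pos ht, modTwo_dual, decoSign, hx]
    · have h2 := quarterPhase_fullIntegral_add hl t s (decoMap hd (Finsupp.single q 1))
        (f := 0) (fun _ _ => rfl) finSupp_zero (by
          rw [coch_decoMap_single, if_neg ht, ← coboundary_modTwo]
          have : modTwo (0 : Cochain L ℤ) = 0 := by funext σ; simp [modTwo]
          rw [this]
          simpa using (coboundary_smul (0 : ZMod 2) (0 : Cochain L (ZMod 2))).symm)
      have : modTwo (0 : Cochain L ℤ) = 0 := by funext σ; simp [modTwo]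
      rw [h2, if_neg ht, this, cup_zero_left, integral_zero]
  rw [thetaW, h1, h1, dot_gaugeMap, sgn_add, thetaW]
  have h3 : sgn (decoSign q) = sgn (if Species.A = q.1.other then decoSign q else 0) *
      sgn (if Species.B = q.1.other then decoSign q else 0) := by
    cases q.1 <;> simp [Species.other, sgn_zero]
  rw [h3]
  ring

/-- Conjugation by `w` turns the decorations of `½ A ∪ B` into gauge constraints. -/
theorem IsDiagConj.map_deco (hd : d + 1 = 2 * l) (hl : Odd l) {w : Alg L l ≃ₐ[ℂ] Alg L l}
    (hw : IsDiagConj thetaW w) (q : Qubit L l) :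
    w (pauAlg (decoMap hd (Finsupp.single q 1), 0)) = sgn (decoSign q) •
      pauAlg (decoMap hd (Finsupp.single q 1), gaugeMap L l (decoMap hd (Finsupp.single q 1))) := by
  refine Subtype.ext (diagOp_mul_right_cancel isLocalPhase_thetaW.ne_zero ((hw _).trans ?_))
  change diagOp thetaW * (xOp _ * zOp ((0 : Config L l) : Qubit L l → ZMod 2)) =
    (sgn _ • (xOp _ * zOp _) : Op L l) * diagOp thetaW
  rw [Finsupp.coe_zero, zOp_zero, mul_one]
  refine op_ext fun s => ?_
  simp only [Module.End.mul_apply, LinearMap.smul_apply, xOp_ket, diagOp_ket, map_smul, zOp_ket,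
    smul_smul, thetaW_add_decoMap hd hl]
  congr 1
  ring

end GaugeTransformations

/-! ### The automaton `β⁻¹ w⁻¹ α w` and the circuit for `α` -/

section Conjugation

variable {d : ℕ} {L : Fin d → ℕ} {l : ℕ}

theorem conj_mul_self_of_norm {z : ℂ} (h : ‖z‖ = 1) : (starRingEnd ℂ) z = z⁻¹ := by
  refine eq_inv_of_mul_eq_one_left ?_
  rw [mul_comm, Complex.mul_conj, Complex.normSq_eq_norm_sq, h]
  simp

theorem IsDiagConj.eq_conj {θ : Config L l → ℂ} (hθ : ∀ s, θ s ≠ 0) {Φ : Alg L l ≃ₐ[ℂ] Alg L l}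
    (h : IsDiagConj θ Φ) (O : Alg L l) :
    (Φ O : Op L l) = diagOp θ * O * diagOp fun s => (θ s)⁻¹ := by
  rw [← h O, mul_assoc, diagOp_mul_inv hθ, mul_one]

/-- `Φ` commutes with the formation of adjoints. -/
def IsStar (Φ : Alg L l ≃ₐ[ℂ] Alg L l) : Prop :=
  ∀ O O' : Alg L l, IsAdjoint (O : Op L l) O' → IsAdjoint (Φ O : Op L l) (Φ O')

theorem IsStar.mul {Φ Ψ : Alg L l ≃ₐ[ℂ] Alg L l} (h : IsStar Φ) (h' : IsStar Ψ) :
    IsStar (Φ * Ψ) := fun O O' hO => h _ _ (h' O O' hO)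

theorem IsDiagConj.isStar {θ : Config L l → ℂ} (hθ : ∀ s, ‖θ s‖ = 1)
    {Φ : Alg L l ≃ₐ[ℂ] Alg L l} (h : IsDiagConj θ Φ) : IsStar Φ := fun O O' hO => by
  have h0 := ne_zero_of_norm_one hθ
  rw [h.eq_conj h0, h.eq_conj h0]
  have h1 := isAdjoint_diagOp θ
  have h2 := isAdjoint_diagOp fun s => (θ s)⁻¹
  simp only [map_inv₀, conj_mul_self_of_norm (hθ _), inv_inv] at h1 h2
  have := (h1.mul hO).mul h2
  rwa [← mul_assoc] at this

/-- `Φ` enlarges the supports of the Pauli operators by at most `r`. -/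
def HasRange (r : ℕ) (Φ : Alg L l ≃ₐ[ℂ] Alg L l) : Prop :=
  ∀ q : Qubit L l, (Φ (xGen q) : Op L l) ∈ localAlg L l {q' | Near r q q'} ∧
    (Φ (zGen q) : Op L l) ∈ localAlg L l {q' | Near r q q'}

theorem HasRange.mul {r r' : ℕ} {Φ Ψ : Alg L l ≃ₐ[ℂ] Alg L l} (h : HasRange r Φ)
    (h' : HasRange r' Ψ) : HasRange (r' + r) (Φ * Ψ) := by
  have key : ∀ (q : Qubit L l) (O : Alg L l), (O : Op L l) ∈ localAlg L l {q' | Near r' q q'} →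
      (Φ O : Op L l) ∈ localAlg L l {q' | Near (r' + r) q q'} := fun q O hO =>
    map_localAlg (Φ : Alg L l →ₐ[ℂ] Alg L l) (fun p hp =>
      ⟨localAlg_mono (fun _ hq' => Near.trans hp hq') (h p).1,
        localAlg_mono (fun _ hq' => Near.trans hp hq') (h p).2⟩) O hO
  exact fun q => ⟨key q _ (h' q).1, key q _ (h' q).2⟩

theorem xGen_mem {q : Qubit L l} {S : Set (Qubit L l)} (h : q ∈ S) :
    (xGen q : Op L l) ∈ localAlg L l S := Algebra.subset_adjoin ⟨q, h, Or.inl rfl⟩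

theorem zGen_mem {q : Qubit L l} {S : Set (Qubit L l)} (h : q ∈ S) :
    (zGen q : Op L l) ∈ localAlg L l S := Algebra.subset_adjoin ⟨q, h, Or.inr rfl⟩

theorem IsQCA.hasRange {r : ℕ} {Φ : Alg L l ≃ₐ[ℂ] Alg L l} (h : IsQCA r Φ) : HasRange r Φ :=
  fun q => ⟨(h.2 q _ (xGen_mem rfl)).1, (h.2 q _ (zGen_mem rfl)).1⟩

theorem IsDiagConj.hasRange {R : ℕ} {θ : Config L l → ℂ} (hθ : IsLocalPhase R θ)
    {Φ : Alg L l ≃ₐ[ℂ] Alg L l} (h : IsDiagConj θ Φ) : HasRange R Φ := fun q => by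
  refine ⟨?_, ?_⟩
  · rw [h.map_xGen hθ.ne_zero]
    exact mul_mem (xGen_mem (Near.refl _ _))
      (zAlg_le _ (diagOp_mem_zAlg (near_finite R q) (hθ.2 q)))
  · rw [h.map_zGen hθ.ne_zero]
    exact zGen_mem (Near.refl _ _)

theorem IsABQCA.mul_self {β : Alg L l ≃ₐ[ℂ] Alg L l} (hd : d + 1 = 2 * l) (hβ : IsABQCA β) :
    β * β = 1 := by
  obtain ⟨hz, hx⟩ := (isABQCA_iff hd).1 hβ
  refine algEquiv_ext (fun q => ?_) fun q => ?_
  · rw [AlgEquiv.mul_apply, hx, hx]; rfl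
  · have h1 : β (pauAlg (decoMap hd (Finsupp.single q 1), 0)) =
        pauAlg (decoMap hd (Finsupp.single q 1), 0) :=
      map_pauAlg_x_congr (Ψ := 1) (fun q => hx q) _
    rw [AlgEquiv.mul_apply, hz, map_mul, hz, h1, mul_assoc, pauAlg_x_mul, config_add_self,
      ← Prod.zero_eq_mk, pauAlg_zero, mul_one]
    rfl

/-- `w` fixes `Z_q` and turns its decoration under `β` into its decoration under `α` up to a sign,
so `α (Z_q) = ± w (β (Z_q))`. -/
theorem conj_map_zGen (hd : d + 1 = 2 * l) (hl : Odd l) {α β w : Alg L l ≃ₐ[ℂ] Alg L l}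
    (hα : IsThreeFermionQCA α) (hβ : IsABQCA β) (hw : IsDiagConj thetaW w) (q : Qubit L l) :
    (β⁻¹ * (w⁻¹ * α * w)) (zGen q) = sgn (decoSign q) • zGen q := by
  obtain ⟨hαz, -⟩ := (isThreeFermionQCA_iff hd).1 hα
  obtain ⟨hβz, -⟩ := (isABQCA_iff hd).1 hβ
  have hwz : ∀ q, w (zGen q) = zGen q := hw.map_zGen isLocalPhase_thetaW.ne_zero
  have h1 : (w⁻¹ * α * w) (zGen q) = sgn (decoSign q) • β (zGen q) := by
    have h2 : α (w (zGen q)) = w (sgn (decoSign q) • β (zGen q)) := by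
      rw [hwz, hαz, hβz, map_smul, map_mul, hwz, hw.map_deco hd hl, mul_smul_comm, smul_smul,
        sgn_mul_self, one_smul]
    rw [mul_assoc, AlgEquiv.mul_apply, AlgEquiv.mul_apply, h2, ← AlgEquiv.mul_apply,
      inv_mul_cancel, AlgEquiv.one_apply]
  rw [AlgEquiv.mul_apply, h1, map_smul, ← AlgEquiv.mul_apply, inv_mul_cancel, AlgEquiv.one_apply]

/-- The automaton `γ = β⁻¹ w⁻¹ α w` is, up to the signs of the Pauli `Z` operators, conjugation by a
diagonal operator of local phases. -/
theorem exists_phase_of_conj (hd : d + 1 = 2 * l) (hl : Odd l) {α β w : Alg L l ≃ₐ[ℂ] Alg L l}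
    (hα : IsThreeFermionQCA α) (hα' : IsQCA 3 α) (hβ : IsABQCA β) (hβ' : IsQCA 3 β)
    (hw : IsDiagConj thetaW w) : ∃ (σ : Alg L l ≃ₐ[ℂ] Alg L l) (θ : Config L l → ℂ),
      σ * σ = 1 ∧ IsLayer Set.univ 0 σ ∧ IsLocalPhase 14 θ ∧
      IsDiagConj θ (β⁻¹ * (w⁻¹ * α * w) * σ) ∧ (2 ≤ l → σ = 1) := by
  -- `σ` removes the signs `decoSign`, which can be nontrivial only for `l = 1`.
  obtain ⟨σ, hσz, hσx, hσσ, hσ⟩ := exists_sign_layer (decoSign (L := L) (l := l))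
  set γ := β⁻¹ * (w⁻¹ * α * w) with hγ
  have hW := isLocalPhase_thetaW (L := L) (l := l)
  have hwi := hw.inv hW.ne_zero
  have hββ : β⁻¹ = β := inv_eq_of_mul_eq_one_left (hβ.mul_self hd)
  -- The ranges add up: 4 for `w`, 3 for `α`, 4 for `w⁻¹` and 3 for `β⁻¹ = β`.
  have hrange : HasRange 14 γ := by
    rw [hγ, hββ]
    exact hβ'.hasRange.mul (((hwi.hasRange hW.inv).mul hα'.hasRange).mul (hw.hasRange hW))
  have hstar : IsStar γ := by
    rw [hγ, hββ]
    exact IsStar.mul hβ'.1 (((hwi.isStar hW.inv.1).mul hα'.1).mul (hw.isStar hW.1))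
  have hx : ∀ q, (γ * σ) (xGen q) = γ (xGen q) := fun q => by
    rw [AlgEquiv.mul_apply, hσx]
  obtain ⟨θ, h1, h2⟩ := exists_localPhase_of_fix_z (R := 14) (γ := γ * σ) (fun q => by
      rw [AlgEquiv.mul_apply, hσz, map_smul, hγ, conj_map_zGen hd hl hα hβ hw, smul_smul,
        sgn_mul_self, one_smul])
    (fun q => by rw [hx]; exact hstar _ _ (isAdjoint_xOp _))
    (fun q => by rw [hx]; exact (hrange q).1)
  refine ⟨σ, θ, hσσ, hσ, h1, h2, fun h => algEquiv_ext hσx fun q => ?_⟩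
  rw [hσz, decoSign_eq_zero hd h, sgn_zero, one_smul]
  rfl

/-- The depth of the circuits. -/
def circuitDepth (d : ℕ) : ℕ :=
  (ballCard d 8 + 1) + 2 * d + (ballCard d 28 + 1) + 1 + (ballCard d 8 + 1)

theorem isFDQC_thetaW {w : Alg L l ≃ₐ[ℂ] Alg L l} (hw : IsDiagConj thetaW w) :
    IsFDQC (ballCard d 8 + 1) 28 w :=
  (isLocalPhase_thetaW.isFDQC hw).mono subset_rfl le_rfl (by norm_num)

theorem isFDQC_inv_thetaW {w : Alg L l ≃ₐ[ℂ] Alg L l} (hw : IsDiagConj thetaW w) :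
    IsFDQC (ballCard d 8 + 1) 28 w⁻¹ :=
  (isLocalPhase_thetaW.inv.isFDQC (hw.inv isLocalPhase_thetaW.ne_zero)).mono subset_rfl le_rfl
    (by norm_num)

/-- In odd degree, the automaton of `½ (A ∪ A + A ∪ B + B ∪ B)` is a finite-depth circuit. -/
theorem IsThreeFermionQCA.isFDQC (hd : d + 1 = 2 * l) (hl : Odd l)
    {α β w : Alg L l ≃ₐ[ℂ] Alg L l} (hα : IsThreeFermionQCA α) (hα' : IsQCA 3 α)
    (hβ : IsABQCA β) (hβ' : IsQCA 3 β) (hc : IsCircuit (czGates L l) (2 * d) 2 β)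
    (hw : IsDiagConj thetaW w) : IsFDQC (circuitDepth d) 28 α := by
  obtain ⟨σ, θ, hσσ, hσ, hθ, hγ, -⟩ := exists_phase_of_conj hd hl hα hα' hβ hβ' hw
  -- The five factors are circuits, and their depths add up to `circuitDepth d`.
  have h1 : α = w * β * (β⁻¹ * (w⁻¹ * α * w) * σ) * σ * w⁻¹ := by
    have : (β⁻¹ * (w⁻¹ * α * w) * σ) * σ = β⁻¹ * (w⁻¹ * α * w) := by rw [mul_assoc, hσσ, mul_one]
    rw [mul_assoc (w * β) _ σ, this]
    group
  rw [h1]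
  have h2 : IsFDQC (2 * d) 28 β := hc.mono (Set.subset_univ _) le_rfl (by norm_num)
  have h3 : IsFDQC (ballCard d 28 + 1) 28 (β⁻¹ * (w⁻¹ * α * w) * σ) := hθ.isFDQC hγ
  have h4 : IsFDQC 1 28 σ := ⟨[σ], le_rfl, by simpa using hσ.mono subset_rfl (by norm_num), by simp⟩
  exact ((((isFDQC_thetaW hw).mul h2).mul h3).mul h4).mul (isFDQC_inv_thetaW hw)

end Conjugation

/-! ### Ground states -/

section GroundStates

variable {d : ℕ} {L : Fin d → ℕ} {l : ℕ}

variable (L l) in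
/-- The expectation value in the state `|00⋯0⟩`, as a linear functional. -/
def vacuumLin : Alg L l →ₗ[ℂ] ℂ :=
  (Finsupp.lapply 0).comp ((LinearMap.applyₗ (ket 0)).comp (Alg L l).val.toLinearMap)

theorem vacuumLin_apply (O : Alg L l) : vacuumLin L l O = vacuumExp O := rfl

/-- The state `ω` is stabilized by all Pauli `Z` operators. -/
def IsStabilized (ω : Alg L l →ₗ[ℂ] ℂ) : Prop :=
  ω 1 = 1 ∧ ∀ (O : Alg L l) q, ω (O * zGen q) = ω O ∧ ω (zGen q * O) = ω O

/-- The `Z` part is absorbed by the state. If the `X` part is nontrivial, it anticommutes with some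
`Z_q`, so its expectation equals its own negative. -/
theorem IsStabilized.map_pauAlg {ω : Alg L l →ₗ[ℂ] ℂ} (h : IsStabilized ω)
    (p : Config L l × Config L l) : ω (pauAlg p) = if p.1 = 0 then 1 else 0 := by
  obtain ⟨w, v⟩ := p
  have h1 : ω (pauAlg (w, v)) = ω (pauAlg (w, 0)) := by
    induction v using config_induction with
    | h0 => rfl
    | hadd v q ih =>
      rw [← ih, ← (h.2 (pauAlg (w, v)) q).1, zGen_eq, pauAlg_mul, map_zero, sgn_zero, one_smul,
        Prod.mk_add_mk, add_zero, add_comm]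
  rw [h1]
  split_ifs with hw
  · simp only at hw
    rw [hw, ← Prod.zero_eq_mk, pauAlg_zero, h.1]
  · obtain ⟨q, hq⟩ := Finsupp.ne_iff.1 hw
    have h2 : zGen q * pauAlg (w, 0) = (-1 : ℂ) • (pauAlg (w, 0) * zGen q) := by
      rw [zGen_eq, pauAlg_mul, pauAlg_mul, map_zero, sgn_zero, one_smul, add_comm (w, _), single_dot,
        (zmod2_cases (w q)).resolve_left hq, sgn_one]
    have h3 := congrArg ω h2
    rw [(h.2 _ q).2, map_smul, (h.2 _ q).1, smul_eq_mul] at h3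
    linear_combination h3 / 2

theorem IsStabilized.unique {ω ω' : Alg L l →ₗ[ℂ] ℂ} (h : IsStabilized ω) (h' : IsStabilized ω') :
    ω = ω' :=
  pauBasis.ext fun p => by rw [pauBasis_apply, h.map_pauAlg, h'.map_pauAlg]

theorem zOp_ket_zero (v : Qubit L l → ZMod 2) : zOp v (ket 0) = ket 0 := by
  rw [zOp_ket, map_zero, sgn_zero, one_smul]

theorem vacuumExp_mul_of_fix (O : Alg L l) {Q : Alg L l} (h : (Q : Op L l) (ket 0) = ket 0) :
    vacuumExp (O * Q) = vacuumExp O := by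
  change ((O : Op L l) ((Q : Op L l) (ket 0))) 0 = _
  rw [h]
  rfl

theorem vacuumExp_mul_of_fix_left (O : Alg L l) {Q : Alg L l} (h : (Q : Op L l) (ket 0) = ket 0)
    (hQ : IsAdjoint (Q : Op L l) Q) : vacuumExp (Q * O) = vacuumExp O := by
  change ((Q : Op L l) ((O : Op L l) (ket 0))) 0 = ((O : Op L l) (ket 0)) 0
  rw [← herm_ket_left, ← hQ, h, herm_ket_left]

theorem isStabilized_vacuumLin : IsStabilized (vacuumLin L l) := by
  refine ⟨by simp [vacuumLin_apply, vacuumExp], fun O q => ⟨?_, ?_⟩⟩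
  · exact vacuumExp_mul_of_fix O (Q := zGen q) (zOp_ket_zero _)
  · exact vacuumExp_mul_of_fix_left O (Q := zGen q) (zOp_ket_zero _) (isAdjoint_zOp _)

/-- `|0⟩` is an eigenvector of the diagonal operator, and the eigenvalue cancels. -/
theorem vacuumExp_diagConj {θ : Config L l → ℂ} (hθ : ∀ s, θ s ≠ 0) {Φ : Alg L l ≃ₐ[ℂ] Alg L l}
    (h : IsDiagConj θ Φ) (O : Alg L l) : vacuumExp (Φ O) = vacuumExp O := by
  have h1 : ((Φ O : Op L l) * diagOp θ) (ket 0) 0 = (diagOp θ * O) (ket 0) 0 := by rw [h]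
  have h2 : ∀ ψ : Hilb L l, diagOp θ ψ 0 = θ 0 * ψ 0 := fun ψ => by
    induction ψ using ket_smul_induction with
    | h0 => simp
    | hadd ψ ψ' h h' => rw [map_add, Finsupp.add_apply, h, h', Finsupp.add_apply, mul_add]
    | hs c s =>
      rw [map_smul, diagOp_ket, Finsupp.smul_apply, Finsupp.smul_apply, Finsupp.smul_apply]
      by_cases hs : s = 0
      · subst hs; simp only [smul_eq_mul]; ring
      · simp [ket, hs]
  rw [Module.End.mul_apply, Module.End.mul_apply, diagOp_ket, map_smul, Finsupp.smul_apply, h2,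
    smul_eq_mul] at h1
  exact mul_left_cancel₀ (hθ 0) h1

theorem zAlg_le_span (S : Set (Qubit L l)) {O : Op L l} (hO : O ∈ zAlg S) :
    O ∈ Submodule.span ℂ {P : Op L l | ∃ z : Config L l, (∀ q, z q ≠ 0 → q ∈ S) ∧ P = zOp z} := by
  have h1 : O ∈ Subalgebra.toSubmodule (zAlg S) := hO
  rw [zAlg, Algebra.adjoin_eq_span] at h1
  refine Submodule.span_mono (fun P hP => ?_) h1
  induction hP using Submonoid.closure_induction with
  | mem P hP =>
    obtain ⟨q, hq, rfl⟩ := hP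
    refine ⟨Finsupp.single q 1, fun p hp => ?_, zOp_single q⟩
    by_cases h : q = p
    · exact h ▸ hq
    · exact absurd (by simp [h]) hp
  | one => exact ⟨0, fun _ h => absurd rfl h, by rw [Finsupp.coe_zero, zOp_zero]⟩
  | mul P P' _ _ h h' =>
    obtain ⟨z, hz, rfl⟩ := h
    obtain ⟨z', hz', rfl⟩ := h'
    refine ⟨z + z', fun q hq => ?_, by rw [Finsupp.coe_add, zOp_add]⟩
    by_cases h : z q = 0
    · exact hz' q fun h' => hq (by rw [Finsupp.add_apply, h, h', add_zero])
    · exact hz q h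

variable (L l) in
/-- The sum of the coefficients of a vector, weighted by a character. -/
def charSum (t : Config L l) : Hilb L l →ₗ[ℂ] ℂ :=
  Finsupp.linearCombination ℂ fun y => sgn (dot y t)

theorem charSum_ket (t y : Config L l) : charSum L l t (ket y) = sgn (dot y t) := by
  simp [charSum, ket]

/-- Fourier uniqueness, by the linear independence of characters. -/
theorem hilb_ext {ψ φ : Hilb L l} (h : ∀ t, charSum L l t ψ = charSum L l t φ) : ψ = φ := by
  rw [← sub_eq_zero]
  refine character_sum_eq_zero fun t => ?_
  have h1 : charSum L l t (ψ - φ) = 0 := by rw [map_sub, h, sub_self]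
  exact h1

/-- The decorations lie on the other species than `z`, so no sign arises when they are collected. -/
theorem IsABQCA.map_z_of_species (hd : d + 1 = 2 * l) {β : Alg L l ≃ₐ[ℂ] Alg L l}
    (hβ : IsABQCA β) {t : Species} (z : Config L l) (hz : ∀ q, z q ≠ 0 → q.1 = t) :
    β (pauAlg (0, z)) = pauAlg (decoMap hd z, z) := by
  obtain ⟨hβz, -⟩ := (isABQCA_iff hd).1 hβ
  induction z using Finsupp.induction with
  | zero => rw [map_zero, ← Prod.zero_eq_mk, pauAlg_zero, map_one]
  | single_add q a z hq ha ih =>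
    obtain rfl : a = 1 := (zmod2_cases a).resolve_left ha
    have hz' : ∀ p, z p ≠ 0 → p.1 = t := fun p hp => hz p (by
      have : q ≠ p := fun h => hp (h ▸ Finsupp.notMem_support_iff.1 hq)
      simpa [Finsupp.single_apply, this] using hp)
    have hqt : q.1 = t := hz q (by simp [Finsupp.notMem_support_iff.1 hq])
    rw [← pauAlg_z_mul, ← zGen_eq, map_mul, hβz, ih hz', zGen_eq, pauAlg_mul, smul_mul_assoc,
      pauAlg_mul, smul_smul, map_add]
    have e1 : dot (Finsupp.single q 1 : Config L l) (decoMap hd (Finsupp.single q 1)) = 0 := by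
      rw [single_dot]
      exact decoMap_apply_of_species hd (t := t) (fun p hp => by
        by_contra h
        exact hp (by
          rw [Finsupp.single_apply, if_neg]
          rintro rfl
          exact h hqt)) hqt
    have e2 : dot (Finsupp.single q 1 : Config L l) (decoMap hd z) = 0 := by
      rw [single_dot]
      exact decoMap_apply_of_species hd hz' hqt
    simp only [Prod.mk_add_mk, add_zero, zero_add, e1, e2, sgn_zero, one_smul, one_mul]

/-- The vector `β(D)|0⟩` for an operator `D` that is diagonal and acts on one species only. -/
theorem IsABQCA.charSum_map (hd : d + 1 = 2 * l) {β : Alg L l ≃ₐ[ℂ] Alg L l}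
    (hβ : IsABQCA β) {S : Set (Qubit L l)} {t : Species} (hS : ∀ q ∈ S, q.1 = t) {O : Alg L l}
    (hO : (O : Op L l) ∈ zAlg S) (y : Config L l) :
    charSum L l y ((β O : Op L l) (ket 0)) = ((O : Op L l) (ket (decoMap hd y))) (decoMap hd y) := by
  have key : ∀ P : Op L l, P ∈ zAlg S → ∃ O : Alg L l, (O : Op L l) = P ∧
      charSum L l y ((β O : Op L l) (ket 0)) = (P (ket (decoMap hd y))) (decoMap hd y) := by
    intro P hP
    have hP' := zAlg_le_span S hP
    clear hP
    induction hP' using Submodule.span_induction with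
    | mem P hP =>
      obtain ⟨z, hz, rfl⟩ := hP
      refine ⟨pauAlg (0, z), coe_pauAlg_z z, ?_⟩
      rw [hβ.map_z_of_species hd z fun q hq => hS q (hz q hq)]
      change charSum L l y (xOp _ (zOp _ (ket 0))) = _
      rw [zOp_ket_zero, xOp_ket, zero_add, charSum_ket, decoMap_adj, zOp_ket, Finsupp.smul_apply]
      simp [ket]
    | zero => exact ⟨0, rfl, by simp⟩
    | add P P' _ _ h h' =>
      obtain ⟨O, rfl, h⟩ := h
      obtain ⟨O', rfl, h'⟩ := h'
      refine ⟨O + O', rfl, ?_⟩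
      rw [map_add, AddMemClass.coe_add, LinearMap.add_apply, map_add, h, h']
      rfl
    | smul c P _ h =>
      obtain ⟨O, rfl, h⟩ := h
      refine ⟨c • O, rfl, ?_⟩
      rw [map_smul]
      change charSum L l y (c • ((β O : Op L l) (ket 0))) = _
      rw [map_smul, h]
      rfl
  obtain ⟨O', h1, h2⟩ := key _ hO
  rwa [Subtype.ext h1] at h2

theorem IsLocalPhase.exists_isLocalFun {R : ℕ} {θ : Config L l → ℂ} (h : IsLocalPhase R θ)
    (w : Config L l) : ∃ S : Set (Qubit L l), S.Finite ∧ IsLocalFun S fun s => θ (s + w) / θ s := by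
  induction w using config_induction with
  | h0 =>
    refine ⟨∅, Set.finite_empty, fun s p _ => ?_⟩
    simp only [add_zero, div_self (h.ne_zero _)]
  | hadd w q ih =>
    obtain ⟨S, hS, hw⟩ := ih
    refine ⟨S ∪ {q' | Near R q q'}, hS.union (near_finite R q), fun s p hp => ?_⟩
    have h1 := hw s p fun h' => hp (Or.inl h')
    have h2 := h.2 q (s + w) p fun h' => hp (Or.inr h')
    beta_reduce at h1 h2 ⊢
    rw [show s + Finsupp.single p 1 + (Finsupp.single q 1 + w) =
        s + w + Finsupp.single p 1 + Finsupp.single q 1 by abel,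
      show s + (Finsupp.single q 1 + w) = s + w + Finsupp.single q 1 by abel,
      ← div_mul_div_cancel₀ (h.ne_zero (s + w + Finsupp.single p 1)), h2,
      add_right_comm s w (Finsupp.single p 1), h1, div_mul_div_cancel₀ (h.ne_zero _)]

theorem coe_pauAlg_x (w : Config L l) : (pauAlg (w, 0) : Op L l) = xOp w := by
  change xOp _ * zOp ((0 : Config L l) : Qubit L l → ZMod 2) = _
  rw [Finsupp.coe_zero, zOp_zero, mul_one]

/-- With `n` the decoration of `q` and `D` the diagonal operator of the ratios `η (s + n) / η s`,
one has `β (u (β Z_q)) = Z_q β(D)`. By `hs`, `D` involves one species only, so the character sums of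
`β(D)|0⟩` are the values of `D` at decorations. By `hη1` these are one, whence `β(D)|0⟩ = |0⟩`. The
functional is therefore stabilized by all `Z`, and only the vacuum expectation is. -/
theorem IsABQCA.vacuumExp_conj (hd : d + 1 = 2 * l) {β u : Alg L l ≃ₐ[ℂ] Alg L l}
    (hβ : IsABQCA β) (hβ' : IsStar β) {R : ℕ} {η : Config L l → ℂ} (hη : IsLocalPhase R η)
    (hu : IsDiagConj η u)
    (hs : ∀ (q p : Qubit L l) s, p.1 = q.1 →
      η (s + Finsupp.single p 1 + decoMap hd (Finsupp.single q 1)) / η (s + Finsupp.single p 1) =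
        η (s + decoMap hd (Finsupp.single q 1)) / η s)
    (hη1 : ∀ y, η (decoMap hd y) = 1) (O : Alg L l) : vacuumExp (β (u (β O))) = vacuumExp O := by
  obtain ⟨hβz, hβx⟩ := (isABQCA_iff hd).1 hβ
  have hQ : ∀ q, ((β (u (β (zGen q))) : Alg L l) : Op L l) (ket 0) = ket 0 ∧
      IsAdjoint (β (u (β (zGen q))) : Op L l) (β (u (β (zGen q)))) := fun q => by
    refine ⟨?_, hβ' _ _ (hu.isStar hη.1 _ _ (hβ' _ _ (isAdjoint_zOp _)))⟩
    set n := decoMap hd (Finsupp.single q 1) with hn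
    have hT : pauAlg (n, 0) * pauAlg (n, 0) = 1 := by
      rw [pauAlg_x_mul, config_add_self, ← Prod.zero_eq_mk, pauAlg_zero]
    have hβT : β (pauAlg (n, 0)) = pauAlg (n, 0) := map_pauAlg_x_congr (Ψ := 1) hβx n
    have hD : ((pauAlg (n, 0) * u (pauAlg (n, 0)) : Alg L l) : Op L l) =
        diagOp fun s => η (s + n) / η s := by
      refine diagOp_mul_right_cancel hη.ne_zero ?_
      rw [MulMemClass.coe_mul, mul_assoc, hu, coe_pauAlg_x, diagOp_mul_xOp_eq hη.ne_zero,
        mul_assoc, ← mul_assoc, ← xOp_add, config_add_self, xOp_zero, one_mul]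
    obtain ⟨S, hS, hS'⟩ := hη.exists_isLocalFun n
    have hmem : ((pauAlg (n, 0) * u (pauAlg (n, 0)) : Alg L l) : Op L l) ∈
        zAlg (S ∩ {p | p.1 = q.1.other}) := by
      rw [hD]
      refine diagOp_mem_zAlg (hS.subset Set.inter_subset_left) fun s p hp => ?_
      by_cases hpS : p ∈ S
      · refine hs q p s ?_
        have : p.1 ≠ q.1.other := fun h => hp ⟨hpS, h⟩
        revert this
        cases p.1 <;> cases q.1 <;> simp [Species.other]
      · exact hS' s p hpS
    have h1 : ((β (pauAlg (n, 0) * u (pauAlg (n, 0))) : Alg L l) : Op L l) (ket 0) = ket 0 := by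
      refine hilb_ext fun t => ?_
      rw [hβ.charSum_map hd (fun p hp => hp.2) hmem, hD, diagOp_ket, Finsupp.smul_apply,
        charSum_ket, Finsupp.coe_zero, dot_zero, sgn_zero, hn, ← map_add, hη1, hη1]
      simp [ket]
    have h2 : β (u (β (zGen q))) = zGen q * β (pauAlg (n, 0) * u (pauAlg (n, 0))) := by
      rw [hβz, map_mul, hu.map_zGen hη.ne_zero, map_mul, hβz, map_mul, hβT, mul_assoc]
    rw [h2, MulMemClass.coe_mul, Module.End.mul_apply, h1]
    exact zOp_ket_zero _
  let ω : Alg L l →ₗ[ℂ] ℂ := (vacuumLin L l).comp (β * u * β : Alg L l ≃ₐ[ℂ] Alg L l).toLinearMap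
  have hω : ∀ O, ω O = vacuumExp (β (u (β O))) := fun O => rfl
  have h : IsStabilized ω := by
    refine ⟨?_, fun O q => ⟨?_, ?_⟩⟩
    · rw [hω, map_one, map_one, map_one]
      exact isStabilized_vacuumLin.1
    · rw [hω, hω, map_mul, map_mul, map_mul]
      exact vacuumExp_mul_of_fix _ (hQ q).1
    · rw [hω, hω, map_mul, map_mul, map_mul]
      exact vacuumExp_mul_of_fix_left _ (hQ q).1 (hQ q).2
  rw [← hω, h.unique isStabilized_vacuumLin, vacuumLin_apply]

/-- Modulo two the decorations are coboundaries, and `δδ = 0`. -/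
theorem isFluxFree_decoMap (hd : d + 1 = 2 * l) (y : Config L l) : IsFluxFree (decoMap hd y) := by
  intro t σ
  obtain ⟨f, hf, -, h⟩ := exists_coch_decoMap hd t y
  have h1 := congrFun (coboundary_modTwo (liftCochain (decoMap hd y) t)) σ
  rw [modTwo_liftCochain, h, coboundary_coboundary hf.hasParity] at h1
  exact (ZMod.intCast_zmod_eq_zero_iff_dvd _ 2).1 h1.symm

/-- The phase by which the circuits `V` and `w` differ on the qubits of one species. -/
def fluxPhase (t : Species) (s : Config L l) : ℂ :=
  quarterPhase (-(2 * fluxIntegral (liftCochain s t)))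

theorem liftCochain_add_of_species {t : Species} (s : Config L l) {w : Config L l}
    (hw : ∀ q, q.1 = t → w q = 0) : liftCochain (s + w) t = liftCochain s t := by
  funext σ
  unfold liftCochain
  split_ifs with h
  · rw [Finsupp.add_apply, hw (t, _) rfl, add_zero]
  · rfl

theorem thetaW_inv_mul_thetaV (s : Config L l) :
    (thetaW s)⁻¹ * thetaV s = fluxPhase .A s * fluxPhase .B s := by
  have h : ∀ t, phaseV t s = quarterPhase (fullIntegral (liftCochain s t)) * fluxPhase t s :=
    fun t => by
      rw [phaseV_eq, fluxPhase, ← quarterPhase_add, fullIntegral]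
      congr 1
      ring
  rw [inv_mul_eq_iff_eq_mul₀ (isLocalPhase_thetaW.ne_zero s), thetaV, thetaW, h, h,
    mul_mul_mul_comm]

/-- The phases of `V` and `w` differ by a product of one flux phase per species. The decoration of
`q` changes only the factor of the other species, so the ratio ignores the qubits of the species of
`q`. -/
theorem vacuumExp_conj_thetaV (hd : d + 1 = 2 * l) {β w v : Alg L l ≃ₐ[ℂ] Alg L l}
    (hβ : IsABQCA β) (hβ' : IsStar β) (hw : IsDiagConj thetaW w) (hv : IsDiagConj thetaV v)
    (O : Alg L l) : vacuumExp (β (w⁻¹ (v (β O)))) = vacuumExp O := by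
  have hW := isLocalPhase_thetaW (L := L) (l := l)
  refine hβ.vacuumExp_conj hd hβ' (u := w⁻¹ * v) (hW.inv.mul isLocalPhase_thetaV)
    ((hw.inv hW.ne_zero).mul hv) (fun q p s hp => ?_) (fun y => ?_) O
  · simp only [thetaW_inv_mul_thetaV]
    have h1 : ∀ (t : Species) (s : Config L l), q.1 = t →
        fluxPhase t (s + decoMap hd (Finsupp.single q 1)) = fluxPhase t s := fun t s ht => by
      rw [fluxPhase, liftCochain_add_of_species, fluxPhase]
      intro p hp
      refine decoMap_apply_of_species hd (t := t) (fun p' hp' => ?_) hp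
      by_contra h
      exact hp' (by
        rw [Finsupp.single_apply, if_neg]
        rintro rfl
        exact h ht)
    have h2 : ∀ (t : Species) (s : Config L l), p.1 ≠ t →
        fluxPhase t (s + Finsupp.single p 1) = fluxPhase t s := fun t s ht => by
      rw [fluxPhase, liftCochain_add_of_species, fluxPhase]
      intro p' hp'
      rw [Finsupp.single_apply, if_neg]
      rintro rfl
      exact ht hp'
    have h0 : ∀ (t : Species) (s : Config L l), fluxPhase t s ≠ 0 :=
      fun t s => quarterPhase_ne_zero _
    cases hq : q.1
    · rw [h1 _ _ hq, h1 _ _ hq, add_right_comm, h2 .B _ (by rw [hp, hq]; exact nofun),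
        h2 .B _ (by rw [hp, hq]; exact nofun), mul_div_mul_left _ _ (h0 _ _),
        mul_div_mul_left _ _ (h0 _ _)]
    · rw [h1 _ _ hq, h1 _ _ hq, add_right_comm, h2 .A _ (by rw [hp, hq]; exact nofun),
        h2 .A _ (by rw [hp, hq]; exact nofun), mul_div_mul_right _ _ (h0 _ _),
        mul_div_mul_right _ _ (h0 _ _)]
  · rw [thetaW_eq_thetaV (isFluxFree_decoMap hd y),
      inv_mul_cancel₀ (isLocalPhase_thetaV.ne_zero _)]

/-- Conjugation by `V` maps the ground state of `β` to the ground state of `α`. -/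
theorem groundState_eq (hd : d + 1 = 2 * l) (hl : Odd l) (hl' : 2 ≤ l)
    {α β w v : Alg L l ≃ₐ[ℂ] Alg L l} (hα : IsThreeFermionQCA α) (hα' : IsQCA 3 α)
    (hβ : IsABQCA β) (hβ' : IsQCA 3 β) (hw : IsDiagConj thetaW w) (hv : IsDiagConj thetaV v)
    (O : Alg L l) : groundState α (v O) = groundState β O := by
  obtain ⟨σ, θ, -, -, hθ, hγ, hσ⟩ := exists_phase_of_conj hd hl hα hα' hβ hβ' hw
  rw [hσ hl', mul_one] at hγ
  have hββ : β⁻¹ = β := inv_eq_of_mul_eq_one_left (hβ.mul_self hd)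
  have hβO : ∀ O, β (β O) = O := fun O => by
    rw [← AlgEquiv.mul_apply, hβ.mul_self hd]
    rfl
  -- In this factorization `w` and `γ⁻¹` are diagonal conjugations on the outside, invisible to the
  -- vacuum; `β⁻¹ w⁻¹ v` remains.
  have h1 : α⁻¹ = w * (β⁻¹ * (w⁻¹ * α * w))⁻¹ * β⁻¹ * w⁻¹ := by group
  have h2 : α.symm (v O) = w ((β⁻¹ * (w⁻¹ * α * w))⁻¹ (β⁻¹ (w⁻¹ (v O)))) :=
    DFunLike.congr_fun h1 (v O)
  have h3 : β.symm O = β O := DFunLike.congr_fun hββ O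
  rw [groundState, groundState, h2, h3, vacuumExp_diagConj isLocalPhase_thetaW.ne_zero hw,
    vacuumExp_diagConj hθ.inv.ne_zero (hγ.inv hθ.ne_zero),
    DFunLike.congr_fun hββ (w⁻¹ (v O))]
  have h4 := vacuumExp_conj_thetaV hd hβ hβ'.1 hw hv (β O)
  rwa [hβO] at h4

end GroundStates

/-! ### A pair of cells with odd `∫ δc ∪₃ δc'` -/

section CubicPhase

variable {d : ℕ} {L : Fin d → ℕ}

theorem of_coboundary_dual_ne_zero {f σ : Cell L}
    (h : coboundary (dual f : Cochain L (ZMod 2)) σ ≠ 0) :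
    ∃ i, i ∉ f.2 ∧ (∀ m, m ∈ σ.2 ↔ m = i ∨ m ∈ f.2) ∧ (∀ m, m ≠ i → σ.1 m = f.1 m) ∧
      (σ.1 + shift L {i} = f.1 ∨ σ.1 = f.1) := by
  rw [coboundary_dual_apply] at h
  obtain ⟨i, -, hi⟩ := Finset.exists_ne_zero_of_sum_ne_zero h
  by_cases h1 : i ∈ σ.2 ∧ σ.2.erase i = f.2
  swap
  · exact absurd (if_neg h1) hi
  obtain ⟨h4, h5⟩ := h1
  rw [if_pos ⟨h4, h5⟩] at hi
  have h6 : σ.1 + shift L {i} = f.1 ∨ σ.1 = f.1 := by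
    by_contra hcon
    obtain ⟨h7, h8⟩ := not_or.1 hcon
    rw [if_neg h7, if_neg h8, add_zero] at hi
    exact hi rfl
  refine ⟨i, h5 ▸ Finset.notMem_erase _ _, fun m => ?_, fun m hm => ?_, h6⟩
  · rw [← Finset.mem_insert, ← h5, Finset.insert_erase h4]
  · rcases h6 with h6 | h6
    · rw [← h6]; simp [shift, hm]
    · rw [h6]

theorem coboundary_dual_eq_one {f σ : Cell L} {i : Fin d} (hL : L i ≠ 1) (hi : i ∉ f.2)
    (h2 : ∀ m, m ∈ σ.2 ↔ m = i ∨ m ∈ f.2) (h1 : σ.1 = f.1) :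
    coboundary (dual f : Cochain L (ZMod 2)) σ = 1 := by
  have h3 : σ.2 = insert i f.2 := Finset.ext fun m => by rw [h2, Finset.mem_insert]
  rw [coboundary_dual_apply, Finset.sum_eq_single i]
  · rw [if_pos ⟨by rw [h3]; exact Finset.mem_insert_self _ _, by rw [h3, Finset.erase_insert hi]⟩,
      if_neg, if_pos h1, zero_add]
    rw [h1]
    intro h
    exact shift_singleton_ne_zero hL (left_eq_add.1 h.symm)
  · rintro m - hm
    rw [if_neg]
    rintro ⟨hm1, hm2⟩
    rw [h3, Finset.mem_insert] at hm1
    refine Finset.notMem_erase m σ.2 (hm2 ▸ hm1.resolve_left hm)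
  · exact fun h => absurd (Finset.mem_univ _) h

variable {l : ℕ} {i₀ i₁ i₂ : Fin d} {A B S S' : Finset (Fin d)}

/-- A pair of cells whose coboundaries have a cup-3 product with a single term. -/
structure IsCubicPair (i₀ i₁ i₂ : Fin d) (A B S S' : Finset (Fin d)) : Prop where
  val_zero : i₀.val = 0
  val_one : i₁.val = 1
  val_two : i₂.val = 2
  mem_left : ∀ m, m ∈ A → 3 ≤ m.val
  mem_right : ∀ m, m ∈ B → 3 ≤ m.val
  disjoint : ∀ m, m ∈ A → m ∉ B
  cover : ∀ m, m = i₀ ∨ m = i₁ ∨ m = i₂ ∨ m ∈ A ∨ m ∈ B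
  mem_fst : ∀ m, m ∈ S ↔ m = i₀ ∨ m = i₂ ∨ m ∈ B
  mem_snd : ∀ m, m ∈ S' ↔ m = i₀ ∨ m = i₁ ∨ m ∈ A

theorem IsCubicPair.ne (h : IsCubicPair i₀ i₁ i₂ A B S S') :
    i₀ ≠ i₁ ∧ i₀ ≠ i₂ ∧ i₁ ≠ i₂ ∧ (i₀ ∉ A ∧ i₁ ∉ A ∧ i₂ ∉ A) ∧ i₀ ∉ B ∧ i₁ ∉ B ∧ i₂ ∉ B := by
  have h0 := h.val_zero
  have h1 := h.val_one
  have h2 := h.val_two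
  have hA := h.mem_left
  have hB := h.mem_right
  refine ⟨fun e => ?_, fun e => ?_, fun e => ?_, ⟨fun e => ?_, fun e => ?_, fun e => ?_⟩,
    fun e => ?_, fun e => ?_, fun e => ?_⟩
  · rw [e] at h0; omega
  · rw [e] at h0; omega
  · rw [e] at h1; omega
  all_goals first
    | (have := hA _ e; omega)
    | (have := hB _ e; omega)

/-- In a nonzero term `T ∪ P` consists of `S` and one more direction `j`, and `T ∪ Q` of `S'` and
one more direction `k`. As `S` and `S'` share only `i₀`, this forces `T = {i₀, j, k}`; comparing the
fixed coordinates of the faces determines `j`, `k` and `x`. -/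
theorem IsCubicPair.of_cupTerm_ne_zero (h : IsCubicPair i₀ i₁ i₂ A B S S') (hL : ∀ i, L i ≠ 1)
    {x : Pos L} {T P : Finset (Fin d)} (hT : T.card = 3) (hP : P ⊆ Finset.univ \ T)
    (hne : cupTerm 3 (coboundary (dual (shift L A, S) : Cochain L (ZMod 2)))
      (coboundary (dual (0, S'))) x T P ((Finset.univ \ T) \ P) ≠ 0) :
    x = 0 ∧ T = {i₀, i₁, i₂} ∧ P = B := by
  obtain ⟨n01, n02, n12, ⟨nA0, nA1, nA2⟩, nB0, nB1, nB2⟩ := h.ne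
  set Q := (Finset.univ \ T) \ P with hQdef
  have hnt : ∀ i, (1 : ZMod (L i)) ≠ 0 := fun i => by
    have : Nontrivial (ZMod (L i)) := ZMod.nontrivial_iff.2 (hL i)
    exact one_ne_zero
  have hQ : ∀ m, m ∈ Q ↔ m ∉ T ∧ m ∉ P := fun m => by simp [hQdef]
  have hPT : ∀ m, m ∈ P → m ∉ T := fun m hm => by simpa using hP hm
  unfold cupTerm at hne
  obtain ⟨j, hjS, hj, hyj, hy⟩ :=
    of_coboundary_dual_ne_zero (right_ne_zero_of_mul (left_ne_zero_of_mul hne))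
  obtain ⟨k, hkS, hk, hyk, hy'⟩ := of_coboundary_dual_ne_zero (right_ne_zero_of_mul hne)
  simp only [Finset.mem_union, h.mem_fst, h.mem_snd, not_or] at hjS hj hkS hk
  simp only at hyj hy hyk hy'
  have h0 : i₀ ∈ T := by
    by_contra h0
    have h1 := (hj i₀).2 (by simp)
    have h2 := (hk i₀).2 (by simp)
    exact ((hQ i₀).1 (h2.resolve_left h0)).2 (h1.resolve_left h0)
  have hsub : T ⊆ {i₀, j, k} := fun m hm => by
    have h1 := (hj m).1 (Or.inl hm)
    have h2 := (hk m).1 (Or.inl hm)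
    have h3 := h.disjoint m
    simp only [Finset.mem_insert, Finset.mem_singleton]
    by_contra hcon
    simp only [not_or] at hcon
    obtain ⟨c1, c2, c3⟩ := hcon
    rcases h1.resolve_left c2 with e | e | e
    · exact c1 e
    · rcases h2.resolve_left c3 with e' | e' | e'
      · exact c1 e'
      · exact n12 (e' ▸ e)
      · exact nA2 (e ▸ e')
    · rcases h2.resolve_left c3 with e' | e' | e'
      · exact c1 e'
      · exact nB1 (e' ▸ e)
      · exact h3 e' e
  have hTeq : T = {i₀, j, k} :=
    Finset.eq_of_subset_of_card_le hsub (Finset.card_le_three.trans hT.ge)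
  have hjk : j ≠ k := by
    rintro rfl
    rw [hTeq] at hT
    have : ({i₀, j, j} : Finset (Fin d)).card ≤ 2 := by
      simpa using Finset.card_le_two (a := i₀) (b := j)
    omega
  have hjT : j ∈ T := by rw [hTeq]; simp
  have hkT : k ∈ T := by rw [hTeq]; simp
  -- Otherwise `i₁` lies in `Q` only and is preceded in `T` just by `i₀`, so the two faces have
  -- different coordinates in direction `i₁`, whereas both cells have coordinate zero there.
  have hj1 : j = i₁ := by
    by_contra hj1
    have hk1 : k ≠ i₁ := fun e => hkS.2.1 e
    have hnotP : ¬(i₁ ∈ T ∨ i₁ ∈ P) := fun hmem => by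
      rcases (hj i₁).1 hmem with e | e | e | e
      · exact hj1 e.symm
      · exact n01 e.symm
      · exact n12 e
      · exact nB1 e
    have hmemQ : i₁ ∈ Q := (hQ i₁).2 (not_or.1 hnotP)
    have hodd : Odd (T.filter (· < i₁)).card := by
      have : T.filter (· < i₁) = {i₀} := by
        ext m
        simp only [Finset.mem_filter, Finset.mem_singleton]
        constructor
        · rintro ⟨-, hm⟩
          have hm' : m.val < i₁.val := hm
          exact Fin.ext (by rw [h.val_zero]; rw [h.val_one] at hm'; omega)
        · rintro rfl
          exact ⟨h0, Fin.lt_def.2 (by rw [h.val_zero, h.val_one]; omega)⟩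
      rw [this]
      simp
    have e1 := hyj i₁ (Ne.symm hj1)
    have e2 := hyk i₁ (Ne.symm hk1)
    simp only [Pi.add_apply, shift, Finset.mem_filter, hmemQ, hodd, not_or.1 hnotP, false_and,
      if_true, if_false, nA1, and_self, add_zero, Pi.zero_apply] at e1 e2
    rw [e2, zero_add] at e1
    exact hnt _ e1
  subst hj1
  -- Otherwise `i₂` lies in `P` only and is preceded in `T` by `i₀` and `i₁`, which gives the same
  -- contradiction in direction `i₂`.
  have hk2 : k = i₂ := by
    by_contra hk2
    have hnotQ : ¬(i₂ ∈ T ∨ i₂ ∈ Q) := fun hmem => by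
      rcases (hk i₂).1 hmem with e | e | e | e
      · exact hk2 e.symm
      · exact n02 e.symm
      · exact n12 e.symm
      · exact nA2 e
    have hmemP : i₂ ∈ P := ((hj i₂).2 (by simp)).resolve_left (not_or.1 hnotQ).1
    have heven : Even (T.filter (· < i₂)).card := by
      have : T.filter (· < i₂) = {i₀, j} := by
        ext m
        simp only [Finset.mem_filter, Finset.mem_singleton, Finset.mem_insert]
        constructor
        · rintro ⟨-, hm⟩
          have hm' : m.val < i₂.val := hm
          rw [h.val_two] at hm'
          rcases Nat.lt_or_ge m.val 1 with h1 | h1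
          · exact Or.inl (Fin.ext (by rw [h.val_zero]; omega))
          · exact Or.inr (Fin.ext (by rw [h.val_one]; omega))
        · rintro (rfl | rfl)
          · exact ⟨h0, Fin.lt_def.2 (by rw [h.val_zero, h.val_two]; omega)⟩
          · exact ⟨hjT, Fin.lt_def.2 (by rw [h.val_one, h.val_two]; omega)⟩
      rw [this, Finset.card_pair n01]
      decide
    have e1 := hyj i₂ (Ne.symm n12)
    have e2 := hyk i₂ (Ne.symm hk2)
    simp only [Pi.add_apply, shift, Finset.mem_filter, hmemP, heven, not_or.1 hnotQ, false_and,
      if_true, if_false, nA2, and_self, add_zero, Pi.zero_apply] at e1 e2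
    rw [e1, zero_add] at e2
    exact hnt _ e2
  subst hk2
  have hmT : ∀ m, m ∈ T ↔ m = i₀ ∨ m = j ∨ m = k := fun m => by rw [hTeq]; simp
  have hPB : P = B := by
    ext m
    constructor
    · intro hm
      have h1 := hPT m hm
      simp only [hmT, not_or] at h1
      exact ((((hj m).1 (Or.inr hm)).resolve_left h1.2.1).resolve_left h1.1).resolve_left h1.2.2
    · intro hm
      refine ((hj m).2 (Or.inr (Or.inr (Or.inr hm)))).resolve_left fun h1 => ?_
      rcases (hmT m).1 h1 with rfl | rfl | rfl
      · exact nB0 hm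
      · exact nB1 hm
      · exact nB2 hm
  refine ⟨?_, hTeq, hPB⟩
  have hcard : ∀ m : Fin d, 3 ≤ m.val → (T.filter (· < m)).card = 3 := fun m hm => by
    rw [Finset.filter_true_of_mem, hT]
    intro m' hm'
    refine Fin.lt_def.2 ?_
    rcases (hmT m').1 hm' with rfl | rfl | rfl
    · rw [h.val_zero]; omega
    · rw [h.val_one]; omega
    · rw [h.val_two]; omega
  have hQA : Q.filter (fun m => Odd (T.filter (· < m)).card) = A := by
    ext m
    simp only [Finset.mem_filter, hQ, hPB, hmT, not_or]
    constructor
    · rintro ⟨⟨⟨c1, c2, c3⟩, c4⟩, -⟩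
      rcases h.cover m with e | e | e | e | e
      · exact absurd e c1
      · exact absurd e c2
      · exact absurd e c3
      · exact e
      · exact absurd e c4
    · intro hm
      refine ⟨⟨⟨?_, ?_, ?_⟩, h.disjoint m hm⟩, ?_⟩
      · rintro rfl; exact nA0 hm
      · rintro rfl; exact nA1 hm
      · rintro rfl; exact nA2 hm
      · rw [hcard m (h.mem_left m hm)]; decide
  have hP0 : P.filter (fun m => Even (T.filter (· < m)).card) = ∅ := by
    rw [hPB]
    refine Finset.filter_false_of_mem fun m hm => ?_
    rw [hcard m (h.mem_right m hm)]; decide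
  rw [hQA] at hy
  rw [hP0, shift_empty, add_zero] at hy'
  -- Each face may sit at either of two positions along its extra direction. Both being displaced
  -- would equate the unit vectors of the different directions `j` and `k`.
  rcases hy' with hy' | hy'
  · rcases hy with hy | hy
    · rw [add_right_comm] at hy
      have h1 : x + shift L {j} = x + shift L {k} := by
        rw [hy']
        exact add_eq_right.1 hy
      have h2 := congrFun (add_left_cancel h1) j
      simp only [shift, Finset.mem_singleton, if_true, if_neg n12] at h2
      exact absurd h2 (hnt _)
    · exact add_eq_right.1 hy
  · exact hy'

/-- Every direction in `A` or `B` is preceded by all three elements of `T`; this is an odd number,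
so the first face is shifted by `A` and the second not at all. -/
theorem IsCubicPair.cupTerm_eq_one (h : IsCubicPair i₀ i₁ i₂ A B S S') (hL : ∀ i, L i ≠ 1) :
    cupTerm 3 (coboundary (dual (shift L A, S) : Cochain L (ZMod 2)))
      (coboundary (dual (0, S'))) 0 {i₀, i₁, i₂} B ((Finset.univ \ {i₀, i₁, i₂}) \ B) = 1 := by
  obtain ⟨n01, n02, n12, ⟨nA0, nA1, nA2⟩, nB0, nB1, nB2⟩ := h.ne
  have hcard : ∀ m : Fin d, 3 ≤ m.val →
      (({i₀, i₁, i₂} : Finset (Fin d)).filter (· < m)).card = 3 := fun m hm => by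
    rw [Finset.filter_true_of_mem]
    · rw [Finset.card_eq_three]
      exact ⟨_, _, _, n01, n02, n12, rfl⟩
    · intro m' hm'
      simp only [Finset.mem_insert, Finset.mem_singleton] at hm'
      refine Fin.lt_def.2 ?_
      rcases hm' with rfl | rfl | rfl
      · rw [h.val_zero]; omega
      · rw [h.val_one]; omega
      · rw [h.val_two]; omega
  have hQ : (Finset.univ \ {i₀, i₁, i₂}) \ B = A := by
    ext m
    simp only [Finset.mem_sdiff, Finset.mem_univ, true_and, Finset.mem_insert,
      Finset.mem_singleton, not_or]
    constructor
    · rintro ⟨⟨c1, c2, c3⟩, c4⟩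
      exact (((h.cover m).resolve_left c1).resolve_left c2).resolve_left c3 |>.resolve_right c4
    · intro hm
      exact ⟨⟨fun e => nA0 (e ▸ hm), fun e => nA1 (e ▸ hm), fun e => nA2 (e ▸ hm)⟩,
        h.disjoint m hm⟩
  rw [hQ, cupTerm, Finset.filter_true_of_mem (s := A), Finset.filter_false_of_mem (s := B),
    coboundary_dual_eq_one (hL i₁), coboundary_dual_eq_one (hL i₂), mul_one, mul_one,
    show (-1 : ZMod 2) = 1 from rfl, one_pow]
  · simp only [h.mem_snd]
    exact not_or.2 ⟨n02.symm, not_or.2 ⟨n12.symm, nA2⟩⟩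
  · intro m
    simp only [Finset.mem_union, Finset.mem_insert, Finset.mem_singleton, h.mem_snd]
    tauto
  · simp only [shift_empty, add_zero]
  · simp only [h.mem_fst]
    exact not_or.2 ⟨n01.symm, not_or.2 ⟨n12, nB1⟩⟩
  · intro m
    simp only [Finset.mem_union, Finset.mem_insert, Finset.mem_singleton, h.mem_fst]
    tauto
  · simp only [zero_add]
  · intro m hm
    rw [hcard m (h.mem_right m hm)]; decide
  · intro m hm
    rw [hcard m (h.mem_left m hm)]; decide

theorem IsCubicPair.integral_eq_one (h : IsCubicPair i₀ i₁ i₂ A B S S') (hL : ∀ i, L i ≠ 1) :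
    integral (cup 3 (coboundary (dual (shift L A, S) : Cochain L (ZMod 2)))
      (coboundary (dual (0, S')))) = 1 := by
  obtain ⟨n01, n02, n12, -, nB0, nB1, nB2⟩ := h.ne
  have hT : ({i₀, i₁, i₂} : Finset (Fin d)).card = 3 :=
    Finset.card_eq_three.2 ⟨_, _, _, n01, n02, n12, rfl⟩
  have hB : B ⊆ Finset.univ \ {i₀, i₁, i₂} := fun m hm => by
    simp only [Finset.mem_sdiff, Finset.mem_univ, true_and, Finset.mem_insert,
      Finset.mem_singleton, not_or]
    exact ⟨fun e => nB0 (e ▸ hm), fun e => nB1 (e ▸ hm), fun e => nB2 (e ▸ hm)⟩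
  have hz : ∀ (x : Pos L) (T P : Finset (Fin d)), T ∈ Finset.powersetCard 3 Finset.univ →
      P ∈ (Finset.univ \ T).powerset → ¬(x = 0 ∧ T = {i₀, i₁, i₂} ∧ P = B) →
      cupTerm 3 (coboundary (dual (shift L A, S) : Cochain L (ZMod 2)))
        (coboundary (dual (0, S'))) x T P ((Finset.univ \ T) \ P) = 0 := fun x T P hT hP hn => by
    by_contra hne
    exact hn (h.of_cupTerm_ne_zero hL (Finset.mem_powersetCard.1 hT).2
      (Finset.mem_powerset.1 hP) hne)
  rw [integral, finsum_eq_single _ 0]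
  · rw [cup_apply, Finset.sum_eq_single {i₀, i₁, i₂}, Finset.sum_eq_single B]
    · exact h.cupTerm_eq_one hL
    · exact fun P hP hne => hz _ _ _
        (Finset.mem_powersetCard.2 ⟨Finset.subset_univ _, hT⟩) hP fun h' => hne h'.2.2
    · exact fun h' => absurd (Finset.mem_powerset.2 hB) h'
    · exact fun T hT hne => Finset.sum_eq_zero fun P hP => hz _ _ _ hT hP fun h' => hne h'.2.1
    · exact fun h' => absurd (Finset.mem_powersetCard.2 ⟨Finset.subset_univ _, hT⟩) h'
  · intro x hx
    rw [cup_apply]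
    exact Finset.sum_eq_zero fun T hT => Finset.sum_eq_zero fun P hP =>
      hz _ _ _ hT hP fun h' => hx h'.1

/-- The `2 * l - 4` directions from 3 on are halved into `A` and `B`, so that `S` and `S'` have `l`
elements each. -/
theorem exists_isCubicPair (hd : d + 1 = 2 * l) (hl : 3 ≤ l) :
    ∃ (i₀ i₁ i₂ : Fin d) (A B S S' : Finset (Fin d)), IsCubicPair i₀ i₁ i₂ A B S S' ∧
      S.card = l ∧ S'.card = l := by
  refine ⟨⟨0, by omega⟩, ⟨1, by omega⟩, ⟨2, by omega⟩,
    (Finset.Ico 3 (l + 1)).attachFin fun n hn => by rw [Finset.mem_Ico] at hn; omega,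
    (Finset.Ico (l + 1) d).attachFin fun n hn => by rw [Finset.mem_Ico] at hn; omega,
    (insert 0 (insert 2 (Finset.Ico (l + 1) d))).attachFin fun n hn => by
      simp only [Finset.mem_insert, Finset.mem_Ico] at hn; omega,
    (insert 0 (insert 1 (Finset.Ico 3 (l + 1)))).attachFin fun n hn => by
      simp only [Finset.mem_insert, Finset.mem_Ico] at hn; omega,
    ⟨rfl, rfl, rfl, ?_, ?_, ?_, ?_, ?_, ?_⟩, ?_, ?_⟩
  · intro m hm
    rw [Finset.mem_attachFin, Finset.mem_Ico] at hm; omega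
  · intro m hm
    rw [Finset.mem_attachFin, Finset.mem_Ico] at hm; omega
  · intro m hm hm'
    rw [Finset.mem_attachFin, Finset.mem_Ico] at hm hm'; omega
  · intro m
    simp only [Finset.mem_attachFin, Finset.mem_Ico, Fin.ext_iff]
    have := m.2
    omega
  · intro m
    simp only [Finset.mem_attachFin, Finset.mem_insert, Fin.ext_iff]
  · intro m
    simp only [Finset.mem_attachFin, Finset.mem_insert, Fin.ext_iff]
  · rw [Finset.card_attachFin, Finset.card_insert_of_notMem, Finset.card_insert_of_notMem,
      Nat.card_Ico]
    · omega
    · rw [Finset.mem_Ico]; omega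
    · rw [Finset.mem_insert, Finset.mem_Ico]; omega
  · rw [Finset.card_attachFin, Finset.card_insert_of_notMem, Finset.card_insert_of_notMem,
      Nat.card_Ico]
    · omega
    · rw [Finset.mem_Ico]; omega
    · rw [Finset.mem_insert, Finset.mem_Ico]; omega

end CubicPhase

/-! ### The circuits are not Clifford -/

section NonClifford

variable {d : ℕ} {L : Fin d → ℕ} {l : ℕ}

/-- A diagonal circuit is Clifford only if its phases are quadratic up to signs. -/
theorem IsDiagConj.eq_sgn_of_isClifford {θ : Config L l → ℂ} (hθ : ∀ s, θ s ≠ 0)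
    {Φ : Alg L l ≃ₐ[ℂ] Alg L l} (h : IsDiagConj θ Φ) (hc : IsClifford Φ) (q : Qubit L l)
    (s : Config L l) :
    ∃ a, θ (s + Finsupp.single q 1) * θ 0 = sgn a * (θ s * θ (Finsupp.single q 1)) := by
  obtain ⟨ζ, w, v, -, h1⟩ := (hc q).1
  rw [h.map_xGen hθ] at h1
  have key : ∀ s : Config L l, (θ (s + Finsupp.single q 1) / θ s) • ket (s + Finsupp.single q 1) =
      (ζ * sgn (dot v s)) • ket (s + w) := fun s => by
    have h2 := congrArg (fun O : Op L l => O (ket s)) h1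
    simp only [Module.End.mul_apply, diagOp_ket, map_smul, LinearMap.smul_apply, zOp_ket, xOp_ket,
      smul_smul] at h2
    rw [← h2]
    change _ = _ • xOp _ (ket s)
    rw [xOp_ket]
  have hne : ∀ s : Config L l, θ (s + Finsupp.single q 1) / θ s ≠ 0 :=
    fun s => div_ne_zero (hθ _) (hθ _)
  have hw : Finsupp.single q 1 = w := by
    by_contra hw
    have h3 := DFunLike.congr_fun (key 0) (0 + Finsupp.single q 1)
    rw [Finsupp.smul_apply, Finsupp.smul_apply, ket, ket, Finsupp.single_eq_same,
      Finsupp.single_eq_of_ne (by simpa using hw)] at h3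
    simp only [smul_eq_mul, mul_one, mul_zero] at h3
    exact hne 0 h3
  have hval : ∀ s : Config L l, θ (s + Finsupp.single q 1) / θ s = ζ * sgn (dot v s) := fun s => by
    have h3 := DFunLike.congr_fun (key s) (s + Finsupp.single q 1)
    rw [← hw] at h3
    simpa [ket] using h3
  have h4 := hval 0
  rw [zero_add, map_zero, sgn_zero, mul_one] at h4
  refine ⟨dot v s, ?_⟩
  rw [div_eq_iff (hθ _)] at h4
  have h5 := hval s
  rw [div_eq_iff (hθ _)] at h5
  rw [h4, h5]
  ring

theorem liftCochain_single (q : Qubit L l) (t : Species) :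
    liftCochain (Finsupp.single q 1) t = if q.1 = t then dual q.2.1 else 0 := by
  funext σ
  obtain ⟨t', c, hc⟩ := q
  by_cases hσ : σ.2.card = l
  · simp only [liftCochain, dif_pos hσ, Finsupp.single_apply, Prod.mk.injEq, Subtype.mk.injEq]
    by_cases ht : t' = t
    · by_cases h : c = σ
      · subst h; simp [ht, dual, ZMod.val_one]
      · simp [ht, h, dual, Ne.symm h]
    · simp [ht]
  · rw [liftCochain, dif_neg hσ]
    split_ifs
    · rw [dual, Pi.single_eq_of_ne]
      exact fun h => hσ ((congrArg (fun σ : Cell L => σ.2.card) h).trans hc)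
    · rfl

/-- Distinct qubits produce no carry, so here the lift is additive. -/
theorem liftCochain_single_add_single {q q' : Qubit L l} (h : q ≠ q') (t : Species) :
    liftCochain (Finsupp.single q 1 + Finsupp.single q' 1) t =
      liftCochain (Finsupp.single q 1) t + liftCochain (Finsupp.single q' 1) t := by
  funext σ
  rw [Pi.add_apply]
  unfold liftCochain
  split_ifs with hσ
  · rw [Finsupp.add_apply, Finsupp.single_apply, Finsupp.single_apply]
    by_cases h1 : q = (t, ⟨σ, hσ⟩)
    · rw [if_pos h1, if_neg fun h2 => h (h1.trans h2.symm)]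
      simp
    · rw [if_neg h1]
      simp
  · rfl

/-- Modulo two, the second difference of `F` at the pair of cells is `∫ δc ∪₃ δc' = 1`, so that of
the phase is `±i`. The even term `2 * G a` plays no role, which treats `V` and `w` together. -/
theorem not_isClifford_of_phase (hd : d + 1 = 2 * l) (hl : Odd l) (hl' : 3 ≤ l)
    (hL : ∀ i, L i ≠ 1) {F : Cochain L ℤ → ℤ} {G : Cochain L ℤ → ℤ}
    (hF : ∀ a, F a = sqIntegral a + 2 * G a) {Φ : Alg L l ≃ₐ[ℂ] Alg L l}
    (h : IsDiagConj (fun s => quarterPhase (F (liftCochain s .A)) *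
      quarterPhase (F (liftCochain s .B))) Φ) : ¬ IsClifford Φ := fun hc => by
  obtain ⟨i₀, i₁, i₂, A, B, S, S', hp, hS, hS'⟩ := exists_isCubicPair hd hl'
  set c : Cell L := (shift L A, S) with hcdef
  set c' : Cell L := (0, S') with hc'def
  let q : Qubit L l := (.A, ⟨c, hS⟩)
  let q' : Qubit L l := (.A, ⟨c', hS'⟩)
  have hqq : q ≠ q' := fun e => by
    have h1 : S = S' := congrArg (fun q : Qubit L l => q.2.1.2) e
    obtain ⟨n01, n02, n12, -, -, nB1, -⟩ := hp.ne
    have h2 := (hp.mem_snd i₁).2 (Or.inr (Or.inl rfl))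
    rw [← h1, hp.mem_fst] at h2
    rcases h2 with e | e | e
    · exact n01 e.symm
    · exact n12 e
    · exact nB1 e
  obtain ⟨a, ha⟩ := h.eq_sgn_of_isClifford (fun s => mul_ne_zero (quarterPhase_ne_zero _)
    (quarterPhase_ne_zero _)) hc q' (Finsupp.single q 1)
  have e0 : ∀ t, liftCochain (0 : Config L l) t = 0 := fun t => by
    funext σ; simp [liftCochain]
  have hA : ∀ c : {σ : Cell L // σ.2.card = l},
      liftCochain (Finsupp.single (Species.A, c) 1) Species.A = dual c.1 := fun c => by
    rw [liftCochain_single, if_pos rfl]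
  have hB : ∀ c : {σ : Cell L // σ.2.card = l},
      liftCochain (Finsupp.single (Species.A, c) 1) Species.B = 0 := fun c => by
    rw [liftCochain_single, if_neg nofun]
  rw [liftCochain_single_add_single hqq, liftCochain_single_add_single hqq, e0, e0, hA, hA, hB, hB,
    add_zero] at ha
  have h1 : quarterPhase (F (dual c + dual c') + F 0 - (F (dual c) + F (dual c'))) = sgn a := by
    rw [quarterPhase_sub, quarterPhase_add, quarterPhase_add,
      div_eq_iff (mul_ne_zero (quarterPhase_ne_zero _) (quarterPhase_ne_zero _))]
    refine mul_right_cancel₀ (mul_ne_zero (quarterPhase_ne_zero (F 0)) (quarterPhase_ne_zero (F 0))) ?_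
    linear_combination ha
  refine quarterPhase_ne_sgn ?_ a h1
  have hdeg : ∀ c : Cell L, c.2.card = l → HasParity l (dual c : Cochain L ℤ) := fun c hc =>
    IsOfDegree.hasParity fun σ hσ =>
      Pi.single_eq_of_ne (fun h => hσ ((congrArg (fun σ : Cell L => σ.2.card) h).trans hc)) _
  have h0 : sqIntegral (0 : Cochain L ℤ) = 0 := by
    rw [sqIntegral, cup_zero_left, cup_zero_left, add_zero, integral_zero]
  have h3 : ((integral (cup 3 (coboundary (dual c : Cochain L ℤ)) (coboundary (dual c'))) : ℤ) :
      ZMod 2) = 1 := by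
    rw [← integral_modTwo ((finSupp_dual c).coboundary.cup_left _ _), ← cup_modTwo,
      ← coboundary_modTwo, ← coboundary_modTwo, modTwo_dual, modTwo_dual]
    exact hp.integral_eq_one hL
  rw [hF, hF, hF, hF, sqIntegral_add hl (hdeg c hS) (hdeg c' hS') (finSupp_dual c) (finSupp_dual c'),
    h0]
  push_cast
  rw [h3, show (2 : ZMod 2) = 0 from rfl]
  ring

theorem not_isClifford_thetaV (hd : d + 1 = 2 * l) (hl : Odd l) (hl' : 3 ≤ l)
    (hL : ∀ i, L i ≠ 1) {v : Alg L l ≃ₐ[ℂ] Alg L l} (hv : IsDiagConj thetaV v) : ¬ IsClifford v :=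
  not_isClifford_of_phase hd hl hl' hL (F := sqIntegral) (G := 0)
    (fun a => by simp) hv

theorem not_isClifford_thetaW (hd : d + 1 = 2 * l) (hl : Odd l) (hl' : 3 ≤ l)
    (hL : ∀ i, L i ≠ 1) {w : Alg L l ≃ₐ[ℂ] Alg L l} (hw : IsDiagConj thetaW w) : ¬ IsClifford w :=
  not_isClifford_of_phase hd hl hl' hL (F := fullIntegral) (G := fluxIntegral) (fun _ => rfl) hw

theorem IsQCA.mono {r r' : ℕ} {Φ : Alg L l ≃ₐ[ℂ] Alg L l} (h : IsQCA r Φ) (hr : r ≤ r') :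
    IsQCA r' Φ :=
  ⟨h.1, fun q O hO => ⟨localAlg_mono (fun _ hp => Near.mono hp hr) (h.2 q O hO).1,
    localAlg_mono (fun _ hp => Near.mono hp hr) (h.2 q O hO).2⟩⟩

theorem isFDQC_conj_thetaW (hd : d + 1 = 2 * l) (hl : Odd l) (hl' : 2 ≤ l)
    {α β w : Alg L l ≃ₐ[ℂ] Alg L l} (hα : IsThreeFermionQCA α) (hα' : IsQCA 3 α)
    (hβ : IsABQCA β) (hβ' : IsQCA 3 β) (hw : IsDiagConj thetaW w) :
    IsFDQC (ballCard d 28 + 1) 28 (β⁻¹ * (w⁻¹ * α * w)) := by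
  obtain ⟨σ, θ, -, -, hθ, hγ, hσ⟩ := exists_phase_of_conj hd hl hα hα' hβ hβ' hw
  rw [hσ hl', mul_one] at hγ
  exact hθ.isFDQC hγ

end NonClifford

end HigherQCA

end

/-! ### Assembly -/

theorem mainTheorem3 :
    -- the coboundary identity for simplicial cochains
    (∀ (X : SSet.{u}) (l n : ℕ), n + 1 = 2 * l → ∀ A : SCochain X l ℤ,
      sCoboundary (sCup 1 n A A + sCup 2 n A (sCoboundary A)) =
          sCup 2 (n + 1) (sCoboundary A) (sCoboundary A) +
            ((-1) ^ l - 1 : ℤ) • (sCup 0 (n + 1) A A + sCup 1 (n + 1) A (sCoboundary A)) ∧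
      (Odd l → (∀ σ, (2 : ℤ) ∣ sCoboundary A σ) →
        (fun σ => ((((sCup 0 (n + 1) A A σ : ℤ) : ℝ) / 2 : ℝ) : AddCircle (1 : ℝ))) =
          sCoboundary fun σ =>
            ((-(((sCup 1 n A A + sCup 2 n A (sCoboundary A)) σ : ℤ) : ℝ) / 4 : ℝ) :
              AddCircle (1 : ℝ)))) ∧
    -- the coboundary identity for cubical cochains
    (∀ (d l : ℕ) (L : Fin d → ℕ) (A : Cochain L ℤ), IsOfDegree l A →
      coboundary (cup 1 A A + cup 2 A (coboundary A)) =
          cup 2 (coboundary A) (coboundary A) +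
            ((-1) ^ l - 1 : ℤ) • (cup 0 A A + cup 1 A (coboundary A)) ∧
      (Odd l → (∀ σ, (2 : ℤ) ∣ coboundary A σ) →
        (fun σ => ((((cup 0 A A σ : ℤ) : ℝ) / 2 : ℝ) : AddCircle (1 : ℝ))) =
          coboundary fun σ =>
            ((-(((cup 1 A A + cup 2 A (coboundary A)) σ : ℤ) : ℝ) / 4 : ℝ) : AddCircle (1 : ℝ)))) ∧
    -- the automata
    (∀ d l : ℕ, d + 1 = 2 * l → ∃ D r : ℕ, ∀ L : Fin d → ℕ,
      ∃ α β : Alg L l ≃ₐ[ℂ] Alg L l,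
        -- the automata of the two actions exist, are unique, and are Clifford
        (IsThreeFermionQCA α ∧ (∀ α', IsThreeFermionQCA α' → α' = α) ∧
          IsQCA r α ∧ IsClifford α) ∧
        (IsABQCA β ∧ (∀ β', IsABQCA β' → β' = β) ∧ IsQCA r β ∧ IsClifford β) ∧
        -- the automaton of `½ A ∪ B` is a circuit of controlled-`Z` gates
        IsCircuit (czGates L l) D r β ∧
        -- in spatial dimension `4m + 1` the automaton `α` is a finite-depth circuit
        (Odd l → IsFDQC D r α) ∧
        -- and it is related to `β` by non-Clifford circuits
        (Odd l → 3 ≤ l →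
          (∃ v : Alg L l ≃ₐ[ℂ] Alg L l,
            (∀ O : Alg L l, (v O : Op L l) * vOp L l = vOp L l * O) ∧ IsFDQC D r v ∧
            (∀ O : Alg L l, groundState α (v O) = groundState β O) ∧
            ((∀ i, L i ≠ 1) → ¬ IsClifford v)) ∧
          (∃ (θ : Config L l → ℂ) (w γ : Alg L l ≃ₐ[ℂ] Alg L l),
            (∀ s, ‖θ s‖ = 1) ∧
            (∀ s, IsFluxFree s → θ s = phaseV Species.A s * phaseV Species.B s) ∧
            (∀ O : Alg L l, (w O : Op L l) * diagOp θ = diagOp θ * O) ∧ IsFDQC D r w ∧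
            ((∀ i, L i ≠ 1) → ¬ IsClifford w) ∧
            w⁻¹ * α * w = β * γ ∧ IsFDQC D r γ ∧ ∀ q, γ (zGen q) = zGen q))) := by
  refine ⟨fun X l n hn A => ⟨sCoboundary_cup_self A, fun hl h2 => sHalf_cup_self hl h2⟩,
    fun d l L A hA => ⟨coboundary_cup_self hA.hasParity,
      fun hl h2 => half_cup_self hA.hasParity hl h2⟩,
    -- 28 is twice the range 14 of the phase of `β⁻¹ w⁻¹ α w`, the largest range that occurs.
    fun d l hd => ⟨circuitDepth d, 28, fun L => ?_⟩⟩
  obtain ⟨α, hα, hα1, hα2, hα3⟩ := exists_threeFermionQCA hd L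
  obtain ⟨β, hβ, hβ1, hβ2, hβ3, hβ4⟩ := exists_abQCA hd L
  obtain ⟨w, hw⟩ := exists_diagConj (isLocalPhase_thetaW (L := L) (l := l))
  obtain ⟨v, hv⟩ := exists_diagConj (isLocalPhase_thetaV (L := L) (l := l))
  have hdepth : ballCard d 8 + 1 ≤ circuitDepth d := by unfold circuitDepth; omega
  refine ⟨α, β, ⟨hα, hα1, hα2.mono (by norm_num), hα3⟩, ⟨hβ, hβ1, hβ2.mono (by norm_num), hβ3⟩,
    hβ4.mono subset_rfl (by unfold circuitDepth; omega) (by norm_num),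
    fun hl => hα.isFDQC hd hl hα2 hβ hβ2 hβ4 hw, fun hl hl' => ⟨⟨v, hv, ?_, ?_, ?_⟩,
      thetaW, w, β⁻¹ * (w⁻¹ * α * w), isLocalPhase_thetaW.1, fun s hs => thetaW_eq_thetaV hs, hw,
      (isFDQC_thetaW hw).mono subset_rfl hdepth le_rfl,
      fun hL => not_isClifford_thetaW hd hl hl' hL hw, ?_, ?_, fun q => ?_⟩⟩
  · exact (isLocalPhase_thetaV.isFDQC hv).mono subset_rfl hdepth (by norm_num)
  · exact groundState_eq hd hl (by omega) hα hα2 hβ hβ2 hw hv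
  · exact fun hL => not_isClifford_thetaV hd hl hl' hL hv
  · rw [mul_inv_cancel_left]
  · exact (isFDQC_conj_thetaW hd hl (by omega) hα hα2 hβ hβ2 hw).mono subset_rfl
      (by unfold circuitDepth; omega) le_rfl
  · rw [conj_map_zGen hd hl hα hβ hw, decoSign_eq_zero hd (by omega), sgn_zero, one_smul]
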